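/- Let $I=[a,b]$ with $a<b$, $\sigma>0$ and $c\in\mathbb R$. Let $X$ be a measurable, mean-zero process on $I$ with $\sup_{t\in I}E|X(t)|^q<\infty$ for every $q\in\mathbb N$ and covariance $C(s,t)=E[X(s)X(t)]$ in $C^2(I\times I)$. Let $X_1,X_2,\dots$ be i.i.d. copies of $X$, let the time points $t_{ij}$ be i.i.d. on $I$ with a density bounded away from $0$ and $\infty$, and let $\epsilon_{ij}$ be i.i.d. $\mathcal N(0,\sigma^2)$, the three families being independent. Put $Y_{ij}=X_i(t_{ij})+\epsilon_{ij}$; $Y_{ij}$ is observed if $Y_{ij}>c$ (then $\delta_{ij}=0$) and missing if $Y_{ij}\le c$ (then $\delta_{ij}=1$). The $n$-th sample consists of subjects $i=1,\dots,n$ with $N_i=N_{n,i}$ measurements each, where for all large $n$ some $N_i\ge2$. Let $$g_{ij}=-0.8194\,\delta_{ij}\sigma+0.502\,\delta_{ij}c+(1-\delta_{ij})Y_{ij},\qquad d_{ij}=1-0.498\,\delta_{ij},\qquad v=\Big(\sum_{i=1}^nN_i(N_i-1)\Big)^{-1},$$ $$\tilde C(s,t)=\frac{\sum_{i=1}^n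 v\sum_{1\le j\ne k\le N_i}K_h(t_{ij}-s)K_h(t_{ik}-t)\,g_{ij}g_{ik}}{\sum_{i=1}^n v\sum_{1\le j\ne k\le N_i}K_h(t_{ij}-s)K_h(t_{ik}-t)\,d_{ij}d_{ik}},\qquad K_h(x)=\tfrac1hK(x/h),$$ where $K$ is an even Lipschitz probability density supported in $[-1,1]$ and $h=h_n>0$, $h_n\to0$. Let $\hat C(s,t)=\tilde C(s,t)-B(s,t)\sigma^2$, where $B$ is the non-vanishing bias caused by the detection limit: $C(s,t)+B(s,t)\sigma^2=E[g\,g']/E[d\,d']$, with $(g,d)$ and $(g',d')$ computed from $X(s)+\epsilon$ and $X(t)+\epsilon'$, $\epsilon,\epsilon'$ independent $\mathcal N(0,\sigma^2)$ errors independent of $X$. Let $$\Gamma_{n,N_i}=v^2\Big[\frac1{h^2}\sum_{i=1}^n N_i(N_i-1)+\frac1h\sum_{i=1}^n N_i(N_i-1)(N_i-2)+\sum_{i=1}^n N_i(N_i-1)(N_i-2)(N_i-3)\Big],$$ let $\Gamma'_{n,N_i}$ be the middle one of its three summands, and put $T_{n,N_i}=\big(h+\Gamma_{n,N_i}^{1/2}\big)^{-2}$.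 Assume that for some $\delta>0$, as $n\to\infty$, $h^{-\delta}\Gamma_{n,N_i}\to0$ and $h^{-\delta}\Gamma'_{n,N_i}=O(T_{n,N_i}^{-1})$. (The second condition holds for small $\delta$ if the $N_i$ are bounded, and also if $\min_{i\le n}N_i\ge h^{-1-2\delta}$.) Let $\lambda_1\ge\lambda_2\ge\cdots\ge0$ and $\psi_1,\psi_2,\dots$ be the ordered eigenvalues (with multiplicity) and corresponding orthonormal eigenfunctions of the integral operator on $L^2(I)$ with kernel $C$. Whenever they exist, let $\hat\lambda_l$ be the $l$-th largest eigenvalue of the integral operator with kernel $\hat C$ and $\hat\psi_l$ a normalised eigenfunction, $$\int_I\hat C(s,t)\hat\psi_l(s)\,ds=\hat\lambda_l\hat\psi_l(t)\quad(t\in I),$$ with its sign chosen so that $\int_I\hat\psi_l\psi_l\ge0$; otherwise $\hat\lambda_l,\hat\psi_l$ are arbitrary. For a threshold $c_\lambda>0$ let $J$ be the set of all $l$ with $\lambda_l>c_\lambda$ and $\lambda_l>\lambda_{l+1}$. Then $J$ is finite, and for each $l\in J$ $$|\hat\lambda_l-\lambda_l|=O_p\big(T_{n,N_i}^{-1/2}\big),$$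 and, if moreover $\lambda_l$ is a simple eigenvalue (that is, $\lambda_k>\lambda_l$ for all $k<l$; this always holds if $\lambda_1>\lambda_2>\cdots$), $$\|\hat\psi_l-\psi_l\|_{L^2(I)}=O_p\big(T_{n,N_i}^{-1/2}\big)\quad\text{and}\quad\sup_{t\in I}|\hat\psi_l(t)-\psi_l(t)|=O_p\big(T_{n,N_i}^{-1/2}\big).$$ In particular, all rates are $\Gamma_{n,N_i}^{1/2}$ when $h=O(\Gamma_{n,N_i}^{1/2})$. -/

import Mathlib

open MeasureTheory ProbabilityTheory Filter Set
open scoped ENNReal NNReal Topology Asymptotics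

noncomputable section

namespace DetectionLimit

/-! ### Ordered eigenpairs of a symmetric kernel on an interval `I` -/

/-- `φ ∈ L²(I)` satisfies `∫_I C(s,t) φ(s) ds = μ φ(t)` for every `t ∈ I`. -/
structure IsEigenfunction (I : Set ℝ) (C : ℝ → ℝ → ℝ) (μ : ℝ) (φ : ℝ → ℝ) : Prop where
  memLp : MemLp φ 2 (volume.restrict I)
  eigen : ∀ t ∈ I, ∫ s in I, C s t * φ s = μ * φ t

/-- `(lam 0, psi 0), …, (lam l, psi l)` are the `l + 1` leading eigenpairs of the integral operator
with kernel `C`: orthonormal eigenfunctions, eigenvalues in non-increasing order and repeated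
according to multiplicity, such that no eigenfunction orthogonal to all of them has a larger
eigenvalue than `lam l`. -/
structure IsLeadingEigensystem (I : Set ℝ) (C : ℝ → ℝ → ℝ) (l : ℕ)
    (lam : ℕ → ℝ) (psi : ℕ → ℝ → ℝ) : Prop where
  isEigenfunction : ∀ k ≤ l, IsEigenfunction I C (lam k) (psi k)
  orthonormal : ∀ j ≤ l, ∀ k ≤ l, ∫ t in I, psi j t * psi k t = if j = k then 1 else 0
  ordered : ∀ j k, j ≤ k → k ≤ l → lam k ≤ lam j
  leading : ∀ (μ : ℝ) (φ : ℝ → ℝ), IsEigenfunction I C μ φ → 0 < ∫ t in I, φ t ^ 2 →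
    (∀ k ≤ l, ∫ t in I, φ t * psi k t = 0) → μ ≤ lam l

/-- `μ` is the `l`-th largest eigenvalue (counting from `0`, with multiplicity) of the kernel `C`,
and `φ` is a normalised eigenfunction belonging to it. -/
def IsNthEigenpair (I : Set ℝ) (C : ℝ → ℝ → ℝ) (l : ℕ) (μ : ℝ) (φ : ℝ → ℝ) : Prop :=
  ∃ (lam : ℕ → ℝ) (psi : ℕ → ℝ → ℝ),
    IsLeadingEigensystem I C l lam psi ∧ lam l = μ ∧ psi l = φ

/-! ### Stochastic order -/

/-- `Y n = O_p(r n)` for `[0,∞]`-valued `Y n`.  The measure of a possibly non-measurable set is its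
outer measure, so no measurability of `Y` is needed. -/
def IsBigOp {Ω : Type*} [MeasurableSpace Ω] (P : Measure Ω) (Y : ℕ → Ω → ℝ≥0∞) (r : ℕ → ℝ) :
    Prop :=
  ∀ η : ℝ≥0∞, 0 < η → ∃ M : ℝ≥0, ∀ᶠ n in atTop,
    P {ω | ENNReal.ofReal ((M : ℝ) * r n) < Y n ω} ≤ η

/-! ### The model -/

/-- The kernel function: an even Lipschitz probability density supported in `[-1, 1]`. -/
structure IsKernel (K : ℝ → ℝ) : Prop where
  nonneg : ∀ x, 0 ≤ K x
  even : ∀ x, K (-x) = K x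
  support : ∀ x, 1 < |x| → K x = 0
  lipschitz : ∃ L : ℝ≥0, LipschitzWith L K
  integral_eq_one : ∫ x, K x = 1

/-- The sampling density on `[a, b]`, bounded away from zero and infinity. -/
structure IsSamplingDensity (a b : ℝ) (f : ℝ → ℝ) : Prop where
  measurable : Measurable f
  bounds : ∃ m M : ℝ, 0 < m ∧ ∀ t ∈ Icc a b, m ≤ f t ∧ f t ≤ M
  integral_eq_one : ∫ t in Icc a b, f t = 1

/-- The covariance function `C(s,t)` of the process `X` defined on the probability space `(S, ρ)`. -/
def covFun {S : Type*} [MeasurableSpace S] (ρ : Measure S) (X : ℝ → S → ℝ) (s t : ℝ) : ℝ :=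
  cov[X s, X t; ρ]

/-- A measurable centred process on `[a, b]` with bounded moments and a twice continuously
differentiable covariance function. -/
structure IsCenteredProcess {S : Type*} [MeasurableSpace S] (ρ : Measure S) (a b : ℝ)
    (X : ℝ → S → ℝ) : Prop where
  measurable : Measurable (Function.uncurry X)
  moments : ∀ q : ℕ, ∃ M : ℝ≥0, ∀ t ∈ Icc a b, eLpNorm (X t) q ρ ≤ M
  mean_zero : ∀ t ∈ Icc a b, ∫ x, X t x ∂ρ = 0
  smooth : ContDiffOn ℝ 2 (fun p : ℝ × ℝ => covFun ρ X p.1 p.2) (Icc a b ×ˢ Icc a b)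

/-- The normal distribution of a measurement error with standard deviation `σ`. -/
def errorLaw (σ : ℝ) : Measure ℝ := gaussianReal 0 (Real.toNNReal (σ ^ 2))

/-- The random mechanism behind the data: `Z i` are i.i.d. with law `ρ`, so that the processes
`t ↦ X t (Z i ω)` are i.i.d. copies of `X`; `τ i j` are i.i.d. time points with density `f` on
`[a, b]`; `e i j` are i.i.d. `N(0, σ²)` errors; and these three families are independent. -/
structure IsSample {S Ω : Type*} [MeasurableSpace S] [MeasurableSpace Ω] (ρ : Measure S)
    (P : Measure Ω) (a b : ℝ) (f : ℝ → ℝ) (σ : ℝ)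
    (Z : ℕ → Ω → S) (τ e : ℕ → ℕ → Ω → ℝ) : Prop where
  law_subject : ∀ i, HasLaw (Z i) ρ P
  law_time : ∀ i j, HasLaw (τ i j)
    ((volume.restrict (Icc a b)).withDensity fun t => ENNReal.ofReal (f t)) P
  law_error : ∀ i j, HasLaw (e i j) (errorLaw σ) P
  indep_subject : iIndepFun Z P
  indep_time : iIndepFun (fun p : ℕ × ℕ => τ p.1 p.2) P
  indep_error : iIndepFun (fun p : ℕ × ℕ => e p.1 p.2) P
  indep_subject_time :
    IndepFun (fun ω i => Z i ω) (fun ω (p : ℕ × ℕ) => τ p.1 p.2 ω) P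
  indep_subject_time_error :
    IndepFun (fun ω => ((fun i => Z i ω), fun p : ℕ × ℕ => τ p.1 p.2 ω))
      (fun ω (p : ℕ × ℕ) => e p.1 p.2 ω) P

/-- The response `Y_ij = X_i(t_ij) + ε_ij`. -/
def response {S Ω : Type*} (X : ℝ → S → ℝ) (Z : ℕ → Ω → S) (τ e : ℕ → ℕ → Ω → ℝ)
    (i j : ℕ) (ω : Ω) : ℝ :=
  X (τ i j ω) (Z i ω) + e i j ω

/-! ### The covariance estimator for data below a detection limit `c` -/

/-- Missingness indicator: `1` if the response `y` does not exceed the detection limit. -/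
def missing (c y : ℝ) : ℝ := if y ≤ c then 1 else 0

/-- One factor of `C_ijl`.  It depends on `y` only through the observed data. -/
def pseudoResponse (σ c y : ℝ) : ℝ :=
  -0.8194 * missing c y * σ + 0.502 * missing c y * c + (1 - missing c y) * y

/-- One factor of `D_ijl`. -/
def pseudoWeight (c y : ℝ) : ℝ := 1 - 0.498 * missing c y

/-- `K_h(x) = K(x / h) / h`. -/
def scaledKernel (K : ℝ → ℝ) (h x : ℝ) : ℝ := 1 / h * K (x / h)

/-- `∑_{i<n} N_i (N_i - 1) ⋯ (N_i - m + 1)`. -/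
def factMoment (N : ℕ → ℕ) (n m : ℕ) : ℝ := ∑ i ∈ Finset.range n, ((N i).descFactorial m : ℝ)

/-- The common weight `1 / ∑ N_i (N_i - 1)` of the OBS scheme. -/
def obsWeight (N : ℕ → ℕ) (n : ℕ) : ℝ := 1 / factMoment N n 2

/-- `R₀₀(s,t)`, from the time points `τ i j` and responses `y i j`, `i < n`, `j < N i`. -/
def numer (K : ℝ → ℝ) (h σ c : ℝ) (N : ℕ → ℕ) (n : ℕ) (τ y : ℕ → ℕ → ℝ) (s t : ℝ) : ℝ :=
  ∑ i ∈ Finset.range n, obsWeight N n * ∑ p ∈ (Finset.range (N i)).offDiag,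
    scaledKernel K h (τ i p.1 - s) * scaledKernel K h (τ i p.2 - t) *
      (pseudoResponse σ c (y i p.1) * pseudoResponse σ c (y i p.2))

/-- `S₀₀(s,t)`. -/
def denom (K : ℝ → ℝ) (h c : ℝ) (N : ℕ → ℕ) (n : ℕ) (τ y : ℕ → ℕ → ℝ) (s t : ℝ) : ℝ :=
  ∑ i ∈ Finset.range n, obsWeight N n * ∑ p ∈ (Finset.range (N i)).offDiag,
    scaledKernel K h (τ i p.1 - s) * scaledKernel K h (τ i p.2 - t) *
      (pseudoWeight c (y i p.1) * pseudoWeight c (y i p.2))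

/-- The local-constant estimator `C̃ = R₀₀ / S₀₀`. -/
def covTilde (K : ℝ → ℝ) (h σ c : ℝ) (N : ℕ → ℕ) (n : ℕ) (τ y : ℕ → ℕ → ℝ) (s t : ℝ) : ℝ :=
  numer K h σ c N n τ y s t / denom K h c N n τ y s t

/-- `E[g(X(s) + ε) g(X(t) + ε')]` with independent `N(0, σ²)` errors `ε`, `ε'`, independent of
`X`. -/
def pairMean {S : Type*} [MeasurableSpace S] (ρ : Measure S) (X : ℝ → S → ℝ) (σ : ℝ) (g : ℝ → ℝ)
    (s t : ℝ) : ℝ :=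
  ∫ x, ∫ u, ∫ v, g (X s x + u) * g (X t x + v) ∂errorLaw σ ∂errorLaw σ ∂ρ

/-- The non-vanishing bias `B(s,t)` of `C̃(s,t)`, in units of `σ²`: a response pair at the times
`(s,t)` has `E[C_ijl] / E[D_ijl] = C(s,t) + B(s,t) σ²`. -/
def biasFun {S : Type*} [MeasurableSpace S] (ρ : Measure S) (X : ℝ → S → ℝ) (σ c s t : ℝ) : ℝ :=
  (pairMean ρ X σ (pseudoResponse σ c) s t / pairMean ρ X σ (pseudoWeight c) s t
    - covFun ρ X s t) / σ ^ 2

/-- The bias-adjusted estimator `Ĉ = C̃ - B σ²`, from the first `n` subjects at the outcome `ω`. -/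
def covHat {S Ω : Type*} [MeasurableSpace S] (ρ : Measure S) (X : ℝ → S → ℝ) (K : ℝ → ℝ)
    (h σ c : ℝ) (N : ℕ → ℕ) (n : ℕ) (Z : ℕ → Ω → S) (τ e : ℕ → ℕ → Ω → ℝ) (ω : Ω) (s t : ℝ) : ℝ :=
  covTilde K h σ c N n (fun i j => τ i j ω) (fun i j => response X Z τ e i j ω) s t
    - biasFun ρ X σ c s t * σ ^ 2

/-! ### The rate -/

/-- The part of the pointwise variance of `C̃` caused by pairs of products that share exactly one
observation. -/
def sharedVar (h : ℝ) (N : ℕ → ℕ) (n : ℕ) : ℝ := obsWeight N n ^ 2 * (factMoment N n 3 / h)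

/-- The order `Γ` of the pointwise variance of `C̃`:
`v² [∑ N_i(N_i-1) / h² + ∑ N_i(N_i-1)(N_i-2) / h + ∑ N_i(N_i-1)(N_i-2)(N_i-3)]`. -/
def pointVar (h : ℝ) (N : ℕ → ℕ) (n : ℕ) : ℝ :=
  obsWeight N n ^ 2 * (factMoment N n 2 / h ^ 2) + sharedVar h N n +
    obsWeight N n ^ 2 * factMoment N n 4

/-- `T = (h + Γ^{1/2})⁻²`: the bandwidth `h` is the order of the smoothing bias of a local-constant
estimator on the whole square `I × I`, `Γ^{1/2}` that of its standard deviation. -/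
def rateT (h : ℝ) (N : ℕ → ℕ) (n : ℕ) : ℝ := ((h + √(pointVar h N n)) ^ 2)⁻¹

end DetectionLimit

end

open MeasureTheory ProbabilityTheory Filter Set
open scoped ENNReal NNReal Topology Asymptotics

noncomputable section

open ENNReal (ofReal ofReal_mul ofReal_le_ofReal ofReal_ne_top ofReal_add ofReal_pow ofReal_one ofReal_coe_nnreal ofReal_div_of_pos ofReal_natCast)
open Finset (range mul_sum sum_congr sum_le_sum sum_nonneg sum_add_distrib sum_sub_distrib sum_mul measurable_sum sum_const sum_coe_sort single_le_sum abs_sum_le_sum_abs sum_range_succ sum_eq_zero)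
open Real (norm_eq_abs dist_eq toNNReal sq_sqrt enorm_eq_ofReal_abs volume_Icc rpow_le_rpow_of_exponent_ge)
open MeasureTheory.Measure (infinitePi)

namespace DetectionLimit

/-! ### Random variables with moments of all orders -/

/-- `Y` has finite moments of all orders. -/
def HasMoments {Ω : Type*} [MeasurableSpace Ω] (μ : Measure Ω) (Y : Ω → ℝ) : Prop :=
  ∀ p : ℕ, MemLp Y p μ

namespace HasMoments

variable {Ω : Type*} [MeasurableSpace Ω] {μ : Measure Ω} {X Y : Ω → ℝ}

lemma aestronglyMeasurable (hX : HasMoments μ X) : AEStronglyMeasurable X μ :=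
  (hX 0).aestronglyMeasurable

lemma aemeasurable (hX : HasMoments μ X) : AEMeasurable X μ := hX.aestronglyMeasurable.aemeasurable

lemma integrable (hX : HasMoments μ X) : Integrable X μ := by
  rw [← memLp_one_iff_integrable]; exact_mod_cast hX 1

lemma add (hX : HasMoments μ X) (hY : HasMoments μ Y) : HasMoments μ (fun ω => X ω + Y ω) :=
  fun p => (hX p).add (hY p)

lemma sub (hX : HasMoments μ X) (hY : HasMoments μ Y) : HasMoments μ (fun ω => X ω - Y ω) :=
  fun p => (hX p).sub (hY p)

lemma const_mul (hX : HasMoments μ X) (c : ℝ) : HasMoments μ (fun ω => c * X ω) :=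
  fun p => (hX p).const_mul c

lemma abs (hX : HasMoments μ X) : HasMoments μ (fun ω => |X ω|) := fun p => (hX p).abs

lemma const [IsFiniteMeasure μ] (c : ℝ) : HasMoments μ (fun _ : Ω => c) := fun _ => memLp_const c

lemma mul (hX : HasMoments μ X) (hY : HasMoments μ Y) : HasMoments μ (fun ω => X ω * Y ω) := by
  intro p
  rcases Nat.eq_zero_or_pos p with rfl | hp
  · exact_mod_cast memLp_zero_iff_aestronglyMeasurable.2
      (hX.aestronglyMeasurable.mul hY.aestronglyMeasurable)
  have : ENNReal.HolderTriple ((2 * p : ℕ) : ℝ≥0∞) ((2 * p : ℕ) : ℝ≥0∞) (p : ℝ≥0∞) := by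
    constructor
    push_cast
    rw [← two_mul, ENNReal.mul_inv (by simp) (by simp), ← mul_assoc,
      ENNReal.mul_inv_cancel (by simp) (by simp), one_mul]
  exact (hY (2 * p)).mul' (hX (2 * p))

lemma pow [IsFiniteMeasure μ] (hX : HasMoments μ X) (k : ℕ) : HasMoments μ (fun ω => X ω ^ k) := by
  induction k with
  | zero => simpa using const (μ := μ) 1
  | succ k ih => simpa only [pow_succ] using ih.mul hX

lemma sum {ι : Type*} (s : Finset ι) {X : ι → Ω → ℝ} (hX : ∀ i ∈ s, HasMoments μ (X i)) :
  HasMoments μ (fun ω => ∑ i ∈ s, X i ω) :=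
  fun p => memLp_finsetSum s fun i hi => hX i hi p

lemma mono (hY : HasMoments μ Y) (hX : AEStronglyMeasurable X μ) (h : ∀ ω, |X ω| ≤ |Y ω|) :
  HasMoments μ X :=
  fun p => (hY p).mono hX (Eventually.of_forall h)

lemma comp {Ω' : Type*} [MeasurableSpace Ω'] {ν : Measure Ω'} {f : Ω' → Ω}
  (hX : HasMoments μ X) (hf : MeasurePreserving f ν μ) : HasMoments ν (fun ω => X (f ω)) :=
  fun p => (hX p).comp_measurePreserving hf

end HasMoments

/-! ### Rosenthal's inequality for even moments -/

/-- A constant in Rosenthal's inequality. -/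
def rosenthalConst : ℕ → ℝ
  | 0 => 1
  | q + 1 => (2 * q + 1) * 4 ^ q * (rosenthalConst q + 1)

lemma rosenthalConst_nonneg (q : ℕ) : 0 ≤ rosenthalConst q := by
  induction q with
  | zero => simp [rosenthalConst]
  | succ q ih => simp only [rosenthalConst]; positivity

lemma abs_mul_add_pow_sub_pow_le (y t : ℝ) (q : ℕ) :
  |y * ((t + y) ^ (2 * q + 1) - t ^ (2 * q + 1))| ≤
    (2 * q + 1) * 4 ^ q * (y ^ 2 * t ^ (2 * q) + y ^ (2 * (q + 1))) := by
  have h1 := abs_pow_sub_pow_le (a := t + y) (b := t) (n := 2 * q + 1)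
  simp only [add_sub_cancel_left, Nat.add_sub_cancel] at h1
  have h2 : max |t + y| |t| ≤ |t| + |y| :=
    max_le (abs_add_le _ _) (le_add_of_nonneg_right (abs_nonneg _))
  have h3 : max |t + y| |t| ^ (2 * q) ≤ 4 ^ q * (t ^ (2 * q) + y ^ (2 * q)) := by
    calc max |t + y| |t| ^ (2 * q) ≤ (|t| + |y|) ^ (2 * q) := by gcongr
      _ ≤ 2 ^ (2 * q - 1) * (|t| ^ (2 * q) + |y| ^ (2 * q)) :=
        add_pow_le (abs_nonneg _) (abs_nonneg _) _
      _ ≤ 2 ^ (2 * q) * (|t| ^ (2 * q) + |y| ^ (2 * q)) := by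
        gcongr
        · norm_num
        · omega
      _ = 4 ^ q * (t ^ (2 * q) + y ^ (2 * q)) := by
        rw [pow_mul |t|, pow_mul |y|, sq_abs, sq_abs, ← pow_mul, ← pow_mul, pow_mul 2]
        norm_num
  rw [abs_mul]
  calc |y| * |(t + y) ^ (2 * q + 1) - t ^ (2 * q + 1)|
      ≤ |y| * (|y| * ((2 * q + 1 : ℕ) : ℝ) * (4 ^ q * (t ^ (2 * q) + y ^ (2 * q)))) := by
        gcongr; exact h1.trans (by gcongr)
    _ = (|y| * |y|) * (2 * q + 1) * (4 ^ q * (t ^ (2 * q) + y ^ (2 * q))) := by push_cast; ring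
    _ = _ := by rw [abs_mul_abs_self]; ring

variable {Ω : Type*} [MeasurableSpace Ω] {μ : Measure Ω}

/-- **Rosenthal's inequality** for even moments, with `D` bounding the variance of the sum and
`Λ * D ^ k` the sums of the moments of order `2 * k`. -/
lemma rosenthal {ι : Type*} [DecidableEq ι] {Y : ι → Ω → ℝ} (hind : iIndepFun Y μ)
  (hY : ∀ i, HasMoments μ (Y i)) (hzero : ∀ i, ∫ ω, Y i ω ∂μ = 0) {D Λ : ℝ} (hD : 0 ≤ D)
  (hΛ : 1 ≤ Λ) (q : ℕ) (s : Finset ι) (hD1 : 1 ≤ q → ∑ i ∈ s, ∫ ω, Y i ω ^ 2 ∂μ ≤ D)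
  (hΛD : ∀ k, 1 ≤ k → k ≤ q → ∑ i ∈ s, ∫ ω, Y i ω ^ (2 * k) ∂μ ≤ Λ * D ^ k) :
  ∫ ω, (∑ i ∈ s, Y i ω) ^ (2 * q) ∂μ ≤ rosenthalConst q * (Λ * D ^ q) := by
  have := hind.isProbabilityMeasure
  induction q generalizing s with
  | zero => simpa [rosenthalConst] using hΛ
  | succ q ih =>
    set S : Ω → ℝ := fun ω => ∑ i ∈ s, Y i ω with hS
    set T : ι → Ω → ℝ := fun j ω => ∑ i ∈ s.erase j, Y i ω with hT
    have hTm : ∀ j, HasMoments μ (T j) := fun j => HasMoments.sum _ fun i _ => hY i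
    have hSm : HasMoments μ S := HasMoments.sum _ fun i _ => hY i
    have hST : ∀ j ∈ s, ∀ ω, S ω = T j ω + Y j ω := fun j hj ω => (Finset.sum_erase_add _ _ hj).symm
    have hindT : ∀ j, IndepFun (T j) (Y j) μ := by
      intro j
      have := hind.indepFun_finsetSum_of_notMem₀ (fun i => (hY i).aemeasurable)
        (s := s.erase j) (i := j) (by simp)
      convert this using 1
      ext ω; simp [hT]
    have hzeroT : ∀ j, ∫ ω, Y j ω * T j ω ^ (2 * q + 1) ∂μ = 0 := by
      intro j
      have h := (hindT j).integral_fun_comp_mul_comp (f := fun x => x ^ (2 * q + 1))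
        (g := fun x => x) (hTm j).aemeasurable (hY j).aemeasurable (by fun_prop) (by fun_prop)
      simp only [hzero, mul_zero] at h
      simpa only [mul_comm] using h
    have hprod : ∀ j, ∫ ω, Y j ω ^ 2 * T j ω ^ (2 * q) ∂μ =
        (∫ ω, Y j ω ^ 2 ∂μ) * ∫ ω, T j ω ^ (2 * q) ∂μ := fun j =>
      (hindT j).symm.integral_fun_comp_mul_comp (f := fun x => x ^ 2)
        (g := fun x => x ^ (2 * q)) (hY j).aemeasurable (hTm j).aemeasurable
        (by fun_prop) (by fun_prop)
    have hTle : ∀ j, ∫ ω, T j ω ^ (2 * q) ∂μ ≤ rosenthalConst q * (Λ * D ^ q) := by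
      intro j
      have hsub : ∀ k, ∑ i ∈ s.erase j, ∫ ω, Y i ω ^ (2 * k) ∂μ ≤
          ∑ i ∈ s, ∫ ω, Y i ω ^ (2 * k) ∂μ := fun k =>
        Finset.sum_le_sum_of_subset_of_nonneg (Finset.erase_subset _ _) fun i _ _ =>
          integral_nonneg fun ω => by rw [pow_mul]; positivity
      refine ih _ (fun _ => ?_) fun k hk hkq => (hsub k).trans (hΛD k hk (by omega))
      have := hsub 1
      simp only [mul_one] at this
      exact this.trans (hD1 (by omega))
    have hterm : ∀ j ∈ s, ∫ ω, Y j ω * S ω ^ (2 * q + 1) ∂μ ≤ (2 * q + 1) * 4 ^ q *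
        ((∫ ω, Y j ω ^ 2 ∂μ) * (rosenthalConst q * (Λ * D ^ q)) +
          ∫ ω, Y j ω ^ (2 * (q + 1)) ∂μ) := by
      intro j hj
      have i1 : Integrable (fun ω => Y j ω * S ω ^ (2 * q + 1)) μ := ((hY j).mul (hSm.pow _)).integrable
      have i2 : Integrable (fun ω => Y j ω * T j ω ^ (2 * q + 1)) μ :=
        ((hY j).mul ((hTm j).pow _)).integrable
      have i3 : Integrable (fun ω => Y j ω ^ 2 * T j ω ^ (2 * q)) μ :=
        (((hY j).pow 2).mul ((hTm j).pow _)).integrable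
      have i4 : Integrable (fun ω => Y j ω ^ (2 * (q + 1))) μ := ((hY j).pow _).integrable
      calc ∫ ω, Y j ω * S ω ^ (2 * q + 1) ∂μ
          = ∫ ω, (Y j ω * S ω ^ (2 * q + 1) - Y j ω * T j ω ^ (2 * q + 1)) ∂μ := by
            rw [integral_sub i1 i2, hzeroT, sub_zero]
        _ ≤ ∫ ω, (2 * q + 1) * 4 ^ q *
            (Y j ω ^ 2 * T j ω ^ (2 * q) + Y j ω ^ (2 * (q + 1))) ∂μ := by
          refine integral_mono (i1.sub i2) ((i3.add i4).const_mul _) fun ω => ?_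
          have := le_of_abs_le (abs_mul_add_pow_sub_pow_le (Y j ω) (T j ω) q)
          simp only [hST j hj ω]
          linarith
        _ = (2 * q + 1) * 4 ^ q * ((∫ ω, Y j ω ^ 2 ∂μ) * (∫ ω, T j ω ^ (2 * q) ∂μ) +
            ∫ ω, Y j ω ^ (2 * (q + 1)) ∂μ) := by
          rw [integral_const_mul, integral_add i3 i4, hprod]
        _ ≤ _ := by
          gcongr
          exact hTle j
    have hsum : ∫ ω, S ω ^ (2 * (q + 1)) ∂μ = ∑ j ∈ s, ∫ ω, Y j ω * S ω ^ (2 * q + 1) ∂μ := by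
      rw [← integral_finsetSum _ fun j _ => ((hY j).mul (hSm.pow _)).integrable]
      refine integral_congr_ae (Eventually.of_forall fun ω => ?_)
      simp only
      rw [← sum_mul]
      change _ = S ω * S ω ^ (2 * q + 1)
      ring
    have hc := rosenthalConst_nonneg q
    calc ∫ ω, S ω ^ (2 * (q + 1)) ∂μ
        ≤ ∑ j ∈ s, (2 * q + 1) * 4 ^ q * ((∫ ω, Y j ω ^ 2 ∂μ) *
            (rosenthalConst q * (Λ * D ^ q)) + ∫ ω, Y j ω ^ (2 * (q + 1)) ∂μ) := by
          rw [hsum]; exact sum_le_sum hterm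
      _ = (2 * q + 1) * 4 ^ q * ((∑ j ∈ s, ∫ ω, Y j ω ^ 2 ∂μ) *
          (rosenthalConst q * (Λ * D ^ q)) + ∑ j ∈ s, ∫ ω, Y j ω ^ (2 * (q + 1)) ∂μ) := by
        rw [← mul_sum, sum_add_distrib, sum_mul]
      _ ≤ (2 * q + 1) * 4 ^ q * (D * (rosenthalConst q * (Λ * D ^ q)) + Λ * D ^ (q + 1)) := by
        gcongr
        · exact hD1 (by omega)
        · exact hΛD _ (by omega) le_rfl
      _ = rosenthalConst (q + 1) * (Λ * D ^ (q + 1)) := by simp only [rosenthalConst]; ring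

variable {Ω : Type*} [MeasurableSpace Ω] {μ : Measure Ω}

/-! ### Double sums over independent pairs -/

/-- A form of the Cauchy–Schwarz inequality. -/
lemma integral_mul_le_of_sq_le {f g : Ω → ℝ} {a b : ℝ} (ha : 0 < a) (hb : 0 < b)
  (hf : HasMoments μ f) (hg : HasMoments μ g) [IsFiniteMeasure μ]
  (hfa : ∫ ω, f ω ^ 2 ∂μ ≤ a ^ 2) (hgb : ∫ ω, g ω ^ 2 ∂μ ≤ b ^ 2) :
  ∫ ω, f ω * g ω ∂μ ≤ a * b := by
  have i1 := (hf.pow 2).integrable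
  have i2 := (hg.pow 2).integrable
  calc ∫ ω, f ω * g ω ∂μ
      ≤ ∫ ω, (b / (2 * a) * f ω ^ 2 + a / (2 * b) * g ω ^ 2) ∂μ := by
        refine integral_mono (hf.mul hg).integrable
          ((i1.const_mul _).add (i2.const_mul _)) fun ω => ?_
        have h : b / (2 * a) * f ω ^ 2 + a / (2 * b) * g ω ^ 2 - f ω * g ω =
          (b * f ω - a * g ω) ^ 2 / (2 * a * b) := by field_simp; ring
        have : 0 ≤ (b * f ω - a * g ω) ^ 2 / (2 * a * b) := by positivity
        simp only
        linarith
    _ = b / (2 * a) * ∫ ω, f ω ^ 2 ∂μ + a / (2 * b) * ∫ ω, g ω ^ 2 ∂μ := by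
      rw [integral_add (i1.const_mul _) (i2.const_mul _), integral_const_mul, integral_const_mul]
    _ ≤ b / (2 * a) * a ^ 2 + a / (2 * b) * b ^ 2 := by gcongr
    _ = a * b := by field_simp; ring

lemma add_pow_two_mul_le (a b : ℝ) (q : ℕ) :
  (a + b) ^ (2 * q) ≤ 4 ^ q * (a ^ (2 * q) + b ^ (2 * q)) := by
  have h : (a + b) ^ 2 ≤ 2 * (a ^ 2 + b ^ 2) := by nlinarith [sq_nonneg (a - b)]
  calc (a + b) ^ (2 * q) = ((a + b) ^ 2) ^ q := pow_mul _ _ _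
    _ ≤ (2 * (a ^ 2 + b ^ 2)) ^ q := by gcongr
    _ = 2 ^ q * (a ^ 2 + b ^ 2) ^ q := mul_pow _ _ _
    _ ≤ 2 ^ q * (2 ^ (q - 1) * ((a ^ 2) ^ q + (b ^ 2) ^ q)) := by
      gcongr; exact add_pow_le (sq_nonneg _) (sq_nonneg _) _
    _ ≤ 2 ^ q * (2 ^ q * ((a ^ 2) ^ q + (b ^ 2) ^ q)) := by
      gcongr
      · norm_num
      · omega
    _ = 4 ^ q * (a ^ (2 * q) + b ^ (2 * q)) := by
      rw [← mul_assoc, ← mul_pow, pow_mul, pow_mul]; norm_num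

lemma integral_pow_two_mul_le [IsProbabilityMeasure μ] {f : Ω → ℝ} (hf : HasMoments μ f)
  (k : ℕ) : (∫ ω, f ω ∂μ) ^ (2 * k) ≤ ∫ ω, f ω ^ (2 * k) ∂μ :=
  (Even.convexOn_pow (even_two_mul k)).map_integral_le (by fun_prop) isClosed_univ (by simp)
    hf.integrable (hf.pow _).integrable

lemma integral_sub_mean_pow_le [IsProbabilityMeasure μ] {f : Ω → ℝ} (hf : HasMoments μ f)
  {m : ℝ} (hm : ∫ ω, f ω ∂μ = m) (k : ℕ) :
  ∫ ω, (f ω - m) ^ (2 * k) ∂μ ≤ 2 * 4 ^ k * ∫ ω, f ω ^ (2 * k) ∂μ := by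
  calc ∫ ω, (f ω - m) ^ (2 * k) ∂μ
      ≤ ∫ ω, 4 ^ k * (f ω ^ (2 * k) + m ^ (2 * k)) ∂μ := by
        refine integral_mono ((hf.sub (.const m)).pow _).integrable
          ((((hf.pow _).add (.const _)).const_mul _).integrable) fun ω => ?_
        have := add_pow_two_mul_le (f ω) (-m) k
        rwa [(even_two_mul k).neg_pow, ← sub_eq_add_neg] at this
    _ = 4 ^ k * (∫ ω, f ω ^ (2 * k) ∂μ + m ^ (2 * k)) := by
      rw [integral_const_mul, integral_add (hf.pow _).integrable (integrable_const _)]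
      simp
    _ ≤ 4 ^ k * (∫ ω, f ω ^ (2 * k) ∂μ + ∫ ω, f ω ^ (2 * k) ∂μ) := by
      gcongr; rw [← hm]; exact integral_pow_two_mul_le hf k
    _ = _ := by ring

lemma integral_sub_mean_sq_le [IsProbabilityMeasure μ] {f : Ω → ℝ} (hf : HasMoments μ f)
  {m : ℝ} (hm : ∫ ω, f ω ∂μ = m) : ∫ ω, (f ω - m) ^ 2 ∂μ ≤ ∫ ω, f ω ^ 2 ∂μ := by
  have h := variance_le_expectation_sq (X := f) hf.aestronglyMeasurable
  rw [variance_eq_integral hf.aemeasurable, hm] at h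
  simpa using h

/-- Moments of a centred i.i.d. sum. -/
lemma integral_centered_sum_pow_le {u : ℕ → Ω → ℝ} (hind : iIndepFun u μ)
  (hu : ∀ j, HasMoments μ (u j)) {m θ p H : ℝ} (hm : ∀ j, ∫ ω, u j ω ∂μ = m) (hθ : 0 ≤ θ)
  (hp : 1 ≤ p) (hH : 1 ≤ H) (q : ℕ)
  (hmom : ∀ j k, 1 ≤ k → k ≤ 2 * q → ∫ ω, |u j ω| ^ k ∂μ ≤ θ * p ^ (k - 1) * H) (N : ℕ) :
  ∫ ω, (∑ j ∈ range N, (u j ω - m)) ^ (2 * q) ∂μ ≤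
    rosenthalConst q * 8 ^ q * (H ^ q * (N * θ * p + p ^ 2) ^ q) := by
  have := hind.isProbabilityMeasure
  have hc := rosenthalConst_nonneg q
  have hindc : iIndepFun (fun j ω => u j ω - m) μ :=
    hind.comp (fun _ x => x - m) fun _ => by fun_prop
  have hbound : ∀ k, 1 ≤ k → k ≤ q → ∑ j ∈ range N, ∫ ω, (u j ω - m) ^ (2 * k) ∂μ ≤
      1 * (8 * (H * (N * θ * p + p ^ 2))) ^ k := by
    intro k hk hkq
    have h1 : ∀ j, ∫ ω, (u j ω - m) ^ (2 * k) ∂μ ≤ 2 * 4 ^ k * (θ * p ^ (2 * k - 1) * H) := by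
      intro j
      refine (integral_sub_mean_pow_le (hu j) (hm j) k).trans ?_
      gcongr
      refine le_trans (le_of_eq ?_) (hmom j (2 * k) (by omega) (by omega))
      simp_rw [(even_two_mul k).pow_abs]
    calc ∑ j ∈ range N, ∫ ω, (u j ω - m) ^ (2 * k) ∂μ
        ≤ ∑ j ∈ range N, 2 * 4 ^ k * (θ * p ^ (2 * k - 1) * H) := sum_le_sum fun j _ => h1 j
      _ = 2 * 4 ^ k * (H * ((N * θ * p) * (p ^ 2) ^ (k - 1))) := by
        obtain ⟨k, rfl⟩ : ∃ k', k = k' + 1 := ⟨k - 1, by omega⟩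
        have : 2 * (k + 1) - 1 = 2 * k + 1 := by omega
        simp only [this, sum_const, Finset.card_range, nsmul_eq_mul, ← pow_mul, Nat.add_sub_cancel]
        ring
      _ ≤ (2 ^ k * 4 ^ k) * (H ^ k * ((N * θ * p + p ^ 2) * (N * θ * p + p ^ 2) ^ (k - 1))) := by
        gcongr
        · exact le_self_pow₀ (by norm_num) (by omega)
        · exact le_self_pow₀ hH (by omega)
        · exact le_add_of_nonneg_right (by positivity)
        · exact le_add_of_nonneg_left (by positivity)
      _ = 1 * (8 * (H * (N * θ * p + p ^ 2))) ^ k := by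
        rw [mul_pow_sub_one (by omega), ← mul_pow, mul_pow 8, mul_pow H]
        norm_num
  refine (rosenthal hindc (fun j => (hu j).sub (.const m)) (fun j => ?_)
    (D := 8 * (H * (N * θ * p + p ^ 2))) (by positivity) le_rfl q (range N)
    (fun hq => ?_) hbound).trans (le_of_eq ?_)
  · rw [integral_sub (hu j).integrable (integrable_const _), hm]; simp
  · simpa using hbound 1 le_rfl hq
  · rw [one_mul, mul_pow, mul_pow]; ring

/-- Moments of an i.i.d. sum. -/
lemma integral_sum_pow_le {u : ℕ → Ω → ℝ} (hind : iIndepFun u μ)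
  (hu : ∀ j, HasMoments μ (u j)) {m θ p H : ℝ} (hm : ∀ j, ∫ ω, u j ω ∂μ = m) (hθ : 0 ≤ θ)
  (hp : 1 ≤ p) (hH : 1 ≤ H) {q : ℕ} (hq : 1 ≤ q)
  (hmom : ∀ j k, 1 ≤ k → k ≤ 2 * q → ∫ ω, |u j ω| ^ k ∂μ ≤ θ * p ^ (k - 1) * H) (N : ℕ) :
  ∫ ω, (∑ j ∈ range N, u j ω) ^ (2 * q) ∂μ ≤
    4 ^ q * (rosenthalConst q * 8 ^ q + 1) * (H * (N * θ + p)) ^ (2 * q) := by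
  have := hind.isProbabilityMeasure
  have hc := rosenthalConst_nonneg q
  have hcen := integral_centered_sum_pow_le hind hu hm hθ hp hH q hmom N
  have hmle : |m| ≤ θ * H := by
    rw [← hm 0]
    refine (abs_integral_le_integral_abs).trans ?_
    simpa using hmom 0 1 le_rfl (by omega)
  have hcm : HasMoments μ (fun ω => ∑ j ∈ range N, (u j ω - m)) :=
    HasMoments.sum _ fun j _ => (hu j).sub (.const m)
  calc ∫ ω, (∑ j ∈ range N, u j ω) ^ (2 * q) ∂μ
      ≤ ∫ ω, 4 ^ q * ((∑ j ∈ range N, (u j ω - m)) ^ (2 * q) + (N * m) ^ (2 * q)) ∂μ := by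
        refine integral_mono ((HasMoments.sum _ fun j _ => hu j).pow _).integrable
          (((hcm.pow _).add (.const _)).const_mul _).integrable fun ω => ?_
        have := add_pow_two_mul_le (∑ j ∈ range N, (u j ω - m)) (N * m) q
        simpa using this
    _ = 4 ^ q * (∫ ω, (∑ j ∈ range N, (u j ω - m)) ^ (2 * q) ∂μ + (N * m) ^ (2 * q)) := by
      rw [integral_const_mul, integral_add (hcm.pow _).integrable (integrable_const _)]
      simp
    _ ≤ 4 ^ q * (rosenthalConst q * 8 ^ q * (H * (N * θ + p)) ^ (2 * q) +
        (H * (N * θ + p)) ^ (2 * q)) := by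
      refine mul_le_mul_of_nonneg_left (add_le_add ?_ ?_) (by positivity)
      · refine hcen.trans ?_
        rw [← mul_pow, pow_mul]
        gcongr
        have h0 : 0 ≤ N * θ := by positivity
        calc H * (N * θ * p + p ^ 2) ≤ (H * H) * ((N * θ + p) ^ 2) := by
              gcongr
              · exact le_mul_of_one_le_left (by linarith) hH
              · nlinarith [mul_nonneg h0 (zero_le_one.trans hp)]
          _ = _ := by ring
      · rw [← (even_two_mul q).pow_abs (N * m), abs_mul, Nat.abs_cast]
        refine pow_le_pow_left₀ (by positivity) ?_ _
        calc N * |m| ≤ N * (θ * H) := by gcongr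
          _ = H * (N * θ) := by ring
          _ ≤ _ := by gcongr; linarith
    _ = _ := by ring

variable {Ω : Type*} [MeasurableSpace Ω] {μ : Measure Ω}

lemma sum_offDiag_range_mul (x y : ℕ → ℝ) (N : ℕ) :
  ∑ p ∈ (range N).offDiag, x p.1 * y p.2 =
    (∑ j ∈ range N, x j) * (∑ j ∈ range N, y j) - ∑ j ∈ range N, x j * y j := by
  have h := Finset.sum_union (Finset.disjoint_diag_offDiag (range N))
    (f := fun p : ℕ × ℕ => x p.1 * y p.2)
  rw [Finset.diag_union_offDiag, Finset.sum_product, Finset.sum_diag] at h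
  rw [Finset.sum_mul_sum]
  linarith

/-- The centred double sum `∑_{j ≠ k} x_j y_k - N (N - 1) xm ym`. -/
def centeredPairSum (x y : ℕ → ℝ) (xm ym : ℝ) (N : ℕ) : ℝ :=
  ∑ p ∈ (range N).offDiag, x p.1 * y p.2 - N * (N - 1) * (xm * ym)

/-- Independent pairs `(x j, y j)` with common means, whose moments up to order `K` grow
geometrically, at the rates `p` and `r`. -/
structure IndepPairs (μ : Measure Ω) (x y : ℕ → Ω → ℝ) (xm ym p r H : ℝ) (K : ℕ) : Prop where
  indep : iIndepFun (fun j ω => (x j ω, y j ω)) μ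
  moments_left : ∀ j, HasMoments μ (x j)
  moments_right : ∀ j, HasMoments μ (y j)
  mean_left : ∀ j, ∫ ω, x j ω ∂μ = xm
  mean_right : ∀ j, ∫ ω, y j ω ∂μ = ym
  mean_mul : ∃ m, ∀ j, ∫ ω, x j ω * y j ω ∂μ = m
  one_le_left : 1 ≤ p
  one_le_right : 1 ≤ r
  one_le : 1 ≤ H
  bound_left : ∀ j k, 1 ≤ k → k ≤ K → ∫ ω, |x j ω| ^ k ∂μ ≤ p ^ (k - 1) * H
  bound_right : ∀ j k, 1 ≤ k → k ≤ K → ∫ ω, |y j ω| ^ k ∂μ ≤ r ^ (k - 1) * H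

namespace IndepPairs

variable {x y : ℕ → Ω → ℝ} {xm ym p r H : ℝ} {K : ℕ}

lemma indep_left (h : IndepPairs μ x y xm ym p r H K) : iIndepFun x μ :=
  h.indep.comp (fun _ z => z.1) fun _ => measurable_fst

lemma indep_right (h : IndepPairs μ x y xm ym p r H K) : iIndepFun y μ :=
  h.indep.comp (fun _ z => z.2) fun _ => measurable_snd

lemma abs_mean_left_le (h : IndepPairs μ x y xm ym p r H K) (hK : 1 ≤ K) : |xm| ≤ H := by
  rw [← h.mean_left 0]
  refine abs_integral_le_integral_abs.trans ?_
  simpa using h.bound_left 0 1 le_rfl hK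

lemma abs_mean_right_le (h : IndepPairs μ x y xm ym p r H K) (hK : 1 ≤ K) : |ym| ≤ H := by
  rw [← h.mean_right 0]
  refine abs_integral_le_integral_abs.trans ?_
  simpa using h.bound_right 0 1 le_rfl hK

lemma hasMoments_centeredPairSum (h : IndepPairs μ x y xm ym p r H K) (N : ℕ) :
  HasMoments μ (fun ω => centeredPairSum (x · ω) (y · ω) xm ym N) := by
  have := h.indep.isProbabilityMeasure
  exact (HasMoments.sum _ fun p _ => (h.moments_left p.1).mul (h.moments_right p.2)).sub (.const _)

lemma bound_mul (h : IndepPairs μ x y xm ym p r H K) (j k : ℕ) (hk : 1 ≤ k) (hkK : 2 * k ≤ K) :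
  ∫ ω, |x j ω * y j ω| ^ k ∂μ ≤ √(p * r) * (p * r) ^ (k - 1) * H := by
  have := h.indep.isProbabilityMeasure
  have hp := zero_lt_one.trans_le h.one_le_left
  have hr := zero_lt_one.trans_le h.one_le_right
  have hH := zero_lt_one.trans_le h.one_le
  have e : ∀ {p : ℝ}, 0 < p → (p ^ (k - 1) * √p * √H) ^ 2 = p ^ (2 * k - 1) * H := fun {p} hp => by
    rw [mul_pow, mul_pow, sq_sqrt hp.le, sq_sqrt hH.le, (by omega : 2 * k - 1 = (k - 1) * 2 + 1),
      pow_succ p, pow_mul]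
  have key := integral_mul_le_of_sq_le (μ := μ) (f := fun ω => |x j ω| ^ k)
    (g := fun ω => |y j ω| ^ k) (a := p ^ (k - 1) * √p * √H) (b := r ^ (k - 1) * √r * √H)
    (by positivity) (by positivity) ((h.moments_left j).abs.pow k) ((h.moments_right j).abs.pow k)
    ?_ ?_
  · simp_rw [abs_mul, mul_pow]
    refine key.trans (le_of_eq ?_)
    rw [Real.sqrt_mul hp.le]
    calc _ = p ^ (k - 1) * √p * (r ^ (k - 1) * √r) * (√H * √H) := by ring
      _ = _ := by rw [Real.mul_self_sqrt hH.le]; ring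
  · simp_rw [e hp, ← pow_mul, mul_comm k 2]
    exact h.bound_left j (2 * k) (by omega) hkK
  · simp_rw [e hr, ← pow_mul, mul_comm k 2]
    exact h.bound_right j (2 * k) (by omega) hkK

end IndepPairs

/-- The scale of `centeredPairSum`. -/
def pairScale (N : ℕ) (p r : ℝ) : ℝ :=
  (N + p) ^ 2 * (N * r + r ^ 2) + (N + r) ^ 2 * (N * p + p ^ 2)

lemma pairScale_nonneg {N : ℕ} {p r : ℝ} (hp : 0 ≤ p) (hr : 0 ≤ r) : 0 ≤ pairScale N p r := by
  unfold pairScale; positivity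

/-- A constant in the moment bound for `centeredPairSum`. -/
def pairConst (q : ℕ) : ℝ :=
  16 ^ q * ((4 ^ (2 * q) * (rosenthalConst (2 * q) * 8 ^ (2 * q) + 1) + 1) ^ 2 +
    rosenthalConst q * 8 ^ q + 8 ^ q * (rosenthalConst q * 8 ^ q + 1) + 1)

lemma pairConst_nonneg (q : ℕ) : 0 ≤ pairConst q := by
  have := rosenthalConst_nonneg q
  unfold pairConst; positivity

lemma IndepPairs.integral_centeredPairSum_pow_le {x y : ℕ → Ω → ℝ} {xm ym p r H : ℝ} {q : ℕ}
  (hq : 1 ≤ q) (h : IndepPairs μ x y xm ym p r H (4 * q)) (N : ℕ) :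
  ∫ ω, centeredPairSum (x · ω) (y · ω) xm ym N ^ (2 * q) ∂μ ≤
    pairConst q * (H ^ (4 * q) * pairScale N p r ^ q) := by
  have := h.indep.isProbabilityMeasure
  have hp1 := h.one_le_left
  have hr1 := h.one_le_right
  have hH1 := h.one_le
  have hp := zero_lt_one.trans_le hp1
  have hr := zero_lt_one.trans_le hr1
  have hH := zero_lt_one.trans_le hH1
  have hc1 := rosenthalConst_nonneg q
  have hc2 := rosenthalConst_nonneg (2 * q)
  have hW : 0 ≤ pairScale N p r := pairScale_nonneg hp.le hr.le
  set W := pairScale N p r with hWdef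
  set c := 4 ^ (2 * q) * (rosenthalConst (2 * q) * 8 ^ (2 * q) + 1) with hcdef
  have hc : 1 ≤ c := by
    rw [hcdef]
    exact one_le_mul_of_one_le_of_one_le (one_le_pow₀ (by norm_num))
      (le_add_of_nonneg_left (by positivity))
  have hcc : c ≤ (c + 1) ^ 2 := by nlinarith
  set A : Ω → ℝ := fun ω => ∑ j ∈ range N, x j ω
  set α : Ω → ℝ := fun ω => ∑ j ∈ range N, (x j ω - xm)
  set β : Ω → ℝ := fun ω => ∑ j ∈ range N, (y j ω - ym)
  set E : Ω → ℝ := fun ω => ∑ j ∈ range N, x j ω * y j ω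
  have mA : HasMoments μ A := HasMoments.sum _ fun j _ => h.moments_left j
  have mα : HasMoments μ α := HasMoments.sum _ fun j _ => (h.moments_left j).sub (.const _)
  have mβ : HasMoments μ β := HasMoments.sum _ fun j _ => (h.moments_right j).sub (.const _)
  have mE : HasMoments μ E := HasMoments.sum _ fun j _ => (h.moments_left j).mul (h.moments_right j)
  -- the four terms
  have hA : ∫ ω, (A ω ^ (2 * q)) ^ 2 ∂μ ≤ ((c + 1) * (H * (N + p)) ^ (2 * q)) ^ 2 := by
    have := integral_sum_pow_le h.indep_left h.moments_left h.mean_left zero_le_one hp1 hH1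
      (q := 2 * q) (by omega) (fun j k hk hkq => by simpa using h.bound_left j k hk (by omega)) N
    simp_rw [← pow_mul, mul_comm (2 * q) 2]
    refine this.trans ?_
    rw [mul_one, mul_pow (c + 1), ← pow_mul (H * _), mul_comm (2 * q) 2]
    gcongr
  have hβ : ∫ ω, (β ω ^ (2 * q)) ^ 2 ∂μ ≤ ((c + 1) * (H * (N * r + r ^ 2)) ^ q) ^ 2 := by
    have := integral_centered_sum_pow_le h.indep_right h.moments_right h.mean_right zero_le_one
      hr1 hH1 (2 * q) (fun j k hk hkq => by simpa using h.bound_right j k hk (by omega)) N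
    simp_rw [← pow_mul, mul_comm (2 * q) 2]
    refine this.trans ?_
    rw [mul_one, ← mul_pow, mul_pow (c + 1), ← pow_mul, mul_comm q 2]
    gcongr
    refine le_trans ?_ hcc
    rw [hcdef]
    have : (1 : ℝ) ≤ 4 ^ (2 * q) := one_le_pow₀ (by norm_num)
    nlinarith [mul_nonneg hc2 (show (0 : ℝ) ≤ 8 ^ (2 * q) by positivity)]
  have t1 : ∫ ω, (A ω * β ω) ^ (2 * q) ∂μ ≤ (c + 1) ^ 2 * (H ^ (4 * q) * W ^ q) := by
    simp_rw [mul_pow]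
    refine (integral_mul_le_of_sq_le (by positivity) (by positivity) (mA.pow _) (mβ.pow _)
      hA hβ).trans ?_
    calc (c + 1) * (H * (N + p)) ^ (2 * q) * ((c + 1) * (H * (N * r + r ^ 2)) ^ q)
        = (c + 1) ^ 2 * (H ^ (3 * q) * ((N + p) ^ 2 * (N * r + r ^ 2)) ^ q) := by
          simp only [mul_pow, ← pow_mul]; ring
      _ ≤ _ := by
        gcongr
        · norm_num
        · rw [hWdef]; unfold pairScale; exact le_add_of_nonneg_right (by positivity)
  have hN2 : (N : ℝ) ^ 2 * p ^ 2 ≤ W := by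
    rw [hWdef]; unfold pairScale
    have e1 : (N : ℝ) ^ 2 * p ^ 2 ≤ (N + r) ^ 2 * (N * p + p ^ 2) := by
      gcongr
      · linarith
      · have : (0 : ℝ) ≤ N * p := by positivity
        linarith
    have : 0 ≤ (N + p) ^ 2 * (N * r + r ^ 2) := by positivity
    linarith
  have t2 : ∫ ω, (N * ym * α ω) ^ (2 * q) ∂μ ≤
      rosenthalConst q * 8 ^ q * (H ^ (4 * q) * W ^ q) := by
    have := integral_centered_sum_pow_le h.indep_left h.moments_left h.mean_left zero_le_one
      hp1 hH1 q (fun j k hk hkq => by simpa using h.bound_left j k hk (by omega)) N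
    simp_rw [mul_pow _ (α _), integral_const_mul]
    have hNy : (N * ym) ^ (2 * q) ≤ (N * H) ^ (2 * q) := by
      rw [← (even_two_mul q).pow_abs (N * ym), abs_mul, Nat.abs_cast]
      gcongr
      exact h.abs_mean_right_le (by omega)
    calc (N * ym) ^ (2 * q) * ∫ ω, α ω ^ (2 * q) ∂μ
        ≤ (N * H) ^ (2 * q) * (rosenthalConst q * 8 ^ q * (H ^ q * (N * 1 * p + p ^ 2) ^ q)) := by
          gcongr
          exact integral_nonneg fun ω => by simp only; rw [pow_mul]; positivity
      _ = rosenthalConst q * 8 ^ q * (H ^ (3 * q) * ((N : ℝ) ^ 2 * (N * p + p ^ 2)) ^ q) := by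
        simp only [mul_pow, ← pow_mul, mul_one]; ring
      _ ≤ _ := by
        gcongr
        · norm_num
        · rw [hWdef]; unfold pairScale
          have e1 : (N : ℝ) ^ 2 * (N * p + p ^ 2) ≤ (N + r) ^ 2 * (N * p + p ^ 2) := by
            gcongr
            linarith
          have : 0 ≤ (N + p) ^ 2 * (N * r + r ^ 2) := by positivity
          linarith
  have t3 : ∫ ω, E ω ^ (2 * q) ∂μ ≤
      8 ^ q * (rosenthalConst q * 8 ^ q + 1) * (H ^ (4 * q) * W ^ q) := by
    obtain ⟨m, hm⟩ := h.mean_mul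
    have hind : iIndepFun (fun j ω => x j ω * y j ω) μ :=
      h.indep.comp (fun _ z => z.1 * z.2) fun _ => by fun_prop
    have := integral_sum_pow_le hind (fun j => (h.moments_left j).mul (h.moments_right j)) hm
      (θ := √(p * r)) (p := p * r) (Real.sqrt_nonneg _) (one_le_mul_of_one_le_of_one_le hp1 hr1)
      hH1 hq (fun j k hk hkq => h.bound_mul j k hk (by omega)) N
    refine this.trans ?_
    have hs : √(p * r) ^ 2 = p * r := sq_sqrt (by positivity)
    have hscale : (N * √(p * r) + p * r) ^ 2 ≤ 2 * W := by
      have e1 : (N * √(p * r) + p * r) ^ 2 ≤ 2 * ((N : ℝ) ^ 2 * (p * r) + p ^ 2 * r ^ 2) := by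
        nlinarith [sq_nonneg (N * √(p * r) - p * r)]
      have e2 : (N : ℝ) ^ 2 * (p * r) ≤ N ^ 2 * p ^ 2 + N ^ 2 * r ^ 2 := by
        rw [← mul_add]
        gcongr
        nlinarith [sq_nonneg (p - r), mul_pos hp hr]
      have e3 : W = N ^ 2 * p ^ 2 + N ^ 2 * r ^ 2 + 2 * (p ^ 2 * r ^ 2) +
          (N ^ 2 * (N * r) + 2 * N * p * (N * r + r ^ 2) + p ^ 2 * (N * r) +
            N ^ 2 * (N * p) + 2 * N * r * (N * p + p ^ 2) + r ^ 2 * (N * p)) := by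
        rw [hWdef]; unfold pairScale; ring
      have e4 : 0 ≤ N ^ 2 * (N * r) + 2 * N * p * (N * r + r ^ 2) + p ^ 2 * (N * r) +
        N ^ 2 * (N * p) + 2 * N * r * (N * p + p ^ 2) + r ^ 2 * (N * p) := by positivity
      have e5 : 0 ≤ p ^ 2 * r ^ 2 := by positivity
      linarith
    calc 4 ^ q * (rosenthalConst q * 8 ^ q + 1) * (H * (N * √(p * r) + p * r)) ^ (2 * q)
        = 4 ^ q * (rosenthalConst q * 8 ^ q + 1) *
            (H ^ (2 * q) * ((N * √(p * r) + p * r) ^ 2) ^ q) := by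
          rw [mul_pow, pow_mul (N * √(p * r) + p * r)]
      _ ≤ 4 ^ q * (rosenthalConst q * 8 ^ q + 1) * (H ^ (4 * q) * (2 * W) ^ q) := by
        gcongr
        · norm_num
      _ = _ := by rw [mul_pow 2 W, show (8 : ℝ) = 4 * 2 by norm_num, mul_pow 4 2]; ring
  have t4 : (N * (xm * ym)) ^ (2 * q) ≤ H ^ (4 * q) * W ^ q := by
    rw [← (even_two_mul q).pow_abs, abs_mul, Nat.abs_cast, abs_mul]
    calc (N * (|xm| * |ym|)) ^ (2 * q) ≤ (N * (H * H)) ^ (2 * q) := by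
          gcongr
          · exact h.abs_mean_left_le (by omega)
          · exact h.abs_mean_right_le (by omega)
      _ = H ^ (4 * q) * ((N : ℝ) ^ 2) ^ q := by simp only [mul_pow, ← pow_mul]; ring
      _ ≤ _ := by
        gcongr
        refine le_trans ?_ hN2
        exact le_mul_of_one_le_right (by positivity) (one_le_pow₀ hp1)
  have hdecomp : ∀ ω, centeredPairSum (x · ω) (y · ω) xm ym N =
      (A ω * β ω + N * ym * α ω) + (N * (xm * ym) + -E ω) := by
    intro ω
    simp only [centeredPairSum, sum_offDiag_range_mul (x · ω) (y · ω), A, α, β, E, sum_sub_distrib,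
      sum_const, Finset.card_range, nsmul_eq_mul]
    ring
  have hpow : ∀ ω, centeredPairSum (x · ω) (y · ω) xm ym N ^ (2 * q) ≤
      16 ^ q * ((A ω * β ω) ^ (2 * q) + (N * ym * α ω) ^ (2 * q) +
        ((N * (xm * ym)) ^ (2 * q) + E ω ^ (2 * q))) := by
    intro ω
    have h1 := add_pow_two_mul_le (A ω * β ω + N * ym * α ω) (N * (xm * ym) + -E ω) q
    have h2 := add_pow_two_mul_le (A ω * β ω) (N * ym * α ω) q
    have h3 := add_pow_two_mul_le (N * (xm * ym)) (-E ω) q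
    rw [(even_two_mul q).neg_pow] at h3
    rw [hdecomp]
    refine h1.trans ((mul_le_mul_of_nonneg_left (add_le_add h2 h3) (by positivity)).trans
      (le_of_eq ?_))
    rw [show (16 : ℝ) = 4 * 4 by norm_num, mul_pow 4 4]; ring
  have i1 : Integrable (fun ω => (A ω * β ω) ^ (2 * q)) μ := ((mA.mul mβ).pow _).integrable
  have i2 : Integrable (fun ω => (N * ym * α ω) ^ (2 * q)) μ := ((mα.const_mul _).pow _).integrable
  have i3 : Integrable (fun ω => E ω ^ (2 * q)) μ := (mE.pow _).integrable
  calc ∫ ω, centeredPairSum (x · ω) (y · ω) xm ym N ^ (2 * q) ∂μ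
      ≤ ∫ ω, 16 ^ q * ((A ω * β ω) ^ (2 * q) + (N * ym * α ω) ^ (2 * q) +
          ((N * (xm * ym)) ^ (2 * q) + E ω ^ (2 * q))) ∂μ :=
        integral_mono ((h.hasMoments_centeredPairSum N).pow _).integrable
          (((i1.add i2).add ((integrable_const _).add i3)).const_mul _) hpow
    _ = 16 ^ q * (∫ ω, (A ω * β ω) ^ (2 * q) ∂μ + ∫ ω, (N * ym * α ω) ^ (2 * q) ∂μ +
        ((N * (xm * ym)) ^ (2 * q) + ∫ ω, E ω ^ (2 * q) ∂μ)) := by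
      have e1 := integral_add (i1.add i2) ((integrable_const ((N * (xm * ym)) ^ (2 * q))).add i3)
      have e2 := integral_add i1 i2
      have e3 := integral_add (μ := μ) (integrable_const ((N * (xm * ym)) ^ (2 * q))) i3
      simp only [Pi.add_apply, integral_const, probReal_univ, smul_eq_mul, one_mul] at e1 e2 e3
      rw [integral_const_mul, e1, e2, e3]
    _ ≤ 16 ^ q * ((c + 1) ^ 2 * (H ^ (4 * q) * W ^ q) +
        rosenthalConst q * 8 ^ q * (H ^ (4 * q) * W ^ q) + (H ^ (4 * q) * W ^ q +
        8 ^ q * (rosenthalConst q * 8 ^ q + 1) * (H ^ (4 * q) * W ^ q))) := by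
      gcongr
    _ = _ := by rw [pairConst]; ring

variable {Ω : Type*} [MeasurableSpace Ω] {μ : Measure Ω}

lemma integral_add_add {f g h : Ω → ℝ} (hf : Integrable f μ) (hg : Integrable g μ)
  (hh : Integrable h μ) :
  ∫ ω, (f ω + g ω + h ω) ∂μ = ∫ ω, f ω ∂μ + ∫ ω, g ω ∂μ + ∫ ω, h ω ∂μ := by
  rw [← integral_add hf hg]
  exact integral_add (hf.add hg) hh

/-- Second moments of the sums and the decoupled double sum over centred independent pairs. -/
lemma integral_centered_offDiag_sq_le {a b : ℕ → Ω → ℝ}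
  (hind : iIndepFun (fun j ω => (a j ω, b j ω)) μ)
  (ha : ∀ j, HasMoments μ (a j)) (hb : ∀ j, HasMoments μ (b j))
  (ha0 : ∀ j, ∫ ω, a j ω ∂μ = 0) (hb0 : ∀ j, ∫ ω, b j ω ∂μ = 0) {A B : ℝ}
  (hA : ∀ j, ∫ ω, a j ω ^ 2 ∂μ ≤ A) (hB : ∀ j, ∫ ω, b j ω ^ 2 ∂μ ≤ B) (N : ℕ) :
  ∫ ω, (∑ j ∈ range N, a j ω) ^ 2 ∂μ ≤ N * A ∧
  ∫ ω, (∑ j ∈ range N, b j ω) ^ 2 ∂μ ≤ N * B ∧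
  ∫ ω, ((∑ j ∈ range N, a j ω) * (∑ j ∈ range N, b j ω) -
    ∑ j ∈ range N, a j ω * b j ω) ^ 2 ∂μ ≤ 2 * N * (N - 1) * (A * B) := by
  have := hind.isProbabilityMeasure
  have hA0 : 0 ≤ A := (integral_nonneg fun ω => sq_nonneg _).trans (hA 0)
  have hB0 : 0 ≤ B := (integral_nonneg fun ω => sq_nonneg _).trans (hB 0)
  induction N with
  | zero => simp
  | succ N ih =>
    obtain ⟨ihα, ihβ, ihd⟩ := ih
    set α : Ω → ℝ := fun ω => ∑ j ∈ range N, a j ω with hα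
    set β : Ω → ℝ := fun ω => ∑ j ∈ range N, b j ω with hβ
    set d : Ω → ℝ := fun ω => α ω * β ω - ∑ j ∈ range N, a j ω * b j ω with hd
    have mα : HasMoments μ α := HasMoments.sum _ fun j _ => ha j
    have mβ : HasMoments μ β := HasMoments.sum _ fun j _ => hb j
    have md : HasMoments μ d := (mα.mul mβ).sub (HasMoments.sum _ fun j _ => (ha j).mul (hb j))
    have ind : IndepFun (fun ω => (α ω, β ω, d ω)) (fun ω => (a N ω, b N ω)) μ := by
      have h := hind.indepFun_finset₀ (range N) {N} (by simp)
        (fun j => (ha j).aemeasurable.prodMk (hb j).aemeasurable)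
      have hψ : Measurable (fun z : ({N} : Finset ℕ) → ℝ × ℝ => z ⟨N, by simp⟩) :=
        measurable_pi_apply _
      have h2 := h.comp (φ := fun z : range N → ℝ × ℝ =>
          (∑ j : range N, (z j).1, ∑ j : range N, (z j).2,
            (∑ j : range N, (z j).1) * (∑ j : range N, (z j).2) - ∑ j : range N, (z j).1 * (z j).2))
        (ψ := fun z : ({N} : Finset ℕ) → ℝ × ℝ => z ⟨N, by simp⟩)
        (by fun_prop) hψ
      convert h2 using 1
      ext ω
      · simp only [hα, Function.comp]
        exact (sum_coe_sort (range N) (fun j => a j ω)).symm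
      · simp only [hβ, Function.comp]
        exact (sum_coe_sort (range N) (fun j => b j ω)).symm
      · simp only [hd, hα, hβ, Function.comp]
        rw [← sum_coe_sort (range N) (fun j => a j ω), ← sum_coe_sort (range N) (fun j => b j ω),
          ← sum_coe_sort (range N) (fun j => a j ω * b j ω)]
      · rfl
    have key : ∀ (f : ℝ × ℝ × ℝ → ℝ) (g : ℝ × ℝ → ℝ) (_ : Measurable f := by fun_prop)
        (_ : Measurable g := by fun_prop),
        ∫ ω, f (α ω, β ω, d ω) * g (a N ω, b N ω) ∂μ =
          (∫ ω, f (α ω, β ω, d ω) ∂μ) * ∫ ω, g (a N ω, b N ω) ∂μ := fun f g hf hg =>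
      ind.integral_fun_comp_mul_comp
        (mα.aemeasurable.prodMk (mβ.aemeasurable.prodMk md.aemeasurable))
        ((ha N).aemeasurable.prodMk (hb N).aemeasurable)
        hf.aestronglyMeasurable hg.aestronglyMeasurable
    have sum_succ : ∀ (s u : Ω → ℝ) (V W : ℝ), HasMoments μ s → HasMoments μ u →
        ∫ ω, s ω * u ω ∂μ = 0 → ∫ ω, s ω ^ 2 ∂μ ≤ V → ∫ ω, u ω ^ 2 ∂μ ≤ W →
        ∫ ω, (s ω + u ω) ^ 2 ∂μ ≤ V + W := by
      intro s u V W hs hu h0 hV hW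
      have i1 := (hs.pow 2).integrable
      have i2 := (hu.pow 2).integrable
      have i3 := (hs.mul hu).integrable.const_mul 2
      calc ∫ ω, (s ω + u ω) ^ 2 ∂μ = ∫ ω, (s ω ^ 2 + u ω ^ 2 + 2 * (s ω * u ω)) ∂μ := by
            congr 1; ext ω; ring
        _ = ∫ ω, s ω ^ 2 ∂μ + ∫ ω, u ω ^ 2 ∂μ + 2 * ∫ ω, s ω * u ω ∂μ := by
          rw [integral_add_add i1 i2 i3, integral_const_mul]
        _ ≤ V + W := by rw [h0]; linarith
    have zα : ∫ ω, α ω * a N ω ∂μ = 0 := by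
      rw [key (fun z => z.1) (fun z => z.1), ha0, mul_zero]
    have zβ : ∫ ω, β ω * b N ω ∂μ = 0 := by
      rw [key (fun z => z.2.1) (fun z => z.2), hb0, mul_zero]
    refine ⟨?_, ?_, ?_⟩
    · simp_rw [sum_range_succ]
      refine (sum_succ α (a N) _ _ mα (ha N) zα ihα (hA N)).trans (le_of_eq ?_)
      push_cast; ring
    · simp_rw [sum_range_succ]
      refine (sum_succ β (b N) _ _ mβ (hb N) zβ ihβ (hB N)).trans (le_of_eq ?_)
      push_cast; ring
    · have m1 : HasMoments μ (fun ω => β ω * a N ω) := mβ.mul (ha N)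
      have m2 : HasMoments μ (fun ω => α ω * b N ω) := mα.mul (hb N)
      have e1 : ∫ ω, (β ω * a N ω) ^ 2 ∂μ ≤ N * B * A := by
        simp_rw [mul_pow]
        rw [key (fun z => z.2.1 ^ 2) (fun z => z.1 ^ 2)]
        exact mul_le_mul ihβ (hA N) (integral_nonneg fun ω => sq_nonneg _) (by positivity)
      have e2 : ∫ ω, (α ω * b N ω) ^ 2 ∂μ ≤ N * A * B := by
        simp_rw [mul_pow]
        rw [key (fun z => z.1 ^ 2) (fun z => z.2 ^ 2)]
        exact mul_le_mul ihα (hB N) (integral_nonneg fun ω => sq_nonneg _) (by positivity)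
      have z : ∫ ω, d ω * (β ω * a N ω + α ω * b N ω) ∂μ = 0 := by
        have i1 : Integrable (fun ω => (d ω * β ω) * a N ω) μ := ((md.mul mβ).mul (ha N)).integrable
        have i2 : Integrable (fun ω => (d ω * α ω) * b N ω) μ := ((md.mul mα).mul (hb N)).integrable
        calc ∫ ω, d ω * (β ω * a N ω + α ω * b N ω) ∂μ
            = ∫ ω, ((d ω * β ω) * a N ω + (d ω * α ω) * b N ω) ∂μ := by congr 1; ext ω; ring
          _ = 0 := by
            rw [integral_add i1 i2,
              key (fun z => z.2.2 * z.2.1) (fun z => z.1),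
              key (fun z => z.2.2 * z.1) (fun z => z.2), ha0, hb0]
            simp
      have e3 : ∫ ω, (β ω * a N ω + α ω * b N ω) ^ 2 ∂μ ≤ 4 * N * (A * B) := by
        have i1 := (m1.pow 2).integrable
        have i2 := (m2.pow 2).integrable
        calc ∫ ω, (β ω * a N ω + α ω * b N ω) ^ 2 ∂μ
            ≤ ∫ ω, (2 * (β ω * a N ω) ^ 2 + 2 * (α ω * b N ω) ^ 2) ∂μ := by
              refine integral_mono ((m1.add m2).pow 2).integrable
                ((i1.const_mul 2).add (i2.const_mul 2)) fun ω => ?_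
              simp only
              nlinarith [sq_nonneg (β ω * a N ω - α ω * b N ω)]
          _ = 2 * ∫ ω, (β ω * a N ω) ^ 2 ∂μ + 2 * ∫ ω, (α ω * b N ω) ^ 2 ∂μ := by
            rw [integral_add (i1.const_mul 2) (i2.const_mul 2), integral_const_mul,
              integral_const_mul]
          _ ≤ _ := by linarith
      have := sum_succ d (fun ω => β ω * a N ω + α ω * b N ω) _ _ md (m1.add m2) z ihd e3
      refine le_trans (le_of_eq ?_) (this.trans (le_of_eq ?_))
      · congr 1; ext ω
        simp only [sum_range_succ, hd, hα, hβ]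
        ring
      · push_cast; ring

lemma IndepPairs.integral_centeredPairSum_sq_le {x y : ℕ → Ω → ℝ} {xm ym p r H : ℝ} {K : ℕ}
  (hK : 2 ≤ K) (h : IndepPairs μ x y xm ym p r H K) {N : ℕ} (hN : 1 ≤ N) :
  ∫ ω, centeredPairSum (x · ω) (y · ω) xm ym N ^ 2 ∂μ ≤
    6 * H ^ 4 * (N * (N - 1) ^ 2 * (p + r) + N * (N - 1) * (p * r)) := by
  have := h.indep.isProbabilityMeasure
  have hp1 := h.one_le_left
  have hr1 := h.one_le_right
  have hH1 := h.one_le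
  have hp := zero_lt_one.trans_le hp1
  have hr := zero_lt_one.trans_le hr1
  have hH := zero_lt_one.trans_le hH1
  have hN1 : (0 : ℝ) ≤ N - 1 := by simpa using (by exact_mod_cast hN : (1 : ℝ) ≤ N)
  have hxm := h.abs_mean_left_le (by omega)
  have hym := h.abs_mean_right_le (by omega)
  have hxx : ∀ j, ∫ ω, (x j ω - xm) ^ 2 ∂μ ≤ p * H := fun j =>
    (integral_sub_mean_sq_le (h.moments_left j) (h.mean_left j)).trans
      (by simpa using h.bound_left j 2 (by norm_num) hK)
  have hyy : ∀ j, ∫ ω, (y j ω - ym) ^ 2 ∂μ ≤ r * H := fun j =>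
    (integral_sub_mean_sq_le (h.moments_right j) (h.mean_right j)).trans
      (by simpa using h.bound_right j 2 (by norm_num) hK)
  have hm1 : ∀ j, HasMoments μ (fun ω => x j ω - xm) := fun j => (h.moments_left j).sub (.const _)
  have hm2 : ∀ j, HasMoments μ (fun ω => y j ω - ym) := fun j => (h.moments_right j).sub (.const _)
  obtain ⟨e1, e2, e3⟩ := integral_centered_offDiag_sq_le (μ := μ)
    (a := fun j ω => x j ω - xm) (b := fun j ω => y j ω - ym)
    (h.indep.comp (fun _ z => (z.1 - xm, z.2 - ym)) fun _ => by fun_prop) hm1 hm2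
    (fun j => by
      rw [integral_sub (h.moments_left j).integrable (integrable_const _), h.mean_left]; simp)
    (fun j => by
      rw [integral_sub (h.moments_right j).integrable (integrable_const _), h.mean_right]; simp)
    hxx hyy N
  set α : Ω → ℝ := fun ω => ∑ j ∈ range N, (x j ω - xm) with hα
  set β : Ω → ℝ := fun ω => ∑ j ∈ range N, (y j ω - ym) with hβ
  set d : Ω → ℝ := fun ω => α ω * β ω - ∑ j ∈ range N, (x j ω - xm) * (y j ω - ym) with hd
  have mα : HasMoments μ α := HasMoments.sum _ fun j _ => hm1 j
  have mβ : HasMoments μ β := HasMoments.sum _ fun j _ => hm2 j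
  have md : HasMoments μ d := (mα.mul mβ).sub (HasMoments.sum _ fun j _ => (hm1 j).mul (hm2 j))
  have hdecomp : ∀ ω, centeredPairSum (x · ω) (y · ω) xm ym N =
      (N - 1) * xm * β ω + (N - 1) * ym * α ω + d ω := by
    intro ω
    have e4 : ∑ j ∈ range N, (x j ω - xm) * (y j ω - ym) =
        ∑ j ∈ range N, x j ω * y j ω - ym * ∑ j ∈ range N, x j ω -
          xm * ∑ j ∈ range N, y j ω + N * (xm * ym) := by
      simp only [sub_mul, mul_sub, sum_sub_distrib, ← sum_mul, ← mul_sum,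
        sum_const, Finset.card_range, nsmul_eq_mul]
      ring
    simp only [centeredPairSum, sum_offDiag_range_mul (x · ω) (y · ω), d, e4]
    simp only [α, β, sum_sub_distrib, sum_const, Finset.card_range, nsmul_eq_mul]
    ring
  have i1 := (mβ.pow 2).integrable
  have i2 := (mα.pow 2).integrable
  have i3 := (md.pow 2).integrable
  calc ∫ ω, centeredPairSum (x · ω) (y · ω) xm ym N ^ 2 ∂μ
      ≤ ∫ ω, (3 * ((N - 1) * xm) ^ 2 * β ω ^ 2 + 3 * ((N - 1) * ym) ^ 2 * α ω ^ 2 +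
          3 * d ω ^ 2) ∂μ := by
        refine integral_mono ((h.hasMoments_centeredPairSum N).pow 2).integrable
          (((i1.const_mul _).add (i2.const_mul _)).add (i3.const_mul _)) fun ω => ?_
        simp only [hdecomp]
        nlinarith [sq_nonneg ((N - 1) * xm * β ω - (N - 1) * ym * α ω),
          sq_nonneg ((N - 1) * xm * β ω - d ω), sq_nonneg ((N - 1) * ym * α ω - d ω)]
    _ = 3 * ((N - 1) * xm) ^ 2 * ∫ ω, β ω ^ 2 ∂μ + 3 * ((N - 1) * ym) ^ 2 * ∫ ω, α ω ^ 2 ∂μ +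
        3 * ∫ ω, d ω ^ 2 ∂μ := by
      rw [integral_add_add (i1.const_mul _) (i2.const_mul _) (i3.const_mul _),
        integral_const_mul, integral_const_mul, integral_const_mul]
    _ ≤ 3 * ((N - 1) * H) ^ 2 * (N * (r * H)) + 3 * ((N - 1) * H) ^ 2 * (N * (p * H)) +
        3 * (2 * N * (N - 1) * (p * H * (r * H))) := by
      have f1 : ((N - 1) * xm) ^ 2 ≤ ((N - 1) * H) ^ 2 := by
        rw [← sq_abs, abs_mul, abs_of_nonneg hN1]; gcongr
      have f2 : ((N - 1) * ym) ^ 2 ≤ ((N - 1) * H) ^ 2 := by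
        rw [← sq_abs, abs_mul, abs_of_nonneg hN1]; gcongr
      gcongr
    _ = 3 * H ^ 3 * (N * (N - 1) ^ 2 * (p + r)) + 6 * H ^ 2 * (N * (N - 1) * (p * r)) := by ring
    _ ≤ 6 * H ^ 4 * (N * (N - 1) ^ 2 * (p + r)) + 6 * H ^ 4 * (N * (N - 1) * (p * r)) := by
      gcongr
      · norm_num
      · norm_num
      · norm_num
    _ = _ := by ring

/-! ### The joint law of the data -/

lemma iIndepFun_prodMk {Ω ι α β : Type*} [MeasurableSpace Ω] [MeasurableSpace α]
  [MeasurableSpace β] {P : Measure Ω} {X : ι → Ω → α} {Y : ι → Ω → β}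
  (hX : ∀ i, Measurable (X i)) (hY : ∀ i, Measurable (Y i)) (iX : iIndepFun X P)
  (iY : iIndepFun Y P) (hXY : IndepFun (fun ω i => X i ω) (fun ω i => Y i ω) P) :
  iIndepFun (fun i ω => (X i ω, Y i ω)) P := by
  rw [iIndepFun_iff_iIndep]
  let π : ι → Set (Set Ω) := fun i =>
    {s | ∃ A B, MeasurableSet A ∧ MeasurableSet B ∧ X i ⁻¹' A ∩ Y i ⁻¹' B = s}
  refine iIndepSets.iIndep (fun i => ((hX i).prodMk (hY i)).comap_le) π ?_ ?_ ?_
  · rintro i _ ⟨A, B, hA, hB, rfl⟩ _ ⟨A', B', hA', hB', rfl⟩ -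
    exact ⟨A ∩ A', B ∩ B', hA.inter hA', hB.inter hB', by ext; simp; tauto⟩
  · intro i
    rw [← generateFrom_prod, MeasurableSpace.comap_generateFrom]
    congr 1
    ext s
    constructor
    · rintro ⟨_, ⟨A, hA, B, hB, rfl⟩, rfl⟩
      exact ⟨A, B, hA, hB, by ext; simp⟩
    · rintro ⟨A, B, hA, hB, rfl⟩
      exact ⟨A ×ˢ B, ⟨A, hA, B, hB, rfl⟩, by ext; simp⟩
  · rw [iIndepSets_iff]
    intro s F hF
    choose! A B hA hB hAB using hF
    have key : ∀ (t : Finset ι), (∀ i ∈ t, i ∈ s) →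
        P ((⋂ i ∈ t, X i ⁻¹' A i) ∩ ⋂ i ∈ t, Y i ⁻¹' B i) =
          (∏ i ∈ t, P (X i ⁻¹' A i)) * ∏ i ∈ t, P (Y i ⁻¹' B i) := by
      intro t ht
      have h1 : (⋂ i ∈ t, X i ⁻¹' A i) =
          (fun ω i => X i ω) ⁻¹' (⋂ i ∈ t, (fun x : ι → α => x i) ⁻¹' A i) := by
        ext; simp
      have h2 : (⋂ i ∈ t, Y i ⁻¹' B i) =
          (fun ω i => Y i ω) ⁻¹' (⋂ i ∈ t, (fun x : ι → β => x i) ⁻¹' B i) := by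
        ext; simp
      have m1 : MeasurableSet (⋂ i ∈ t, (fun x : ι → α => x i) ⁻¹' A i) :=
        .biInter (Finset.countable_toSet t) fun i hi => measurable_pi_apply i (hA i (ht i hi))
      have m2 : MeasurableSet (⋂ i ∈ t, (fun x : ι → β => x i) ⁻¹' B i) :=
        .biInter (Finset.countable_toSet t) fun i hi => measurable_pi_apply i (hB i (ht i hi))
      rw [h1, h2, hXY.measure_inter_preimage_eq_mul _ _ m1 m2, ← h1, ← h2,
        iX.measure_inter_preimage_eq_mul t fun i hi => hA i (ht i hi),
        iY.measure_inter_preimage_eq_mul t fun i hi => hB i (ht i hi)]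
    have h3 : (⋂ i ∈ s, F i) = (⋂ i ∈ s, X i ⁻¹' A i) ∩ ⋂ i ∈ s, Y i ⁻¹' B i := by
      ext ω
      simp only [mem_iInter, mem_inter_iff]
      refine ⟨fun h => ⟨fun i hi => ?_, fun i hi => ?_⟩, fun h i hi => ?_⟩
      · exact ((hAB i hi).symm ▸ h i hi).1
      · exact ((hAB i hi).symm ▸ h i hi).2
      · exact (hAB i hi) ▸ ⟨h.1 i hi, h.2 i hi⟩
    rw [h3, key s fun _ h => h, ← Finset.prod_mul_distrib]
    refine Finset.prod_congr rfl fun i hi => ?_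
    rw [← hAB i hi]
    have := key {i} (by simpa using hi)
    simpa using this.symm

lemma measurePreserving_zip {ι α β : Type*} [Countable ι] [MeasurableSpace α]
  [MeasurableSpace β] (μ : Measure α) (ν : Measure β) [IsProbabilityMeasure μ]
  [IsProbabilityMeasure ν] :
  MeasurePreserving (fun (p : (ι → α) × (ι → β)) i => (p.1 i, p.2 i))
    ((infinitePi fun _ => μ).prod (infinitePi fun _ => ν))
    (infinitePi fun _ : ι => μ.prod ν) := by
  set P := (infinitePi fun _ : ι => μ).prod (infinitePi fun _ : ι => ν) with hP
  have f1 : MeasurePreserving Prod.fst P (infinitePi fun _ : ι => μ) := measurePreserving_fst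
  have f2 : MeasurePreserving Prod.snd P (infinitePi fun _ : ι => ν) := measurePreserving_snd
  have l1 : ∀ i : ι, HasLaw (fun p : (ι → α) × (ι → β) => p.1 i) μ P := fun i =>
    ((measurePreserving_eval_infinitePi (fun _ : ι => μ) i).comp f1).hasLaw
  have l2 : ∀ i : ι, HasLaw (fun p : (ι → α) × (ι → β) => p.2 i) ν P := fun i =>
    ((measurePreserving_eval_infinitePi (fun _ : ι => ν) i).comp f2).hasLaw
  have i1 : iIndepFun (fun (i : ι) (p : (ι → α) × (ι → β)) => p.1 i) P :=
    (iIndepFun_iff_hasLaw_Pi_infinitePi l1 (by fun_prop)).2 f1.hasLaw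
  have i2 : iIndepFun (fun (i : ι) (p : (ι → α) × (ι → β)) => p.2 i) P :=
    (iIndepFun_iff_hasLaw_Pi_infinitePi l2 (by fun_prop)).2 f2.hasLaw
  have i3 : IndepFun (fun (p : (ι → α) × (ι → β)) (i : ι) => p.1 i)
      (fun (p : (ι → α) × (ι → β)) (i : ι) => p.2 i) P :=
    indepFun_prod₀ (X := fun x => x) (Y := fun y => y) aemeasurable_id aemeasurable_id
  have i4 := iIndepFun_prodMk (by fun_prop) (by fun_prop) i1 i2 i3
  have l3 : ∀ i : ι, HasLaw (fun p : (ι → α) × (ι → β) => (p.1 i, p.2 i)) (μ.prod ν) P := fun i =>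
    ((measurePreserving_eval_infinitePi (fun _ : ι => μ) i).prod
      (measurePreserving_eval_infinitePi (fun _ : ι => ν) i)).hasLaw
  exact ⟨by fun_prop, (i4.hasLaw_infinitePi l3 (by fun_prop)).map_eq⟩

/-- The law of a time point. -/
def timeLaw (a b : ℝ) (f : ℝ → ℝ) : Measure ℝ :=
  (volume.restrict (Icc a b)).withDensity fun t => ofReal (f t)

/-- The law of a time point and a measurement error. -/
def obsLaw (a b : ℝ) (f : ℝ → ℝ) (σ : ℝ) : Measure (ℝ × ℝ) := (timeLaw a b f).prod (errorLaw σ)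

/-- The law of the data of one subject. -/
def subjectLaw {S : Type*} [MeasurableSpace S] (ρ : Measure S) (κ : Measure (ℝ × ℝ)) :
  Measure (S × (ℕ → ℝ × ℝ)) := ρ.prod (infinitePi fun _ => κ)

/-- The space of the data of all subjects. -/
abbrev Data (S : Type*) := ℕ → S × (ℕ → ℝ × ℝ)

/-- The data of all subjects. -/
def dataMap {S Ω : Type*} (Z : ℕ → Ω → S) (τ e : ℕ → ℕ → Ω → ℝ) (ω : Ω) :
  Data S :=
  fun i => (Z i ω, fun j => (τ i j ω, e i j ω))

instance (σ : ℝ) : IsProbabilityMeasure (errorLaw σ) := by unfold errorLaw; infer_instance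

lemma IsSample.hasLaw_dataMap {S Ω : Type*} [MeasurableSpace S] [MeasurableSpace Ω]
  {ρ : Measure S} {P : Measure Ω} [IsProbabilityMeasure ρ] [IsProbabilityMeasure P]
  {a b : ℝ} {f : ℝ → ℝ} {σ : ℝ} {Z : ℕ → Ω → S} {τ e : ℕ → ℕ → Ω → ℝ}
  [IsProbabilityMeasure (timeLaw a b f)]
  (h : IsSample ρ P a b f σ Z τ e) :
  HasLaw (dataMap Z τ e) (infinitePi fun _ => subjectLaw ρ (obsLaw a b f σ)) P := by
  have hτ : ∀ p : ℕ × ℕ, HasLaw (τ p.1 p.2) (timeLaw a b f) P := fun p => h.law_time p.1 p.2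
  have he : ∀ p : ℕ × ℕ, HasLaw (e p.1 p.2) (errorLaw σ) P := fun p => h.law_error p.1 p.2
  have lZ := h.indep_subject.hasLaw_infinitePi h.law_subject
    (aemeasurable_pi_iff.2 fun i => (h.law_subject i).aemeasurable)
  have lτ := h.indep_time.hasLaw_infinitePi hτ (aemeasurable_pi_iff.2 fun p => (hτ p).aemeasurable)
  have le := h.indep_error.hasLaw_infinitePi he (aemeasurable_pi_iff.2 fun p => (he p).aemeasurable)
  have l1 := h.indep_subject_time.hasLaw_prod lZ lτ
  have l2 := h.indep_subject_time_error.hasLaw_prod l1 le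
  have g1 := measurePreserving_prodAssoc (infinitePi fun _ : ℕ => ρ)
    (infinitePi fun _ : ℕ × ℕ => timeLaw a b f)
    (infinitePi fun _ : ℕ × ℕ => errorLaw σ)
  have hk : IsProbabilityMeasure (obsLaw a b f σ) := by unfold obsLaw; infer_instance
  have g2 : MeasurePreserving (fun (ζ : ℕ × ℕ → ℝ × ℝ) i j => ζ (i, j))
      (infinitePi fun _ => obsLaw a b f σ)
      (infinitePi fun _ => infinitePi fun _ => obsLaw a b f σ) :=
    ⟨by fun_prop, Measure.infinitePi_map_curry (fun (_ _ : ℕ) => obsLaw a b f σ)⟩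
  have g3 := (MeasurePreserving.id (infinitePi fun _ : ℕ => ρ)).prod
    (g2.comp (measurePreserving_zip (ι := ℕ × ℕ) (timeLaw a b f) (errorLaw σ)))
  have g4 := measurePreserving_zip (ι := ℕ) ρ (infinitePi fun _ : ℕ => obsLaw a b f σ)
  exact ((g4.comp g3).comp g1).hasLaw.comp l2

/-! ### Leading eigenvectors of compact symmetric operators -/

section Hilbert

local notation "⟪" x ", " y "⟫" => inner ℝ x y

variable {E : Type*} [NormedAddCommGroup E] [InnerProductSpace ℝ E]

/-- A compact symmetric operator whose quadratic form takes a positive value has an eigenvector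
that maximises the Rayleigh quotient. -/
lemma exists_eigenvector_rayleigh [CompleteSpace E] {T : E →L[ℝ] E} (hT : IsCompactOperator T)
  (hs : ∀ x y, ⟪T x, y⟫ = ⟪x, T y⟫) {x₀ : E} (hx₀ : 0 < ⟪T x₀, x₀⟫) :
  ∃ (μ : ℝ) (u : E), 0 < μ ∧ ‖u‖ = 1 ∧ T u = μ • u ∧ ∀ x, ⟪T x, x⟫ ≤ μ * ‖x‖ ^ 2 := by
  have hx₀0 : x₀ ≠ 0 := by rintro rfl; simp at hx₀
  set R : Set ℝ := (fun x => ⟪T x, x⟫) '' Metric.sphere (0 : E) 1 with hR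
  have hbdd : BddAbove R := by
    refine ⟨‖T‖, ?_⟩
    rintro _ ⟨x, hx, rfl⟩
    have hx1 : ‖x‖ = 1 := by simpa using hx
    calc ⟪T x, x⟫ ≤ ‖T x‖ * ‖x‖ := real_inner_le_norm _ _
      _ ≤ ‖T‖ * ‖x‖ * ‖x‖ := by gcongr; exact T.le_opNorm x
      _ = ‖T‖ := by rw [hx1]; ring
  have hquad : ∀ (c : ℝ) (x : E), ⟪T (c • x), c • x⟫ = c ^ 2 * ⟪T x, x⟫ := fun c x => by
    rw [map_smul, inner_smul_left, inner_smul_right]; simp; ring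
  have hmem : ∀ x : E, x ≠ 0 → ⟪T x, x⟫ / ‖x‖ ^ 2 ∈ R := fun x hx => by
    refine ⟨‖x‖⁻¹ • x, by simp [norm_smul, hx], ?_⟩
    simp only [hquad]; field_simp
  set M := sSup R with hM
  have hMle : ∀ x : E, ⟪T x, x⟫ ≤ M * ‖x‖ ^ 2 := fun x => by
    rcases eq_or_ne x 0 with rfl | hx
    · simp
    · rw [← div_le_iff₀ (by positivity)]
      exact le_csSup hbdd (hmem x hx)
  have hMpos : 0 < M := lt_of_lt_of_le (by positivity) (le_csSup hbdd (hmem x₀ hx₀0))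
  suffices hev : Module.End.HasEigenvalue (T : Module.End ℝ E) M by
    obtain ⟨u, hu⟩ := hev.exists_hasEigenvector
    have hu0 : u ≠ 0 := hu.2
    refine ⟨M, ‖u‖⁻¹ • u, hMpos, by simp [norm_smul, hu0], ?_, hMle⟩
    rw [map_smul, smul_comm]
    congr 1
    exact hu.apply_eq_smul
  by_contra hev
  obtain ⟨K, hK⟩ := hT.antilipschitz_of_not_hasEigenvalue hMpos.ne' hev
  have hlow : ∀ x : E, ‖x‖ ≤ K * ‖T x - M • x‖ := fun x => by
    have := hK.le_mul_dist x 0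
    simpa [dist_eq_norm] using this
  have hKpos : (0 : ℝ) < K := by
    by_contra h
    have h0 : (K : ℝ) = 0 := le_antisymm (not_lt.1 h) K.2
    have := hlow x₀
    rw [h0, zero_mul] at this
    exact hx₀0 (norm_le_zero_iff.1 this)
  -- the operator `B = M - T` is nonnegative, hence `t * ‖B x‖ ^ 2 ≤ ⟪B x, x⟫`
  set t : ℝ := (M + ‖T‖)⁻¹ with ht
  have hMT : 0 < M + ‖T‖ := by positivity
  have htpos : 0 < t := by positivity
  have hB : ∀ x : E, t * ‖T x - M • x‖ ^ 2 ≤ M * ‖x‖ ^ 2 - ⟪T x, x⟫ := fun x => by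
    set y := T x - M • x with hy
    have h1 := hMle (x + t • y)
    have h2 : ⟪T y, y⟫ ≥ -(‖T‖ * ‖y‖ ^ 2) := by
      have : |⟪T y, y⟫| ≤ ‖T‖ * ‖y‖ ^ 2 := by
        calc |⟪T y, y⟫| ≤ ‖T y‖ * ‖y‖ := abs_real_inner_le_norm _ _
          _ ≤ ‖T‖ * ‖y‖ * ‖y‖ := by gcongr; exact T.le_opNorm y
          _ = _ := by ring
      linarith [neg_abs_le ⟪T y, y⟫]
    have h3 : ⟪T (x + t • y), x + t • y⟫ = ⟪T x, x⟫ + 2 * t * ⟪T x, y⟫ + t ^ 2 * ⟪T y, y⟫ := by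
      rw [map_add, inner_add_left, inner_add_right, inner_add_right, hquad, map_smul,
        inner_smul_left, inner_smul_right, hs y x, real_inner_comm (T x) y]
      simp; ring
    have h4 : ‖x + t • y‖ ^ 2 = ‖x‖ ^ 2 + 2 * t * ⟪x, y⟫ + t ^ 2 * ‖y‖ ^ 2 := by
      rw [norm_add_sq_real, inner_smul_right, norm_smul, mul_pow, norm_eq_abs, sq_abs]; ring
    have h5 : ⟪T x, y⟫ - M * ⟪x, y⟫ = ‖y‖ ^ 2 := by
      rw [← real_inner_self_eq_norm_sq]
      conv_rhs => rw [hy]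
      rw [inner_sub_left, inner_smul_left]; simp [hy]
    rw [h3, h4] at h1
    have h6 : t ^ 2 * (M + ‖T‖) = t := by rw [ht]; field_simp
    have h7 : t ^ 2 * ⟪T y, y⟫ ≥ t ^ 2 * -(‖T‖ * ‖y‖ ^ 2) := by gcongr
    have h8 : t * ‖y‖ ^ 2 = t ^ 2 * M * ‖y‖ ^ 2 + t ^ 2 * ‖T‖ * ‖y‖ ^ 2 := by
      rw [← add_mul, ← mul_add, h6]
    have h9 : 2 * t * ⟪T x, y⟫ = 2 * t * (M * ⟪x, y⟫) + 2 * t * ‖y‖ ^ 2 := by rw [← h5]; ring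
    nlinarith
  have hlt : ∀ r ∈ R, r ≤ M - t / K ^ 2 := by
    rintro _ ⟨x, hx, rfl⟩
    have hx1 : ‖x‖ = 1 := by simpa using hx
    have h1 := hB x
    have h2 := hlow x
    rw [hx1] at h1 h2
    have h3 : 1 / K ≤ ‖T x - M • x‖ := by rw [div_le_iff₀ hKpos]; linarith
    have h4 : (1 / (K : ℝ)) ^ 2 ≤ ‖T x - M • x‖ ^ 2 := by gcongr
    have h5 : t / K ^ 2 = t * (1 / (K : ℝ)) ^ 2 := by field_simp
    have h6 : t * (1 / (K : ℝ)) ^ 2 ≤ t * ‖T x - M • x‖ ^ 2 := by gcongr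
    simp only
    linarith
  have h1 : M ≤ M - t / K ^ 2 := csSup_le ⟨_, hmem x₀ hx₀0⟩ hlt
  have h2 : 0 < t / (K : ℝ) ^ 2 := by positivity
  linarith

/-- The version of `exists_eigenvector_rayleigh` on the orthogonal complement of finitely many
eigenvectors. -/
lemma exists_eigenvector_rayleigh_orthogonal [CompleteSpace E] {T : E →L[ℝ] E}
  (hT : IsCompactOperator T) (hs : ∀ x y, ⟪T x, y⟫ = ⟪x, T y⟫) {m : ℕ} {lam : ℕ → ℝ}
  {v : ℕ → E} (hv : ∀ k < m, T (v k) = lam k • v k) {x₀ : E} (hx₀ : 0 < ⟪T x₀, x₀⟫)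
  (hx₀v : ∀ k < m, ⟪v k, x₀⟫ = 0) :
  ∃ (μ : ℝ) (u : E), 0 < μ ∧ ‖u‖ = 1 ∧ T u = μ • u ∧ (∀ k < m, ⟪v k, u⟫ = 0) ∧
    ∀ x, (∀ k < m, ⟪v k, x⟫ = 0) → ⟪T x, x⟫ ≤ μ * ‖x‖ ^ 2 := by
  let V : Submodule ℝ E := Submodule.span ℝ (v '' Set.Iio m)
  have hmem : ∀ x : E, x ∈ Vᗮ ↔ ∀ k < m, ⟪v k, x⟫ = 0 := by
    intro x
    rw [Submodule.mem_orthogonal]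
    constructor
    · exact fun h k hk => h _ (Submodule.subset_span ⟨k, hk, rfl⟩)
    · intro h u hu
      induction hu using Submodule.span_induction with
      | mem u hu => obtain ⟨k, hk, rfl⟩ := hu; exact h k hk
      | zero => simp
      | add a b _ _ ha hb => rw [inner_add_left, ha, hb, add_zero]
      | smul c a _ ha => rw [inner_smul_left, ha, mul_zero]
  have hinv : ∀ x ∈ Vᗮ, T x ∈ Vᗮ := by
    intro x hx
    rw [hmem] at hx ⊢
    intro k hk
    rw [← hs, hv k hk, inner_smul_left, hx k hk, mul_zero]
  let S : Vᗮ →L[ℝ] Vᗮ := T.restrict hinv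
  have hSapp : ∀ x : Vᗮ, (S x : E) = T x := fun x => rfl
  have hS : IsCompactOperator S := hT.restrict' hinv
  obtain ⟨μ, u, hμ, hu1, hu, hle⟩ := exists_eigenvector_rayleigh hS
    (fun x y => by simp only [Submodule.coe_inner, hSapp]; exact hs x y)
    (x₀ := ⟨x₀, (hmem x₀).2 hx₀v⟩) (by simpa only [Submodule.coe_inner, hSapp] using hx₀)
  refine ⟨μ, u, hμ, by simpa using hu1, ?_, (hmem u).1 u.2, fun x hx => ?_⟩
  · rw [← hSapp, hu]; simp
  · simpa only [Submodule.coe_inner, hSapp, Submodule.coe_norm] using hle ⟨x, (hmem x).2 hx⟩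

/-- `(lam k, v k)`, `k ≤ l`, are orthonormal eigenpairs in non-increasing order, and `lam l` bounds
the Rayleigh quotient on the orthogonal complement of `v 0, …, v (l - 1)`. -/
structure IsLeadingVectors (T : E →L[ℝ] E) (l : ℕ) (lam : ℕ → ℝ) (v : ℕ → E) : Prop where
  eigen : ∀ k ≤ l, T (v k) = lam k • v k
  orthonormal : ∀ j ≤ l, ∀ k ≤ l, ⟪v j, v k⟫ = if j = k then 1 else 0
  ordered : ∀ j k, j ≤ k → k ≤ l → lam k ≤ lam j
  rayleigh : ∀ x, (∀ k < l, ⟪v k, x⟫ = 0) → ⟪T x, x⟫ ≤ lam l * ‖x‖ ^ 2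

variable {T T' : E →L[ℝ] E} {l : ℕ} {lam lam' : ℕ → ℝ} {v v' : ℕ → E}

lemma inner_sum_smul_self {m : ℕ} (hv : ∀ j < m, ∀ k < m, ⟪v j, v k⟫ = if j = k then 1 else 0)
  (c d : ℕ → ℝ) :
  ⟪∑ k ∈ range m, c k • v k, ∑ k ∈ range m, d k • v k⟫ = ∑ k ∈ range m, c k * d k := by
  rw [sum_inner]
  refine sum_congr rfl fun j hj => ?_
  rw [inner_sum, Finset.sum_eq_single j]
  · rw [inner_smul_left, inner_smul_right, hv j (Finset.mem_range.1 hj) j (Finset.mem_range.1 hj)]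
    simp
  · intro k hk hkj
    rw [inner_smul_left, inner_smul_right, hv j (Finset.mem_range.1 hj) k (Finset.mem_range.1 hk)]
    simp [hkj.symm]
  · exact fun h => absurd hj h

lemma le_inner_sum_smul {m : ℕ} (he : ∀ k < m, T (v k) = lam k • v k)
  (hv : ∀ j < m, ∀ k < m, ⟪v j, v k⟫ = if j = k then 1 else 0) {θ : ℝ}
  (hθ : ∀ k < m, θ ≤ lam k) (c : ℕ → ℝ) :
  θ * ‖∑ k ∈ range m, c k • v k‖ ^ 2 ≤
    ⟪T (∑ k ∈ range m, c k • v k), ∑ k ∈ range m, c k • v k⟫ := by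
  have h1 : T (∑ k ∈ range m, c k • v k) = ∑ k ∈ range m, (lam k * c k) • v k := by
    rw [map_sum]
    refine sum_congr rfl fun k hk => ?_
    rw [map_smul, he k (Finset.mem_range.1 hk), smul_smul, mul_comm]
  rw [h1, inner_sum_smul_self hv, ← real_inner_self_eq_norm_sq, inner_sum_smul_self hv, mul_sum]
  refine sum_le_sum fun k hk => ?_
  have := hθ k (Finset.mem_range.1 hk)
  nlinarith [mul_self_nonneg (c k)]

/-- A non-trivial combination of `m + 1` vectors is orthogonal to `m` given ones. -/
lemma exists_combination_orthogonal (v w : ℕ → E) (m : ℕ) :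
  ∃ c : ℕ → ℝ, (∃ k < m + 1, c k ≠ 0) ∧ ∀ k < m, ⟪w k, ∑ j ∈ range (m + 1), c j • v j⟫ = 0 := by
  let F : (Fin (m + 1) → ℝ) →ₗ[ℝ] (Fin m → ℝ) :=
    LinearMap.pi fun k => ∑ j : Fin (m + 1), ⟪w k, v j⟫ • LinearMap.proj j
  have hF := LinearMap.ker_ne_bot_of_finrank_lt (f := F) (by simp)
  obtain ⟨x, hx, hx0⟩ := Submodule.exists_mem_ne_zero_of_ne_bot hF
  obtain ⟨k, hk⟩ : ∃ k, x k ≠ 0 := by by_contra h; push Not at h; exact hx0 (funext h)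
  refine ⟨fun j => if h : j < m + 1 then x ⟨j, h⟩ else 0, ⟨k, k.2, by
    simp only [dif_pos k.2]; exact hk⟩, ?_⟩
  have hj : ∀ j : Fin (m + 1), (if h : (j : ℕ) < m + 1 then x ⟨j, h⟩ else 0) = x j :=
    fun j => dif_pos j.2
  intro k hk
  have h1 : F x ⟨k, hk⟩ = 0 := by rw [LinearMap.mem_ker.1 hx]; rfl
  rw [inner_sum, Finset.sum_range]
  simp only [hj]
  simpa [F, LinearMap.pi_apply, inner_smul_right, mul_comm] using h1

lemma norm_combination_pos {m : ℕ}
  (hv : ∀ j < m, ∀ k < m, ⟪v j, v k⟫ = if j = k then 1 else 0) {c : ℕ → ℝ}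
  (hc : ∃ k < m, c k ≠ 0) : 0 < ‖∑ k ∈ range m, c k • v k‖ ^ 2 := by
  obtain ⟨k, hk, hck⟩ := hc
  rw [← real_inner_self_eq_norm_sq, inner_sum_smul_self hv]
  exact Finset.sum_pos' (fun _ _ => mul_self_nonneg _)
    ⟨k, Finset.mem_range.2 hk, mul_self_pos.2 hck⟩

/-- Every `l + 1` dimensional space contains a direction in which `T'` is nearly as large as
`lam l`. -/
lemma IsLeadingVectors.exists_large (h : IsLeadingVectors T l lam v) {ε : ℝ}
  (hε : ∀ x, |⟪T' x, x⟫ - ⟪T x, x⟫| ≤ ε * ‖x‖ ^ 2) {m : ℕ} (hm : m ≤ l) (w : ℕ → E) :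
  ∃ x : E, 0 < ‖x‖ ^ 2 ∧ (∀ k < m, ⟪w k, x⟫ = 0) ∧ (lam l - ε) * ‖x‖ ^ 2 ≤ ⟪T' x, x⟫ := by
  obtain ⟨c, hc, hw⟩ := exists_combination_orthogonal v w m
  have hon : ∀ j < m + 1, ∀ k < m + 1, ⟪v j, v k⟫ = if j = k then 1 else 0 :=
    fun j hj k hk => h.orthonormal j (by omega) k (by omega)
  refine ⟨_, norm_combination_pos hon hc, hw, ?_⟩
  have h1 := le_inner_sum_smul (T := T) (fun k hk => h.eigen k (by omega)) hon
    (θ := lam l) (fun k hk => h.ordered k l (by omega) le_rfl) c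
  have h2 := neg_le_of_abs_le (hε (∑ k ∈ range (m + 1), c k • v k))
  linarith

/-- **Weyl's inequality**. -/
lemma IsLeadingVectors.abs_sub_le (h : IsLeadingVectors T l lam v)
  (h' : IsLeadingVectors T' l lam' v') {ε : ℝ}
  (hε : ∀ x, |⟪T' x, x⟫ - ⟪T x, x⟫| ≤ ε * ‖x‖ ^ 2) : |lam' l - lam l| ≤ ε := by
  obtain ⟨x, hx, hxw, hxl⟩ := h.exists_large hε le_rfl v'
  obtain ⟨y, hy, hyw, hyl⟩ := h'.exists_large (T' := T) (ε := ε)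
    (fun x => by rw [abs_sub_comm]; exact hε x) le_rfl v
  have h1 := le_of_mul_le_mul_right (hxl.trans (h'.rayleigh x hxw)) hx
  have h2 := le_of_mul_le_mul_right (hyl.trans (h.rayleigh y hyw)) hy
  rw [abs_le]
  constructor <;> linarith

/-- If no eigenvector for a positive eigenvalue larger than `lam l` is orthogonal to
`v 0, …, v l`, then `max (lam l) 0` bounds the Rayleigh quotient on the orthogonal complement of
`v 0, …, v (l - 1)`. -/
lemma rayleigh_le_of_leading [CompleteSpace E] (hT : IsCompactOperator T)
  (hs : ∀ x y, ⟪T x, y⟫ = ⟪x, T y⟫) (he : ∀ k ≤ l, T (v k) = lam k • v k)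
  (ho : ∀ j ≤ l, ∀ k ≤ l, ⟪v j, v k⟫ = if j = k then 1 else 0)
  (hlead : ∀ (μ : ℝ) (u : E), 0 < μ → ‖u‖ = 1 → T u = μ • u → (∀ k ≤ l, ⟪v k, u⟫ = 0) →
    μ ≤ lam l) (x : E) (hx : ∀ k < l, ⟪v k, x⟫ = 0) :
  ⟪T x, x⟫ ≤ max (lam l) 0 * ‖x‖ ^ 2 := by
  set α := ⟪v l, x⟫ with hα
  set y := x - α • v l with hy
  have hvl : ⟪v l, v l⟫ = 1 := by rw [ho l le_rfl l le_rfl, if_pos rfl]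
  have hly : ⟪v l, y⟫ = 0 := by rw [hy, inner_sub_right, inner_smul_right, hvl]; simp [hα]
  have hyl : ⟪y, v l⟫ = 0 := by rw [real_inner_comm, hly]
  have hky : ∀ k < l + 1, ⟪v k, y⟫ = 0 := by
    intro k hk
    rcases (Nat.lt_succ_iff_lt_or_eq.1 hk) with hk | rfl
    · rw [hy, inner_sub_right, inner_smul_right, hx k hk, ho k hk.le l le_rfl, if_neg hk.ne]; simp
    · exact hly
  have hxy : x = y + α • v l := by rw [hy]; abel
  have hTyl : ⟪T y, v l⟫ = 0 := by rw [hs, he l le_rfl, inner_smul_right, hyl, mul_zero]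
  have hTx : ⟪T x, x⟫ = ⟪T y, y⟫ + lam l * α ^ 2 := by
    rw [hxy, map_add, map_smul, he l le_rfl]
    simp only [inner_add_left, inner_add_right, inner_smul_left, inner_smul_right, hTyl, hly, hvl,
      conj_trivial]
    ring
  have hnx : ‖x‖ ^ 2 = ‖y‖ ^ 2 + α ^ 2 := by
    rw [← real_inner_self_eq_norm_sq, hxy]
    simp only [inner_add_left, inner_add_right, inner_smul_left, inner_smul_right, hyl, hly, hvl,
      conj_trivial, real_inner_self_eq_norm_sq]
    ring
  have hy' : ⟪T y, y⟫ ≤ max (lam l) 0 * ‖y‖ ^ 2 := by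
    rcases le_or_gt ⟪T y, y⟫ 0 with h0 | h0
    · exact h0.trans (by positivity)
    · obtain ⟨μ, u, hμ, hu1, hu, huv, hmax⟩ := exists_eigenvector_rayleigh_orthogonal hT hs
        (m := l + 1) (fun k hk => he k (by omega)) h0 hky
      refine (hmax y hky).trans ?_
      gcongr
      exact (hlead μ u hμ hu1 hu fun k hk => huv k (by omega)).trans (le_max_left _ _)
  rw [hTx, hnx]
  nlinarith [le_max_left (lam l) 0, sq_nonneg α]

/-- If `T` has `l + 1` eigenvalues larger than `ε`, then the `l`-th eigenvalue of a perturbation is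
positive. -/
lemma IsLeadingVectors.pos_of_leading [CompleteSpace E] (h : IsLeadingVectors T l lam v)
  (hT' : IsCompactOperator T') (hs' : ∀ x y, ⟪T' x, y⟫ = ⟪x, T' y⟫) {ε : ℝ}
  (hε : ∀ x, |⟪T' x, x⟫ - ⟪T x, x⟫| ≤ ε * ‖x‖ ^ 2) (hεl : ε < lam l)
  (he : ∀ k ≤ l, T' (v' k) = lam' k • v' k)
  (hord : ∀ j k, j ≤ k → k ≤ l → lam' k ≤ lam' j)
  (hlead : ∀ (μ : ℝ) (u : E), 0 < μ → ‖u‖ = 1 → T' u = μ • u → (∀ k ≤ l, ⟪v' k, u⟫ = 0) →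
    μ ≤ lam' l) : 0 < lam' l := by
  by_contra! hneg
  obtain ⟨p, hpl, hp, hp'⟩ : ∃ p ≤ l, (∀ k < p, 0 < lam' k) ∧ ∀ k ≤ l, p ≤ k → lam' k ≤ 0 := by
    classical
    have hex : ∃ p, lam' p ≤ 0 := ⟨l, hneg⟩
    refine ⟨Nat.find hex, Nat.find_min' hex hneg, fun k hk => not_le.1 (Nat.find_min hex hk),
      fun k hk hpk => (hord _ k hpk hk).trans (Nat.find_spec hex)⟩
  obtain ⟨x, hx, hxw, hxl⟩ := h.exists_large hε hpl v'
  obtain ⟨μ, u, hμ, hu1, hu, huv, -⟩ := exists_eigenvector_rayleigh_orthogonal hT' hs' (m := p)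
    (fun k hk => he k (by omega)) (x₀ := x) (lt_of_lt_of_le (mul_pos (by linarith) hx) hxl) hxw
  refine absurd (hlead μ u hμ hu1 hu fun k hk => ?_) (by linarith)
  rcases lt_or_ge k p with hkp | hkp
  · exact huv k hkp
  · have h1 := hs' (v' k) u
    rw [he k hk, hu, inner_smul_left, inner_smul_right, conj_trivial] at h1
    have h2 : (lam' k - μ) * ⟪v' k, u⟫ = 0 := by linarith
    exact (mul_eq_zero.1 h2).resolve_left (by linarith [hp' k hk hkp])

lemma IsLeadingVectors.exists_perturbation [CompleteSpace E] (h : IsLeadingVectors T l lam v)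
  (hT' : IsCompactOperator T') (hs' : ∀ x y, ⟪T' x, y⟫ = ⟪x, T' y⟫) {ε : ℝ}
  (hε : ∀ x, |⟪T' x, x⟫ - ⟪T x, x⟫| ≤ ε * ‖x‖ ^ 2) (hεl : ε < lam l) :
  ∃ lam' v', IsLeadingVectors T' l lam' v' ∧ 0 < lam' l := by
  have key : ∀ m ≤ l + 1, ∃ (lam' : ℕ → ℝ) (v' : ℕ → E), (∀ k < m, T' (v' k) = lam' k • v' k) ∧
      (∀ j < m, ∀ k < m, ⟪v' j, v' k⟫ = if j = k then 1 else 0) ∧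
      (∀ j k, j ≤ k → k < m → lam' k ≤ lam' j) ∧
      (∀ k < m, 0 < lam' k ∧ ∀ x, (∀ j < k, ⟪v' j, x⟫ = 0) → ⟪T' x, x⟫ ≤ lam' k * ‖x‖ ^ 2) := by
    intro m
    induction m with
    | zero => intro _; exact ⟨fun _ => 0, fun _ => 0, by simp, by simp, by simp, by simp⟩
    | succ m ih =>
      intro hm
      obtain ⟨lam', v', he, ho, hord, hray⟩ := ih (by omega)
      obtain ⟨x, hx, hxw, hxl⟩ := h.exists_large hε (by omega : m ≤ l) v'
      obtain ⟨μ, u, hμ, hu1, hu, huv, hmax⟩ := exists_eigenvector_rayleigh_orthogonal hT' hs' he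
        (x₀ := x) (lt_of_lt_of_le (mul_pos (by linarith) hx) hxl) hxw
      have hne : ∀ k, k < m → k ≠ m := fun k hk => hk.ne
      have hμle : ∀ j < m, μ ≤ lam' j := by
        intro j hj
        have := (hray j hj).2 u fun i hi => huv i (hi.trans hj)
        rw [hu, inner_smul_left, real_inner_self_eq_norm_sq, hu1] at this
        simpa using this
      refine ⟨Function.update lam' m μ, Function.update v' m u, ?_, ?_, ?_, ?_⟩
      · intro k hk
        rcases (Nat.lt_succ_iff_lt_or_eq.1 hk) with hk | rfl
        · simp [Function.update_of_ne (hne k hk), he k hk]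
        · simp [hu]
      · intro j hj k hk
        rcases (Nat.lt_succ_iff_lt_or_eq.1 hj) with hj | rfl <;>
        rcases (Nat.lt_succ_iff_lt_or_eq.1 hk) with hk | rfl
        · simp [Function.update_of_ne (hne _ hk), Function.update_of_ne (hne _ hj), ho j hj k hk]
        · simp [huv j hj, hj.ne]
        · rw [Function.update_self, Function.update_of_ne (hne _ hk), real_inner_comm, huv k hk,
            if_neg hk.ne']
        · simp [hu1]
      · intro j k hjk hk
        rcases (Nat.lt_succ_iff_lt_or_eq.1 hk) with hk | rfl
        · rw [Function.update_of_ne (hne _ hk), Function.update_of_ne (hne _ (by omega))]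
          exact hord j k hjk hk
        · rcases hjk.lt_or_eq with hj | rfl
          · rw [Function.update_self, Function.update_of_ne (hne _ hj)]
            exact hμle j hj
          · exact le_rfl
      · intro k hk
        have hup : ∀ j < k, Function.update v' m u j = v' j := fun j hj =>
          Function.update_of_ne (by omega) _ _
        rcases (Nat.lt_succ_iff_lt_or_eq.1 hk) with hk' | rfl
        · rw [Function.update_of_ne (hne _ hk')]
          refine ⟨(hray k hk').1, fun x hx => (hray k hk').2 x fun j hj => ?_⟩
          rw [← hup j hj]; exact hx j hj
        · rw [Function.update_self]
          refine ⟨hμ, fun x hx => hmax x fun j hj => ?_⟩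
          rw [← hup j hj]; exact hx j hj
  obtain ⟨lam', v', he, ho, hord, hray⟩ := key (l + 1) le_rfl
  exact ⟨lam', v', ⟨fun k hk => he k (by omega), fun j hj k hk => ho j (by omega) k (by omega),
    fun j k hjk hk => hord j k hjk (by omega), (hray l (by omega)).2⟩, (hray l (by omega)).1⟩

/-- An approximate eigenvector for a simple eigenvalue is close to the eigenvector. -/
lemma IsLeadingVectors.norm_sub_le (h : IsLeadingVectors T l lam v)
  (hs : ∀ x y, ⟪T x, y⟫ = ⟪x, T y⟫) {θ g : ℝ} (hg : 0 < g)
  (hray : ∀ x, (∀ k ≤ l, ⟪v k, x⟫ = 0) → ⟪T x, x⟫ ≤ θ * ‖x‖ ^ 2)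
  (hg1 : ∀ k < l, lam l + g ≤ lam k) (hg2 : θ + g ≤ lam l)
  {φ : E} (hφ : ‖φ‖ = 1) {η : ℝ} (hη : ‖T φ - lam l • φ‖ ≤ η) (hpos : 0 ≤ ⟪φ, v l⟫) :
  ‖φ - v l‖ ≤ 2 * (η / g) := by
  have hvl : ‖v l‖ = 1 := by
    have := h.orthonormal l (by omega) l (by omega)
    rw [real_inner_self_eq_norm_sq, if_pos rfl] at this
    exact (pow_eq_one_iff_of_nonneg (norm_nonneg _) two_ne_zero).1 this
  set a := ⟪φ, v l⟫ with ha
  set y := φ - a • v l with hy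
  set b := ∑ k ∈ range l, ⟪v k, φ⟫ • v k with hb
  set z := y - b with hz
  have hon : ∀ j < l, ∀ k < l, ⟪v j, v k⟫ = if j = k then 1 else 0 :=
    fun j hj k hk => h.orthonormal j (by omega) k (by omega)
  have hvb : ∀ k < l, ⟪v k, b⟫ = ⟪v k, φ⟫ := by
    intro k hk
    rw [hb, inner_sum, Finset.sum_eq_single k]
    · rw [inner_smul_right, hon k hk k hk]; simp
    · intro j hj hjk
      rw [inner_smul_right, hon k hk j (Finset.mem_range.1 hj)]; simp [hjk.symm]
    · intro hk'; exact absurd (Finset.mem_range.2 hk) hk'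
  have hvlb : ⟪v l, b⟫ = 0 := by
    rw [hb, inner_sum]
    refine sum_eq_zero fun k hk => ?_
    have hk := Finset.mem_range.1 hk
    rw [inner_smul_right, h.orthonormal l (by omega) k (by omega), if_neg (by omega), mul_zero]
  have hvz : ∀ k < l, ⟪v k, z⟫ = 0 := by
    intro k hk
    rw [hz, hy, inner_sub_right, inner_sub_right, inner_smul_right,
      h.orthonormal k (by omega) l (by omega), if_neg (by omega), hvb k hk]
    simp
  have hvly : ⟪v l, y⟫ = 0 := by
    rw [hy, inner_sub_right, inner_smul_right, real_inner_self_eq_norm_sq, hvl, ha, real_inner_comm]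
    simp
  have hvlz : ⟪v l, z⟫ = 0 := by rw [hz, inner_sub_right, hvly, hvlb, sub_zero]
  have hbz : ⟪b, z⟫ = 0 := by
    rw [hb, sum_inner]
    refine sum_eq_zero fun k hk => ?_
    rw [inner_smul_left, hvz k (Finset.mem_range.1 hk), mul_zero]
  have hTb : T b = ∑ k ∈ range l, (lam k * ⟪v k, φ⟫) • v k := by
    rw [hb, map_sum]
    refine sum_congr rfl fun k hk => ?_
    rw [map_smul, h.eigen k (by have := Finset.mem_range.1 hk; omega), smul_smul, mul_comm]
  have hTbz : ⟪T b, z⟫ = 0 := by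
    rw [hTb, sum_inner]
    refine sum_eq_zero fun k hk => ?_
    rw [inner_smul_left, hvz k (Finset.mem_range.1 hk), mul_zero]
  have h1 : (lam l + g) * ‖b‖ ^ 2 ≤ ⟪T b, b⟫ :=
    le_inner_sum_smul (T := T) (fun k hk => h.eigen k (by omega)) hon hg1 _
  have h2 : ⟪T z, z⟫ ≤ θ * ‖z‖ ^ 2 := by
    refine hray z fun k hk => ?_
    rcases hk.lt_or_eq with hk | rfl
    · exact hvz k hk
    · exact hvlz
  have hyz : y = z + b := by rw [hz]; abel
  have hny : ‖y‖ ^ 2 = ‖z‖ ^ 2 + ‖b‖ ^ 2 := by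
    rw [hyz, norm_add_sq_real, real_inner_comm, hbz]; ring
  have hnzb : ‖b - z‖ ^ 2 = ‖y‖ ^ 2 := by rw [norm_sub_sq_real, hbz, hny]; ring
  have hnzb' : ‖b - z‖ = ‖y‖ := by
    have := Real.sqrt_sq (norm_nonneg (b - z))
    rw [← this, hnzb, Real.sqrt_sq (norm_nonneg _)]
  have hTzb : ⟪T z, b⟫ = 0 := by rw [hs, real_inner_comm, hTbz]
  have hinner : g * ‖y‖ ^ 2 ≤ ⟪T y - lam l • y, b - z⟫ := by
    have : ⟪T y - lam l • y, b - z⟫ = ⟪T b, b⟫ - lam l * ‖b‖ ^ 2 -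
        (⟪T z, z⟫ - lam l * ‖z‖ ^ 2) := by
      have e1 : ⟪z, b⟫ = 0 := by rw [real_inner_comm, hbz]
      rw [hyz, map_add]
      simp only [inner_sub_left, inner_sub_right, inner_add_left, inner_smul_left, hTbz, hTzb, hbz,
        e1, real_inner_self_eq_norm_sq]
      simp only [conj_trivial]; ring
    rw [this, hny]
    nlinarith [sq_nonneg ‖z‖, sq_nonneg ‖b‖]
  have hTy : T y - lam l • y = T φ - lam l • φ := by
    rw [hy, map_sub, map_smul, h.eigen l (by omega), smul_sub, smul_comm a]
    abel
  have hyle : g * ‖y‖ ≤ η := by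
    rcases (norm_nonneg y).eq_or_lt with h0 | h0
    · rw [← h0, mul_zero]; exact (norm_nonneg _).trans hη
    · have : g * ‖y‖ ^ 2 ≤ η * ‖y‖ := by
        refine hinner.trans ((real_inner_le_norm _ _).trans ?_)
        rw [hnzb', hTy]; gcongr
      refine le_of_mul_le_mul_right ?_ h0
      linarith [sq ‖y‖]
  have hyle' : ‖y‖ ≤ η / g := by rw [le_div_iff₀ hg]; linarith
  have ha1 : a ≤ 1 := by
    have := real_inner_le_norm φ (v l)
    rwa [hφ, hvl, one_mul] at this
  have hny2 : ‖y‖ ^ 2 = 1 - a ^ 2 := by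
    rw [hy, norm_sub_sq_real, inner_smul_right, norm_smul, hφ, hvl, ← ha]
    simp; ring
  have hnd : ‖φ - v l‖ ^ 2 ≤ (2 * ‖y‖) ^ 2 := by
    rw [norm_sub_sq_real, hφ, hvl, ← ha, mul_pow, hny2]
    nlinarith
  calc ‖φ - v l‖ ≤ 2 * ‖y‖ := (pow_le_pow_iff_left₀ (norm_nonneg _) (by positivity) two_ne_zero).1 hnd
    _ ≤ _ := by gcongr

end Hilbert

section IntegralOperator

variable {α : Type*} [MeasurableSpace α] {μ : Measure α}

variable (μ) in
/-- The Hilbert–Schmidt operator `f ↦ (t ↦ ⟪F t, f⟫)` of an `L²` kernel. -/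
def hilbertSchmidt : Lp (Lp ℝ 2 μ) 2 μ →L[ℝ] Lp ℝ 2 μ →L[ℝ] Lp ℝ 2 μ :=
  LinearMap.mkContinuous₂ (LinearMap.mk₂ ℝ (fun F f => (innerSL ℝ f).compLp F)
    (fun F F' f => ((innerSL ℝ f).compLpₗ 2 μ).map_add F F')
    (fun c F f => ((innerSL ℝ f).compLpₗ 2 μ).map_smul c F)
    (fun F f f' => by rw [map_add, ContinuousLinearMap.add_compLp])
    (fun c F f => by rw [map_smul, ContinuousLinearMap.smul_compLp])) 1 fun F f => by
      rw [one_mul, mul_comm]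
      exact (ContinuousLinearMap.norm_compLp_le _ _).trans (by rw [innerSL_apply_norm])

lemma coeFn_hilbertSchmidt (F : Lp (Lp ℝ 2 μ) 2 μ) (f : Lp ℝ 2 μ) :
  hilbertSchmidt μ F f =ᵐ[μ] fun t => inner ℝ f (F t) :=
  (innerSL ℝ f).coeFn_compLp F

lemma norm_hilbertSchmidt_le (F : Lp (Lp ℝ 2 μ) 2 μ) : ‖hilbertSchmidt μ F‖ ≤ ‖F‖ := by
  refine ContinuousLinearMap.opNorm_le_bound _ (norm_nonneg _) fun f => ?_
  rw [mul_comm]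
  exact (ContinuousLinearMap.norm_compLp_le (innerSL ℝ f) F).trans (by rw [innerSL_apply_norm])

lemma isCompactOperator_hilbertSchmidt (F : Lp (Lp ℝ 2 μ) 2 μ) :
  IsCompactOperator (hilbertSchmidt μ F) := by
  refine Lp.induction (by norm_num) (fun F => IsCompactOperator (hilbertSchmidt μ F)) ?_ ?_ ?_ F
  · intro g s hs hμs
    have h1 : ∀ f, hilbertSchmidt μ (Lp.simpleFunc.indicatorConst 2 hs hμs.ne g : Lp (Lp ℝ 2 μ) 2 μ)
        f = (inner ℝ f g : ℝ) • indicatorConstLp 2 hs hμs.ne (1 : ℝ) := by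
      intro f
      refine Lp.ext ?_
      filter_upwards [coeFn_hilbertSchmidt (Lp.simpleFunc.indicatorConst 2 hs hμs.ne g :
        Lp (Lp ℝ 2 μ) 2 μ) f, Lp.coeFn_smul (inner ℝ f g : ℝ) (indicatorConstLp 2 hs hμs.ne (1 : ℝ)),
        indicatorConstLp_coeFn (p := 2) (hs := hs) (hμs := hμs.ne) (c := g),
        indicatorConstLp_coeFn (p := 2) (hs := hs) (hμs := hμs.ne) (c := (1 : ℝ))] with t h1 h2 h3 h4
      rw [h1, h2, Pi.smul_apply, h4, Lp.simpleFunc.coe_indicatorConst, h3]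
      by_cases ht : t ∈ s <;> simp [ht]
    have h2 : IsCompactOperator (ContinuousLinearMap.smulRight (innerSL ℝ g)
        (indicatorConstLp 2 hs hμs.ne (1 : ℝ) : Lp ℝ 2 μ)) := by
      exact (isCompactOperator_id_iff_locallyCompactSpace.2 inferInstance :
        IsCompactOperator (id : ℝ → ℝ)).comp_clm (innerSL ℝ g) |>.clm_comp
          (ContinuousLinearMap.toSpanSingleton ℝ _)
    convert h2 using 1
    ext1 f
    rw [h1 f, ContinuousLinearMap.smulRight_apply, innerSL_apply_apply, real_inner_comm]
  · intro f g hf hg _ h1 h2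
    rw [map_add]
    exact h1.add h2
  · exact (isClosed_setOfPred_isCompactOperator (𝕜₁ := ℝ) (𝕜₂ := ℝ) (σ₁₂ := RingHom.id ℝ)
      (M₁ := Lp ℝ 2 μ) (M₂ := Lp ℝ 2 μ)).preimage (hilbertSchmidt μ).continuous

variable [TopologicalSpace α] [CompactSpace α] [SecondCountableTopology α] [BorelSpace α]
  [IsFiniteMeasure μ]

variable (μ) in
/-- A continuous kernel as an `L²` kernel. -/
def kernelLp : C(α × α, ℝ) →ₗ[ℝ] Lp (Lp ℝ 2 μ) 2 μ where
  toFun k := ContinuousMap.toLp 2 μ ℝ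
    ((⟨ContinuousMap.toLp 2 μ ℝ, ContinuousLinearMap.continuous _⟩ :
      C(C(α, ℝ), Lp ℝ 2 μ)).comp k.curry)
  map_add' k k' := by
    rw [← map_add]
    congr 1
  map_smul' c k := by
    rw [RingHom.id_apply, ← map_smul]
    congr 1

lemma coeFn_kernelLp (k : C(α × α, ℝ)) :
  kernelLp μ k =ᵐ[μ] fun t => ContinuousMap.toLp 2 μ ℝ (k.curry t) :=
  ContinuousMap.coeFn_toLp μ _

lemma inner_toLp_left (g : C(α, ℝ)) (f : Lp ℝ 2 μ) :
  inner ℝ f (ContinuousMap.toLp 2 μ ℝ g) = ∫ s, g s * f s ∂μ := by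
  rw [L2.inner_def]
  refine integral_congr_ae ?_
  filter_upwards [ContinuousMap.coeFn_toLp (p := 2) (𝕜 := ℝ) μ g] with s hs
  simp only [RCLike.inner_apply, conj_trivial, hs]

variable (μ) in
/-- The integral operator of a continuous kernel. -/
def integralOperator (k : C(α × α, ℝ)) : Lp ℝ 2 μ →L[ℝ] Lp ℝ 2 μ := hilbertSchmidt μ (kernelLp μ k)

lemma coeFn_integralOperator (k : C(α × α, ℝ)) (f : Lp ℝ 2 μ) :
  integralOperator μ k f =ᵐ[μ] fun t => ∫ s, k (t, s) * f s ∂μ := by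
  filter_upwards [coeFn_hilbertSchmidt (kernelLp μ k) f, coeFn_kernelLp k] with t h1 h2
  rw [integralOperator, h1, h2, inner_toLp_left]
  rfl

lemma isCompactOperator_integralOperator (k : C(α × α, ℝ)) :
  IsCompactOperator (integralOperator μ k) :=
  isCompactOperator_hilbertSchmidt _

lemma norm_kernelLp_sq (k : C(α × α, ℝ)) : ‖kernelLp μ k‖ ^ 2 = ∫ t, ∫ s, k (t, s) ^ 2 ∂μ ∂μ := by
  rw [← real_inner_self_eq_norm_sq, L2.inner_def]
  refine integral_congr_ae ?_
  filter_upwards [coeFn_kernelLp k] with t ht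
  rw [ht, inner_toLp_left]
  refine integral_congr_ae ?_
  filter_upwards [ContinuousMap.coeFn_toLp (p := 2) (𝕜 := ℝ) μ (k.curry t)] with s hs
  rw [hs, sq]
  rfl

lemma norm_integralOperator_sub_le (k k' : C(α × α, ℝ)) {ε : ℝ} (hε : 0 ≤ ε)
  (h : ∫ t, ∫ s, (k' (t, s) - k (t, s)) ^ 2 ∂μ ∂μ ≤ ε ^ 2) :
  ‖integralOperator μ k' - integralOperator μ k‖ ≤ ε := by
  rw [integralOperator, integralOperator, ← map_sub, ← map_sub]
  refine (norm_hilbertSchmidt_le _).trans ?_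
  refine (pow_le_pow_iff_left₀ (norm_nonneg _) hε two_ne_zero).1 ?_
  rw [norm_kernelLp_sq]
  exact h

lemma inner_integralOperator_comm {k : C(α × α, ℝ)} (hk : ∀ s t, k (s, t) = k (t, s))
  (f g : Lp ℝ 2 μ) :
  inner ℝ (integralOperator μ k f) g = inner ℝ f (integralOperator μ k g) := by
  have hf : Integrable f μ := (Lp.memLp f).integrable (by norm_num)
  have hg : Integrable g μ := (Lp.memLp g).integrable (by norm_num)
  have e1 : inner ℝ (integralOperator μ k f) g = ∫ t, ∫ s, k (t, s) * (g t * f s) ∂μ ∂μ := by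
    rw [L2.inner_def]
    refine integral_congr_ae ?_
    filter_upwards [coeFn_integralOperator k f] with t ht
    simp only [ht, RCLike.inner_apply, conj_trivial]
    rw [← integral_const_mul]
    exact integral_congr_ae (ae_of_all _ fun s => by simp only; ring)
  have e2 : inner ℝ f (integralOperator μ k g) = ∫ s, ∫ t, k (t, s) * (g t * f s) ∂μ ∂μ := by
    rw [L2.inner_def]
    refine integral_congr_ae ?_
    filter_upwards [coeFn_integralOperator k g] with t ht
    simp only [ht, RCLike.inner_apply, conj_trivial]
    rw [← integral_mul_const]
    exact integral_congr_ae (ae_of_all _ fun s => by simp only [hk s t]; ring)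
  rw [e1, e2]
  refine integral_integral_swap ?_
  have h1 : Integrable (fun p : α × α => g p.1 * f p.2) (μ.prod μ) := hg.mul_prod hf
  obtain ⟨B, hB⟩ : ∃ B, ∀ p, ‖k p‖ ≤ B := ⟨‖k‖, k.norm_coe_le_norm⟩
  exact h1.bdd_mul k.continuous.aestronglyMeasurable (ae_of_all _ hB)

lemma abs_inner_sub_le_of_norm_le {E : Type*} [NormedAddCommGroup E] [InnerProductSpace ℝ E]
  {T T' : E →L[ℝ] E} {ε : ℝ} (h : ‖T' - T‖ ≤ ε) (x : E) :
  |inner ℝ (T' x) x - inner ℝ (T x) x| ≤ ε * ‖x‖ ^ 2 := by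
  rw [← inner_sub_left, ← sub_apply]
  refine (abs_real_inner_le_norm _ _).trans ?_
  calc ‖(T' - T) x‖ * ‖x‖ ≤ (ε * ‖x‖) * ‖x‖ := by
        gcongr; exact (T' - T).le_of_opNorm_le h x
    _ = _ := by ring

end IntegralOperator

section Interval

variable {a b : ℝ}

local notation "I" => Icc a b

/-- Lebesgue measure on the subtype `[a, b]`. -/
def intervalMeasure (a b : ℝ) : Measure (Icc a b) := Measure.comap Subtype.val volume

lemma measurePreserving_intervalMeasure (a b : ℝ) :
  MeasurePreserving (Subtype.val : Icc a b → ℝ) (intervalMeasure a b)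
    (volume.restrict (Icc a b)) := by
  refine ⟨measurable_subtype_coe, ?_⟩
  rw [intervalMeasure, (MeasurableEmbedding.subtype_coe measurableSet_Icc).map_comap,
    Subtype.range_coe]

instance : IsFiniteMeasure (intervalMeasure a b) := by
  constructor
  have h := (measurePreserving_intervalMeasure a b).measure_preimage
    (MeasurableSet.univ.nullMeasurableSet)
  rw [preimage_univ] at h
  rw [h]
  exact measure_lt_top _ _

lemma integral_intervalMeasure (φ : ℝ → ℝ) : ∫ s, φ s ∂intervalMeasure a b = ∫ s in I, φ s :=
  integral_subtype_comap measurableSet_Icc φ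

/-- A kernel that is continuous and symmetric on `[a, b]²`. -/
structure IsSymmKernel (a b : ℝ) (C : ℝ → ℝ → ℝ) : Prop where
  continuousOn : ContinuousOn (fun p : ℝ × ℝ => C p.1 p.2) (Icc a b ×ˢ Icc a b)
  symm : ∀ s ∈ Icc a b, ∀ t ∈ Icc a b, C s t = C t s

variable {C C' : ℝ → ℝ → ℝ}

/-- The restriction of a kernel to `[a, b]²`. -/
def IsSymmKernel.toContinuousMap (hC : IsSymmKernel a b C) : C(Icc a b × Icc a b, ℝ) where
  toFun p := C p.2 p.1
  continuous_toFun := by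
    have h := hC.continuousOn.comp_continuous
      (f := fun p : Icc a b × Icc a b => ((p.2 : ℝ), (p.1 : ℝ))) (by fun_prop)
      (fun p => ⟨p.2.2, p.1.2⟩)
    exact h

/-- The integral operator on `L²([a, b])`. -/
def IsSymmKernel.operator (hC : IsSymmKernel a b C) :
  Lp ℝ 2 (intervalMeasure a b) →L[ℝ] Lp ℝ 2 (intervalMeasure a b) :=
  integralOperator _ hC.toContinuousMap

lemma IsSymmKernel.inner_operator (hC : IsSymmKernel a b C) (f g : Lp ℝ 2 (intervalMeasure a b)) :
  inner ℝ (hC.operator f) g = inner ℝ f (hC.operator g) :=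
  inner_integralOperator_comm (fun s t => hC.symm _ t.2 _ s.2) f g

lemma IsSymmKernel.coeFn_operator (hC : IsSymmKernel a b C) (f : Lp ℝ 2 (intervalMeasure a b)) :
  hC.operator f =ᵐ[intervalMeasure a b] fun t => ∫ s, C s t * f s ∂intervalMeasure a b :=
  coeFn_integralOperator _ f

lemma IsSymmKernel.norm_operator_sub_le (hC : IsSymmKernel a b C) (hC' : IsSymmKernel a b C')
  {ε : ℝ} (hε : 0 ≤ ε)
  (h : ∫ t in I, ∫ s in I, (C' s t - C s t) ^ 2 ≤ ε ^ 2) :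
  ‖hC'.operator - hC.operator‖ ≤ ε := by
  refine norm_integralOperator_sub_le _ _ hε (le_of_eq_of_le ?_ h)
  rw [← integral_intervalMeasure fun t => ∫ s in I, (C' s t - C s t) ^ 2]
  refine integral_congr_ae (ae_of_all _ fun t => ?_)
  exact integral_intervalMeasure fun s => (C' s t - C s t) ^ 2

/-- The class of a function in `L²([a, b])`. -/
def toL2 (a b : ℝ) (φ : ℝ → ℝ) : Lp ℝ 2 (intervalMeasure a b) :=
  open Classical in
  if h : MemLp (fun t : Icc a b => φ t) 2 (intervalMeasure a b) then h.toLp else 0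

lemma coeFn_toL2 {φ : ℝ → ℝ} (hφ : MemLp φ 2 (volume.restrict I)) :
  toL2 a b φ =ᵐ[intervalMeasure a b] fun t => φ t := by
  have h : MemLp (fun t : I => φ t) 2 (intervalMeasure a b) :=
    hφ.comp_measurePreserving (measurePreserving_intervalMeasure a b)
  rw [toL2, dif_pos h]
  exact h.coeFn_toLp

lemma inner_toL2 {φ ψ : ℝ → ℝ} (hφ : MemLp φ 2 (volume.restrict I))
  (hψ : MemLp ψ 2 (volume.restrict I)) :
  inner ℝ (toL2 a b φ) (toL2 a b ψ) = ∫ t in I, φ t * ψ t := by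
  rw [L2.inner_def, ← integral_intervalMeasure fun t => φ t * ψ t]
  refine integral_congr_ae ?_
  filter_upwards [coeFn_toL2 hφ, coeFn_toL2 hψ] with t h1 h2
  simp only [h1, h2, RCLike.inner_apply, conj_trivial, mul_comm]

lemma IsSymmKernel.operator_toL2 (hC : IsSymmKernel a b C) {μ : ℝ} {φ : ℝ → ℝ}
  (hφ : IsEigenfunction I C μ φ) : hC.operator (toL2 a b φ) = μ • toL2 a b φ := by
  refine Lp.ext ?_
  filter_upwards [hC.coeFn_operator (toL2 a b φ), Lp.coeFn_smul μ (toL2 a b φ),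
    coeFn_toL2 hφ.memLp] with t h1 h2 h3
  rw [h1, h2, Pi.smul_apply, h3, smul_eq_mul, ← hφ.eigen t t.2,
    ← integral_intervalMeasure fun s => C s t * φ s]
  refine integral_congr_ae ?_
  filter_upwards [coeFn_toL2 hφ.memLp] with s hs
  rw [hs]

lemma IsSymmKernel.exists_isEigenfunction (hC : IsSymmKernel a b C) {μ : ℝ} (hμ : μ ≠ 0)
  {u : Lp ℝ 2 (intervalMeasure a b)} (hu : hC.operator u = μ • u) :
  ∃ φ, IsEigenfunction I C μ φ ∧ toL2 a b φ = u := by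
  let φ : ℝ → ℝ := fun t => μ⁻¹ * ∫ s, C s t * u s ∂intervalMeasure a b
  have hφu : (fun t : I => φ t) =ᵐ[intervalMeasure a b] u := by
    have h := hC.coeFn_operator u
    rw [hu] at h
    filter_upwards [h, Lp.coeFn_smul μ u] with t h1 h2
    rw [h2, Pi.smul_apply, smul_eq_mul] at h1
    simp only [φ, ← h1]
    field_simp
  have hmem : MemLp (fun t : I => φ t) 2 (intervalMeasure a b) :=
    (memLp_congr_ae hφu).2 (Lp.memLp u)
  have hmem' : MemLp φ 2 (volume.restrict I) := by
    rw [← (measurePreserving_intervalMeasure a b).map_eq]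
    exact (MeasurableEmbedding.subtype_coe measurableSet_Icc).memLp_map_measure_iff.2 hmem
  refine ⟨φ, ⟨hmem', fun t _ => ?_⟩, Lp.ext ((coeFn_toL2 hmem').trans hφu)⟩
  have h1 : ∫ s, C s t * φ s ∂intervalMeasure a b = ∫ s, C s t * u s ∂intervalMeasure a b := by
    refine integral_congr_ae ?_
    filter_upwards [hφu] with s hs
    rw [hs]
  rw [← integral_intervalMeasure fun s => C s t * φ s, h1]
  simp only [φ]
  field_simp

variable {l : ℕ} {lam lam' : ℕ → ℝ} {psi psi' : ℕ → ℝ → ℝ}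

lemma IsLeadingEigensystem.memLp (h : IsLeadingEigensystem I C l lam psi) {k : ℕ}
  (hk : k ≤ l) : MemLp (psi k) 2 (volume.restrict I) := (h.isEigenfunction k hk).memLp

lemma IsLeadingEigensystem.inner_eq (h : IsLeadingEigensystem I C l lam psi) {j k : ℕ}
  (hj : j ≤ l) (hk : k ≤ l) :
  inner ℝ (toL2 a b (psi j)) (toL2 a b (psi k)) = if j = k then (1 : ℝ) else 0 := by
  rw [inner_toL2 (h.memLp hj) (h.memLp hk), h.orthonormal j hj k hk]

lemma IsLeadingEigensystem.le_of_eigenvector (h : IsLeadingEigensystem I C l lam psi)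
  (hC : IsSymmKernel a b C) {μ : ℝ} {u : Lp ℝ 2 (intervalMeasure a b)} (hμ : 0 < μ)
  (hu1 : ‖u‖ = 1) (hu : hC.operator u = μ • u)
  (ho : ∀ k ≤ l, inner ℝ (toL2 a b (psi k)) u = (0 : ℝ)) : μ ≤ lam l := by
  obtain ⟨φ, hφ, rfl⟩ := hC.exists_isEigenfunction hμ.ne' hu
  refine h.leading μ φ hφ ?_ fun k hk => ?_
  · have h1 : ∫ t in I, φ t ^ 2 = 1 := by
      simp_rw [sq]
      rw [← inner_toL2 hφ.memLp hφ.memLp, real_inner_self_eq_norm_sq, hu1, one_pow]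
    rw [h1]; exact one_pos
  · rw [← inner_toL2 hφ.memLp (h.memLp hk), real_inner_comm, ho k hk]

lemma IsLeadingEigensystem.rayleigh_le (h : IsLeadingEigensystem I C l lam psi)
  (hC : IsSymmKernel a b C) (x : Lp ℝ 2 (intervalMeasure a b))
  (hx : ∀ k < l, inner ℝ (toL2 a b (psi k)) x = (0 : ℝ)) :
  inner ℝ (hC.operator x) x ≤ max (lam l) 0 * ‖x‖ ^ 2 :=
  rayleigh_le_of_leading (v := fun k => toL2 a b (psi k)) (isCompactOperator_integralOperator _)
    hC.inner_operator (fun k hk => hC.operator_toL2 (h.isEigenfunction k hk))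
    (fun _ hj _ hk => h.inner_eq hj hk)
    (fun _ _ hμ hu1 hu ho => h.le_of_eigenvector hC hμ hu1 hu ho) x hx

lemma IsLeadingEigensystem.isLeadingVectors (h : IsLeadingEigensystem I C l lam psi)
  (hC : IsSymmKernel a b C) (hl : 0 < lam l) :
  IsLeadingVectors hC.operator l lam fun k => toL2 a b (psi k) where
  eigen k hk := hC.operator_toL2 (h.isEigenfunction k hk)
  orthonormal j hj k hk := h.inner_eq hj hk
  ordered := h.ordered
  rayleigh x hx := by
    have := h.rayleigh_le hC x hx
    rwa [max_eq_left hl.le] at this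

lemma IsLeadingVectors.exists_isLeadingEigensystem {hC : IsSymmKernel a b C}
  {v : ℕ → Lp ℝ 2 (intervalMeasure a b)} (h : IsLeadingVectors hC.operator l lam v)
  (hl : 0 < lam l) : ∃ psi, IsLeadingEigensystem I C l lam psi := by
  have hex : ∀ k, ∃ φ, k ≤ l → IsEigenfunction I C (lam k) φ ∧ toL2 a b φ = v k := by
    intro k
    by_cases hk : k ≤ l
    · obtain ⟨φ, h1, h2⟩ := hC.exists_isEigenfunction
        (hl.trans_le (h.ordered k l hk le_rfl)).ne' (h.eigen k hk)
      exact ⟨φ, fun _ => ⟨h1, h2⟩⟩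
    · exact ⟨0, fun hk' => absurd hk' hk⟩
  choose psi hpsi using hex
  refine ⟨psi, ⟨fun k hk => (hpsi k hk).1, fun j hj k hk => ?_, h.ordered,
    fun μ φ hφ hpos ho => ?_⟩⟩
  · rw [← inner_toL2 (hpsi j hj).1.memLp (hpsi k hk).1.memLp, (hpsi j hj).2, (hpsi k hk).2,
      h.orthonormal j hj k hk]
  · have h1 := h.rayleigh (toL2 a b φ) fun k hk => by
      rw [← (hpsi k hk.le).2, inner_toL2 (hpsi k hk.le).1.memLp hφ.memLp, ← ho k hk.le]
      simp only [mul_comm]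
    rw [hC.operator_toL2 hφ, inner_smul_left, conj_trivial, ← real_inner_self_eq_norm_sq,
      inner_toL2 hφ.memLp hφ.memLp] at h1
    refine le_of_mul_le_mul_right h1 ?_
    simpa only [sq] using hpos

variable {ε : ℝ}

lemma IsLeadingEigensystem.exists_isNthEigenpair
  (h : IsLeadingEigensystem I C l lam psi) (hC : IsSymmKernel a b C)
  (hC' : IsSymmKernel a b C') (hε : 0 ≤ ε)
  (hCC : ∫ t in I, ∫ s in I, (C' s t - C s t) ^ 2 ≤ ε ^ 2) (hεl : ε < lam l) :
  ∃ μ φ, IsNthEigenpair I C' l μ φ := by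
  obtain ⟨lam', v', h1, h2⟩ := (h.isLeadingVectors hC (by linarith)).exists_perturbation
    (isCompactOperator_integralOperator _) hC'.inner_operator
    (abs_inner_sub_le_of_norm_le (hC.norm_operator_sub_le hC' hε hCC)) hεl
  obtain ⟨psi', h3⟩ := h1.exists_isLeadingEigensystem h2
  exact ⟨lam' l, psi' l, lam', psi', h3, rfl, rfl⟩

lemma IsLeadingEigensystem.abs_eigenvalue_sub_le
  (h : IsLeadingEigensystem I C l lam psi) (hC : IsSymmKernel a b C)
  (hC' : IsSymmKernel a b C') (hε : 0 ≤ ε)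
  (hCC : ∫ t in I, ∫ s in I, (C' s t - C s t) ^ 2 ≤ ε ^ 2) (hεl : ε < lam l)
  {μ : ℝ} {φ : ℝ → ℝ} (hμ : IsNthEigenpair I C' l μ φ) : |μ - lam l| ≤ ε := by
  obtain ⟨lam', psi', h', rfl, rfl⟩ := hμ
  have hv := h.isLeadingVectors hC (by linarith)
  have hq := abs_inner_sub_le_of_norm_le (hC.norm_operator_sub_le hC' hε hCC)
  have hpos : 0 < lam' l := hv.pos_of_leading (v' := fun k => toL2 a b (psi' k))
    (isCompactOperator_integralOperator _) hC'.inner_operator hq hεl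
    (fun k hk => hC'.operator_toL2 (h'.isEigenfunction k hk)) h'.ordered
    (fun μ u hμ hu1 hu ho => h'.le_of_eigenvector hC' hμ hu1 hu ho)
  exact hv.abs_sub_le (h'.isLeadingVectors hC' hpos) hq

lemma IsNthEigenpair.integral_sq_eq_one {μ : ℝ} {φ : ℝ → ℝ} (hμ : IsNthEigenpair I C l μ φ) :
  IsEigenfunction I C μ φ ∧ ∫ t in I, φ t ^ 2 = 1 := by
  obtain ⟨lam', psi', h', rfl, rfl⟩ := hμ
  refine ⟨h'.isEigenfunction l le_rfl, ?_⟩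
  have := h'.orthonormal l le_rfl l le_rfl
  simpa only [sq, if_true] using this

lemma IsLeadingEigensystem.integral_eigenfunction_sub_sq_le
  (h : ∀ k ≤ l + 1, IsLeadingEigensystem I C k lam psi) (hC : IsSymmKernel a b C)
  (hC' : IsSymmKernel a b C') (hε : 0 ≤ ε)
  (hCC : ∫ t in I, ∫ s in I, (C' s t - C s t) ^ 2 ≤ ε ^ 2) (hεl : ε < lam l)
  {g : ℝ} (hg : 0 < g) (hg1 : ∀ k < l, lam l + g ≤ lam k) (hg2 : max (lam (l + 1)) 0 + g ≤ lam l)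
  {μ : ℝ} {φ : ℝ → ℝ} (hμ : IsNthEigenpair I C' l μ φ)
  (hsign : 0 ≤ ∫ t in I, φ t * psi l t) :
  ∫ t in I, (φ t - psi l t) ^ 2 ≤ (4 * ε / g) ^ 2 := by
  have hl := h l (by omega)
  have hv := hl.isLeadingVectors hC (by linarith)
  have hop := hC.norm_operator_sub_le hC' hε hCC
  have hval := hl.abs_eigenvalue_sub_le hC hC' hε hCC hεl hμ
  obtain ⟨hφ, hφ1⟩ := hμ.integral_sq_eq_one
  have hn : ‖toL2 a b φ‖ = 1 := by
    have : ‖toL2 a b φ‖ ^ 2 = 1 := by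
      rw [← real_inner_self_eq_norm_sq, inner_toL2 hφ.memLp hφ.memLp, ← hφ1]; simp only [sq]
    exact (pow_eq_one_iff_of_nonneg (norm_nonneg _) two_ne_zero).1 this
  have hη : ‖hC.operator (toL2 a b φ) - lam l • toL2 a b φ‖ ≤ 2 * ε := by
    have e : hC.operator (toL2 a b φ) - lam l • toL2 a b φ =
        (μ - lam l) • toL2 a b φ - (hC'.operator - hC.operator) (toL2 a b φ) := by
      rw [sub_apply, hC'.operator_toL2 hφ, sub_smul]; abel
    rw [e]
    refine (norm_sub_le _ _).trans ?_
    have h1 := (hC'.operator - hC.operator).le_of_opNorm_le hop (toL2 a b φ)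
    rw [norm_smul, hn, norm_eq_abs]
    rw [hn] at h1
    linarith
  have hm := hl.memLp le_rfl
  have key := hv.norm_sub_le hC.inner_operator hg (θ := max (lam (l + 1)) 0)
    (fun x hx => (h (l + 1) le_rfl).rayleigh_le hC x fun k hk => hx k (by omega)) hg1 hg2 hn hη
    (by rw [inner_toL2 hφ.memLp hm]; exact hsign)
  have e : ‖toL2 a b φ - toL2 a b (psi l)‖ ^ 2 = ∫ t in I, (φ t - psi l t) ^ 2 := by
    rw [← real_inner_self_eq_norm_sq, L2.inner_def,
      ← integral_intervalMeasure fun t => (φ t - psi l t) ^ 2]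
    refine integral_congr_ae ?_
    filter_upwards [Lp.coeFn_sub (toL2 a b φ) (toL2 a b (psi l)), coeFn_toL2 hφ.memLp,
      coeFn_toL2 hm] with t h1 h2 h3
    rw [h1, Pi.sub_apply, h2, h3]
    simp only [RCLike.inner_apply, conj_trivial, sq]
  rw [← e]
  have : 4 * ε / g = 2 * (2 * ε / g) := by ring
  rw [this]
  gcongr

end Interval

lemma sq_integral_mul_le {α : Type*} [MeasurableSpace α] {μ : Measure α} {f g : α → ℝ}
  (hf : MemLp f 2 μ) (hg : MemLp g 2 μ) :
  (∫ x, f x * g x ∂μ) ^ 2 ≤ (∫ x, f x ^ 2 ∂μ) * ∫ x, g x ^ 2 ∂μ := by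
  have key : ∀ {f g : α → ℝ} (hf : MemLp f 2 μ) (hg : MemLp g 2 μ),
      inner ℝ (hf.toLp f) (hg.toLp g) = ∫ x, f x * g x ∂μ := by
    intro f g hf hg
    rw [L2.inner_def]
    refine integral_congr_ae ?_
    filter_upwards [hf.coeFn_toLp, hg.coeFn_toLp] with x h1 h2
    simp only [h1, h2, RCLike.inner_apply, conj_trivial, mul_comm]
  have h := real_inner_mul_inner_self_le (hf.toLp f) (hg.toLp g)
  rw [key, key, key, ← sq] at h
  simpa only [sq] using h

section Interval

variable {a b : ℝ} {C C' : ℝ → ℝ → ℝ}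

local notation "I" => Icc a b

/-- A section of a symmetric kernel is continuous. -/
lemma IsSymmKernel.continuousOn_left (hC : IsSymmKernel a b C) {t : ℝ} (ht : t ∈ I) :
  ContinuousOn (fun s => C s t) I := by
  exact hC.continuousOn.comp (f := fun s : ℝ => (s, t)) (by fun_prop) fun s hs => ⟨hs, ht⟩

lemma IsSymmKernel.memLp_left (hC : IsSymmKernel a b C) {t : ℝ} (ht : t ∈ I) :
  MemLp (fun s => C s t) 2 (volume.restrict I) := by
  obtain ⟨B, hB⟩ := isCompact_Icc.exists_bound_of_continuousOn (hC.continuousOn_left ht)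
  exact MemLp.of_bound ((hC.continuousOn_left ht).aestronglyMeasurable measurableSet_Icc) B
    ((ae_restrict_iff' measurableSet_Icc).2 (ae_of_all _ hB))

lemma IsSymmKernel.abs_integral_mul_le (hab : a ≤ b) (hC : IsSymmKernel a b C) {B : ℝ}
  (hB0 : 0 ≤ B) (hB : ∀ s ∈ I, ∀ t ∈ I, |C s t| ≤ B) {φ : ℝ → ℝ}
  (hφ : MemLp φ 2 (volume.restrict I)) {η : ℝ} (hη : 0 ≤ η)
  (hφη : ∫ s in I, φ s ^ 2 ≤ η ^ 2) {t : ℝ} (ht : t ∈ I) :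
  |∫ s in I, C s t * φ s| ≤ B * √(b - a) * η := by
  refine abs_le_of_sq_le_sq ?_ (by positivity)
  have h1 : ∫ s in I, C s t ^ 2 ≤ (b - a) * B ^ 2 := by
    have : ∫ s in I, C s t ^ 2 ≤ ∫ s in I, B ^ 2 := by
      refine setIntegral_mono_on (hC.memLp_left ht).integrable_sq (integrable_const _)
        measurableSet_Icc fun s hs => ?_
      exact sq_le_sq' (neg_le_of_abs_le (hB s hs t ht)) (le_of_abs_le (hB s hs t ht))
    simpa [hab] using this
  calc (∫ s in I, C s t * φ s) ^ 2
      ≤ (∫ s in I, C s t ^ 2) * ∫ s in I, φ s ^ 2 := sq_integral_mul_le (hC.memLp_left ht) hφ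
    _ ≤ ((b - a) * B ^ 2) * η ^ 2 := by gcongr
    _ = (B * √(b - a) * η) ^ 2 := by rw [mul_pow, mul_pow, sq_sqrt (by linarith)]; ring

lemma IsEigenfunction.abs_le (hab : a ≤ b) (hC : IsSymmKernel a b C) {B : ℝ} (hB0 : 0 ≤ B)
  (hB : ∀ s ∈ I, ∀ t ∈ I, |C s t| ≤ B) {μ : ℝ} (hμ : 0 < μ) {φ : ℝ → ℝ}
  (hφ : IsEigenfunction I C μ φ) (hφ1 : ∫ t in I, φ t ^ 2 ≤ 1) {t : ℝ}
  (ht : t ∈ I) : |φ t| ≤ B * √(b - a) / μ := by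
  have h := hC.abs_integral_mul_le hab hB0 hB hφ.memLp zero_le_one (by simpa using hφ1) ht
  rw [hφ.eigen t ht, abs_mul, abs_of_pos hμ, mul_one] at h
  rw [le_div_iff₀ hμ]; linarith

lemma IsEigenfunction.continuousOn (hC : IsSymmKernel a b C) {μ : ℝ} (hμ : μ ≠ 0) {φ : ℝ → ℝ}
  (hφ : IsEigenfunction I C μ φ) : ContinuousOn φ I := by
  obtain ⟨B, hB⟩ := (isCompact_Icc.prod isCompact_Icc).exists_bound_of_continuousOn hC.continuousOn
  have h1 : ContinuousOn (fun t => μ⁻¹ * ∫ s in I, C s t * φ s) I := by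
    refine continuousOn_const.mul ?_
    refine continuousOn_of_dominated (bound := fun s => B * |φ s|) (fun t ht => ?_)
      (fun t ht => ?_) ?_ ?_
    · exact (hC.memLp_left ht).aestronglyMeasurable.mul hφ.memLp.aestronglyMeasurable
    · refine (ae_restrict_iff' measurableSet_Icc).2 (ae_of_all _ fun s hs => ?_)
      rw [norm_mul]
      exact mul_le_mul_of_nonneg_right (hB (s, t) ⟨hs, ht⟩) (norm_nonneg _)
    · exact ((hφ.memLp.integrable (by norm_num)).abs).const_mul _
    · refine (ae_restrict_iff' measurableSet_Icc).2 (ae_of_all _ fun s hs => ?_)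
      refine ContinuousOn.mul ?_ continuousOn_const
      exact hC.continuousOn.comp (f := fun t : ℝ => (s, t)) (by fun_prop) fun t ht => ⟨hs, ht⟩
  refine h1.congr fun t ht => ?_
  simp only [hφ.eigen t ht]
  field_simp

lemma IsEigenfunction.abs_sub_le (hab : a ≤ b) (hC : IsSymmKernel a b C)
  (hC' : IsSymmKernel a b C') {B B' : ℝ} (hB0 : 0 ≤ B) (hB0' : 0 ≤ B')
  (hB : ∀ s ∈ I, ∀ t ∈ I, |C s t| ≤ B)
  (hB' : ∀ s ∈ I, ∀ t ∈ I, |C' s t| ≤ B') {lam μ : ℝ} (hlam : 0 < lam) (hμ : 0 < μ)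
  {φ ψ : ℝ → ℝ} (hφ : IsEigenfunction I C' μ φ) (hψ : IsEigenfunction I C lam ψ)
  (hψ1 : ∫ t in I, ψ t ^ 2 ≤ 1) {η : ℝ} (hη : 0 ≤ η)
  (hφψ : ∫ t in I, (φ t - ψ t) ^ 2 ≤ η ^ 2) {t : ℝ} (ht : t ∈ I) :
  |φ t - ψ t| ≤ (B' * √(b - a) * η + |∫ s in I, (C' s t - C s t) * ψ s| +
    |μ - lam| * (B * √(b - a) / lam)) / μ := by
  have h1 := hC'.abs_integral_mul_le hab hB0' hB' (hφ.memLp.sub hψ.memLp) hη hφψ ht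
  have h2 := hψ.abs_le hab hC hB0 hB hlam hψ1 ht
  have i1 := (hC'.memLp_left ht).integrable_mul hφ.memLp
  have i2 := (hC'.memLp_left ht).integrable_mul hψ.memLp
  have i3 := (hC.memLp_left ht).integrable_mul hψ.memLp
  have e : μ * (φ t - ψ t) = (∫ s in I, C' s t * (φ - ψ) s) +
      (∫ s in I, (C' s t - C s t) * ψ s) - (μ - lam) * ψ t := by
    have e1 : ∫ s in I, C' s t * (φ - ψ) s = (∫ s in I, C' s t * φ s) - ∫ s in I, C' s t * ψ s := by
      simp only [Pi.sub_apply, mul_sub]; exact integral_sub i1 i2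
    have e2 : ∫ s in I, (C' s t - C s t) * ψ s =
        (∫ s in I, C' s t * ψ s) - ∫ s in I, C s t * ψ s := by
      simp only [sub_mul]; exact integral_sub i2 i3
    rw [e1, e2, hφ.eigen t ht, hψ.eigen t ht]; ring
  rw [le_div_iff₀ hμ, mul_comm, ← abs_of_pos hμ, ← abs_mul, e, abs_of_pos hμ]
  refine (_root_.abs_sub _ _).trans (add_le_add ((abs_add_le _ _).trans (add_le_add h1 le_rfl)) ?_)
  rw [abs_mul]
  gcongr

/-- A compact operator has finitely many eigenvalues above a positive threshold. -/
lemma finite_setOf_lt_eigenvalue {lam : ℕ → ℝ} {psi : ℕ → ℝ → ℝ} (hC : IsSymmKernel a b C)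
  (h : ∀ l, IsLeadingEigensystem I C l lam psi) {c : ℝ} (hc : 0 < c) :
  {l | c < lam l}.Finite := by
  by_contra hinf
  have hall : ∀ k, c < lam k := by
    intro k
    obtain ⟨l, hl, hkl⟩ := (show {l | c < lam l}.Infinite from hinf).exists_gt k
    exact lt_of_lt_of_le hl ((h l).ordered k l hkl.le le_rfl)
  set v : ℕ → Lp ℝ 2 (intervalMeasure a b) := fun k => toL2 a b (psi k) with hv
  have hon : ∀ j k, inner ℝ (v j) (v k) = if j = k then (1 : ℝ) else 0 := fun j k =>
    (h (max j k)).inner_eq (le_max_left _ _) (le_max_right _ _)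
  have hn : ∀ k, ‖v k‖ = 1 := by
    intro k
    have := hon k k
    rw [real_inner_self_eq_norm_sq, if_pos rfl] at this
    exact (pow_eq_one_iff_of_nonneg (norm_nonneg _) two_ne_zero).1 this
  obtain ⟨K, hK, hKsub⟩ :=
    IsCompactOperator.image_closedBall_subset_compact (𝕜₁ := ℝ) (𝕜₂ := ℝ) (σ₁₂ := RingHom.id ℝ)
      (f := (hC.operator : Lp ℝ 2 (intervalMeasure a b) →ₗ[ℝ] Lp ℝ 2 (intervalMeasure a b)))
      (show IsCompactOperator hC.operator from isCompactOperator_integralOperator _) 1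
  have hmem : ∀ k, lam k • v k ∈ K := by
    intro k
    rw [← hC.operator_toL2 ((h k).isEigenfunction k le_rfl)]
    exact hKsub ⟨v k, by simp [hn], rfl⟩
  obtain ⟨x, -, f, hf, hlim⟩ := hK.tendsto_subseq hmem
  have hcau := hlim.cauchySeq
  obtain ⟨n, hn'⟩ := Metric.cauchySeq_iff.1 hcau c hc
  have hlt := hn' n le_rfl (n + 1) (by omega)
  have hne : f n ≠ f (n + 1) := (hf (Nat.lt_succ_self n)).ne
  have hsq : ‖lam (f n) • v (f n) - lam (f (n + 1)) • v (f (n + 1))‖ ^ 2 =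
      lam (f n) ^ 2 + lam (f (n + 1)) ^ 2 := by
    rw [norm_sub_sq_real, inner_smul_left, inner_smul_right, hon, if_neg hne, norm_smul, norm_smul,
      hn, hn]
    simp
  simp only [Function.comp_apply, dist_eq_norm] at hlt
  have h1 := hall (f n)
  have h2 := pow_lt_pow_left₀ hlt (norm_nonneg _) two_ne_zero
  rw [hsq] at h2
  nlinarith [sq_nonneg (lam (f (n + 1)))]

end Interval

/-! ### Marks -/

/-- The conditional expectation of `φ (x + ε)`. -/
def smoothed (σ : ℝ) (φ : ℝ → ℝ) (x : ℝ) : ℝ := ∫ u, φ (x + u) ∂errorLaw σ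

lemma hasMoments_id_errorLaw (σ : ℝ) : HasMoments (errorLaw σ) (fun u => u) := by
  intro p
  have := memLp_id_gaussianReal (μ := 0) (v := toNNReal (σ ^ 2)) (p : ℝ≥0)
  exact_mod_cast this

/-- A measurable function of linear growth. -/
structure HasLinearGrowth (φ : ℝ → ℝ) : Prop where
  measurable : Measurable φ
  growth : ∃ L : ℝ, 0 ≤ L ∧ ∀ y, |φ y| ≤ L * (1 + |y|)

lemma HasLinearGrowth.one_add_abs {φ : ℝ → ℝ} (h : HasLinearGrowth φ) :
  HasLinearGrowth fun y => 1 + |φ y| := by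
  obtain ⟨L, hL, hφ⟩ := h.growth
  refine ⟨measurable_const.add (measurable_abs_comp h.measurable), L + 1, by positivity,
    fun y => ?_⟩
  rw [abs_of_nonneg (by positivity)]
  nlinarith [hφ y, abs_nonneg y]
where
  measurable_abs_comp {φ : ℝ → ℝ} (h : Measurable φ) : Measurable fun y => |φ y| := by
    simpa only [norm_eq_abs] using h.norm

/-- A function of a response that has linear growth and becomes Lipschitz after averaging over the
measurement error. -/
structure IsMark (σ : ℝ) (φ : ℝ → ℝ) : Prop extends HasLinearGrowth φ where
  lipschitz : ∃ L : ℝ, 0 ≤ L ∧ ∀ x y, |smoothed σ φ x - smoothed σ φ y| ≤ L * |x - y|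

lemma HasLinearGrowth.hasMoments_comp {Ω : Type*} [MeasurableSpace Ω] {μ : Measure Ω}
  [IsProbabilityMeasure μ] {φ : ℝ → ℝ} (h : HasLinearGrowth φ) {Y : Ω → ℝ}
  (hY : HasMoments μ Y) : HasMoments μ (fun ω => φ (Y ω)) := by
  obtain ⟨L, hL, hφ⟩ := h.growth
  refine HasMoments.mono (((HasMoments.const 1).add hY.abs).const_mul L)
    (h.measurable.comp_aemeasurable hY.aemeasurable).aestronglyMeasurable fun ω => ?_
  rw [abs_of_nonneg (a := L * (1 + |Y ω|)) (by positivity)]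
  exact hφ _

lemma HasLinearGrowth.hasMoments_errorLaw {φ : ℝ → ℝ} (h : HasLinearGrowth φ) (σ x : ℝ) :
  HasMoments (errorLaw σ) (fun u => φ (x + u)) :=
  h.hasMoments_comp ((HasMoments.const x).add (hasMoments_id_errorLaw σ))

lemma measurable_missing (c : ℝ) : Measurable (missing c) :=
  Measurable.ite measurableSet_Iic measurable_const measurable_const

lemma missing_nonneg (c y : ℝ) : 0 ≤ missing c y := by unfold missing; split_ifs <;> simp

lemma missing_le_one (c y : ℝ) : missing c y ≤ 1 := by unfold missing; split_ifs <;> simp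

lemma hasLinearGrowth_missing (c : ℝ) : HasLinearGrowth (missing c) := by
  refine ⟨measurable_missing c, 1, zero_le_one, fun y => ?_⟩
  rw [abs_of_nonneg (missing_nonneg c y)]
  linarith [missing_le_one c y, abs_nonneg y]

lemma isMark_missing {σ : ℝ} (hσ : 0 < σ) (c : ℝ) : IsMark σ (missing c) := by
  have hv : toNNReal (σ ^ 2) ≠ 0 := by
    simpa only [ne_eq, Real.toNNReal_eq_zero, not_le] using pow_pos hσ 2
  set B : ℝ := (√(2 * Real.pi * toNNReal (σ ^ 2)))⁻¹ with hB
  have hB0 : 0 ≤ B := by positivity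
  have hpdf : ∀ x, gaussianPDF 0 (toNNReal (σ ^ 2)) x ≤ ofReal B := by
    intro x
    refine ofReal_le_ofReal ?_
    rw [gaussianPDFReal]
    refine mul_le_of_le_one_right hB0 (Real.exp_le_one_iff.2 ?_)
    exact div_nonpos_of_nonpos_of_nonneg (neg_nonpos.2 (sq_nonneg _)) (by positivity)
  have hle : ∀ x y, x ≤ y → |smoothed σ (missing c) x - smoothed σ (missing c) y| ≤
      B * |x - y| := by
    intro x y hxy
    have i := fun x => ((hasLinearGrowth_missing c).hasMoments_errorLaw σ x).integrable
    rw [smoothed, smoothed, ← integral_sub (i x) (i y)]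
    have e : ∀ u, missing c (x + u) - missing c (y + u) =
        (Ioc (c - y) (c - x)).indicator (fun _ => (1 : ℝ)) u := by
      intro u
      simp only [missing, indicator, mem_Ioc]
      split_ifs <;> grind
    simp_rw [e]
    rw [integral_indicator_const _ measurableSet_Ioc, smul_eq_mul, mul_one,
      abs_of_nonneg measureReal_nonneg, abs_sub_comm, abs_of_nonneg (sub_nonneg.2 hxy),
      Measure.real]
    refine ENNReal.toReal_le_of_le_ofReal (by nlinarith) ?_
    rw [errorLaw, gaussianReal_of_var_ne_zero _ hv, withDensity_apply _ measurableSet_Ioc]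
    calc ∫⁻ u in Ioc (c - y) (c - x), gaussianPDF 0 (toNNReal (σ ^ 2)) u
        ≤ ∫⁻ u in Ioc (c - y) (c - x), ofReal B := lintegral_mono fun u => hpdf u
      _ = ofReal (B * (y - x)) := by
        rw [setLIntegral_const, Real.volume_Ioc, ← ofReal_mul hB0]; congr 2; ring
  refine ⟨hasLinearGrowth_missing c, B, hB0, fun x y => ?_⟩
  rcases le_total x y with hxy | hxy
  · exact hle x y hxy
  · rw [abs_sub_comm, abs_sub_comm x]; exact hle y x hxy

lemma IsMark.of_lipschitz {σ : ℝ} {φ : ℝ → ℝ} (h : LipschitzWith 1 φ) : IsMark σ φ := by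
  have hd : ∀ x y, |φ x - φ y| ≤ |x - y| := fun x y => by simpa [dist_eq] using h.dist_le_mul x y
  have hg : HasLinearGrowth φ := by
    refine ⟨h.continuous.measurable, 1 + |φ 0|, by positivity, fun y => ?_⟩
    have := abs_sub_abs_le_abs_sub (φ y) (φ 0)
    have := hd y 0
    rw [sub_zero] at this
    nlinarith [abs_nonneg y, abs_nonneg (φ 0)]
  refine ⟨hg, 1, zero_le_one, fun x y => ?_⟩
  have i := fun x => (hg.hasMoments_errorLaw σ x).integrable
  rw [smoothed, smoothed, ← integral_sub (i x) (i y)]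
  have h1 := norm_integral_le_of_norm_le_const (μ := errorLaw σ)
    (f := fun u => φ (x + u) - φ (y + u)) (C := |x - y|) (ae_of_all _ fun u => by
      rw [norm_eq_abs]; convert hd (x + u) (y + u) using 2; ring)
  simpa using h1

lemma HasLinearGrowth.add {φ ψ : ℝ → ℝ} (hφ : HasLinearGrowth φ) (hψ : HasLinearGrowth ψ) :
  HasLinearGrowth fun y => φ y + ψ y := by
  obtain ⟨L, hL, h1⟩ := hφ.growth
  obtain ⟨L', hL', h2⟩ := hψ.growth
  refine ⟨hφ.measurable.add hψ.measurable, L + L', by positivity, fun y => ?_⟩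
  have := abs_add_le (φ y) (ψ y)
  linarith [h1 y, h2 y]

lemma HasLinearGrowth.const_mul {φ : ℝ → ℝ} (hφ : HasLinearGrowth φ) (c : ℝ) :
  HasLinearGrowth fun y => c * φ y := by
  obtain ⟨L, hL, h1⟩ := hφ.growth
  refine ⟨hφ.measurable.const_mul c, |c| * L, by positivity, fun y => ?_⟩
  rw [abs_mul, mul_assoc]
  exact mul_le_mul_of_nonneg_left (h1 y) (abs_nonneg c)

lemma IsMark.add {σ : ℝ} {φ ψ : ℝ → ℝ} (hφ : IsMark σ φ) (hψ : IsMark σ ψ) :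
  IsMark σ fun y => φ y + ψ y := by
  obtain ⟨L, hL, h1⟩ := hφ.lipschitz
  obtain ⟨L', hL', h2⟩ := hψ.lipschitz
  refine ⟨hφ.toHasLinearGrowth.add hψ.toHasLinearGrowth, L + L', by positivity, fun x y => ?_⟩
  have e : ∀ x, smoothed σ (fun y => φ y + ψ y) x = smoothed σ φ x + smoothed σ ψ x := fun x =>
    integral_add (hφ.hasMoments_errorLaw σ x).integrable (hψ.hasMoments_errorLaw σ x).integrable
  have := abs_add_le (smoothed σ φ x - smoothed σ φ y) (smoothed σ ψ x - smoothed σ ψ y)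
  rw [e, e, add_sub_add_comm]
  linarith [h1 x y, h2 x y]

lemma IsMark.const_mul {σ : ℝ} {φ : ℝ → ℝ} (hφ : IsMark σ φ) (c : ℝ) :
  IsMark σ fun y => c * φ y := by
  obtain ⟨L, hL, h1⟩ := hφ.lipschitz
  refine ⟨hφ.toHasLinearGrowth.const_mul c, |c| * L, by positivity, fun x y => ?_⟩
  have e : ∀ x, smoothed σ (fun y => c * φ y) x = c * smoothed σ φ x := fun x =>
    integral_const_mul _ _
  rw [e, e, ← mul_sub, abs_mul, mul_assoc]
  exact mul_le_mul_of_nonneg_left (h1 x y) (abs_nonneg c)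

lemma isMark_pseudoResponse {σ : ℝ} (hσ : 0 < σ) (c : ℝ) : IsMark σ (pseudoResponse σ c) := by
  have h1 : LipschitzWith 1 fun y : ℝ => max y c := LipschitzWith.id.max_const c
  have e : pseudoResponse σ c = fun y => max y c + (-0.8194 * σ + 0.502 * c - c) * missing c y := by
    funext y
    unfold pseudoResponse missing
    split_ifs with h
    · rw [max_eq_right h]; ring
    · rw [max_eq_left (not_le.1 h).le]; ring
  rw [e]
  exact (IsMark.of_lipschitz h1).add ((isMark_missing hσ c).const_mul _)

lemma isMark_pseudoWeight {σ : ℝ} (hσ : 0 < σ) (c : ℝ) : IsMark σ (pseudoWeight c) := by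
  have e : pseudoWeight c = fun y => 1 + (-0.498) * missing c y := by
    funext y; unfold pseudoWeight; ring
  rw [e]
  exact (IsMark.of_lipschitz (LipschitzWith.const' 1)).add ((isMark_missing hσ c).const_mul _)

lemma IsMark.hasLinearGrowth_smoothed {σ : ℝ} {φ : ℝ → ℝ} (hφ : IsMark σ φ) :
  HasLinearGrowth (smoothed σ φ) := by
  obtain ⟨L, hL, h1⟩ := hφ.lipschitz
  have hl : LipschitzWith (toNNReal L) (smoothed σ φ) := by
    refine LipschitzWith.of_dist_le_mul fun x y => ?_
    rw [dist_eq, dist_eq, Real.coe_toNNReal L hL]; exact h1 x y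
  refine ⟨hl.continuous.measurable, L + |smoothed σ φ 0|, by positivity, fun y => ?_⟩
  have := abs_sub_abs_le_abs_sub (smoothed σ φ y) (smoothed σ φ 0)
  have := h1 y 0
  rw [sub_zero] at this
  nlinarith [abs_nonneg y, abs_nonneg (smoothed σ φ 0)]

lemma smoothed_pseudoWeight_ge {σ : ℝ} (hσ : 0 < σ) (c x : ℝ) :
  0.502 ≤ smoothed σ (pseudoWeight c) x := by
  have h := integral_mono (μ := errorLaw σ) (integrable_const 0.502)
    ((isMark_pseudoWeight hσ c).hasMoments_errorLaw σ x).integrable fun u => ?_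
  · simpa [smoothed] using h
  · simp only [pseudoWeight]; linarith [missing_le_one c (x + u)]

lemma HasLinearGrowth.exists_lintegral_le {φ : ℝ → ℝ} (hφ : HasLinearGrowth φ) (k : ℕ)
  (M : ℝ≥0) : ∃ B : ℝ≥0, ∀ {Ω : Type*} [MeasurableSpace Ω] {μ : Measure Ω}
    [IsProbabilityMeasure μ] {Y : Ω → ℝ}, AEStronglyMeasurable Y μ → eLpNorm Y k μ ≤ M →
      ∫⁻ ω, ‖φ (Y ω)‖ₑ ^ k ∂μ ≤ B := by
  obtain ⟨L, hL, hg⟩ := hφ.growth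
  refine ⟨(toNNReal L * (1 + M)) ^ k, fun {Ω _ μ _ Y} hY hM => ?_⟩
  rcases Nat.eq_zero_or_pos k with rfl | hk
  · simp
  have h1 : eLpNorm (fun ω => φ (Y ω)) k μ ≤ toNNReal L * (1 + M) := by
    calc eLpNorm (fun ω => φ (Y ω)) k μ
        ≤ eLpNorm (L • fun ω => 1 + |Y ω|) k μ := by
          refine eLpNorm_mono fun ω => ?_
          simp only [Pi.smul_apply, smul_eq_mul, norm_eq_abs]
          rw [abs_of_nonneg (a := L * (1 + |Y ω|)) (by positivity)]
          exact hg _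
      _ = toNNReal L * eLpNorm ((fun _ => (1 : ℝ)) + fun ω => |Y ω|) k μ := by
        rw [eLpNorm_const_smul, Real.enorm_of_nonneg hL]; rfl
      _ ≤ _ := by
        gcongr
        refine (eLpNorm_add_le aestronglyMeasurable_const hY.norm (by exact_mod_cast hk)).trans ?_
        gcongr
        · rw [eLpNorm_const _ (by exact_mod_cast hk.ne') (IsProbabilityMeasure.ne_zero μ)]; simp
        · exact le_of_eq_of_le (eLpNorm_norm _) hM
  have h2 := eLpNorm_nnreal_pow_eq_lintegral (μ := μ) (f := fun ω => φ (Y ω)) (p := (k : ℝ≥0))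
    (by exact_mod_cast hk.ne')
  simp only [NNReal.coe_natCast, ENNReal.rpow_natCast, ENNReal.coe_natCast] at h2
  rw [← h2]
  push_cast
  gcongr

namespace IsCenteredProcess

variable {S : Type*} [MeasurableSpace S] {ρ : Measure S} {a b : ℝ} {X : ℝ → S → ℝ}

local notation "I" => Icc a b

lemma measurable_apply (hX : IsCenteredProcess ρ a b X) (t : ℝ) : Measurable (X t) :=
  hX.measurable.comp measurable_prodMk_left

lemma hasMoments (hX : IsCenteredProcess ρ a b X) {t : ℝ} (ht : t ∈ I) : HasMoments ρ (X t) := by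
  intro p
  obtain ⟨M, hM⟩ := hX.moments p
  exact ⟨(hX.measurable_apply t).aestronglyMeasurable, (hM t ht).trans_lt ENNReal.coe_lt_top⟩

variable [IsProbabilityMeasure ρ]

lemma exists_lintegral_le (hX : IsCenteredProcess ρ a b X) {ψ : ℝ → ℝ}
  (hψ : HasLinearGrowth ψ) (k : ℕ) :
  ∃ B : ℝ≥0, ∀ t ∈ I, ∫⁻ x, ‖ψ (X t x)‖ₑ ^ k ∂ρ ≤ B := by
  obtain ⟨M, hM⟩ := hX.moments k
  obtain ⟨B, hB⟩ := hψ.exists_lintegral_le k M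
  exact ⟨B, fun t ht => hB (hX.measurable_apply t).aestronglyMeasurable (hM t ht)⟩

lemma exists_integral_le (hX : IsCenteredProcess ρ a b X) {ψ : ℝ → ℝ}
  (hψ : HasLinearGrowth ψ) (k : ℕ) :
  ∃ B : ℝ, 0 ≤ B ∧ ∀ t ∈ I, ∫ x, |ψ (X t x)| ^ k ∂ρ ≤ B := by
  obtain ⟨B, hB⟩ := hX.exists_lintegral_le hψ k
  refine ⟨B, B.2, fun t ht => ?_⟩
  have hm := ((hψ.hasMoments_comp (hX.hasMoments ht)).abs.pow k)
  rw [integral_eq_lintegral_of_nonneg_ae (ae_of_all _ fun _ => by positivity)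
    hm.aestronglyMeasurable]
  refine ENNReal.toReal_le_coe_of_le_coe (le_of_eq_of_le (lintegral_congr fun x => ?_) (hB t ht))
  rw [ofReal_pow (abs_nonneg _), ← enorm_eq_ofReal_abs]

lemma exists_lintegral_error_le (hX : IsCenteredProcess ρ a b X) (σ : ℝ) {φ : ℝ → ℝ}
  (hφ : HasLinearGrowth φ) (k : ℕ) :
  ∃ B : ℝ≥0, ∀ t ∈ I, ∫⁻ x, ∫⁻ u, ‖φ (X t x + u)‖ₑ ^ k ∂errorLaw σ ∂ρ ≤ B := by
  rcases Nat.eq_zero_or_pos k with rfl | hk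
  · exact ⟨1, fun t _ => by simp⟩
  obtain ⟨M, hM⟩ := hX.moments k
  have hm := (hasMoments_id_errorLaw σ) k
  obtain ⟨B, hB⟩ := hφ.exists_lintegral_le k (M + (eLpNorm (fun u => u) k (errorLaw σ)).toNNReal)
  refine ⟨B, fun t ht => ?_⟩
  have mX := hX.measurable_apply t
  have mY : Measurable fun p : S × ℝ => X t p.1 + p.2 := by fun_prop
  have h1 := hB (μ := ρ.prod (errorLaw σ)) (Y := fun p => X t p.1 + p.2) mY.aestronglyMeasurable ?_
  · rwa [lintegral_prod _ (by have := hφ.measurable; fun_prop)] at h1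
  · refine (eLpNorm_add_le (f := fun p : S × ℝ => X t p.1) (g := fun p : S × ℝ => p.2)
      (mX.comp measurable_fst).aestronglyMeasurable (by fun_prop)
      (by exact_mod_cast hk)).trans ?_
    push_cast
    rw [ENNReal.coe_toNNReal hm.2.ne]
    gcongr
    · exact le_of_eq_of_le (eLpNorm_comp_measurePreserving (g := X t) mX.aestronglyMeasurable
        measurePreserving_fst) (hM t ht)
    · exact (eLpNorm_comp_measurePreserving (g := fun u : ℝ => u) (by fun_prop)
        measurePreserving_snd).le

lemma covFun_eq (hX : IsCenteredProcess ρ a b X) {s t : ℝ} (hs : s ∈ I)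
  (ht : t ∈ I) : covFun ρ X s t = ∫ x, X s x * X t x ∂ρ := by
  rw [covFun, covariance_eq_sub (by exact_mod_cast hX.hasMoments hs 2)
    (by exact_mod_cast hX.hasMoments ht 2), hX.mean_zero s hs, zero_mul, sub_zero]
  rfl

lemma exists_integral_sub_sq_le (hab : a < b) (hX : IsCenteredProcess ρ a b X) :
  ∃ L : ℝ, 0 ≤ L ∧ ∀ s ∈ I, ∀ t ∈ I, ∫ x, (X s x - X t x) ^ 2 ∂ρ ≤ L * (s - t) ^ 2 := by
  set Q : Set (ℝ × ℝ) := I ×ˢ I with hQ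
  set F : ℝ × ℝ → ℝ := fun p => covFun ρ X p.1 p.2 with hF
  have hu : UniqueDiffOn ℝ Q := (uniqueDiffOn_Icc hab).prod (uniqueDiffOn_Icc hab)
  have hconv : Convex ℝ Q := (convex_Icc a b).prod (convex_Icc a b)
  have h1 : ContDiffOn ℝ 1 (fderivWithin ℝ F Q) Q := hX.smooth.fderivWithin hu (by norm_num)
  obtain ⟨L, hL⟩ := h1.exists_lipschitzOnWith one_ne_zero hconv (isCompact_Icc.prod isCompact_Icc)
  refine ⟨L, L.2, fun s hs t ht => ?_⟩
  have hd : ∀ u ∈ I, ∀ x ∈ I,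
      HasDerivWithinAt (fun x => F (u, x)) (fderivWithin ℝ F Q (u, x) (0, 1)) I x := by
    intro u hu' x hx
    have hF' : HasFDerivWithinAt F (fderivWithin ℝ F Q (u, x)) Q (u, x) :=
      (hX.smooth.differentiableOn (by norm_num) _ ⟨hu', hx⟩).hasFDerivWithinAt
    have hg : HasDerivWithinAt (fun x : ℝ => (u, x)) ((0 : ℝ), (1 : ℝ)) I x :=
      (hasDerivWithinAt_const x _ u).prodMk (hasDerivWithinAt_id x _)
    exact hF'.comp_hasDerivWithinAt x hg fun y hy => ⟨hu', hy⟩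
  have key := Convex.norm_image_sub_le_of_norm_hasDerivWithin_le
    (f := fun x => F (s, x) - F (t, x)) (C := L * |s - t|)
    (fun x hx => (hd s hs x hx).sub (hd t ht x hx)) (fun x hx => ?_) (convex_Icc a b) ht hs
  · have e : ∫ x, (X s x - X t x) ^ 2 ∂ρ = F (s, s) - F (t, s) - (F (s, t) - F (t, t)) := by
      simp only [hF, hX.covFun_eq hs hs, hX.covFun_eq ht hs, hX.covFun_eq hs ht, hX.covFun_eq ht ht]
      have i := fun {u v} (hu : u ∈ I) (hv : v ∈ I) => (hX.hasMoments hu).mul (hX.hasMoments hv)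
      rw [← integral_sub (i hs hs).integrable (i ht hs).integrable,
        ← integral_sub (i hs ht).integrable (i ht ht).integrable,
        ← integral_sub ((i hs hs).sub (i ht hs)).integrable ((i hs ht).sub (i ht ht)).integrable]
      refine integral_congr_ae (ae_of_all _ fun x => ?_)
      simp only; ring
    rw [e]
    refine (le_abs_self _).trans ?_
    simp only [norm_eq_abs] at key
    calc _ ≤ _ := key
      _ = L * (s - t) ^ 2 := by rw [mul_assoc, ← sq, sq_abs]
  · rw [← sub_apply]
    refine (ContinuousLinearMap.le_opNorm _ _).trans ?_
    have h2 := hL.dist_le_mul (s, x) ⟨hs, hx⟩ (t, x) ⟨ht, hx⟩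
    rw [dist_eq_norm] at h2
    have h3 : dist (s, x) (t, x) = |s - t| := by simp [Prod.dist_eq, dist_eq]
    have h4 : ‖((0 : ℝ), (1 : ℝ))‖ = 1 := by simp [Prod.norm_def]
    rw [h4, mul_one, ← h3]
    exact h2

end IsCenteredProcess

/-- `R` is Lipschitz on `[a, b]²`. -/
structure IsLipschitzKernel (a b : ℝ) (R : ℝ → ℝ → ℝ) (L : ℝ) : Prop where
  nonneg : 0 ≤ L
  abs_sub_le : ∀ s ∈ Icc a b, ∀ s' ∈ Icc a b, ∀ t ∈ Icc a b, ∀ t' ∈ Icc a b,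
    |R s t - R s' t'| ≤ L * (|s - s'| + |t - t'|)

namespace IsLipschitzKernel

variable {a b : ℝ} {R R' : ℝ → ℝ → ℝ} {L L' : ℝ}

local notation "I" => Icc a b

lemma exists_bound (hab : a ≤ b) (h : IsLipschitzKernel a b R L) :
  ∃ B, 0 ≤ B ∧ ∀ s ∈ I, ∀ t ∈ I, |R s t| ≤ B := by
  have ha : a ∈ I := left_mem_Icc.2 hab
  refine ⟨|R a a| + L * (2 * (b - a)), ?_, fun s hs t ht => ?_⟩
  · have := h.nonneg
    have := sub_nonneg.2 hab
    positivity
  · have h1 := h.abs_sub_le s hs a ha t ht a ha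
    have h2 := abs_sub_abs_le_abs_sub (R s t) (R a a)
    have h3 : |s - a| ≤ b - a := by rw [abs_of_nonneg (sub_nonneg.2 hs.1)]; linarith [hs.2]
    have h4 : |t - a| ≤ b - a := by rw [abs_of_nonneg (sub_nonneg.2 ht.1)]; linarith [ht.2]
    have h5 : L * (|s - a| + |t - a|) ≤ L * (2 * (b - a)) :=
      mul_le_mul_of_nonneg_left (by linarith) h.nonneg
    linarith

lemma continuousOn (h : IsLipschitzKernel a b R L) :
  ContinuousOn (fun p : ℝ × ℝ => R p.1 p.2) (I ×ˢ I) := by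
  have hl : LipschitzOnWith (toNNReal (2 * L)) (fun p : ℝ × ℝ => R p.1 p.2) (I ×ˢ I) := by
    refine LipschitzOnWith.of_dist_le_mul fun p hp p' hp' => ?_
    rw [Real.coe_toNNReal _ (by linarith [h.nonneg]), dist_eq]
    refine (h.abs_sub_le _ hp.1 _ hp'.1 _ hp.2 _ hp'.2).trans ?_
    have h1 : |p.1 - p'.1| ≤ dist p p' := by rw [Prod.dist_eq, ← dist_eq]; exact le_max_left _ _
    have h2 : |p.2 - p'.2| ≤ dist p p' := by rw [Prod.dist_eq, ← dist_eq]; exact le_max_right _ _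
    nlinarith [h.nonneg]
  exact hl.continuousOn

lemma mul (hab : a ≤ b) (h : IsLipschitzKernel a b R L) (h' : IsLipschitzKernel a b R' L') :
  ∃ M, IsLipschitzKernel a b (fun s t => R s t * R' s t) M := by
  obtain ⟨B, hB0, hB⟩ := h.exists_bound hab
  obtain ⟨B', hB0', hB'⟩ := h'.exists_bound hab
  have := h.nonneg
  have := h'.nonneg
  refine ⟨B * L' + B' * L, by positivity, fun s hs s' hs' t ht t' ht' => ?_⟩
  have e : R s t * R' s t - R s' t' * R' s' t' =
    R s t * (R' s t - R' s' t') + (R s t - R s' t') * R' s' t' := by ring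
  rw [e]
  refine (abs_add_le _ _).trans ?_
  rw [abs_mul, abs_mul]
  have h1 := mul_le_mul (hB s hs t ht) (h'.abs_sub_le s hs s' hs' t ht t' ht') (abs_nonneg _) hB0
  have h2 := mul_le_mul (h.abs_sub_le s hs s' hs' t ht t' ht') (hB' s' hs' t' ht') (abs_nonneg _)
    (by positivity)
  linarith

lemma inv (h : IsLipschitzKernel a b R L) {c : ℝ} (hc : 0 < c) (hR : ∀ s ∈ I, ∀ t ∈ I, c ≤ R s t) :
  IsLipschitzKernel a b (fun s t => (R s t)⁻¹) (L / c ^ 2) := by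
  have := h.nonneg
  refine ⟨by positivity, fun s hs s' hs' t ht t' ht' => ?_⟩
  have h1 := hR s hs t ht
  have h2 := hR s' hs' t' ht'
  have p1 : 0 < R s t := hc.trans_le h1
  have p2 : 0 < R s' t' := hc.trans_le h2
  rw [inv_sub_inv p1.ne' p2.ne', abs_div, abs_of_pos (mul_pos p1 p2), abs_sub_comm, div_mul_eq_mul_div]
  refine div_le_div₀ (by positivity) (h.abs_sub_le s hs s' hs' t ht t' ht') (by positivity) ?_
  nlinarith

end IsLipschitzKernel

section PairMean

variable {S : Type*} [MeasurableSpace S] {ρ : Measure S} {a b : ℝ} {X : ℝ → S → ℝ} {σ : ℝ}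
  {φ : ℝ → ℝ}

local notation "I" => Icc a b
local notation "g[" u ", " x "]" => smoothed σ φ (X u x)

lemma pairMean_eq (s t : ℝ) :
  pairMean ρ X σ φ s t = ∫ x, g[s, x] * g[t, x] ∂ρ := by
  refine integral_congr_ae (ae_of_all _ fun x => ?_)
  simp only [smoothed]
  rw [← integral_mul_const]
  refine integral_congr_ae (ae_of_all _ fun u => ?_)
  simp only [integral_const_mul]

lemma pairMean_symm (s t : ℝ) : pairMean ρ X σ φ s t = pairMean ρ X σ φ t s := by
  simp only [pairMean_eq, mul_comm]

variable [IsProbabilityMeasure ρ]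

lemma HasMoments.sq_integral_mul_le {f g : S → ℝ} (hf : HasMoments ρ f) (hg : HasMoments ρ g) :
  (∫ x, f x * g x ∂ρ) ^ 2 ≤ (∫ x, f x ^ 2 ∂ρ) * ∫ x, g x ^ 2 ∂ρ :=
  DetectionLimit.sq_integral_mul_le (by exact_mod_cast hf 2) (by exact_mod_cast hg 2)

lemma IsCenteredProcess.hasMoments_smoothed (hX : IsCenteredProcess ρ a b X) (hφ : IsMark σ φ)
  {t : ℝ} (ht : t ∈ I) : HasMoments ρ (fun x => g[t, x]) :=
  hφ.hasLinearGrowth_smoothed.hasMoments_comp (hX.hasMoments ht)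

lemma IsCenteredProcess.exists_integral_smoothed_sub_sq_le (hab : a < b)
  (hX : IsCenteredProcess ρ a b X) (hφ : IsMark σ φ) :
  ∃ L : ℝ, 0 ≤ L ∧ ∀ s ∈ I, ∀ t ∈ I,
    ∫ x, (g[s, x] - g[t, x]) ^ 2 ∂ρ ≤ L * (s - t) ^ 2 := by
  obtain ⟨L, hL0, hL⟩ := hX.exists_integral_sub_sq_le hab
  obtain ⟨L', hL0', hL'⟩ := hφ.lipschitz
  refine ⟨L' ^ 2 * L, by positivity, fun s hs t ht => ?_⟩
  calc ∫ x, (g[s, x] - g[t, x]) ^ 2 ∂ρ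
      ≤ ∫ x, L' ^ 2 * (X s x - X t x) ^ 2 ∂ρ := by
        refine integral_mono
          (((hX.hasMoments_smoothed hφ hs).sub (hX.hasMoments_smoothed hφ ht)).pow 2).integrable
          ((((hX.hasMoments hs).sub (hX.hasMoments ht)).pow 2).const_mul _).integrable fun x => ?_
        simp only
        rw [← mul_pow, ← sq_abs, ← sq_abs (L' * _), abs_mul, abs_of_nonneg hL0']
        exact pow_le_pow_left₀ (abs_nonneg _) (hL' _ _) 2
    _ ≤ _ := by
      rw [integral_const_mul, mul_assoc]
      exact mul_le_mul_of_nonneg_left (hL s hs t ht) (by positivity)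

lemma IsCenteredProcess.isLipschitzKernel_pairMean (hab : a < b)
  (hX : IsCenteredProcess ρ a b X) (hφ : IsMark σ φ) :
  ∃ L, IsLipschitzKernel a b (pairMean ρ X σ φ) L := by
  obtain ⟨L, hL0, hL⟩ := hX.exists_integral_smoothed_sub_sq_le hab hφ
  obtain ⟨B, hB0, hB⟩ := hX.exists_integral_le hφ.hasLinearGrowth_smoothed 2
  have h1 : ∀ s ∈ I, ∀ s' ∈ I, ∀ t ∈ I,
      |pairMean ρ X σ φ s t - pairMean ρ X σ φ s' t| ≤ √(L * B) * |s - s'| := by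
    intro s hs s' hs' t ht
    refine abs_le_of_sq_le_sq ?_ (by positivity)
    have m := fun {t} (ht : t ∈ I) => hX.hasMoments_smoothed hφ ht
    rw [pairMean_eq, pairMean_eq, ← integral_sub ((m hs).mul (m ht)).integrable
      ((m hs').mul (m ht)).integrable]
    simp_rw [← sub_mul]
    refine (((m hs).sub (m hs')).sq_integral_mul_le (m ht)).trans ?_
    rw [mul_pow, sq_sqrt (by positivity), sq_abs]
    have h2 := hB t ht
    simp only [sq_abs] at h2
    calc _ ≤ (L * (s - s') ^ 2) * B := by gcongr; exact hL s hs s' hs'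
      _ = _ := by ring
  refine ⟨√(L * B), by positivity, fun s hs s' hs' t ht t' ht' => ?_⟩
  have e : pairMean ρ X σ φ s t - pairMean ρ X σ φ s' t' =
      (pairMean ρ X σ φ s t - pairMean ρ X σ φ s' t) +
        (pairMean ρ X σ φ t s' - pairMean ρ X σ φ t' s') := by
    rw [pairMean_symm t, pairMean_symm t']; ring
  rw [e, mul_add]
  exact (abs_add_le _ _).trans (add_le_add (h1 s hs s' hs' t ht) (h1 t ht t' ht' s' hs'))

lemma IsCenteredProcess.pairMean_pseudoWeight_ge (hσ : 0 < σ) (hX : IsCenteredProcess ρ a b X)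
  (c : ℝ) {s t : ℝ} (hs : s ∈ I) (ht : t ∈ I) :
  1 / 4 ≤ pairMean ρ X σ (pseudoWeight c) s t := by
  have hφ := isMark_pseudoWeight hσ c
  rw [pairMean_eq]
  have h := integral_mono (μ := ρ) (integrable_const (1 / 4 : ℝ))
    ((hX.hasMoments_smoothed hφ hs).mul (hX.hasMoments_smoothed hφ ht)).integrable fun x => ?_
  · simpa using h
  · have h1 := smoothed_pseudoWeight_ge hσ c (X s x)
    have h2 := smoothed_pseudoWeight_ge hσ c (X t x)
    simp only
    nlinarith

/-- Mean square continuity of the products `G (X u) * G (X w)` in `w`. -/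
lemma IsCenteredProcess.exists_integral_mul_sub_sq_le (hab : a < b)
  (hX : IsCenteredProcess ρ a b X) (hφ : IsMark σ φ) :
  ∃ L : ℝ, 0 ≤ L ∧ ∀ u ∈ I, ∀ w ∈ I, ∀ w' ∈ I,
    ∫ x, (g[u, x] * g[w, x] -
      g[u, x] * g[w', x]) ^ 2 ∂ρ ≤ L * |w - w'| ^ (3 / 2 : ℝ) := by
  obtain ⟨L, hL0, hL⟩ := hX.exists_integral_smoothed_sub_sq_le hab hφ
  obtain ⟨B, hB0, hB⟩ := hX.exists_integral_le hφ.hasLinearGrowth_smoothed 16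
  obtain ⟨B', hB0', hB'⟩ := hX.exists_integral_le hφ.hasLinearGrowth_smoothed 4
  set G := smoothed σ φ
  set K₁ := √(32 * B' * B)
  set K₂ := √(L * K₁)
  refine ⟨√(L * K₂), by positivity, fun u hu w hw w' hw' => ?_⟩
  have m := fun {t} (ht : t ∈ I) => hX.hasMoments_smoothed hφ ht
  set Δ : S → ℝ := fun x => G (X w x) - G (X w' x) with hΔdef
  have mΔ : HasMoments ρ Δ := (m hw).sub (m hw')
  have hΔ : ∫ x, Δ x ^ 2 ∂ρ ≤ L * (w - w') ^ 2 := hL w hw w' hw'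
  have hG : ∫ x, (G (X u x) ^ 8) ^ 2 ∂ρ ≤ B := by
    have h := hB u hu
    simp only [(show Even 16 by decide).pow_abs] at h
    simpa only [← pow_mul] using h
  have hΔ4 : ∫ x, (Δ x ^ 2) ^ 2 ∂ρ ≤ 32 * B' := by
    have h4 : ∀ {t}, t ∈ I → ∫ x, G (X t x) ^ 4 ∂ρ ≤ B' := fun ht => by
      simpa only [(show Even 4 by decide).pow_abs] using hB' _ ht
    have hle : ∀ x, (Δ x ^ 2) ^ 2 ≤ 16 * (G (X w x) ^ 4 + G (X w' x) ^ 4) := by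
      intro x
      have h := add_pow_two_mul_le (G (X w x)) (-G (X w' x)) 2
      rw [(even_two_mul 2).neg_pow] at h
      calc (Δ x ^ 2) ^ 2 = (G (X w x) + -G (X w' x)) ^ (2 * 2) := by
            simp only [hΔdef]; ring
        _ ≤ _ := by refine h.trans (le_of_eq ?_); ring
    have h := integral_mono ((mΔ.pow 2).pow 2).integrable
      (((((m hw).pow 4).add ((m hw').pow 4)).const_mul 16).integrable) hle
    rw [integral_const_mul, integral_add ((m hw).pow 4).integrable ((m hw').pow 4).integrable] at h
    linarith [h4 hw, h4 hw']
  have e1 : ∫ x, (Δ x * G (X u x) ^ 4) ^ 2 ∂ρ = ∫ x, Δ x * (Δ x * G (X u x) ^ 8) ∂ρ :=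
    integral_congr_ae (ae_of_all _ fun x => by simp only; ring)
  have e2 : ∫ x, (Δ x * G (X u x) ^ 2) ^ 2 ∂ρ = ∫ x, Δ x * (Δ x * G (X u x) ^ 4) ∂ρ :=
    integral_congr_ae (ae_of_all _ fun x => by simp only; ring)
  have e3 : ∫ x, (G (X u x) * G (X w x) - G (X u x) * G (X w' x)) ^ 2 ∂ρ =
      ∫ x, Δ x * (Δ x * G (X u x) ^ 2) ∂ρ :=
    integral_congr_ae (ae_of_all _ fun x => by simp only [hΔdef]; ring)
  have e4 : ∫ x, Δ x * (Δ x * G (X u x) ^ 8) ∂ρ = ∫ x, Δ x ^ 2 * G (X u x) ^ 8 ∂ρ :=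
    integral_congr_ae (ae_of_all _ fun x => by simp only; ring)
  have h8 : ∫ x, Δ x * (Δ x * G (X u x) ^ 8) ∂ρ ≤ K₁ := by
    refine le_of_abs_le (abs_le_of_sq_le_sq ?_ (Real.sqrt_nonneg _))
    rw [e4, sq_sqrt (by positivity)]
    refine ((mΔ.pow 2).sq_integral_mul_le ((m hu).pow 8)).trans ?_
    gcongr
  have h4 : ∫ x, Δ x * (Δ x * G (X u x) ^ 4) ∂ρ ≤ K₂ * |w - w'| := by
    refine le_of_abs_le (abs_le_of_sq_le_sq ?_ (by positivity))
    rw [mul_pow, sq_sqrt (by positivity), sq_abs]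
    refine (mΔ.sq_integral_mul_le (mΔ.mul ((m hu).pow 4))).trans ?_
    rw [e1]
    calc _ ≤ (L * (w - w') ^ 2) * K₁ := mul_le_mul hΔ h8 (by
          rw [← e1]; exact integral_nonneg fun x => sq_nonneg _) (by positivity)
      _ = _ := by ring
  rw [e3]
  refine le_of_abs_le (abs_le_of_sq_le_sq ?_ (by positivity))
  rw [mul_pow, sq_sqrt (by positivity), ← Real.rpow_mul_natCast (abs_nonneg _)]
  refine (mΔ.sq_integral_mul_le (mΔ.mul ((m hu).pow 2))).trans ?_
  rw [e2]
  calc _ ≤ (L * (w - w') ^ 2) * (K₂ * |w - w'|) := mul_le_mul hΔ h4 (by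
        rw [← e2]; exact integral_nonneg fun x => sq_nonneg _) (by positivity)
    _ = L * K₂ * |w - w'| ^ (3 : ℕ) := by rw [← sq_abs]; ring
    _ = _ := by rw [← Real.rpow_natCast]; norm_num

end PairMean

notation "𝓚[" K "; " h "; " s "]" => fun u => scaledKernel K h (u - s)

/-! ### The law of the time points -/

section TimeLaw

variable {a b : ℝ} {f : ℝ → ℝ}

local notation "𝓣" => timeLaw a b f
local notation "I" => Icc a b

lemma IsSamplingDensity.integrable (hf : IsSamplingDensity a b f) :
  Integrable f (volume.restrict I) := by
  obtain ⟨m, M, hm, hb⟩ := hf.bounds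
  refine Integrable.of_bound hf.measurable.aestronglyMeasurable M
    ((ae_restrict_iff' measurableSet_Icc).2 (ae_of_all _ fun t ht => ?_))
  rw [Real.norm_of_nonneg (hm.le.trans (hb t ht).1)]
  exact (hb t ht).2

lemma IsSamplingDensity.isProbabilityMeasure (hf : IsSamplingDensity a b f) :
  IsProbabilityMeasure 𝓣 := by
  obtain ⟨m, M, hm, hb⟩ := hf.bounds
  constructor
  rw [timeLaw, withDensity_apply _ MeasurableSet.univ, Measure.restrict_univ,
    ← ofReal_integral_eq_lintegral_ofReal hf.integrable
      ((ae_restrict_iff' measurableSet_Icc).2 (ae_of_all _ fun t ht => hm.le.trans (hb t ht).1)),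
    hf.integral_eq_one, ofReal_one]

lemma ae_mem_timeLaw : ∀ᵐ t ∂𝓣, t ∈ I :=
  (withDensity_absolutelyContinuous _ _).ae_le (ae_restrict_mem measurableSet_Icc)

lemma IsSamplingDensity.exists_le (hf : IsSamplingDensity a b f) :
  ∃ M : ℝ≥0, 𝓣 ≤ M • volume.restrict I := by
  obtain ⟨m, M, hm, hb⟩ := hf.bounds
  refine ⟨toNNReal M, ?_⟩
  change _ ≤ (toNNReal M : ℝ≥0∞) • volume.restrict I
  rw [← withDensity_const]
  refine withDensity_mono ((ae_restrict_iff' measurableSet_Icc).2 (ae_of_all _ fun t ht => ?_))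
  exact ofReal_le_ofReal (hb t ht).2

lemma IsSamplingDensity.exists_ge (hf : IsSamplingDensity a b f) :
  ∃ m : ℝ≥0, 0 < m ∧ m • volume.restrict I ≤ 𝓣 := by
  obtain ⟨m, M, hm, hb⟩ := hf.bounds
  refine ⟨toNNReal m, by simpa using hm, ?_⟩
  change (toNNReal m : ℝ≥0∞) • volume.restrict I ≤ _
  rw [← withDensity_const]
  refine withDensity_mono ((ae_restrict_iff' measurableSet_Icc).2 (ae_of_all _ fun t ht => ?_))
  exact ofReal_le_ofReal (hb t ht).1

end TimeLaw

/-! ### The kernel function -/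

section Kernel

variable {K : ℝ → ℝ} {h : ℝ}

lemma IsKernel.continuous (hK : IsKernel K) : Continuous K := by
  obtain ⟨L, hL⟩ := hK.lipschitz
  exact hL.continuous

lemma IsKernel.exists_le (hK : IsKernel K) : ∃ B : ℝ, 1 ≤ B ∧ ∀ x, K x ≤ B := by
  obtain ⟨B, hB⟩ := isCompact_Icc.exists_bound_of_continuousOn (s := Icc (-1 : ℝ) 1)
    hK.continuous.continuousOn
  refine ⟨max B 1, le_max_right _ _, fun x => ?_⟩
  by_cases hx : 1 < |x|
  · rw [hK.support x hx]; positivity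
  · exact (le_abs_self _).trans ((hB x (abs_le.1 (not_lt.1 hx))).trans (le_max_left _ _))

lemma IsKernel.integrable (hK : IsKernel K) : Integrable K := by
  by_contra hn
  have := hK.integral_eq_one
  rw [integral_undef hn] at this
  norm_num at this

lemma IsKernel.scaledKernel_nonneg (hK : IsKernel K) (hh : 0 < h) (x : ℝ) :
  0 ≤ scaledKernel K h x := mul_nonneg (by positivity) (hK.nonneg _)

lemma IsKernel.scaledKernel_le {B : ℝ} (hB : ∀ x, K x ≤ B) (hh : 0 < h) (x : ℝ) :
  scaledKernel K h x ≤ B / h := by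
  rw [scaledKernel, one_div, inv_mul_eq_div]
  gcongr; exact hB _

lemma IsKernel.scaledKernel_neg (hK : IsKernel K) (x : ℝ) :
  scaledKernel K h (-x) = scaledKernel K h x := by
  rw [scaledKernel, neg_div, hK.even, scaledKernel]

lemma IsKernel.scaledKernel_eq_zero (hK : IsKernel K) (hh : 0 < h) {x : ℝ} (hx : h < |x|) :
  scaledKernel K h x = 0 := by
  rw [scaledKernel, hK.support, mul_zero]
  rwa [abs_div, abs_of_pos hh, lt_div_iff₀ hh, one_mul]

lemma IsKernel.exists_scaledKernel_lipschitz (hK : IsKernel K) : ∃ L : ℝ, 0 ≤ L ∧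
  ∀ h, 0 < h → ∀ x y, |scaledKernel K h x - scaledKernel K h y| ≤ L / h ^ 2 * |x - y| := by
  obtain ⟨L, hL⟩ := hK.lipschitz
  refine ⟨L, L.2, fun h hh x y => ?_⟩
  have h1 := hL.dist_le_mul (x / h) (y / h)
  rw [dist_eq, dist_eq, ← sub_div, abs_div, abs_of_pos hh] at h1
  rw [scaledKernel, scaledKernel, ← mul_sub, abs_mul, abs_of_pos (one_div_pos.2 hh)]
  calc 1 / h * |K (x / h) - K (y / h)| ≤ 1 / h * (L * (|x - y| / h)) := by gcongr
    _ = _ := by ring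

lemma IsKernel.continuous_scaledKernel (hK : IsKernel K) (h : ℝ) :
  Continuous (scaledKernel K h) := by
  have := hK.continuous
  unfold scaledKernel
  fun_prop

lemma IsKernel.integrable_scaledKernel (hK : IsKernel K) (hh : 0 < h) :
  Integrable (scaledKernel K h) :=
  (hK.integrable.comp_div hh.ne').const_mul _

lemma IsKernel.integral_scaledKernel (hK : IsKernel K) (hh : 0 < h) :
  ∫ x, scaledKernel K h x = 1 := by
  simp only [scaledKernel]
  rw [integral_const_mul, Measure.integral_comp_div, hK.integral_eq_one, abs_of_pos hh, smul_eq_mul]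
  field_simp

lemma IsKernel.integral_Ioi_scaledKernel (hK : IsKernel K) (hh : 0 < h) :
  ∫ x in Ioi 0, scaledKernel K h x = 1 / 2 ∧ ∫ x in Iic 0, scaledKernel K h x = 1 / 2 := by
  have h1 := integral_comp_neg_Ioi 0 (scaledKernel K h)
  simp only [hK.scaledKernel_neg, neg_zero] at h1
  have h2 := integral_add_compl (measurableSet_Ioi (a := (0 : ℝ))) (hK.integrable_scaledKernel hh)
  rw [compl_Ioi, hK.integral_scaledKernel hh] at h2
  constructor <;> linarith

variable {a b : ℝ}

local notation "I" => Icc a b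

lemma IsKernel.integrable_scaledKernel_sub (hK : IsKernel K) (hh : 0 < h) (s : ℝ) :
  Integrable 𝓚[K; h; s] :=
  (hK.integrable_scaledKernel hh).comp_sub_right s

lemma IsKernel.half_le_integral_scaledKernel (hK : IsKernel K) (hh : 0 < h)
  (hhab : h ≤ (b - a) / 2) {s : ℝ} (hs : s ∈ I) :
  1 / 2 ≤ ∫ u in I, scaledKernel K h (u - s) := by
  have e : ∫ u in I, scaledKernel K h (u - s) = ∫ x, (Icc a b).indicator 𝓚[K; h; s] (x + s) := by
    rw [integral_add_right_eq_self, integral_indicator measurableSet_Icc]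
  have i2 : Integrable fun x => (Icc a b).indicator 𝓚[K; h; s] (x + s) :=
    ((hK.integrable_scaledKernel_sub hh s).indicator measurableSet_Icc).comp_add_right s
  obtain ⟨h1, h2⟩ := hK.integral_Ioi_scaledKernel hh
  rw [e]
  have hnn := fun x => hK.scaledKernel_nonneg hh x
  rcases le_total s ((a + b) / 2) with hs2 | hs2
  · rw [← h1, ← integral_indicator measurableSet_Ioi]
    refine integral_mono ((hK.integrable_scaledKernel hh).indicator measurableSet_Ioi) i2
      fun x => ?_
    simp only [indicator, mem_Ioi, mem_Icc, add_sub_cancel_right]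
    split_ifs with hx hx'
    · exact le_rfl
    · rw [hK.scaledKernel_eq_zero hh]
      rw [abs_of_pos hx]
      by_contra! hxh
      exact hx' ⟨by linarith [hs.1], by linarith⟩
    · exact hnn x
    · exact le_rfl
  · rw [← h2, ← integral_indicator measurableSet_Iic]
    refine integral_mono ((hK.integrable_scaledKernel hh).indicator measurableSet_Iic) i2
      fun x => ?_
    simp only [indicator, mem_Iic, mem_Icc, add_sub_cancel_right]
    split_ifs with hx hx'
    · exact le_rfl
    · rw [hK.scaledKernel_eq_zero hh]
      rw [abs_of_nonpos hx]
      by_contra! hxh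
      exact hx' ⟨by linarith, by linarith [hs.2]⟩
    · exact hnn x
    · exact le_rfl

lemma IsKernel.integral_scaledKernel_le_one (hK : IsKernel K) (hh : 0 < h) (s : ℝ) (T : Set ℝ) :
  ∫ u in T, scaledKernel K h (u - s) ≤ 1 := by
  have h1 : ∫ u, scaledKernel K h (u - s) = 1 := by
    rw [integral_sub_right_eq_self, hK.integral_scaledKernel hh]
  rw [← h1]
  exact setIntegral_le_integral (hK.integrable_scaledKernel_sub hh s)
    (ae_of_all _ fun u => hK.scaledKernel_nonneg hh _)

/-- The smoothed sampling density. -/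
def smoothedDensity (a b : ℝ) (f K : ℝ → ℝ) (h s : ℝ) : ℝ :=
  ∫ u, scaledKernel K h (u - s) ∂timeLaw a b f

variable {f : ℝ → ℝ}

local notation "𝓣" => timeLaw a b f

lemma integrable_timeLaw_of_le {M : ℝ≥0} (hM : 𝓣 ≤ M • volume.restrict I)
  {g : ℝ → ℝ} (hg : Integrable g (volume.restrict I)) : Integrable g 𝓣 :=
  (hg.smul_measure ENNReal.coe_ne_top).mono_measure hM

lemma integral_timeLaw_le {M : ℝ≥0} (hM : 𝓣 ≤ M • volume.restrict I)
  {g : ℝ → ℝ} (hg : Integrable g (volume.restrict I)) (h0 : ∀ x, 0 ≤ g x) :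
  ∫ u, g u ∂𝓣 ≤ M * ∫ u in I, g u := by
  refine (integral_mono_measure hM (ae_of_all _ h0) (hg.smul_measure ENNReal.coe_ne_top)).trans ?_
  rw [integral_smul_nnreal_measure]
  rfl

lemma IsKernel.smoothedDensity_le (hK : IsKernel K) (hh : 0 < h) {M : ℝ≥0}
  (hM : 𝓣 ≤ M • volume.restrict I) (s : ℝ) :
  smoothedDensity a b f K h s ≤ M := by
  refine (integral_timeLaw_le hM (hK.integrable_scaledKernel_sub hh s).integrableOn
    fun x => hK.scaledKernel_nonneg hh _).trans ?_
  exact mul_le_of_le_one_right M.2 (hK.integral_scaledKernel_le_one hh s _)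

lemma IsKernel.le_smoothedDensity (hK : IsKernel K) (hf : IsSamplingDensity a b f) (hh : 0 < h)
  (hhab : h ≤ (b - a) / 2) {m : ℝ≥0} (hm : m • volume.restrict I ≤ 𝓣) {s : ℝ}
  (hs : s ∈ I) : m / 2 ≤ smoothedDensity a b f K h s := by
  obtain ⟨M, hM⟩ := hf.exists_le
  have i := (hK.integrable_scaledKernel_sub hh s).integrableOn (s := I)
  have h1 := integral_mono_measure hm
    (ae_of_all _ fun u => hK.scaledKernel_nonneg hh (u - s)) (integrable_timeLaw_of_le hM i)
  rw [integral_smul_nnreal_measure] at h1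
  refine le_trans ?_ h1
  have h2 := hK.half_le_integral_scaledKernel hh hhab hs
  calc (m : ℝ) / 2 = m * (1 / 2) := by ring
    _ ≤ m * ∫ u in I, scaledKernel K h (u - s) := by gcongr
    _ = _ := rfl

lemma IsKernel.continuous_smoothedDensity (hK : IsKernel K) (hf : IsSamplingDensity a b f)
  (hh : 0 < h) : Continuous (smoothedDensity a b f K h) := by
  have := hf.isProbabilityMeasure
  obtain ⟨B, -, hB⟩ := hK.exists_le
  have hc := hK.continuous_scaledKernel h
  refine continuous_of_dominated (bound := fun _ => B / h) (fun s => ?_) (fun s => ?_)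
    (integrable_const _) ?_
  · exact (by fun_prop : Continuous 𝓚[K; h; s]).aestronglyMeasurable
  · refine ae_of_all _ fun u => ?_
    rw [Real.norm_of_nonneg (hK.scaledKernel_nonneg hh _)]
    exact IsKernel.scaledKernel_le hB hh _
  · exact ae_of_all _ fun u => by fun_prop

end Kernel

namespace HasMoments

variable {Ω : Type*} [MeasurableSpace Ω] {μ : Measure Ω} {Y : Ω → ℝ}

lemma of_lintegral_lt_top (hY : AEStronglyMeasurable Y μ)
  (h : ∀ k : ℕ, ∫⁻ ω, ‖Y ω‖ₑ ^ k ∂μ < ∞) : HasMoments μ Y := by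
  intro p
  rcases Nat.eq_zero_or_pos p with rfl | hp
  · exact_mod_cast memLp_zero_iff_aestronglyMeasurable.2 hY
  · refine ⟨hY, (eLpNorm_lt_top_iff_lintegral_rpow_enorm_lt_top (by exact_mod_cast hp.ne')
      (ENNReal.natCast_ne_top p)).2 ?_⟩
    simpa using h p

lemma of_integrable_pow [IsProbabilityMeasure μ] (hY : AEStronglyMeasurable Y μ)
  (h : ∀ k : ℕ, Integrable (fun ω => Y ω ^ (2 * k)) μ) : HasMoments μ Y := by
  intro p
  have h1 : MemLp Y ((2 * (p + 1) : ℕ) : ℝ≥0∞) μ := by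
    refine ⟨hY, (eLpNorm_lt_top_iff_lintegral_rpow_enorm_lt_top
      (by exact_mod_cast (by omega : 2 * (p + 1) ≠ 0)) (ENNReal.natCast_ne_top _)).2 ?_⟩
    have h2 := (h (p + 1)).2
    rw [HasFiniteIntegral] at h2
    simpa only [ENNReal.toReal_natCast, ENNReal.rpow_natCast, enorm_pow] using h2
  exact h1.mono_exponent (by exact_mod_cast (by omega : p ≤ 2 * (p + 1)))

variable {Ω' : Type*} [MeasurableSpace Ω'] {ν : Measure Ω'} {F : Ω × Ω' → ℝ}
  [IsProbabilityMeasure μ] [IsProbabilityMeasure ν]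

lemma prod_right_ae (hF : HasMoments (μ.prod ν) F) : ∀ᵐ x ∂μ, HasMoments ν (fun y => F (x, y)) := by
  have h1 : ∀ᵐ x ∂μ, ∀ k : ℕ, Integrable (fun y => F (x, y) ^ (2 * k)) ν :=
    ae_all_iff.2 fun k => (hF.pow (2 * k)).integrable.prod_right_ae
  filter_upwards [h1, hF.aestronglyMeasurable.prodMk_left] with x h1 h2
  exact .of_integrable_pow h2 h1

lemma integral_prod_right (hF : HasMoments (μ.prod ν) F) :
  HasMoments μ (fun x => ∫ y, F (x, y) ∂ν) := by
  have hm := hF.aestronglyMeasurable.integral_prod_right'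
  refine .of_integrable_pow hm fun k => ?_
  refine (hF.pow (2 * k)).integrable.integral_prod_left.mono (hm.pow _) ?_
  filter_upwards [hF.prod_right_ae] with x hx
  rw [Real.norm_of_nonneg ((even_two_mul k).pow_nonneg _)]
  exact (integral_pow_two_mul_le hx k).trans (le_abs_self _)

end HasMoments

lemma IndepPairs.integral_centeredPairSum {Ω : Type*} [MeasurableSpace Ω] {μ : Measure Ω}
  {x y : ℕ → Ω → ℝ} {xm ym p r H : ℝ} {K : ℕ} (h : IndepPairs μ x y xm ym p r H K) (N : ℕ) :
  ∫ ω, centeredPairSum (x · ω) (y · ω) xm ym N ∂μ = 0 := by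
  have := h.indep.isProbabilityMeasure
  simp only [centeredPairSum]
  rw [integral_sub, integral_finsetSum]
  · have e : ∀ p ∈ (range N).offDiag, ∫ ω, x p.1 ω * y p.2 ω ∂μ = xm * ym := by
      intro p hp
      have hne := (Finset.mem_offDiag.1 hp).2.2
      have hi := (h.indep.indepFun hne).comp (φ := Prod.fst) (ψ := Prod.snd) measurable_fst
        measurable_snd
      have := hi.integral_fun_mul_eq_mul_integral (h.moments_left p.1).aestronglyMeasurable
        (h.moments_right p.2).aestronglyMeasurable
      simp only [Function.comp_apply] at this
      rw [this, h.mean_left, h.mean_right]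
    rw [sum_congr rfl e, sum_const, Finset.offDiag_card, Finset.card_range]
    simp only [nsmul_eq_mul, integral_const, probReal_univ, smul_eq_mul, one_mul]
    rw [Nat.cast_sub (Nat.le_mul_self N)]
    push_cast; ring
  · exact fun p _ => ((h.moments_left p.1).mul (h.moments_right p.2)).integrable
  · exact (HasMoments.sum _ fun p _ => (h.moments_left p.1).mul (h.moments_right p.2)).integrable
  · exact integrable_const _

section Subject

variable {S U : Type*} [MeasurableSpace S] [MeasurableSpace U] {ρ : Measure S} {κ : Measure U}
  [IsProbabilityMeasure ρ] [IsProbabilityMeasure κ]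

/-- The sum over pairs of observations of a subject with data `d`, centred given the process. -/
def subjectPairSum (κ : Measure U) (F F' : S × U → ℝ) (N : ℕ) (d : S × (ℕ → U)) : ℝ :=
  centeredPairSum (fun j => F (d.1, d.2 j)) (fun j => F' (d.1, d.2 j))
    (∫ u, F (d.1, u) ∂κ) (∫ u, F' (d.1, u) ∂κ) N

lemma measurePreserving_eval_right (j : ℕ) :
  MeasurePreserving (fun d : S × (ℕ → U) => (d.1, d.2 j))
    (ρ.prod (infinitePi fun _ => κ)) (ρ.prod κ) :=
  (MeasurePreserving.id ρ).prod (measurePreserving_eval_infinitePi (fun _ : ℕ => κ) j)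

/-- Moment bounds given the process, with a constant that depends on the process. -/
structure HasConditionalMoments (ρ : Measure S) (κ : Measure U) (F F' : S × U → ℝ) (p r : ℝ)
  (H : S → ℝ) (K : ℕ) : Prop where
  measurable_left : Measurable F
  measurable_right : Measurable F'
  moments_left : HasMoments (ρ.prod κ) F
  moments_right : HasMoments (ρ.prod κ) F'
  moments : HasMoments ρ H
  one_le_left : 1 ≤ p
  one_le_right : 1 ≤ r
  one_le : ∀ x, 1 ≤ H x
  bound_left : ∀ᵐ x ∂ρ, ∀ k, 1 ≤ k → k ≤ K → ∫ u, |F (x, u)| ^ k ∂κ ≤ p ^ (k - 1) * H x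
  bound_right : ∀ᵐ x ∂ρ, ∀ k, 1 ≤ k → k ≤ K → ∫ u, |F' (x, u)| ^ k ∂κ ≤ r ^ (k - 1) * H x

namespace HasConditionalMoments

variable {F F' : S × U → ℝ} {p r : ℝ} {H : S → ℝ} {K : ℕ}

lemma indepPairs (h : HasConditionalMoments ρ κ F F' p r H K) :
  ∀ᵐ x ∂ρ, IndepPairs (infinitePi fun _ : ℕ => κ) (fun j u => F (x, u j))
    (fun j u => F' (x, u j)) (∫ u, F (x, u) ∂κ) (∫ u, F' (x, u) ∂κ) p r (H x) K := by
  filter_upwards [h.bound_left, h.bound_right, h.moments_left.prod_right_ae,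
    h.moments_right.prod_right_ae] with x h1 h2 h3 h4
  have ev := fun j : ℕ => measurePreserving_eval_infinitePi (fun _ : ℕ => κ) j
  have m1 := h.measurable_left.comp (measurable_prodMk_left (x := x))
  have m2 := h.measurable_right.comp (measurable_prodMk_left (x := x))
  have ei : ∀ {g : U → ℝ}, Measurable g → ∀ j : ℕ,
      ∫ u, g (u j) ∂(infinitePi fun _ : ℕ => κ) = ∫ u, g u ∂κ := by
    intro g hg j
    have := integral_map (μ := infinitePi fun _ : ℕ => κ)
      (ev j).measurable.aemeasurable (f := g) hg.aestronglyMeasurable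
    rw [(ev j).map_eq] at this
    exact this.symm
  exact
    { indep := iIndepFun_infinitePi (X := fun _ u => (F (x, u), F' (x, u))) fun _ => m1.prodMk m2
      moments_left := fun j => h3.comp (ev j)
      moments_right := fun j => h4.comp (ev j)
      mean_left := ei m1
      mean_right := ei m2
      mean_mul := ⟨_, ei (m1.mul m2)⟩
      one_le_left := h.one_le_left
      one_le_right := h.one_le_right
      one_le := h.one_le x
      bound_left := fun j k hk hkK =>
        (ei (g := fun u => |F (x, u)| ^ k) (by simpa using m1.norm.pow_const k) j).trans_le
          (h1 k hk hkK)
      bound_right := fun j k hk hkK =>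
        (ei (g := fun u => |F' (x, u)| ^ k) (by simpa using m2.norm.pow_const k) j).trans_le
          (h2 k hk hkK) }

lemma hasMoments_subjectPairSum (h : HasConditionalMoments ρ κ F F' p r H K) (N : ℕ) :
  HasMoments (ρ.prod (infinitePi fun _ : ℕ => κ)) (subjectPairSum κ F F' N) := by
  have e1 := fun j => h.moments_left.comp (measurePreserving_eval_right (ρ := ρ) (κ := κ) j)
  have e2 := fun j => h.moments_right.comp (measurePreserving_eval_right (ρ := ρ) (κ := κ) j)
  have e3 := h.moments_left.integral_prod_right.comp
    (measurePreserving_fst (μ := ρ) (ν := infinitePi fun _ : ℕ => κ))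
  have e4 := h.moments_right.integral_prod_right.comp
    (measurePreserving_fst (μ := ρ) (ν := infinitePi fun _ : ℕ => κ))
  exact (HasMoments.sum _ fun p _ => (e1 p.1).mul (e2 p.2)).sub ((e3.mul e4).const_mul _)

lemma integral_subjectPairSum (h : HasConditionalMoments ρ κ F F' p r H K) (N : ℕ) :
  ∫ d, subjectPairSum κ F F' N d ∂(ρ.prod (infinitePi fun _ : ℕ => κ)) = 0 := by
  rw [integral_prod _ (h.hasMoments_subjectPairSum N).integrable, integral_eq_zero_of_ae]
  filter_upwards [h.indepPairs] with x hx
  exact hx.integral_centeredPairSum N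

lemma integral_subjectPairSum_pow_le {q : ℕ} (hq : 1 ≤ q)
  (h : HasConditionalMoments ρ κ F F' p r H (4 * q)) {C : ℝ}
  (hC : ∫ x, H x ^ (4 * q) ∂ρ ≤ C) (N : ℕ) :
  ∫ d, subjectPairSum κ F F' N d ^ (2 * q) ∂(ρ.prod (infinitePi fun _ : ℕ => κ)) ≤
    pairConst q * (C * pairScale N p r ^ q) := by
  have hp := pairScale_nonneg (N := N) (zero_le_one.trans h.one_le_left)
    (zero_le_one.trans h.one_le_right)
  have i1 := ((h.hasMoments_subjectPairSum N).pow (2 * q)).integrable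
  rw [integral_prod _ i1]
  calc ∫ x, ∫ u, subjectPairSum κ F F' N (x, u) ^ (2 * q)
        ∂(infinitePi fun _ : ℕ => κ) ∂ρ
      ≤ ∫ x, pairConst q * (H x ^ (4 * q) * pairScale N p r ^ q) ∂ρ := by
        refine integral_mono_ae i1.integral_prod_left
          (((h.moments.pow _).integrable.mul_const _).const_mul _) ?_
        filter_upwards [h.indepPairs] with x hx
        exact hx.integral_centeredPairSum_pow_le hq N
    _ ≤ _ := by
      rw [integral_const_mul, integral_mul_const]
      gcongr
      exact pairConst_nonneg q

lemma integral_subjectPairSum_sq_le (hK : 2 ≤ K)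
  (h : HasConditionalMoments ρ κ F F' p r H K) {C : ℝ} (hC : ∫ x, H x ^ 4 ∂ρ ≤ C) {N : ℕ}
  (hN : 1 ≤ N) :
  ∫ d, subjectPairSum κ F F' N d ^ 2 ∂(ρ.prod (infinitePi fun _ : ℕ => κ)) ≤
    6 * C * (N * (N - 1) ^ 2 * (p + r) + N * (N - 1) * (p * r)) := by
  have hN1 : (0 : ℝ) ≤ N - 1 := by simpa using (by exact_mod_cast hN : (1 : ℝ) ≤ N)
  have hp := zero_le_one.trans h.one_le_left
  have hr := zero_le_one.trans h.one_le_right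
  have i1 := ((h.hasMoments_subjectPairSum N).pow 2).integrable
  rw [integral_prod _ i1]
  calc ∫ x, ∫ u, subjectPairSum κ F F' N (x, u) ^ 2 ∂(infinitePi fun _ : ℕ => κ) ∂ρ
      ≤ ∫ x, 6 * H x ^ 4 * (N * (N - 1) ^ 2 * (p + r) + N * (N - 1) * (p * r)) ∂ρ := by
        refine integral_mono_ae i1.integral_prod_left
          (((h.moments.pow _).integrable.const_mul _).mul_const _) ?_
        filter_upwards [h.indepPairs] with x hx
        exact hx.integral_centeredPairSum_sq_le hK hN
    _ ≤ _ := by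
      rw [integral_mul_const, integral_const_mul]
      gcongr

end HasConditionalMoments

end Subject

lemma add_mul_sub_le_pow {F c : ℝ} (hF : 0 ≤ F) (hc : 0 ≤ c) {m : ℕ} (hm : 1 ≤ m) :
  c ^ m + m * c ^ (m - 1) * (F - c) ≤ F ^ m := by
  obtain ⟨n, rfl⟩ := Nat.exists_eq_add_of_le' hm
  rcases hc.eq_or_lt with rfl | hc
  · rcases Nat.eq_zero_or_pos n with rfl | hn
    · simp
    · simp [hn.ne', pow_nonneg hF]
  · have h := one_add_mul_le_pow (a := F / c - 1) (by have := div_nonneg hF hc.le; linarith) (n + 1)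
    have h2 : (1 + (F / c - 1)) ^ (n + 1) = F ^ (n + 1) / c ^ (n + 1) := by
      rw [add_sub_cancel, div_pow]
    rw [h2, le_div_iff₀ (by positivity)] at h
    refine le_trans (le_of_eq ?_) h
    rw [Nat.add_sub_cancel]
    field_simp
    ring

/-- Jensen's inequality for a finite measure given by a weight. -/
lemma pow_integral_mul_le {Ω : Type*} [MeasurableSpace Ω] {μ : Measure Ω} {w F : Ω → ℝ} {m : ℕ}
  (hm : 1 ≤ m) (hw0 : ∀ x, 0 ≤ w x) (hF0 : ∀ x, 0 ≤ F x) (hw : Integrable w μ)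
  (hwF : Integrable (fun x => w x * F x) μ) (hwFm : Integrable (fun x => w x * F x ^ m) μ)
  {A : ℝ} (hA : 0 < A) (hwA : ∫ x, w x ∂μ ≤ A) :
  (∫ x, w x * F x ∂μ) ^ m ≤ A ^ (m - 1) * ∫ x, w x * F x ^ m ∂μ := by
  set J := ∫ x, w x * F x ∂μ with hJ
  set W := ∫ x, w x ∂μ with hW
  have hJ0 : 0 ≤ J := integral_nonneg fun x => mul_nonneg (hw0 x) (hF0 x)
  set c := J / A with hc
  have hc0 : 0 ≤ c := by positivity
  have hm1 : (1 : ℝ) ≤ m := by exact_mod_cast hm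
  have h1 : ∫ x, ((c ^ m - m * c ^ (m - 1) * c) * w x + m * c ^ (m - 1) * (w x * F x)) ∂μ ≤
      ∫ x, w x * F x ^ m ∂μ := by
    refine integral_mono ((hw.const_mul _).add (hwF.const_mul _)) hwFm fun x => ?_
    have := mul_le_mul_of_nonneg_left (add_mul_sub_le_pow (hF0 x) hc0 hm) (hw0 x)
    simp only
    linarith
  rw [integral_add (hw.const_mul _) (hwF.const_mul _), integral_const_mul, integral_const_mul,
    ← hW, ← hJ] at h1
  have hcm : c ^ (m - 1) * c = c ^ m := by rw [← pow_succ, Nat.sub_add_cancel hm]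
  have hJc : J = c * A := by rw [hc]; field_simp
  have h2 : c ^ m * A ≤ ∫ x, w x * F x ^ m ∂μ := by
    refine le_trans ?_ h1
    have e : (c ^ m - m * c ^ (m - 1) * c) * W + m * c ^ (m - 1) * J =
      c ^ m * W + m * (c ^ (m - 1) * c) * (A - W) := by rw [hJc]; ring
    rw [e, hcm]
    have : 0 ≤ (m - 1) * (c ^ m * (A - W)) :=
      mul_nonneg (by linarith) (mul_nonneg (by positivity) (by linarith))
    linarith
  calc J ^ m = A ^ (m - 1) * (c ^ m * A) := by
        rw [hJc, mul_pow, ← Nat.sub_add_cancel hm, pow_succ A, Nat.add_sub_cancel]; ring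
    _ ≤ _ := by gcongr

instance (a b : ℝ) (f : ℝ → ℝ) : SFinite (timeLaw a b f) := by unfold timeLaw; infer_instance

instance (a b σ : ℝ) (f : ℝ → ℝ) [IsProbabilityMeasure (timeLaw a b f)] :
  IsProbabilityMeasure (obsLaw a b f σ) := by unfold obsLaw; infer_instance

section Model

variable {S : Type*} [MeasurableSpace S] {ρ : Measure S} {a b : ℝ} {X : ℝ → S → ℝ} {σ : ℝ}
  {φ f : ℝ → ℝ}

local notation "𝓣" => timeLaw a b f
local notation "I" => Icc a b
local notation "𝓛" => obsLaw a b f σ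

/-- The weighted mark of an observation. -/
def obsMark (X : ℝ → S → ℝ) (φ α : ℝ → ℝ) (d : S × (ℝ × ℝ)) : ℝ :=
  α d.2.1 * φ (X d.2.1 d.1 + d.2.2)

local notation "ξ[" α "]" => obsMark X φ α

lemma measurable_obsResponse (hX : Measurable (Function.uncurry X)) :
  Measurable fun d : S × (ℝ × ℝ) => X d.2.1 d.1 + d.2.2 := by
  have h : Measurable fun d : S × (ℝ × ℝ) => Function.uncurry X (d.2.1, d.1) :=
    hX.comp (by fun_prop)
  exact h.add (by fun_prop)

lemma measurable_obsMark (hX : Measurable (Function.uncurry X)) (hφ : Measurable φ)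
  {α : ℝ → ℝ} (hα : Measurable α) : Measurable ξ[α] :=
  (hα.comp (measurable_fst.comp measurable_snd)).mul (hφ.comp (measurable_obsResponse hX))

variable [IsProbabilityMeasure ρ]

lemma lintegral_obs_le (hX : Measurable (Function.uncurry X)) (hφ : Measurable φ) {k : ℕ} {B : ℝ≥0}
  (hB : ∀ t ∈ I, ∫⁻ x, ∫⁻ u, ‖φ (X t x + u)‖ₑ ^ k ∂errorLaw σ ∂ρ ≤ B) {α : ℝ → ℝ}
  (hα : Measurable α) :
  ∫⁻ d, ‖α d.2.1‖ₑ * ‖φ (X d.2.1 d.1 + d.2.2)‖ₑ ^ k ∂(ρ.prod 𝓛) ≤ (∫⁻ t, ‖α t‖ₑ ∂𝓣) * B := by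
  have hr := measurable_obsResponse hX
  have hm : Measurable fun d : S × (ℝ × ℝ) => ‖α d.2.1‖ₑ * ‖φ (X d.2.1 d.1 + d.2.2)‖ₑ ^ k :=
    ((hα.comp (measurable_fst.comp measurable_snd)).enorm).mul ((hφ.comp hr).enorm.pow_const k)
  unfold obsLaw
  rw [lintegral_prod_symm _ hm.aemeasurable, lintegral_prod _ (by
    exact (hm.comp measurable_swap).lintegral_prod_right'.aemeasurable)]
  rw [← lintegral_mul_const _ hα.enorm]
  refine lintegral_mono_ae ?_
  filter_upwards [ae_mem_timeLaw] with t ht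
  have hm2 : Measurable fun p : ℝ × S => ‖φ (X t p.2 + p.1)‖ₑ ^ k := by
    have : Measurable fun p : ℝ × S => X t p.2 + p.1 := by
      have : Measurable fun p : ℝ × S => Function.uncurry X (t, p.2) := hX.comp (by fun_prop)
      exact this.add measurable_fst
    exact (hφ.comp this).enorm.pow_const k
  calc ∫⁻ e, ∫⁻ x, ‖α t‖ₑ * ‖φ (X t x + e)‖ₑ ^ k ∂ρ ∂errorLaw σ
      = ‖α t‖ₑ * ∫⁻ e, ∫⁻ x, ‖φ (X t x + e)‖ₑ ^ k ∂ρ ∂errorLaw σ := by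
        rw [← lintegral_const_mul _ (by exact hm2.lintegral_prod_right')]
        refine lintegral_congr fun e => ?_
        rw [lintegral_const_mul _ (by exact hm2.comp measurable_prodMk_left)]
    _ = ‖α t‖ₑ * ∫⁻ x, ∫⁻ e, ‖φ (X t x + e)‖ₑ ^ k ∂errorLaw σ ∂ρ := by
      rw [lintegral_lintegral_swap (by exact hm2.aemeasurable)]
    _ ≤ _ := by gcongr; exact hB t ht

lemma IsCenteredProcess.hasMoments_obs (hX : IsCenteredProcess ρ a b X)
  (hf : IsSamplingDensity a b f) (hφ : HasLinearGrowth φ) :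
  HasMoments (ρ.prod 𝓛) (fun d => φ (X d.2.1 d.1 + d.2.2)) := by
  have := hf.isProbabilityMeasure
  refine .of_lintegral_lt_top
    (hφ.measurable.comp (measurable_obsResponse hX.measurable)).aestronglyMeasurable fun k => ?_
  obtain ⟨B, hB⟩ := hX.exists_lintegral_error_le σ hφ k
  have h := lintegral_obs_le (f := f) hX.measurable hφ.measurable hB
    (measurable_const (a := (1 : ℝ)))
  simp only [enorm_one, one_mul, lintegral_const, measure_univ] at h
  exact h.trans_lt ENNReal.coe_lt_top

lemma HasMoments.of_bounded {Ω : Type*} [MeasurableSpace Ω] {μ : Measure Ω}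
  [IsProbabilityMeasure μ] {g : Ω → ℝ} (hg : Measurable g) {p : ℝ} (hp : ∀ x, |g x| ≤ p) :
  HasMoments μ g := fun _ => MemLp.of_bound hg.aestronglyMeasurable p (ae_of_all _ hp)

lemma IsCenteredProcess.hasMoments_obsMark (hX : IsCenteredProcess ρ a b X)
  (hf : IsSamplingDensity a b f) (hφ : HasLinearGrowth φ) {α : ℝ → ℝ} (hα : Measurable α) {p : ℝ}
  (hαp : ∀ t, |α t| ≤ p) : HasMoments (ρ.prod 𝓛) ξ[α] := by
  have := hf.isProbabilityMeasure
  exact (HasMoments.of_bounded (g := fun d : S × (ℝ × ℝ) => α d.2.1) (by fun_prop)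
    fun d => hαp _).mul (hX.hasMoments_obs hf hφ)

lemma integral_obs_le (hX : IsCenteredProcess ρ a b X) (hf : IsSamplingDensity a b f)
  (hφ : HasLinearGrowth φ) {k : ℕ} {B : ℝ≥0}
  (hB : ∀ t ∈ I, ∫⁻ x, ∫⁻ u, ‖φ (X t x + u)‖ₑ ^ k ∂errorLaw σ ∂ρ ≤ B) {α : ℝ → ℝ}
  (hα : Measurable α) {p A : ℝ} (hαp : ∀ t, |α t| ≤ p) (hA : ∫ t, |α t| ∂𝓣 ≤ A) :
  ∫ d, |α d.2.1| * |φ (X d.2.1 d.1 + d.2.2)| ^ k ∂(ρ.prod 𝓛) ≤ A * B := by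
  have := hf.isProbabilityMeasure
  have hA0 : 0 ≤ A := (integral_nonneg fun t => abs_nonneg _).trans hA
  have hmeas : AEStronglyMeasurable (fun d : S × (ℝ × ℝ) =>
      |α d.2.1| * |φ (X d.2.1 d.1 + d.2.2)| ^ k) (ρ.prod 𝓛) :=
    (((hα.comp (measurable_fst.comp measurable_snd)).norm).mul
      ((hφ.measurable.comp (measurable_obsResponse hX.measurable)).norm.pow_const k)
      ).aestronglyMeasurable
  rw [integral_eq_lintegral_of_nonneg_ae (ae_of_all _ fun _ => by positivity) hmeas]
  refine ENNReal.toReal_le_of_le_ofReal (by positivity) ?_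
  have h := lintegral_obs_le (f := f) hX.measurable hφ.measurable hB hα
  refine le_trans (le_of_eq (lintegral_congr fun d => ?_)) (h.trans ?_)
  · rw [ofReal_mul (abs_nonneg _), ofReal_pow (abs_nonneg _),
      ← enorm_eq_ofReal_abs, ← enorm_eq_ofReal_abs]
  · rw [ofReal_mul hA0, ofReal_coe_nnreal]
    gcongr
    have i : Integrable α 𝓣 := Integrable.of_bound hα.aestronglyMeasurable p (ae_of_all _ hαp)
    rw [← ofReal_integral_norm_eq_lintegral_enorm i]
    exact ofReal_le_ofReal hA

lemma add_add_pow_le {x y z : ℝ} (hx : 0 ≤ x) (hy : 0 ≤ y) (hz : 0 ≤ z) (m : ℕ) :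
  (x + y + z) ^ m ≤ 3 ^ m * (x ^ m + y ^ m + z ^ m) := by
  set M := max x (max y z) with hM
  have h1 : x ≤ M := le_max_left _ _
  have h2 : y ≤ M := (le_max_left _ _).trans (le_max_right _ _)
  have h3 : z ≤ M := (le_max_right _ _).trans (le_max_right _ _)
  have h4 : M ^ m ≤ x ^ m + y ^ m + z ^ m := by
    have p1 := pow_nonneg hx m
    have p2 := pow_nonneg hy m
    have p3 := pow_nonneg hz m
    rcases max_choice x (max y z) with h | h
    · rw [hM, h]; linarith
    · rcases max_choice y z with h' | h' <;> rw [hM, h, h'] <;> linarith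
  calc (x + y + z) ^ m ≤ (3 * M) ^ m := pow_le_pow_left₀ (by positivity) (by linarith) m
    _ = 3 ^ m * M ^ m := mul_pow _ _ _
    _ ≤ _ := by gcongr

lemma IsCenteredProcess.exists_hasConditionalMoments (hX : IsCenteredProcess ρ a b X)
  (hf : IsSamplingDensity a b f) (hφ : HasLinearGrowth φ) {A : ℝ} (hA : 0 < A) (K : ℕ) {m : ℕ}
  (hm : 1 ≤ m) :
  ∃ C : ℝ, 0 ≤ C ∧ ∀ (α β : ℝ → ℝ) (p r : ℝ), Measurable α → Measurable β →
    (∀ t, |α t| ≤ p) → (∀ t, |β t| ≤ r) → 1 ≤ p → 1 ≤ r →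
    ∫ t, |α t| ∂𝓣 ≤ A → ∫ t, |β t| ∂𝓣 ≤ A →
    ∃ H, HasConditionalMoments ρ 𝓛 ξ[α] ξ[β] p r H K ∧ ∫ x, H x ^ m ∂ρ ≤ C := by
  have := hf.isProbabilityMeasure
  set Φ : S × (ℝ × ℝ) → ℝ := fun d => 1 + |φ (X d.2.1 d.1 + d.2.2)| with hΦ
  have hφ1 := hφ.one_add_abs
  have mΦ : HasMoments (ρ.prod 𝓛) Φ := hX.hasMoments_obs hf hφ1
  have hΦ1 : ∀ d, 1 ≤ Φ d := fun d => by simp only [hΦ]; linarith [abs_nonneg (φ (X d.2.1 d.1 + d.2.2))]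
  obtain ⟨B, hB⟩ := hX.exists_lintegral_error_le σ hφ1 (K * m)
  refine ⟨3 ^ m * (1 + A ^ m * B + A ^ m * B), by positivity,
    fun α β p r hα hβ hαp hβr hp hr hαA hβA => ?_⟩
  have key : ∀ (α : ℝ → ℝ) (p : ℝ), Measurable α → (∀ t, |α t| ≤ p) → 1 ≤ p → ∫ t, |α t| ∂𝓣 ≤ A →
      ∃ Q : S → ℝ, HasMoments ρ Q ∧ (∀ x, 0 ≤ Q x) ∧ (∀ᵐ x ∂ρ, ∀ k, 1 ≤ k → k ≤ K →
        ∫ u, |ξ[α] (x, u)| ^ k ∂𝓛 ≤ p ^ (k - 1) * Q x) ∧ ∫ x, Q x ^ m ∂ρ ≤ A ^ m * B := by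
    intro α p hα hαp hp hαA
    have mα : HasMoments (ρ.prod 𝓛) (fun d => |α d.2.1|) :=
      (HasMoments.of_bounded (g := fun d : S × (ℝ × ℝ) => α d.2.1) (by fun_prop) fun d => hαp _).abs
    have mα' : HasMoments 𝓛 (fun u => |α u.1|) :=
      (HasMoments.of_bounded (g := fun u : ℝ × ℝ => α u.1) (by fun_prop) fun d => hαp _).abs
    have m1 := mα.mul (mΦ.pow K)
    have m2 := mα.mul ((mΦ.pow K).pow m)
    refine ⟨fun x => ∫ u, |α u.1| * Φ (x, u) ^ K ∂𝓛, m1.integral_prod_right, fun x =>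
      integral_nonneg fun u => mul_nonneg (abs_nonneg _) (pow_nonneg (zero_le_one.trans (hΦ1 _)) _),
      ?_, ?_⟩
    · filter_upwards [m1.prod_right_ae, (hX.hasMoments_obsMark (σ := σ) hf hφ hα hαp).prod_right_ae]
        with x h1 h2 k hk hkK
      rw [← integral_const_mul]
      refine integral_mono (h2.abs.pow k).integrable (h1.const_mul _).integrable fun u => ?_
      simp only [obsMark, abs_mul, mul_pow]
      have e1 : |α u.1| ^ k ≤ p ^ (k - 1) * |α u.1| := by
        calc |α u.1| ^ k = |α u.1| ^ (k - 1) * |α u.1| := by rw [← pow_succ, Nat.sub_add_cancel hk]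
          _ ≤ _ := by gcongr; exact hαp _
      have e2 : |φ (X u.1 x + u.2)| ^ k ≤ Φ (x, u) ^ K := by
        calc |φ (X u.1 x + u.2)| ^ k ≤ Φ (x, u) ^ k := by
              gcongr; simp only [hΦ]; linarith
          _ ≤ Φ (x, u) ^ K := pow_le_pow_right₀ (hΦ1 _) hkK
      calc _ ≤ (p ^ (k - 1) * |α u.1|) * Φ (x, u) ^ K := mul_le_mul e1 e2 (by positivity)
            (by have := abs_nonneg (α u.1); positivity)
        _ = _ := by ring
    · calc ∫ x, (∫ u, |α u.1| * Φ (x, u) ^ K ∂𝓛) ^ m ∂ρ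
          ≤ ∫ x, A ^ (m - 1) * ∫ u, |α u.1| * (Φ (x, u) ^ K) ^ m ∂𝓛 ∂ρ := by
            refine integral_mono_ae (m1.integral_prod_right.pow m).integrable
              (m2.integral_prod_right.const_mul _).integrable ?_
            filter_upwards [m1.prod_right_ae, m2.prod_right_ae] with x h1 h2
            refine pow_integral_mul_le hm (fun u => abs_nonneg _)
              (fun u => pow_nonneg (zero_le_one.trans (hΦ1 _)) _) mα'.integrable h1.integrable
              h2.integrable hA (le_of_eq_of_le ?_ hαA)
            have := integral_map (μ := 𝓛) (φ := Prod.fst) (by fun_prop)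
              (f := fun t => |α t|) (by
                have := hα.norm; simp only [norm_eq_abs] at this
                exact this.aestronglyMeasurable)
            rw [← this]
            congr 1
            exact measurePreserving_fst.map_eq
        _ ≤ A ^ (m - 1) * (A * B) := by
          rw [integral_const_mul]
          gcongr
          rw [← integral_prod (fun d : S × (ℝ × ℝ) => |α d.2.1| * (Φ d ^ K) ^ m) m2.integrable]
          refine le_of_eq_of_le ?_ (integral_obs_le hX hf hφ1 hB hα hαp hαA)
          refine integral_congr_ae (ae_of_all _ fun d => ?_)
          simp only [← pow_mul]
          rw [abs_of_nonneg (zero_le_one.trans (hΦ1 d))]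
        _ = _ := by rw [← mul_assoc, ← pow_succ, Nat.sub_add_cancel hm]
  obtain ⟨Q, a4, na, a2, a3⟩ := key α p hα hαp hp hαA
  obtain ⟨R, b4, nb, b2, b3⟩ := key β r hβ hβr hr hβA
  refine ⟨fun x => 1 + Q x + R x, ?_, ?_⟩
  · exact
      { measurable_left := measurable_obsMark hX.measurable hφ.measurable hα
        measurable_right := measurable_obsMark hX.measurable hφ.measurable hβ
        moments_left := hX.hasMoments_obsMark hf hφ hα hαp
        moments_right := hX.hasMoments_obsMark hf hφ hβ hβr
        moments := ((HasMoments.const 1).add a4).add b4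
        one_le_left := hp
        one_le_right := hr
        one_le := fun x => by linarith [na x, nb x]
        bound_left := by
          filter_upwards [a2] with x hx k hk hkK
          refine (hx k hk hkK).trans ?_
          gcongr
          linarith [nb x]
        bound_right := by
          filter_upwards [b2] with x hx k hk hkK
          refine (hx k hk hkK).trans ?_
          gcongr
          linarith [na x] }
  · calc _ ≤ ∫ x, 3 ^ m * (1 ^ m + Q x ^ m + R x ^ m) ∂ρ := by
          refine integral_mono ((((HasMoments.const 1).add a4).add b4).pow m).integrable
            ((((HasMoments.const _).add (a4.pow m)).add (b4.pow m)).const_mul _).integrable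
            fun x => add_add_pow_le zero_le_one (na x) (nb x) m
      _ ≤ _ := by
        rw [integral_const_mul, integral_add_add (integrable_const _) (a4.pow m).integrable
          (b4.pow m).integrable]
        simp only [one_pow, integral_const, probReal_univ, smul_eq_mul, mul_one]
        gcongr

end Model

lemma sum_pow_le_pow_sum {ι : Type*} {s : Finset ι} {x : ι → ℝ} (hx : ∀ i, 0 ≤ x i) {k : ℕ}
  (hk : 1 ≤ k) : ∑ i ∈ s, x i ^ k ≤ (∑ i ∈ s, x i) ^ k := by
  have h0 : 0 ≤ ∑ i ∈ s, x i := sum_nonneg fun i _ => hx i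
  calc ∑ i ∈ s, x i ^ k ≤ ∑ i ∈ s, (∑ i ∈ s, x i) ^ (k - 1) * x i := by
        refine sum_le_sum fun i hi => ?_
        conv_lhs => rw [← Nat.sub_add_cancel hk, pow_succ]
        gcongr
        · exact hx i
        · exact hx i
        · exact single_le_sum (fun i _ => hx i) hi
    _ = _ := by rw [← mul_sum, ← pow_succ, Nat.sub_add_cancel hk]

section Subjects

variable {S U : Type*} [MeasurableSpace S] [MeasurableSpace U] {ρ : Measure S} {κ : Measure U}
  [IsProbabilityMeasure ρ] [IsProbabilityMeasure κ]

/-- The law of the data of all subjects. -/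
def sampleLaw (ρ : Measure S) (κ : Measure U) [IsProbabilityMeasure ρ] [IsProbabilityMeasure κ] :
  Measure (ℕ → S × (ℕ → U)) :=
  infinitePi fun _ => ρ.prod (infinitePi fun _ => κ)

instance : IsProbabilityMeasure (sampleLaw ρ κ) := by unfold sampleLaw; infer_instance

lemma measurePreserving_subject (i : ℕ) :
  MeasurePreserving (fun D : ℕ → S × (ℕ → U) => D i) (sampleLaw ρ κ)
    (ρ.prod (infinitePi fun _ => κ)) :=
  measurePreserving_eval_infinitePi _ i

lemma measurePreserving_process (i : ℕ) :
  MeasurePreserving (fun D : ℕ → S × (ℕ → U) => (D i).1) (sampleLaw ρ κ) ρ :=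
  measurePreserving_fst.comp (measurePreserving_subject i)

/-- Rosenthal's inequality for a weighted sum over independent subjects. -/
lemma rosenthal_subject {g : ℕ → S × (ℕ → U) → ℝ} (hg : ∀ i, Measurable (g i))
  (hM : ∀ i, HasMoments (ρ.prod (infinitePi fun _ => κ)) (g i))
  (h0 : ∀ i, ∫ d, g i d ∂(ρ.prod (infinitePi fun _ => κ)) = 0) (w : ℕ → ℝ) {D Λ : ℝ} (hD : 0 ≤ D)
  (hΛ : 1 ≤ Λ) (q n : ℕ)
  (h1 : 1 ≤ q → ∑ i ∈ range n, w i ^ 2 * ∫ d, g i d ^ 2 ∂(ρ.prod (infinitePi fun _ => κ)) ≤ D)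
  (hk : ∀ k, 1 ≤ k → k ≤ q →
    ∑ i ∈ range n, w i ^ (2 * k) * ∫ d, g i d ^ (2 * k) ∂(ρ.prod (infinitePi fun _ => κ)) ≤ Λ * D ^ k) :
  ∫ ω, (∑ i ∈ range n, w i * g i (ω i)) ^ (2 * q) ∂sampleLaw ρ κ ≤
    rosenthalConst q * (Λ * D ^ q) := by
  have hpow : ∀ i k, ∫ ω, (w i * g i (ω i)) ^ k ∂sampleLaw ρ κ =
      w i ^ k * ∫ d, g i d ^ k ∂(ρ.prod (infinitePi fun _ => κ)) := by
    intro i k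
    have h := measurePreserving_subject (ρ := ρ) (κ := κ) i
    simp_rw [mul_pow]
    rw [integral_const_mul, ← h.map_eq, integral_map h.measurable.aemeasurable
      ((hg i).pow_const k).aestronglyMeasurable]
  refine rosenthal (μ := sampleLaw ρ κ) (iIndepFun_infinitePi (X := fun i d => w i * g i d) fun i => (hg i).const_mul _)
    (fun i => ((hM i).comp (measurePreserving_subject i)).const_mul _) (fun i => ?_) hD hΛ q _
    (fun hq => ?_) fun k h hkq => ?_
  · simpa [h0] using hpow i 1
  · simpa only [hpow] using h1 hq
  · simpa only [hpow] using hk k h hkq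

/-- Rosenthal's inequality for a weighted centred sum over independent processes. -/
lemma rosenthal_process {ξ : S → ℝ} (hξ : Measurable ξ) (hM : HasMoments ρ ξ) {m : ℝ}
  (hm : m = ∫ x, ξ x ∂ρ) (w : ℕ → ℝ) {D : ℝ} (hD : 0 ≤ D) (q n : ℕ)
  (hk : ∀ k, 1 ≤ k → k ≤ q →
    (∑ i ∈ range n, w i ^ (2 * k)) * ∫ x, (ξ x - m) ^ (2 * k) ∂ρ ≤ D ^ k) :
  ∫ ω, (∑ i ∈ range n, w i * (ξ (ω i).1 - m)) ^ (2 * q) ∂sampleLaw ρ κ ≤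
    rosenthalConst q * D ^ q := by
  have e : ∀ k, ∫ d, (ξ d.1 - m) ^ k ∂(ρ.prod (infinitePi fun _ : ℕ => κ)) = ∫ x, (ξ x - m) ^ k ∂ρ :=
    fun k => by rw [integral_fun_fst (fun x => (ξ x - m) ^ k)]; simp
  have := rosenthal_subject (κ := κ) (g := fun _ d => ξ d.1 - m)
    (fun _ => (hξ.comp measurable_fst).sub_const m)
    (fun _ => (hM.sub (.const m)).comp measurePreserving_fst) (fun _ => ?_) w hD le_rfl q n
    (fun hq => ?_) fun k h hkq => ?_
  · rwa [one_mul] at this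
  · have := e 1
    simp only [pow_one] at this
    rw [this, integral_sub hM.integrable (integrable_const _)]
    simp [hm]
  · simpa only [e, ← sum_mul, mul_one, pow_one] using hk 1 le_rfl hq
  · simpa only [e, ← sum_mul, one_mul] using hk k h hkq

lemma measurable_condMean {F : S × U → ℝ} (hF : Measurable F) :
  Measurable fun x => ∫ u, F (x, u) ∂κ :=
  hF.stronglyMeasurable.integral_prod_right'.measurable

lemma measurable_subjectPairSum {F F' : S × U → ℝ} (hF : Measurable F) (hF' : Measurable F')
  (N : ℕ) : Measurable (subjectPairSum κ F F' N) := by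
  have e : ∀ j : ℕ, Measurable fun d : S × (ℕ → U) => (d.1, d.2 j) := fun j => by fun_prop
  have h1 : Measurable fun d : S × (ℕ → U) => ∫ u, F (d.1, u) ∂κ :=
    (measurable_condMean (κ := κ) hF).comp measurable_fst
  have h2 : Measurable fun d : S × (ℕ → U) => ∫ u, F' (d.1, u) ∂κ :=
    (measurable_condMean (κ := κ) hF').comp measurable_fst
  exact (measurable_sum _ fun p _ => (hF.comp (e p.1)).mul (hF'.comp (e p.2))).sub
    ((h1.mul h2).const_mul _)

lemma subjectPairSum_eq_zero {F F' : S × U → ℝ} {N : ℕ} (hN : N < 2) (d : S × (ℕ → U)) :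
  subjectPairSum κ F F' N d = 0 := by
  interval_cases N <;> simp [subjectPairSum, centeredPairSum]

variable {F F' : S × U → ℝ} {p r : ℝ} {H : S → ℝ} {K : ℕ}

lemma HasConditionalMoments.mono (h : HasConditionalMoments ρ κ F F' p r H K) {K' : ℕ}
  (hK : K' ≤ K) : HasConditionalMoments ρ κ F F' p r H K' :=
  { h with
    bound_left := h.bound_left.mono fun _ hx k hk hkK => hx k hk (hkK.trans hK)
    bound_right := h.bound_right.mono fun _ hx k hk hkK => hx k hk (hkK.trans hK) }

lemma HasConditionalMoments.integral_pow_le (h : HasConditionalMoments ρ κ F F' p r H K)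
  {C : ℝ} {m : ℕ} (hC : ∫ x, H x ^ m ∂ρ ≤ C) {k : ℕ} (hk : k ≤ m) : ∫ x, H x ^ k ∂ρ ≤ C :=
  (integral_mono (h.moments.pow k).integrable (h.moments.pow m).integrable fun x =>
    pow_le_pow_right₀ (h.one_le x) hk).trans hC

lemma HasConditionalMoments.one_le_bound (h : HasConditionalMoments ρ κ F F' p r H K)
  {C : ℝ} {m : ℕ} (hC : ∫ x, H x ^ m ∂ρ ≤ C) : 1 ≤ C := by
  have := h.integral_pow_le hC (Nat.zero_le m)
  simpa using this

lemma HasConditionalMoments.sum_integral_subjectPairSum_sq_le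
  (h : HasConditionalMoments ρ κ F F' p r H K) (hK : 2 ≤ K) {C : ℝ} (hC : ∫ x, H x ^ 4 ∂ρ ≤ C)
  {n : ℕ} {N : ℕ → ℕ} {v D : ℝ}
  (h2 : ∑ i ∈ range n, v ^ 2 * ((N i : ℝ) * (N i - 1) ^ 2 * (p + r) +
    N i * (N i - 1) * (p * r)) ≤ D) :
  ∑ i ∈ range n, v ^ 2 * ∫ d, subjectPairSum κ F F' (N i) d ^ 2 ∂(ρ.prod (infinitePi fun _ => κ)) ≤
    6 * C * D := by
  have hC1 := h.one_le_bound hC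
  calc _ ≤ ∑ i ∈ range n, 6 * C * (v ^ 2 * ((N i : ℝ) * (N i - 1) ^ 2 * (p + r) +
          N i * (N i - 1) * (p * r))) := by
        refine sum_le_sum fun i _ => ?_
        rcases Nat.eq_zero_or_pos (N i) with h0 | h0
        · simp only [subjectPairSum_eq_zero (κ := κ) (F := F) (F' := F') (by omega : N i < 2)]
          simp [h0]
        · have := h.integral_subjectPairSum_sq_le hK hC h0
          calc _ ≤ v ^ 2 * _ := mul_le_mul_of_nonneg_left this (sq_nonneg v)
            _ = _ := by ring
    _ ≤ _ := by
      rw [← mul_sum]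
      gcongr

/-- Moments of the sum of the centred pair sums of independent subjects. -/
lemma HasConditionalMoments.integral_sum_subjectPairSum_pow_le {q : ℕ} (hq : 1 ≤ q)
  (h : HasConditionalMoments ρ κ F F' p r H (4 * q)) {C : ℝ} (hC : ∫ x, H x ^ (4 * q) ∂ρ ≤ C)
  {n : ℕ} {N : ℕ → ℕ} {v D Λ : ℝ} (hD : 0 ≤ D) (hΛ : 1 ≤ Λ)
  (h2 : ∑ i ∈ range n, v ^ 2 * ((N i : ℝ) * (N i - 1) ^ 2 * (p + r) +
    N i * (N i - 1) * (p * r)) ≤ D)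
  (hmax : ∀ i < n, 2 ≤ N i → v ^ 2 * pairScale (N i) p r ≤ D)
  (hsum : ∑ i ∈ range n with 2 ≤ N i, v ^ 2 * pairScale (N i) p r ≤ Λ * D) :
  ∫ ω, (∑ i ∈ range n, v * subjectPairSum κ F F' (N i) (ω i)) ^ (2 * q) ∂sampleLaw ρ κ ≤
    rosenthalConst q * (((1 + ∑ k ∈ range (q + 1), pairConst k) * C * Λ) * (6 * C * D) ^ q) := by
  have hp0 := zero_le_one.trans h.one_le_left
  have hr0 := zero_le_one.trans h.one_le_right
  have hC1 := h.one_le_bound hC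
  set c := ∑ k ∈ range (q + 1), pairConst k with hc
  have hc0 : 0 ≤ c := sum_nonneg fun k _ => pairConst_nonneg k
  refine rosenthal_subject
    (fun i => measurable_subjectPairSum h.measurable_left h.measurable_right (N i))
    (fun i => h.hasMoments_subjectPairSum (N i)) (fun i => h.integral_subjectPairSum _) (fun _ => v)
    (by positivity) ?_ q n (fun _ => h.sum_integral_subjectPairSum_sq_le (by omega)
      (h.integral_pow_le hC (by omega : 4 ≤ 4 * q)) h2) fun k hk hkq => ?_
  · nlinarith [mul_nonneg hc0 (by linarith : 0 ≤ C), one_le_mul_of_one_le_of_one_le hC1 hΛ,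
      mul_nonneg (mul_nonneg hc0 (by linarith : 0 ≤ C)) (by linarith : 0 ≤ Λ)]
  · rw [← Finset.sum_filter_of_ne (p := fun i => 2 ≤ N i) fun i _ hne => ?_]
    swap
    · by_contra hlt
      refine hne ?_
      simp only [subjectPairSum_eq_zero (κ := κ) (F := F) (F' := F') (not_le.1 hlt)]
      rw [zero_pow (by omega)]
      simp
    calc _ ≤ ∑ i ∈ range n with 2 ≤ N i,
          (pairConst k * C * D ^ (k - 1)) * (v ^ 2 * pairScale (N i) p r) := by
          refine sum_le_sum fun i hi => ?_
          obtain ⟨hi1, hi2⟩ := Finset.mem_filter.1 hi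
          have hW := pairScale_nonneg (N := N i) hp0 hr0
          have := (h.mono (by omega : 4 * k ≤ 4 * q)).integral_subjectPairSum_pow_le hk
            (h.integral_pow_le hC (by omega : 4 * k ≤ 4 * q)) (N i)
          have hk' := pairConst_nonneg k
          calc _ ≤ v ^ (2 * k) * (pairConst k * (C * pairScale (N i) p r ^ k)) :=
                mul_le_mul_of_nonneg_left this ((even_two_mul k).pow_nonneg v)
            _ = pairConst k * C * ((v ^ 2 * pairScale (N i) p r) ^ (k - 1) *
                (v ^ 2 * pairScale (N i) p r)) := by
              rw [← pow_succ, Nat.sub_add_cancel hk, mul_pow, ← pow_mul]; ring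
            _ ≤ pairConst k * C * (D ^ (k - 1) * (v ^ 2 * pairScale (N i) p r)) := by
              gcongr
              exact hmax i (Finset.mem_range.1 hi1) hi2
            _ = _ := by ring
      _ ≤ (pairConst k * C * D ^ (k - 1)) * (Λ * D) := by
        rw [← mul_sum]
        have hk' := pairConst_nonneg k
        gcongr
      _ = (pairConst k * C * Λ) * D ^ k := by
        have : D ^ k = D ^ (k - 1) * D := by rw [← pow_succ, Nat.sub_add_cancel hk]
        rw [this]; ring
      _ ≤ _ := by
        have hk' : pairConst k ≤ 1 + c := by
          have := single_le_sum (fun k _ => pairConst_nonneg k)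
            (Finset.mem_range.2 (by omega : k < q + 1))
          linarith
        gcongr
        nlinarith

/-- Moments of a weighted centred sum over independent subjects. -/
lemma integral_sum_process_pow_le {ξ : S → ℝ} (hξ : Measurable ξ) (hM : HasMoments ρ ξ) {q : ℕ}
  {C : ℝ} (hC1 : 1 ≤ C) (hC : ∀ k, 1 ≤ k → k ≤ q → ∫ x, ξ x ^ (2 * k) ∂ρ ≤ C) (w : ℕ → ℝ) (n : ℕ) :
  ∫ ω, (∑ i ∈ range n, w i * (ξ (ω i).1 - ∫ x, ξ x ∂ρ)) ^ (2 * q) ∂sampleLaw ρ κ ≤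
    rosenthalConst q * (2 * 4 ^ q * C * ∑ i ∈ range n, w i ^ 2) ^ q := by
  set m := ∫ x, ξ x ∂ρ with hm
  have hc1 : 1 ≤ 2 * 4 ^ q * C := by
    have : (1 : ℝ) ≤ 4 ^ q := one_le_pow₀ (by norm_num)
    nlinarith
  have hW : 0 ≤ ∑ i ∈ range n, w i ^ 2 := sum_nonneg fun i _ => sq_nonneg _
  refine rosenthal_process hξ hM hm w (by positivity) q n fun k hk hkq => ?_
  have h1 : ∫ x, (ξ x - m) ^ (2 * k) ∂ρ ≤ 2 * 4 ^ q * C :=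
    (integral_sub_mean_pow_le hM rfl k).trans (mul_le_mul (by gcongr; norm_num) (hC k hk hkq)
      (integral_nonneg fun x => (even_two_mul k).pow_nonneg _) (by positivity))
  simp_rw [pow_mul (w _)]
  calc _ ≤ (∑ i ∈ range n, w i ^ 2) ^ k * (2 * 4 ^ q * C) ^ k := by
        refine mul_le_mul (sum_pow_le_pow_sum (fun i => sq_nonneg _) hk)
          (h1.trans (le_self_pow₀ hc1 (by omega)))
          (integral_nonneg fun x => (even_two_mul k).pow_nonneg _) (by positivity)
    _ = _ := by rw [← mul_pow, mul_comm]

end Subjects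

/-- The first of the three summands of `pointVar`. -/
def pairVar (h : ℝ) (N : ℕ → ℕ) (n : ℕ) : ℝ :=
  obsWeight N n ^ 2 * (factMoment N n 2 / h ^ 2)

section Rates

lemma cast_descFactorial_three (N : ℕ) : (N.descFactorial 3 : ℝ) = N * (N - 1) * (N - 2) := by
  rcases N with _ | _ | N
  · simp
  · simp
  · simp [Nat.descFactorial_succ]; ring

lemma cast_descFactorial_four (N : ℕ) :
  (N.descFactorial 4 : ℝ) = N * (N - 1) * (N - 2) * (N - 3) := by
  rcases N with _ | _ | _ | N
  · simp
  · simp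
  · simp [Nat.descFactorial_succ]
  · simp [Nat.descFactorial_succ]; ring

variable {N : ℕ → ℕ} {n : ℕ} {h : ℝ}
local notation "v" => obsWeight N n
local notation "M" => factMoment N n
local notation "G" => pointVar h N n
local notation "G₁" => pairVar h N n
local notation "G₂" => sharedVar h N n
local notation "S[" i "]" => v ^ 2 * ((N i : ℝ) * (N i - 1) ^ 2 / h)
local notation "P[" i "]" => v ^ 2 * ((N i : ℝ) * (N i - 1) / h ^ 2)

lemma factMoment_nonneg (m : ℕ) : 0 ≤ M m := sum_nonneg fun _ _ => Nat.cast_nonneg _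

lemma descFactorial_le_factMoment {i : ℕ} (hi : i < n) (m : ℕ) :
  ((N i).descFactorial m : ℝ) ≤ M m :=
  single_le_sum (f := fun i => ((N i).descFactorial m : ℝ))
    (fun _ _ => Nat.cast_nonneg _) (Finset.mem_range.2 hi)

lemma factMoment_two_pos (hN : ∃ i < n, 2 ≤ N i) : 0 < M 2 := by
  obtain ⟨i, hi, h2⟩ := hN
  refine lt_of_lt_of_le ?_ (descFactorial_le_factMoment hi 2)
  rw [Nat.cast_descFactorial_two]
  have : (2 : ℝ) ≤ N i := by exact_mod_cast h2
  nlinarith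

lemma factMoment_two : M 2 = ∑ i ∈ range n, (N i : ℝ) * (N i - 1) := by
  simp only [factMoment, Nat.cast_descFactorial_two]

lemma sum_mul_sub_one_sq : ∑ i ∈ range n, (N i : ℝ) * (N i - 1) ^ 2 = M 3 + M 2 := by
  rw [factMoment, factMoment, ← sum_add_distrib]
  refine sum_congr rfl fun i _ => ?_
  rw [cast_descFactorial_three, Nat.cast_descFactorial_two]; ring

lemma sum_mul_sub_one_mul_sq :
  ∑ i ∈ range n, ((N i : ℝ) * (N i - 1)) ^ 2 = M 4 + 4 * M 3 + 2 * M 2 := by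
  rw [factMoment, factMoment, factMoment, mul_sum, mul_sum, ← sum_add_distrib, ← sum_add_distrib]
  refine sum_congr rfl fun i _ => ?_
  rw [cast_descFactorial_four, cast_descFactorial_three, Nat.cast_descFactorial_two]; ring

lemma obsWeight_nonneg : 0 ≤ v := one_div_nonneg.2 (factMoment_nonneg 2)

lemma obsWeight_mul (hN : 0 < M 2) : v * M 2 = 1 := by rw [obsWeight]; field_simp

lemma pairVar_nonneg : 0 ≤ G₁ :=
  mul_nonneg (sq_nonneg _) (div_nonneg (factMoment_nonneg _) (sq_nonneg _))

lemma sharedVar_nonneg (hh : 0 < h) : 0 ≤ G₂ :=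
  mul_nonneg (sq_nonneg _) (div_nonneg (factMoment_nonneg _) hh.le)

lemma pointVar_eq : G = G₁ + G₂ + v ^ 2 * M 4 := rfl

lemma fourth_nonneg : 0 ≤ v ^ 2 * M 4 := mul_nonneg (sq_nonneg _) (factMoment_nonneg _)

lemma pointVar_nonneg (hh : 0 < h) : 0 ≤ G :=
  add_nonneg (add_nonneg pairVar_nonneg (sharedVar_nonneg hh)) fourth_nonneg

lemma pairVar_le (hh : 0 < h) : G₁ ≤ G := by
  rw [pointVar_eq]; linarith [sharedVar_nonneg (N := N) (n := n) hh, fourth_nonneg (N := N) (n := n)]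

lemma pairVar_eq (hN : 0 < M 2) : G₁ = v / h ^ 2 := by
  have := obsWeight_mul hN
  rw [pairVar, sq, mul_assoc, ← mul_div_assoc, this, mul_one_div]

lemma sum_pairWeight (hN : 0 < M 2) : ∑ i ∈ range n, v * ((N i : ℝ) * (N i - 1)) = 1 := by
  rw [← mul_sum, ← factMoment_two, obsWeight_mul hN]

lemma sum_pairWeight_sq_le (hh : 0 < h) (hh1 : h ≤ 1) :
  ∑ i ∈ range n, (v * ((N i : ℝ) * (N i - 1))) ^ 2 ≤ 4 * G := by
  simp_rw [mul_pow (v)]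
  rw [← mul_sum, sum_mul_sub_one_mul_sq, pointVar_eq, pairVar, sharedVar]
  have h2 : 0 ≤ M 2 := factMoment_nonneg 2
  have h3 : 0 ≤ M 3 := factMoment_nonneg 3
  have h4 : 0 ≤ v ^ 2 * M 4 := fourth_nonneg
  have e2 : M 2 ≤ M 2 / h ^ 2 := by
    rw [le_div_iff₀ (by positivity)]; exact mul_le_of_le_one_right h2 (pow_le_one₀ hh.le hh1)
  have e3 : M 3 ≤ M 3 / h := by rw [le_div_iff₀ hh]; exact mul_le_of_le_one_right h3 hh1
  have e2' := mul_le_mul_of_nonneg_left e2 (sq_nonneg (v))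
  have e3' := mul_le_mul_of_nonneg_left e3 (sq_nonneg (v))
  have h2' := mul_nonneg (sq_nonneg (v)) h2
  nlinarith

lemma sum_shared_eq (hh : 0 < h) : ∑ i ∈ range n, S[i] = G₂ + h * G₁ := by
  rw [← mul_sum, ← Finset.sum_div, sum_mul_sub_one_sq, sharedVar, pairVar]
  field_simp

lemma sum_pair_eq : ∑ i ∈ range n, P[i] = G₁ := by
  rw [← mul_sum, ← Finset.sum_div, ← factMoment_two, pairVar]

lemma sum_filter_le_sum {g g' : ℕ → ℝ} (hg : ∀ i, 2 ≤ N i → g i ≤ g' i) (hg' : ∀ i, 0 ≤ g' i) :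
  ∑ i ∈ range n with 2 ≤ N i, g i ≤ ∑ i ∈ range n, g' i :=
  (sum_le_sum fun i hi => hg i (Finset.mem_filter.1 hi).2).trans
    (Finset.sum_le_sum_of_subset_of_nonneg (Finset.filter_subset _ _) fun i _ _ => hg' i)

lemma mul_sub_one_nonneg (N : ℕ) : (0 : ℝ) ≤ N * (N - 1) := by
  rw [← Nat.cast_descFactorial_two]; positivity

lemma shared_term_nonneg (hh : 0 < h) (i : ℕ) : 0 ≤ S[i] := by positivity

lemma pair_term_nonneg (i : ℕ) : 0 ≤ P[i] :=
  mul_nonneg (sq_nonneg _) (div_nonneg (mul_sub_one_nonneg _) (sq_nonneg _))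

lemma shared_term_le (hh : 0 < h) {i : ℕ} (hi : i < n) : S[i] ≤ G₂ + h * G₁ := by
  rw [← sum_shared_eq hh]
  exact single_le_sum (f := fun i => S[i])
    (fun i _ => shared_term_nonneg hh i) (Finset.mem_range.2 hi)

lemma cube_le {N : ℕ} (hN : 2 ≤ N) : (N : ℝ) ^ 3 ≤ 4 * (N * (N - 1) ^ 2) := by
  have h2 : (2 : ℝ) ≤ N := by exact_mod_cast hN
  nlinarith [mul_nonneg (by linarith : (0 : ℝ) ≤ N) (mul_nonneg (by linarith : (0 : ℝ) ≤ N - 2) (by linarith : (0 : ℝ) ≤ 3 * N - 2))]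

lemma pairScale_self_le {N : ℕ} {p : ℝ} (hN : 2 ≤ N) (hp : 1 ≤ p) :
  pairScale N p p ≤ 32 * (N * (N - 1) ^ 2 * p) + 8 * p ^ 4 := by
  have e : pairScale N p p = 2 * p * (N + p) ^ 3 := by unfold pairScale; ring
  have h3 : ((N : ℝ) + p) ^ 3 ≤ 4 * (N ^ 3 + p ^ 3) := by
    have h := add_pow_le (by positivity : (0 : ℝ) ≤ N) (by positivity : 0 ≤ p) 3
    norm_num at h
    linarith
  have h4 := cube_le hN
  rw [e]
  calc 2 * p * ((N : ℝ) + p) ^ 3 ≤ 2 * p * (4 * (4 * (N * (N - 1) ^ 2) + p ^ 3)) := by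
        gcongr
        linarith
    _ = _ := by ring

/-- The bounds needed for two factors `K_h`. -/
lemma rate_bounds_two_kernels (hN : 0 < M 2) (hh : 0 < h) (hh1 : h ≤ 1)
  (hΓ : G ≤ 1) {B : ℝ} (hB : 1 ≤ B) :
  (∑ i ∈ range n, v ^ 2 * ((N i : ℝ) * (N i - 1) ^ 2 * (B / h + B / h) +
    N i * (N i - 1) * (B / h * (B / h))) ≤ 40 * B ^ 4 * G) ∧
  (∀ i < n, 2 ≤ N i → v ^ 2 * pairScale (N i) (B / h) (B / h) ≤ 40 * B ^ 4 * G) ∧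
  ∑ i ∈ range n with 2 ≤ N i, v ^ 2 * pairScale (N i) (B / h) (B / h) ≤
    (1 / h ^ 2) * (40 * B ^ 4 * G) := by
  have g1 : 0 ≤ G₁ := pairVar_nonneg
  have g2 : 0 ≤ G₂ := sharedVar_nonneg hh
  have g4 : 0 ≤ v ^ 2 * M 4 := fourth_nonneg
  have hp : 1 ≤ B / h := by rw [le_div_iff₀ hh]; linarith
  have hle : G₂ + h * G₁ ≤ G := by rw [pointVar_eq]; nlinarith
  have hle1 : G₁ ≤ G := pairVar_le hh
  have hG0 : 0 ≤ G := pointVar_nonneg hh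
  have hB2 : B ≤ B ^ 4 := le_self_pow₀ hB (by norm_num)
  have hB3 : B ^ 2 ≤ B ^ 4 := pow_le_pow_right₀ hB (by norm_num)
  have hpv : v ^ 2 * (B / h) ^ 4 = B ^ 4 * G₁ ^ 2 := by rw [pairVar_eq hN]; field_simp
  refine ⟨?_, ?_, ?_⟩
  · calc _ = 2 * B * (G₂ + h * G₁) + B ^ 2 * G₁ := by
          rw [← sum_shared_eq hh, ← sum_pair_eq (h := h), mul_sum, mul_sum, ← sum_add_distrib]
          refine sum_congr rfl fun i _ => ?_
          field_simp; ring
      _ ≤ 2 * B * G + B ^ 2 * G := by gcongr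
      _ ≤ 2 * B ^ 4 * G + B ^ 4 * G := by gcongr
      _ ≤ _ := by nlinarith [mul_nonneg (by positivity : 0 ≤ B ^ 4) hG0]
  · intro i hi hi2
    calc v ^ 2 * pairScale (N i) (B / h) (B / h)
        ≤ v ^ 2 * (32 * (N i * (N i - 1) ^ 2 * (B / h)) + 8 * (B / h) ^ 4) := by
          gcongr; exact pairScale_self_le hi2 hp
      _ = 32 * B * S[i] + 8 * (v ^ 2 * (B / h) ^ 4) := by ring
      _ ≤ 32 * B * G + 8 * (B ^ 4 * G) := by
        rw [hpv]
        have := (shared_term_le hh hi).trans hle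
        gcongr
        nlinarith
      _ ≤ 32 * B ^ 4 * G + 8 * (B ^ 4 * G) := by gcongr
      _ = _ := by ring
  · have hh2 : 1 ≤ 1 / h ^ 2 := by rw [le_div_iff₀ (by positivity), one_mul]; exact pow_le_one₀ hh.le hh1
    calc _ ≤ ∑ i ∈ range n, (32 * B * S[i] +
          8 * B ^ 4 / h ^ 2 * P[i]) := by
          refine sum_filter_le_sum (fun i hi2 => ?_) fun i => ?_
          · have h2 : (2 : ℝ) ≤ N i := by exact_mod_cast hi2
            calc v ^ 2 * pairScale (N i) (B / h) (B / h)
                ≤ v ^ 2 * (32 * (N i * (N i - 1) ^ 2 * (B / h)) + 8 * (B / h) ^ 4) := by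
                  gcongr; exact pairScale_self_le hi2 hp
              _ = 32 * B * S[i] + 8 * B ^ 4 / h ^ 2 * (v ^ 2 * (1 / h ^ 2)) := by field_simp
              _ ≤ _ := by gcongr; nlinarith
          · have a1 : 0 ≤ S[i] := shared_term_nonneg hh i
            have a2 : 0 ≤ P[i] := pair_term_nonneg i
            positivity
      _ = 32 * B * (G₂ + h * G₁) + 8 * B ^ 4 / h ^ 2 * G₁ := by
        rw [← sum_shared_eq hh, ← sum_pair_eq (h := h), mul_sum, mul_sum, ← sum_add_distrib]
      _ ≤ 32 * B * G + 8 * B ^ 4 / h ^ 2 * G := by gcongr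
      _ ≤ 1 / h ^ 2 * (32 * B ^ 4 * G) + 8 * B ^ 4 / h ^ 2 * G := by
        refine add_le_add ?_ le_rfl
        refine le_trans ?_ (le_mul_of_one_le_left (by positivity) hh2)
        exact mul_le_mul_of_nonneg_right (by linarith) hG0
      _ = _ := by ring

lemma pairScale_le {N : ℕ} {p r : ℝ} (hN : 2 ≤ N) (hp : 1 ≤ p) (hr : 1 ≤ r) :
  pairScale N p r ≤ 3 * (1 + p) ^ 2 * (4 * (N * (N - 1) ^ 2) * r + N ^ 2 * r ^ 2) := by
  have h2 : (2 : ℝ) ≤ N := by exact_mod_cast hN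
  have h4 := cube_le hN
  have a1 : (N : ℝ) + p ≤ (1 + p) * N := by nlinarith
  have a2 : (N : ℝ) * p + p ^ 2 ≤ (1 + p) ^ 2 * N := by nlinarith
  have a3 : ((N : ℝ) + r) ^ 2 ≤ 2 * (N ^ 2 * r + N * r ^ 2) := by nlinarith [sq_nonneg ((N : ℝ) - r)]
  calc pairScale N p r ≤ ((1 + p) * N) ^ 2 * (N * r + r ^ 2) +
        (2 * (N ^ 2 * r + N * r ^ 2)) * ((1 + p) ^ 2 * N) := by
        unfold pairScale; gcongr
    _ = 3 * (1 + p) ^ 2 * (N ^ 3 * r + N ^ 2 * r ^ 2) := by ring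
    _ ≤ _ := by gcongr

lemma obsWeight_mul_sq_le (hN : 0 < M 2) (hh : 0 < h) {θ : ℝ} (hhθ : h ≤ θ)
  (hθ : θ ≤ 1) (hΓ : G ≤ θ ^ 2) {i : ℕ} (hi : i < n) :
  v * (N i : ℝ) ^ 2 ≤ 9 * θ := by
  have hθ0 := hh.trans_le hhθ
  have hv : 0 ≤ v := obsWeight_nonneg
  rcases le_or_gt 4 (N i) with h4 | h4
  · have h4' : (4 : ℝ) ≤ N i := by exact_mod_cast h4
    have h5 : (N i : ℝ) ^ 4 ≤ 16 * (N i * (N i - 1) * (N i - 2) * (N i - 3)) := by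
      obtain ⟨x, hx, hx'⟩ : ∃ x : ℝ, 0 ≤ x ∧ (N i : ℝ) = x + 4 := ⟨N i - 4, by linarith, by ring⟩
      rw [hx']
      nlinarith [pow_nonneg hx 2, pow_nonneg hx 3, pow_nonneg hx 4]
    have h6 := descFactorial_le_factMoment (N := N) hi 4
    rw [cast_descFactorial_four] at h6
    have h7 : v ^ 2 * M 4 ≤ θ ^ 2 := by
      refine le_trans ?_ hΓ
      rw [pointVar_eq]
      linarith [pairVar_nonneg (h := h) (N := N) (n := n), sharedVar_nonneg (N := N) (n := n) hh]
    have h8 : (v * (N i : ℝ) ^ 2) ^ 2 ≤ (9 * θ) ^ 2 := by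
      calc _ = v ^ 2 * (N i : ℝ) ^ 4 := by ring
        _ ≤ v ^ 2 * (16 * M 4) := by gcongr; linarith
        _ ≤ 16 * θ ^ 2 := by linarith
        _ ≤ _ := by nlinarith [sq_nonneg θ]
    exact le_of_abs_le (abs_le_of_sq_le_sq h8 (by positivity))
  · have h3 : (N i : ℝ) ≤ 3 := by exact_mod_cast (by omega : N i ≤ 3)
    have h5 : v = h ^ 2 * G₁ := by rw [pairVar_eq hN]; field_simp
    have h6 : G₁ ≤ 1 := (pairVar_le hh).trans (hΓ.trans (pow_le_one₀ hθ0.le hθ))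
    have h7 : v ≤ θ := by
      rw [h5]
      calc h ^ 2 * G₁ ≤ h ^ 2 * 1 := by gcongr
        _ ≤ θ := by nlinarith
    calc v * (N i : ℝ) ^ 2 ≤ θ * 3 ^ 2 := by gcongr
      _ = _ := by ring

/-- The bounds needed for one bounded factor and one factor `K_h`. -/
lemma rate_bounds_one_kernel (hN : 0 < M 2) (hh : 0 < h) {θ : ℝ} (hhθ : h ≤ θ)
  (hθ : θ ≤ 1) (hΓ : G ≤ θ ^ 2) {C₀ R : ℝ} (hC₀ : 0 ≤ C₀) (hR : G ≤ R)
  (hS : G₂ ≤ C₀ * (θ * R)) {p B : ℝ} (hp : 1 ≤ p) (hB : 1 ≤ B) :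
  (∑ i ∈ range n, v ^ 2 * ((N i : ℝ) * (N i - 1) ^ 2 * (p + B / h) +
    N i * (N i - 1) * (p * (B / h))) ≤ 39 * (1 + p) ^ 2 * (1 + B) ^ 2 * (1 + C₀) * (θ * R)) ∧
  (∀ i < n, 2 ≤ N i → v ^ 2 * pairScale (N i) p (B / h) ≤
    39 * (1 + p) ^ 2 * (1 + B) ^ 2 * (1 + C₀) * (θ * R)) ∧
  ∑ i ∈ range n with 2 ≤ N i, v ^ 2 * pairScale (N i) p (B / h) ≤
    (1 / h ^ 2) * (39 * (1 + p) ^ 2 * (1 + B) ^ 2 * (1 + C₀) * (θ * R)) := by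
  have hθ0 := hh.trans_le hhθ
  have hh1 := hhθ.trans hθ
  have hv0 : 0 ≤ v := obsWeight_nonneg
  have g1 : 0 ≤ G₁ := pairVar_nonneg
  have g2 : 0 ≤ G₂ := sharedVar_nonneg hh
  have hr : 1 ≤ B / h := by rw [le_div_iff₀ hh]; linarith
  have hle1 : G₁ ≤ R := (pairVar_le hh).trans hR
  have hR0 : 0 ≤ R := g1.trans hle1
  have hle : G₂ + h * G₁ ≤ (1 + C₀) * (θ * R) := by
    have : h * G₁ ≤ θ * R := by gcongr
    linarith
  have hle2 : h * G₁ ≤ (1 + C₀) * (θ * R) := by linarith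
  set Q := (1 + C₀) * (θ * R) with hQ
  have hQ0 : 0 ≤ Q := by positivity
  have hθR : θ * R ≤ Q := by rw [hQ]; exact le_mul_of_one_le_left (by positivity) (by linarith)
  have ec : 39 * (1 + p) ^ 2 * (1 + B) ^ 2 * (1 + C₀) * (θ * R) =
    39 * (1 + p) ^ 2 * (1 + B) ^ 2 * Q := by rw [hQ]; ring
  rw [ec]
  refine ⟨?_, ?_, ?_⟩
  · calc _ ≤ (p + B) * (G₂ + h * G₁) + p * B * (h * G₁) := by
          rw [← sum_shared_eq hh, ← sum_pair_eq (h := h), mul_sum, mul_sum,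
            mul_sum, ← sum_add_distrib]
          refine sum_le_sum fun i _ => ?_
          have e : v ^ 2 * ((N i : ℝ) * (N i - 1) ^ 2 * (p + B / h) +
            N i * (N i - 1) * (p * (B / h))) =
            (p * h + B) * S[i] +
            p * B * (h * P[i]) := by field_simp
          rw [e]
          have a1 : 0 ≤ S[i] := shared_term_nonneg hh i
          gcongr
          nlinarith
      _ ≤ (p + B) * Q + p * B * Q := by gcongr
      _ ≤ _ := by
        rw [← add_mul]
        gcongr
        have hp2 : 1 + p ≤ (1 + p) ^ 2 := by nlinarith
        have hB2 : 1 + B ≤ (1 + B) ^ 2 := by nlinarith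
        have := mul_le_mul hp2 hB2 (by positivity) (by positivity)
        nlinarith
  · intro i hi hi2
    have h9 := obsWeight_mul_sq_le hN hh hhθ hθ hΓ hi
    calc v ^ 2 * pairScale (N i) p (B / h)
        ≤ v ^ 2 * (3 * (1 + p) ^ 2 * (4 * (N i * (N i - 1) ^ 2) * (B / h) +
          N i ^ 2 * (B / h) ^ 2)) := by gcongr; exact pairScale_le hi2 hp hr
      _ = 3 * (1 + p) ^ 2 * (4 * B * S[i] + B ^ 2 * (v / h ^ 2 * (v * (N i : ℝ) ^ 2))) := by ring
      _ ≤ 3 * (1 + p) ^ 2 * (4 * B * Q + B ^ 2 * (R * (9 * θ))) := by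
        have a1 := (shared_term_le hh hi).trans hle
        have a2 : v / h ^ 2 ≤ R := by rw [← pairVar_eq hN]; exact hle1
        gcongr
      _ ≤ 3 * (1 + p) ^ 2 * (4 * B * Q + B ^ 2 * (9 * Q)) := by
        have : R * (9 * θ) ≤ 9 * Q := by linarith
        gcongr
      _ = (1 + p) ^ 2 * (12 * B + 27 * B ^ 2) * Q := by ring
      _ ≤ (1 + p) ^ 2 * (39 * (1 + B) ^ 2) * Q := by gcongr; nlinarith
      _ = _ := by ring
  · have hh2 : 1 ≤ 1 / h ^ 2 := by
      rw [le_div_iff₀ (by positivity), one_mul]; exact pow_le_one₀ hh.le hh1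
    have hRΛ : R ≤ 1 / h ^ 2 * Q := by
      have : 1 ≤ 1 / h ^ 2 * θ := by rw [one_div_mul_eq_div, le_div_iff₀ (by positivity)]; nlinarith
      calc R ≤ (1 / h ^ 2 * θ) * R := le_mul_of_one_le_left hR0 this
        _ = 1 / h ^ 2 * (θ * R) := by ring
        _ ≤ _ := by gcongr
    have hQΛ : Q ≤ 1 / h ^ 2 * Q := le_mul_of_one_le_left hQ0 hh2
    calc _ ≤ ∑ i ∈ range n, 3 * (1 + p) ^ 2 *
          (4 * B * S[i] + 2 * B ^ 2 * P[i]) := by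
          refine sum_filter_le_sum (fun i hi2 => ?_) fun i => ?_
          · have h2 : (2 : ℝ) ≤ N i := by exact_mod_cast hi2
            calc v ^ 2 * pairScale (N i) p (B / h)
                ≤ v ^ 2 * (3 * (1 + p) ^ 2 * (4 * (N i * (N i - 1) ^ 2) * (B / h) +
                  N i ^ 2 * (B / h) ^ 2)) := by gcongr; exact pairScale_le hi2 hp hr
              _ = 3 * (1 + p) ^ 2 * (4 * B * S[i] +
                B ^ 2 * (v ^ 2 * ((N i : ℝ) ^ 2 / h ^ 2))) := by ring
              _ ≤ 3 * (1 + p) ^ 2 * (4 * B * S[i] +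
                  B ^ 2 * (v ^ 2 * (2 * ((N i : ℝ) * (N i - 1)) / h ^ 2))) := by
                gcongr; nlinarith
              _ = _ := by ring
          · have a1 : 0 ≤ S[i] := shared_term_nonneg hh i
            have a2 : 0 ≤ P[i] := pair_term_nonneg i
            positivity
      _ = 3 * (1 + p) ^ 2 * (4 * B * (G₂ + h * G₁) + 2 * B ^ 2 * G₁) := by
        rw [← sum_shared_eq hh, ← sum_pair_eq (h := h), mul_sum, mul_sum,
          ← sum_add_distrib, mul_sum]
      _ ≤ 3 * (1 + p) ^ 2 * (4 * B * (1 / h ^ 2 * Q) + 2 * B ^ 2 * (1 / h ^ 2 * Q)) := by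
        have l1 := hle.trans hQΛ
        have l2 := hle1.trans hRΛ
        gcongr
      _ = (1 / h ^ 2) * ((1 + p) ^ 2 * (12 * B + 6 * B ^ 2) * Q) := by ring
      _ ≤ (1 / h ^ 2) * ((1 + p) ^ 2 * (39 * (1 + B) ^ 2) * Q) := by gcongr; nlinarith
      _ = _ := by ring

end Rates

section PairAverage

variable {S U : Type*} [MeasurableSpace S] [MeasurableSpace U]

/-- The weighted sum over all pairs of observations of the same subject. -/
def pairAverage (N : ℕ → ℕ) (n : ℕ) (F F' : S × U → ℝ) (D : ℕ → S × (ℕ → U)) : ℝ :=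
  ∑ i ∈ range n, obsWeight N n * ∑ p ∈ (range (N i)).offDiag,
    F ((D i).1, (D i).2 p.1) * F' ((D i).1, (D i).2 p.2)

/-- The product of the conditional means of two marks given the process. -/
def condProd (κ : Measure U) (F F' : S × U → ℝ) (x : S) : ℝ :=
  (∫ u, F (x, u) ∂κ) * ∫ u, F' (x, u) ∂κ

/-- The deviation of `pairAverage` from its conditional mean given the processes. -/
def noisePart (κ : Measure U) (N : ℕ → ℕ) (n : ℕ) (F F' : S × U → ℝ) (D : ℕ → S × (ℕ → U)) : ℝ :=
  ∑ i ∈ range n, obsWeight N n * subjectPairSum κ F F' (N i) (D i)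

/-- The deviation of the conditional mean of `pairAverage` given the processes from its mean. -/
def processPart (ρ : Measure S) (N : ℕ → ℕ) (n : ℕ) (ξ : S → ℝ) (D : ℕ → S × (ℕ → U)) : ℝ :=
  ∑ i ∈ range n, (obsWeight N n * ((N i : ℝ) * (N i - 1))) * (ξ (D i).1 - ∫ x, ξ x ∂ρ)

variable {ρ : Measure S} {κ : Measure U} {N : ℕ → ℕ} {n : ℕ} {h : ℝ} {F F' : S × U → ℝ}

lemma pairAverage_sub_eq (hN : 0 < factMoment N n 2) (D : ℕ → S × (ℕ → U)) :
  pairAverage N n F F' D - ∫ x, condProd κ F F' x ∂ρ =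
    noisePart κ N n F F' D + processPart ρ N n (condProd κ F F') D := by
  set m := ∫ x, condProd κ F F' x ∂ρ with hm
  have e : m = ∑ i ∈ range n, obsWeight N n * ((N i : ℝ) * (N i - 1)) * m := by
    rw [← sum_mul, sum_pairWeight hN, one_mul]
  conv_lhs => rw [e]
  rw [pairAverage, noisePart, processPart, ← sum_sub_distrib, ← sum_add_distrib]
  refine sum_congr rfl fun i _ => ?_
  rw [subjectPairSum, centeredPairSum, condProd]
  ring

variable [IsProbabilityMeasure ρ] [IsProbabilityMeasure κ]

lemma measurable_condProd (hF : Measurable F) (hF' : Measurable F') :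
  Measurable (condProd κ F F') :=
  (measurable_condMean hF).mul (measurable_condMean hF')

variable {p r : ℝ} {H : S → ℝ}

lemma HasConditionalMoments.hasMoments_condProd {K : ℕ}
  (h : HasConditionalMoments ρ κ F F' p r H K) : HasMoments ρ (condProd κ F F') :=
  h.moments_left.integral_prod_right.mul h.moments_right.integral_prod_right

lemma HasConditionalMoments.hasMoments_noisePart {K : ℕ}
  (h : HasConditionalMoments ρ κ F F' p r H K) :
  HasMoments (sampleLaw ρ κ) (noisePart κ N n F F') :=
  HasMoments.sum _ fun i _ =>
    ((h.hasMoments_subjectPairSum (N i)).comp (measurePreserving_subject i)).const_mul _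

lemma hasMoments_processPart {ξ : S → ℝ} (hξ : HasMoments ρ ξ) :
  HasMoments (sampleLaw ρ κ) (processPart ρ N n ξ) :=
  HasMoments.sum _ fun i _ => ((hξ.sub (.const _)).comp (measurePreserving_process i)).const_mul _

lemma HasConditionalMoments.integral_noisePart_sq_le
  (h : HasConditionalMoments ρ κ F F' p r H 4) {C : ℝ} (hC : ∫ x, H x ^ 4 ∂ρ ≤ C) {D : ℝ}
  (hD : 0 ≤ D)
  (h2 : ∑ i ∈ range n, obsWeight N n ^ 2 * ((N i : ℝ) * (N i - 1) ^ 2 * (p + r) +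
    N i * (N i - 1) * (p * r)) ≤ D) :
  ∫ ω, noisePart κ N n F F' ω ^ 2 ∂sampleLaw ρ κ ≤ rosenthalConst 1 * (6 * C * D) := by
  have hC1 := h.one_le_bound hC
  have hs := h.sum_integral_subjectPairSum_sq_le (by norm_num) hC h2
  have key := rosenthal_subject
    (fun i => measurable_subjectPairSum h.measurable_left h.measurable_right (N i))
    (fun i => h.hasMoments_subjectPairSum (N i)) (fun i => h.integral_subjectPairSum _)
    (fun _ => obsWeight N n) (by positivity) le_rfl 1 n (fun _ => hs) fun k hk hkq => ?_
  · simpa [noisePart] using key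
  · obtain rfl : k = 1 := by omega
    simpa using hs

lemma HasConditionalMoments.integral_condProd_pow_le {q : ℕ}
  (h : HasConditionalMoments ρ κ F F' p r H (4 * q)) {C : ℝ} (hC : ∫ x, H x ^ (4 * q) ∂ρ ≤ C)
  {k : ℕ} (hk : 1 ≤ k) (hkq : k ≤ q) : ∫ x, condProd κ F F' x ^ (2 * k) ∂ρ ≤ C := by
  refine le_trans (integral_mono_ae (h.hasMoments_condProd.pow _).integrable
    (h.moments.pow (4 * k)).integrable ?_) (h.integral_pow_le hC (by omega : 4 * k ≤ 4 * q))
  filter_upwards [h.bound_left, h.bound_right] with x h1 h2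
  have b1 := h1 1 le_rfl (by omega)
  have b2 := h2 1 le_rfl (by omega)
  simp only [pow_one, tsub_self, pow_zero, one_mul] at b1 b2
  have b3 := abs_integral_le_integral_abs (f := fun u => F (x, u)) (μ := κ)
  have b4 := abs_integral_le_integral_abs (f := fun u => F' (x, u)) (μ := κ)
  have hH := zero_le_one.trans (h.one_le x)
  calc condProd κ F F' x ^ (2 * k) = (|∫ u, F (x, u) ∂κ| * |∫ u, F' (x, u) ∂κ|) ^ (2 * k) := by
        rw [← abs_mul, (even_two_mul k).pow_abs, condProd]
    _ ≤ (H x * H x) ^ (2 * k) := by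
      gcongr
      · exact b3.trans b1
      · exact b4.trans b2
    _ = H x ^ (4 * k) := by rw [← sq, ← pow_mul]; ring_nf

lemma HasConditionalMoments.integral_processPart_pow_le {q : ℕ}
  (h : HasConditionalMoments ρ κ F F' p r H (4 * q)) {C : ℝ} (hC : ∫ x, H x ^ (4 * q) ∂ρ ≤ C)
  {b : ℝ} (hb : 0 < b) (hb1 : b ≤ 1) :
  ∫ ω, processPart ρ N n (condProd κ F F') ω ^ (2 * q) ∂sampleLaw ρ κ ≤
    rosenthalConst q * (2 * 4 ^ q * C * 4) ^ q * pointVar b N n ^ q := by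
  have hC1 := h.one_le_bound hC
  refine (integral_sum_process_pow_le (measurable_condProd h.measurable_left h.measurable_right)
    h.hasMoments_condProd hC1 (fun k hk hkq => h.integral_condProd_pow_le hC hk hkq) _ _).trans ?_
  rw [mul_assoc (rosenthalConst q), ← mul_pow, mul_assoc _ 4 (pointVar b N n)]
  have := sum_pairWeight_sq_le (N := N) (n := n) hb hb1
  have h0 := rosenthalConst_nonneg q
  have h1 : 0 ≤ ∑ i ∈ range n, (obsWeight N n * ((N i : ℝ) * (N i - 1))) ^ 2 :=
    sum_nonneg fun i _ => sq_nonneg _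
  gcongr

end PairAverage

section Estimator

variable {S : Type*} [MeasurableSpace S] {ρ : Measure S} [IsProbabilityMeasure ρ] {a b : ℝ}
  {X : ℝ → S → ℝ} {σ : ℝ} {φ f : ℝ → ℝ}

local notation "𝓣" => timeLaw a b f
local notation "ξ[" α "]" => obsMark X φ α
local notation "𝓛" => obsLaw a b f σ
local notation "𝓢" => sampleLaw ρ 𝓛

lemma IsSamplingDensity.isProbabilityMeasure_obsLaw (hf : IsSamplingDensity a b f) (σ : ℝ) :
  IsProbabilityMeasure (obsLaw a b f σ) := by
  have := hf.isProbabilityMeasure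
  unfold obsLaw; infer_instance

/-- Second moments for two factors of size `1 / h`. -/
lemma IsCenteredProcess.exists_integral_pairAverage_sub_sq_le (hX : IsCenteredProcess ρ a b X)
  (hf : IsSamplingDensity a b f) (hφ : HasLinearGrowth φ) {A B : ℝ} (hA : 0 < A) (hB : 1 ≤ B)
  [IsProbabilityMeasure 𝓛] :
  ∃ C : ℝ, 0 ≤ C ∧ ∀ (N : ℕ → ℕ) (n : ℕ) (h : ℝ) (α β : ℝ → ℝ), 0 < factMoment N n 2 → 0 < h →
    h ≤ 1 → pointVar h N n ≤ 1 → Measurable α → Measurable β → (∀ t, |α t| ≤ B / h) →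
    (∀ t, |β t| ≤ B / h) → ∫ t, |α t| ∂𝓣 ≤ A → ∫ t, |β t| ∂𝓣 ≤ A →
    HasMoments 𝓢 (fun D =>
      pairAverage N n ξ[α] ξ[β] D -
      ∫ x, condProd 𝓛 ξ[α] ξ[β] x ∂ρ) ∧
    ∫ D, (pairAverage N n ξ[α] ξ[β] D - ∫ x, condProd 𝓛 ξ[α] ξ[β] x ∂ρ) ^ 2
      ∂𝓢 ≤ C * pointVar h N n := by
  obtain ⟨C, hC0, hC⟩ := hX.exists_hasConditionalMoments (σ := σ) hf hφ hA 4 (m := 4) (by norm_num)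
  have hr := rosenthalConst_nonneg 1
  refine ⟨4 * (rosenthalConst 1 * (6 * C * (40 * B ^ 4)) + rosenthalConst 1 * (2 * 4 * C * 4)),
    by positivity, fun N n h α β hN hh hh1 hΓ mα mβ hα hβ iα iβ => ?_⟩
  have hp : 1 ≤ B / h := by rw [le_div_iff₀ hh]; linarith
  obtain ⟨H, hH, hHC⟩ := hC α β _ _ mα mβ hα hβ hp hp iα iβ
  have hΓ0 := pointVar_nonneg (N := N) (n := n) hh
  have e1 := hH.integral_noisePart_sq_le hHC (by positivity)
    (rate_bounds_two_kernels hN hh hh1 hΓ hB).1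
  have e2 := hH.integral_processPart_pow_le (q := 1) (N := N) (n := n) hHC hh hh1
  have m1 := hH.hasMoments_noisePart (N := N) (n := n)
  have m2 := hasMoments_processPart (κ := 𝓛) (N := N) (n := n) hH.hasMoments_condProd
  simp_rw [pairAverage_sub_eq hN]
  refine ⟨m1.add m2, ?_⟩
  calc _ ≤ ∫ D, 4 * (noisePart 𝓛 N n ξ[α] ξ[β] D ^ 2 +
        processPart ρ N n (condProd 𝓛 ξ[α] ξ[β]) D ^ 2)
        ∂𝓢 := by
        refine integral_mono ((m1.add m2).pow 2).integrable
          (((m1.pow 2).add (m2.pow 2)).const_mul 4).integrable fun D => ?_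
        have := add_pow_two_mul_le (noisePart 𝓛 N n ξ[α] ξ[β] D)
          (processPart ρ N n (condProd 𝓛 ξ[α] ξ[β]) D) 1
        simpa using this
    _ ≤ _ := by
      rw [integral_const_mul, integral_add (m1.pow 2).integrable (m2.pow 2).integrable]
      norm_num at e2
      nlinarith

/-- Higher moments for two factors of size `1 / h`. -/
lemma IsCenteredProcess.exists_integral_pairAverage_sub_pow_le (hX : IsCenteredProcess ρ a b X)
  (hf : IsSamplingDensity a b f) (hφ : HasLinearGrowth φ) {A B : ℝ} (hA : 0 < A) (hB : 1 ≤ B)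
  [IsProbabilityMeasure 𝓛] {q : ℕ} (hq : 1 ≤ q) :
  ∃ C : ℝ, 0 ≤ C ∧ ∀ (N : ℕ → ℕ) (n : ℕ) (h : ℝ) (α β : ℝ → ℝ), 0 < factMoment N n 2 → 0 < h →
    h ≤ 1 → pointVar h N n ≤ 1 → Measurable α → Measurable β → (∀ t, |α t| ≤ B / h) →
    (∀ t, |β t| ≤ B / h) → ∫ t, |α t| ∂𝓣 ≤ A → ∫ t, |β t| ∂𝓣 ≤ A →
    HasMoments 𝓢 (fun D =>
      pairAverage N n ξ[α] ξ[β] D -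
      ∫ x, condProd 𝓛 ξ[α] ξ[β] x ∂ρ) ∧
    ∫ D, (pairAverage N n ξ[α] ξ[β] D - ∫ x, condProd 𝓛 ξ[α] ξ[β] x ∂ρ) ^ (2 * q)
      ∂𝓢 ≤ C * (1 / h ^ 2 * pointVar h N n ^ q) := by
  obtain ⟨C, hC0, hC⟩ := hX.exists_hasConditionalMoments (σ := σ) hf hφ hA (4 * q) (m := 4 * q)
    (by omega)
  have hr := rosenthalConst_nonneg q
  have hpc : 0 ≤ ∑ k ∈ range (q + 1), pairConst k := sum_nonneg fun k _ => pairConst_nonneg k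
  refine ⟨4 ^ q * (rosenthalConst q * (((1 + ∑ k ∈ range (q + 1), pairConst k) * C) *
    (6 * C * (40 * B ^ 4)) ^ q) + rosenthalConst q * (2 * 4 ^ q * C * 4) ^ q),
    by positivity, fun N n h α β hN hh hh1 hΓ mα mβ hα hβ iα iβ => ?_⟩
  have hp : 1 ≤ B / h := by rw [le_div_iff₀ hh]; linarith
  have hh2 : 1 ≤ 1 / h ^ 2 := by
    rw [le_div_iff₀ (by positivity), one_mul]; exact pow_le_one₀ hh.le hh1
  obtain ⟨H, hH, hHC⟩ := hC α β _ _ mα mβ hα hβ hp hp iα iβ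
  have hΓ0 := pointVar_nonneg (N := N) (n := n) hh
  obtain ⟨b1, b2, b3⟩ := rate_bounds_two_kernels hN hh hh1 hΓ hB
  have e1 := hH.integral_sum_subjectPairSum_pow_le hq hHC (by positivity) hh2 b1 b2 b3
  have e2 := hH.integral_processPart_pow_le (q := q) (N := N) (n := n) hHC hh hh1
  have m1 := hH.hasMoments_noisePart (N := N) (n := n)
  have m2 := hasMoments_processPart (κ := 𝓛) (N := N) (n := n) hH.hasMoments_condProd
  simp_rw [pairAverage_sub_eq hN]
  refine ⟨m1.add m2, ?_⟩
  calc _ ≤ ∫ D, 4 ^ q * (noisePart 𝓛 N n ξ[α] ξ[β] D ^ (2 * q) +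
        processPart ρ N n (condProd 𝓛 ξ[α] ξ[β]) D ^ (2 * q))
        ∂𝓢 :=
        integral_mono ((m1.add m2).pow (2 * q)).integrable
          (((m1.pow (2 * q)).add (m2.pow (2 * q))).const_mul _).integrable fun D =>
          add_pow_two_mul_le _ _ q
    _ ≤ 4 ^ q * (rosenthalConst q * (((1 + ∑ k ∈ range (q + 1), pairConst k) * C *
        (1 / h ^ 2)) * (6 * C * (40 * B ^ 4 * pointVar h N n)) ^ q) +
        (1 / h ^ 2) * (rosenthalConst q * (2 * 4 ^ q * C * 4) ^ q * pointVar h N n ^ q)) := by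
      rw [integral_const_mul, integral_add (m1.pow (2 * q)).integrable (m2.pow (2 * q)).integrable]
      gcongr
      · exact e1
      · exact e2.trans (le_mul_of_one_le_left (by positivity) hh2)
    _ = _ := by
      have : (6 * C * (40 * B ^ 4 * pointVar h N n)) ^ q =
        (6 * C * (40 * B ^ 4)) ^ q * pointVar h N n ^ q := by rw [← mul_pow]; ring
      rw [this]; ring

/-- Higher moments for one bounded factor and one factor of size `1 / h`. -/
lemma IsCenteredProcess.exists_integral_noisePart_pow_le (hX : IsCenteredProcess ρ a b X)
  (hf : IsSamplingDensity a b f) (hφ : HasLinearGrowth φ) {A B p C₀ : ℝ} (hA : 0 < A)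
  (hB : 1 ≤ B) (hp : 1 ≤ p) (hC₀ : 0 ≤ C₀)
  [IsProbabilityMeasure 𝓛] {q : ℕ} (hq : 1 ≤ q) :
  ∃ C : ℝ, 0 ≤ C ∧ ∀ (N : ℕ → ℕ) (n : ℕ) (h θ R : ℝ) (α β : ℝ → ℝ), 0 < factMoment N n 2 →
    0 < h → h ≤ θ → θ ≤ 1 → pointVar h N n ≤ θ ^ 2 → pointVar h N n ≤ R →
    sharedVar h N n ≤ C₀ * (θ * R) → Measurable α → Measurable β → (∀ t, |α t| ≤ p) →
    (∀ t, |β t| ≤ B / h) → ∫ t, |α t| ∂𝓣 ≤ A → ∫ t, |β t| ∂𝓣 ≤ A →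
    HasMoments 𝓢 (noisePart 𝓛 N n ξ[α] ξ[β]) ∧
    ∫ D, noisePart 𝓛 N n ξ[α] ξ[β] D ^ (2 * q) ∂𝓢 ≤ C * (1 / h ^ 2 * (θ * R) ^ q) := by
  obtain ⟨C, hC0, hC⟩ := hX.exists_hasConditionalMoments (σ := σ) hf hφ hA (4 * q) (m := 4 * q)
    (by omega)
  have hr := rosenthalConst_nonneg q
  have hpc : 0 ≤ ∑ k ∈ range (q + 1), pairConst k := sum_nonneg fun k _ => pairConst_nonneg k
  refine ⟨rosenthalConst q * (((1 + ∑ k ∈ range (q + 1), pairConst k) * C) *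
    (6 * C * (39 * (1 + p) ^ 2 * (1 + B) ^ 2 * (1 + C₀))) ^ q),
    by positivity, fun N n h θ R α β hN hh hhθ hθ hΓ hR hS mα mβ hα hβ iα iβ => ?_⟩
  have hr : 1 ≤ B / h := by rw [le_div_iff₀ hh]; linarith
  have hθ0 := hh.trans_le hhθ
  have hR0 := (pointVar_nonneg (N := N) (n := n) hh).trans hR
  have hh2 : 1 ≤ 1 / h ^ 2 := by
    rw [le_div_iff₀ (by positivity), one_mul]; exact pow_le_one₀ hh.le (hhθ.trans hθ)
  obtain ⟨H, hH, hHC⟩ := hC α β _ _ mα mβ hα hβ hp hr iα iβ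
  obtain ⟨b1, b2, b3⟩ := rate_bounds_one_kernel hN hh hhθ hθ hΓ hC₀ hR hS hp hB
  have e1 := hH.integral_sum_subjectPairSum_pow_le hq hHC (by positivity) hh2 b1 b2 b3
  refine ⟨hH.hasMoments_noisePart, e1.trans (le_of_eq ?_)⟩
  have : (6 * C * (39 * (1 + p) ^ 2 * (1 + B) ^ 2 * (1 + C₀) * (θ * R))) ^ q =
      (6 * C * (39 * (1 + p) ^ 2 * (1 + B) ^ 2 * (1 + C₀))) ^ q * (θ * R) ^ q := by
    rw [← mul_pow]; ring
  rw [this]; ring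

end Estimator

section Suprema

lemma measure_ge_le_ofReal_div {Ω : Type*} [MeasurableSpace Ω] {μ : Measure Ω} {f : Ω → ℝ}
  (hf : Integrable f μ) (h0 : 0 ≤ᵐ[μ] f) {A u : ℝ} (hA : ∫ ω, f ω ∂μ ≤ A) (hu : 0 < u) :
  μ {ω | u ≤ f ω} ≤ ofReal (A / u) := by
  have h1 := meas_ge_le_lintegral_div (μ := μ) (f := fun ω => ofReal (f ω))
    hf.aemeasurable.ennreal_ofReal (ε := ofReal u) (by simpa using hu)
    ofReal_ne_top
  rw [← ofReal_integral_eq_lintegral_ofReal hf h0, ← ofReal_div_of_pos hu] at h1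
  refine le_trans (measure_mono fun ω hω => ofReal_le_ofReal hω) (h1.trans ?_)
  gcongr

lemma exists_net {a b η : ℝ} (hab : a ≤ b) (hη : 0 < η) (hη1 : η ≤ 1) : ∃ t : Finset ℝ,
  (↑t ⊆ Icc a b) ∧ (∀ x ∈ Icc a b, ∃ y ∈ t, |x - y| ≤ η) ∧ (t.card : ℝ) ≤ (b - a + 1) / η := by
  have hd : 0 ≤ (b - a) / η := div_nonneg (sub_nonneg.2 hab) hη.le
  refine ⟨(range (⌊(b - a) / η⌋₊ + 1)).image fun k : ℕ => a + k * η, ?_, ?_, ?_⟩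
  · intro y hy
    simp only [Finset.coe_image, Finset.coe_range, mem_image, mem_Iio] at hy
    obtain ⟨k, hk, rfl⟩ := hy
    have h1 : (k : ℝ) ≤ (b - a) / η := (Nat.le_floor_iff hd).1 (by omega)
    rw [le_div_iff₀ hη] at h1
    exact ⟨by linarith [mul_nonneg (Nat.cast_nonneg (α := ℝ) k) hη.le], by linarith⟩
  · intro x hx
    have h0 : 0 ≤ (x - a) / η := div_nonneg (sub_nonneg.2 hx.1) hη.le
    have h1 := Nat.floor_le h0
    have h2 := Nat.lt_floor_add_one ((x - a) / η)
    rw [le_div_iff₀ hη] at h1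
    rw [div_lt_iff₀ hη] at h2
    refine ⟨a + ⌊(x - a) / η⌋₊ * η, Finset.mem_image_of_mem _ (Finset.mem_range.2
      (Nat.lt_succ_of_le (Nat.floor_le_floor ?_))), ?_⟩
    · exact div_le_div_of_nonneg_right (by linarith [hx.2]) hη.le
    · rw [abs_of_nonneg (by linarith)]; linarith
  · refine (Nat.cast_le.2 Finset.card_image_le).trans ?_
    rw [Finset.card_range, add_div]
    push_cast
    exact add_le_add (Nat.floor_le hd) ((one_le_div hη).2 hη1)

/-- A union bound over a net, together with a Lipschitz bound between its points. -/
lemma measure_exists_lt_abs_le {E Ω : Type*} [PseudoMetricSpace E] [MeasurableSpace Ω]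
  {μ : Measure Ω} {T : Set E} {t : Finset E} (ht : ↑t ⊆ T) {η : ℝ}
  (hη : ∀ x ∈ T, ∃ y ∈ t, dist x y ≤ η) {F : E → Ω → ℝ} {ζ : Ω → ℝ} (hζ0 : 0 ≤ᵐ[μ] ζ)
  (hF : ∀ᵐ ω ∂μ, ∀ x ∈ T, ∀ y ∈ T, |F x ω - F y ω| ≤ ζ ω * dist x y) {q : ℕ} {A B : ℝ}
  (hA : ∀ x ∈ T, Integrable (fun ω => F x ω ^ (2 * q)) μ ∧ ∫ ω, F x ω ^ (2 * q) ∂μ ≤ A)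
  (hζ : Integrable ζ μ) (hB : ∫ ω, ζ ω ∂μ ≤ B) {u : ℝ} (hu : 0 < u) (hη0 : 0 < η) :
  μ {ω | ∃ x ∈ T, u < |F x ω|} ≤
    t.card * ofReal (A / (u / 2) ^ (2 * q)) + ofReal (B / (u / 2 / η)) := by
  have hu2 : 0 < u / 2 := half_pos hu
  have hsub : {ω | ∃ x ∈ T, u < |F x ω|} ≤ᵐ[μ]
      ((⋃ y ∈ t, {ω | (u / 2) ^ (2 * q) ≤ F y ω ^ (2 * q)}) ∪ {ω | u / 2 / η ≤ ζ ω} : Set Ω) := by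
    filter_upwards [hF, hζ0] with ω hω hζω h
    obtain ⟨x, hx, hux⟩ : ∃ x ∈ T, u < |F x ω| := h
    obtain ⟨y, hy, hxy⟩ := hη x hx
    by_contra hcon
    change ω ∉ ((⋃ y ∈ t, {ω | (u / 2) ^ (2 * q) ≤ F y ω ^ (2 * q)}) ∪ {ω | u / 2 / η ≤ ζ ω}) at hcon
    simp only [mem_union, mem_iUnion, mem_ofPred_eq, exists_prop, not_or, not_exists, not_and,
      not_le] at hcon
    obtain ⟨h1, h2⟩ := hcon
    have h3 : |F y ω| < u / 2 := by
      by_contra hcon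
      have := pow_le_pow_left₀ hu2.le (not_lt.1 hcon) (2 * q)
      rw [(even_two_mul q).pow_abs] at this
      exact absurd (h1 y hy) (not_lt.2 this)
    have h4 : |F x ω - F y ω| ≤ u / 2 := by
      refine (hω x hx y (ht hy)).trans ?_
      have : ζ ω * dist x y ≤ (u / 2 / η) * η := by gcongr
      rwa [div_mul_cancel₀ _ hη0.ne'] at this
    have := abs_sub_abs_le_abs_sub (F x ω) (F y ω)
    linarith
  refine (measure_mono_ae hsub).trans ((measure_union_le _ _).trans (add_le_add ?_ ?_))
  · refine (measure_biUnion_finset_le _ _).trans ?_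
    rw [← nsmul_eq_mul]
    refine Finset.sum_le_card_nsmul _ _ _ fun y hy => ?_
    obtain ⟨h1, h2⟩ := hA y (ht hy)
    exact measure_ge_le_ofReal_div h1 (ae_of_all _ fun ω => (even_two_mul q).pow_nonneg _) h2
      (by positivity)
  · exact measure_ge_le_ofReal_div hζ hζ0 hB (by positivity)

variable {a b : ℝ}

local notation "I" => Icc a b

/-- Averages over short intervals are controlled by the average over `[a, b]` and by a weighted
integral of squared increments. -/
lemma lintegral_Icc_dyadic_le (hab : a < b) {U : ℝ → ℝ≥0∞} (hU : Measurable U)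
  {W : ℝ → ℝ → ℝ≥0∞} (hW0 : ∀ w, W w w = 0)
  (hW : ∀ w ∈ I, ∀ w' ∈ I, ∀ k : ℝ, 0 < k → U w ≤ U w' + (ofReal k * W w w' + ofReal (1 / k)))
  {r : ℝ} (hr : 0 < r) (k : ℕ) :
  ∀ x, a ≤ x → x + (b - a) / 2 ^ k ≤ b →
    ∫⁻ w in Icc x (x + (b - a) / 2 ^ k), U w ≤ ofReal ((b - a) / 2 ^ k) *
      (ofReal (1 / (b - a)) * (∫⁻ w in I, U w) +
        ofReal (2 * (b - a) ^ (1 / 8 : ℝ) / (1 - 2 ^ (-(1 / 8) : ℝ)) *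
          (1 - (2 ^ (-(1 / 8) : ℝ)) ^ k)) *
        (ofReal (1 / r) * (∫⁻ w in I, ∫⁻ w' in I,
          W w w' * ofReal (|w - w'| ^ (-(9 / 4) : ℝ))) + ofReal r)) := by
  have hd : 0 < b - a := sub_pos.2 hab
  set ϱ : ℝ := 2 ^ (-(1 / 8) : ℝ) with hϱ
  have hϱ0 : 0 < ϱ := by positivity
  have hϱ1 : ϱ < 1 := Real.rpow_lt_one_of_one_lt_of_neg (by norm_num) (by norm_num)
  set B := ∫⁻ w in I, ∫⁻ w' in I, W w w' * ofReal (|w - w'| ^ (-(9 / 4) : ℝ)) with hB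
  set m := ofReal (1 / (b - a)) * ∫⁻ w in I, U w with hm
  set c := 2 * (b - a) ^ (1 / 8 : ℝ) / (1 - ϱ) with hc
  have hc0 : 0 ≤ c := div_nonneg (by positivity) (by linarith)
  induction k with
  | zero =>
    intro x hx hxb
    have : x = a := by
      simp only [pow_zero, div_one] at hxb
      linarith
    subst this
    simp only [pow_zero, div_one, add_sub_cancel, sub_self, mul_zero, ENNReal.ofReal_zero, zero_mul,
      add_zero]
    rw [← mul_assoc, ← ofReal_mul hd.le, mul_one_div_cancel hd.ne', ofReal_one, one_mul]
  | succ k ih =>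
    intro x hx hxb
    set l := (b - a) / 2 ^ (k + 1) with hl
    have hl0 : 0 < l := by positivity
    have hl2 : (b - a) / 2 ^ k = 2 * l := by rw [hl, pow_succ]; field_simp
    have hl2d : 2 * l ≤ b - a := by rw [← hl2]; exact div_le_self hd.le (one_le_pow₀ (by norm_num))
    obtain ⟨y, hy, hyb, hyx, hxy⟩ : ∃ y, a ≤ y ∧ y + 2 * l ≤ b ∧ y ≤ x ∧ x + l ≤ y + 2 * l := by
      rcases le_or_gt (x + 2 * l) b with h | h
      · exact ⟨x, hx, h, le_rfl, by linarith⟩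
      · exact ⟨b - 2 * l, by linarith, by linarith, by linarith, by linarith⟩
    have IH := ih y hy (by rw [hl2]; exact hyb)
    rw [hl2] at IH
    have hJI : Icc x (x + l) ⊆ I := Icc_subset_Icc hx hxb
    have hJ'I : Icc y (y + 2 * l) ⊆ I := Icc_subset_Icc hy hyb
    set g := (2 * l) ^ (1 / 8 : ℝ) with hg
    have hg0 : 0 < g := by positivity
    set κ := 1 / (r * g) with hκ
    have hκ0 : 0 < κ := by positivity
    have hv : volume (Icc y (y + 2 * l)) = ofReal (2 * l) := by rw [volume_Icc]; congr 1; ring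
    have hvl : volume (Icc x (x + l)) = ofReal l := by rw [volume_Icc]; congr 1; ring
    have hU1 : ∀ w ∈ Icc x (x + l), U w ≤ ofReal (1 / (2 * l)) *
        (∫⁻ w' in Icc y (y + 2 * l), U w') + (ofReal (1 / (2 * l)) * (ofReal κ *
          ∫⁻ w' in Icc y (y + 2 * l), W w w') + ofReal (1 / κ)) := by
      intro w hw
      have e : ofReal (1 / (2 * l)) * ofReal (2 * l) = 1 := by
        rw [← ofReal_mul (by positivity), one_div_mul_cancel (by positivity), ofReal_one]
      calc U w = ofReal (1 / (2 * l)) * ∫⁻ _ in Icc y (y + 2 * l), U w := by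
            rw [setLIntegral_const, hv, mul_comm (U w), ← mul_assoc, e, one_mul]
        _ ≤ ofReal (1 / (2 * l)) * ∫⁻ w' in Icc y (y + 2 * l),
            (U w' + (ofReal κ * W w w' + ofReal (1 / κ))) := by
          exact mul_le_mul_right (setLIntegral_mono' measurableSet_Icc fun w' hw' =>
            hW w (hJI hw) w' (hJ'I hw') κ hκ0) _
        _ = _ := by
          rw [lintegral_add_left hU, lintegral_add_right _ measurable_const,
            lintegral_const_mul' _ _ ofReal_ne_top, setLIntegral_const, hv, mul_add,
            mul_add, mul_comm (ofReal (1 / κ)), ← mul_assoc _ _ (ofReal (1 / κ)),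
            e, one_mul]
    have hWB : ∫⁻ w in Icc x (x + l), ∫⁻ w' in Icc y (y + 2 * l), W w w' ≤
        ofReal ((2 * l) ^ (9 / 4 : ℝ)) * B := by
      calc _ ≤ ∫⁻ w in Icc x (x + l), ∫⁻ w' in Icc y (y + 2 * l),
            ofReal ((2 * l) ^ (9 / 4 : ℝ)) * (W w w' * ofReal (|w - w'| ^ (-(9 / 4) : ℝ))) := by
            refine setLIntegral_mono' measurableSet_Icc fun w hw =>
              setLIntegral_mono' measurableSet_Icc fun w' hw' => ?_
            rcases eq_or_ne w w' with rfl | hne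
            · rw [hW0]; exact zero_le
            · have hpos : 0 < |w - w'| := abs_pos.2 (sub_ne_zero.2 hne)
              have hle : |w - w'| ≤ 2 * l := by
                rw [abs_le]; constructor <;> linarith [hw.1, hw.2, hw'.1, hw'.2]
              rw [mul_left_comm, ← ofReal_mul (by positivity)]
              refine le_mul_of_one_le_right zero_le ?_
              rw [← ofReal_one]
              refine ofReal_le_ofReal ?_
              rw [Real.rpow_neg hpos.le, ← div_eq_mul_inv, le_div_iff₀ (by positivity), one_mul]
              exact Real.rpow_le_rpow hpos.le hle (by norm_num)
        _ = ofReal ((2 * l) ^ (9 / 4 : ℝ)) * ∫⁻ w in Icc x (x + l),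
            ∫⁻ w' in Icc y (y + 2 * l), W w w' * ofReal (|w - w'| ^ (-(9 / 4) : ℝ)) := by
          simp_rw [lintegral_const_mul' _ _ ofReal_ne_top]
        _ ≤ _ := by
          rw [hB]
          gcongr ofReal ((2 * l) ^ (9 / 4 : ℝ)) * ?_
          refine (lintegral_mono_set hJI).trans (lintegral_mono fun w => lintegral_mono_set hJ'I)
    calc ∫⁻ w in Icc x (x + l), U w
        ≤ ∫⁻ w in Icc x (x + l), (ofReal (1 / (2 * l)) *
        (∫⁻ w' in Icc y (y + 2 * l), U w') + (ofReal (1 / (2 * l)) * (ofReal κ *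
          ∫⁻ w' in Icc y (y + 2 * l), W w w') + ofReal (1 / κ))) :=
          setLIntegral_mono' measurableSet_Icc hU1
      _ = ofReal (1 / (2 * l)) * (∫⁻ w' in Icc y (y + 2 * l), U w') * ofReal l +
        (ofReal (1 / (2 * l)) * (ofReal κ *
          ∫⁻ w in Icc x (x + l), ∫⁻ w' in Icc y (y + 2 * l), W w w') +
          ofReal (1 / κ) * ofReal l) := by
        rw [lintegral_add_left measurable_const, lintegral_add_right _ measurable_const,
          lintegral_const_mul' _ _ ofReal_ne_top,
          setLIntegral_const, setLIntegral_const, hvl,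
          lintegral_const_mul' _ _ ofReal_ne_top,
          lintegral_const_mul' _ _ ofReal_ne_top, mul_assoc]
      _ ≤ ofReal (1 / (2 * l)) * (ofReal (2 * l) * (m + ofReal
          (c * (1 - ϱ ^ k)) * (ofReal (1 / r) * B + ofReal r))) *
          ofReal l + (ofReal (1 / (2 * l)) * (ofReal κ *
          (ofReal ((2 * l) ^ (9 / 4 : ℝ)) * B)) +
          ofReal (1 / κ) * ofReal l) :=
        add_le_add (mul_le_mul_left (mul_le_mul_right IH _) _)
          (add_le_add (mul_le_mul_right (mul_le_mul_right hWB _) _) le_rfl)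
      _ = ofReal l * (m + ofReal (c * (1 - ϱ ^ k)) * (ofReal (1 / r) * B + ofReal r)) +
        (ofReal l * (ofReal (2 * g) * (ofReal (1 / r) * B)) +
          ofReal l * (ofReal g * ofReal r)) := by
        congr 1
        · rw [← mul_assoc, ← ofReal_mul (by positivity),
            one_div_mul_cancel (by positivity), ofReal_one, one_mul, mul_comm]
        · congr 1
          · rw [← mul_assoc, ← mul_assoc, ← mul_assoc, ← mul_assoc,
              ← ofReal_mul (by positivity), ← ofReal_mul (by positivity),
              ← ofReal_mul (by positivity), ← ofReal_mul (by positivity)]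
            congr 2
            have e : (2 * l) ^ (9 / 4 : ℝ) = (2 * l) ^ 2 * g * g := by
              rw [hg, mul_assoc, ← Real.rpow_add (by positivity), ← Real.rpow_natCast,
                ← Real.rpow_add (by positivity)]
              norm_num
            rw [e, hκ]
            field_simp
          · rw [← ofReal_mul (by positivity), ← ofReal_mul (by positivity),
              ← ofReal_mul (by positivity)]
            congr 1
            rw [hκ]
            field_simp
      _ ≤ ofReal l * (m + ofReal (c * (1 - ϱ ^ k)) * (ofReal (1 / r) * B + ofReal r)) +
        (ofReal l * (ofReal (2 * g) * (ofReal (1 / r) * B)) +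
          ofReal l * (ofReal (2 * g) * ofReal r)) := by
        gcongr
        linarith
      _ = _ := by
        have e : c * (1 - ϱ ^ (k + 1)) = c * (1 - ϱ ^ k) + 2 * g := by
          have eg : g = (b - a) ^ (1 / 8 : ℝ) * ϱ ^ k := by
            rw [hg, ← hl2, Real.div_rpow hd.le (by positivity), hϱ, ← Real.rpow_natCast,
              ← Real.rpow_natCast, ← Real.rpow_mul (by norm_num), ← Real.rpow_mul (by norm_num),
              mul_comm (k : ℝ), neg_mul, Real.rpow_neg (by norm_num), div_eq_mul_inv]
          have : 1 - ϱ ≠ 0 := by linarith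
          rw [eg, hc, pow_succ]
          field_simp
          ring
        have p1 : 0 ≤ c * (1 - ϱ ^ k) := mul_nonneg hc0 (sub_nonneg.2 (pow_le_one₀ hϱ0.le hϱ1.le))
        rw [e, ofReal_add p1 (by positivity)]
        ring

lemma lintegral_Icc_inter_le (hab : a < b) : ∃ C : ℝ, 0 ≤ C ∧
  ∀ (U : ℝ → ℝ≥0∞) (W : ℝ → ℝ → ℝ≥0∞), Measurable U → (∀ w, W w w = 0) →
  (∀ w ∈ I, ∀ w' ∈ I, ∀ k : ℝ, 0 < k → U w ≤ U w' + (ofReal k * W w w' + ofReal (1 / k))) →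
  ∀ r h t : ℝ, 0 < r → 0 < h → 2 * h ≤ b - a → t ∈ I →
    ∫⁻ w in I ∩ Icc (t - h) (t + h), U w ≤ ofReal (C * h) *
      ((∫⁻ w in I, U w) + (ofReal (1 / r) * (∫⁻ w in I, ∫⁻ w' in I,
        W w w' * ofReal (|w - w'| ^ (-(9 / 4) : ℝ))) + ofReal r)) := by
  have hd : 0 < b - a := sub_pos.2 hab
  have hϱ1 : (2 : ℝ) ^ (-(1 / 8) : ℝ) < 1 :=
    Real.rpow_lt_one_of_one_lt_of_neg (by norm_num) (by norm_num)
  set c : ℝ := 2 * (b - a) ^ (1 / 8 : ℝ) / (1 - 2 ^ (-(1 / 8) : ℝ)) with hc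
  have hc0 : 0 ≤ c := div_nonneg (by positivity) (by linarith)
  refine ⟨4 * (1 / (b - a) + c), by positivity, fun U W hU hW0 hW r h t hr hh hhb ht => ?_⟩
  obtain ⟨k, hk1, hk2⟩ := exists_nat_pow_near (x := (b - a) / (2 * h)) (y := (2 : ℝ))
    (by rw [le_div_iff₀ (by positivity)]; linarith) (by norm_num)
  set l := (b - a) / 2 ^ k with hl
  have l1 : 2 * h ≤ l := by rw [le_div_iff₀ (by positivity)] at hk1 ⊢; linarith
  have l2 : l ≤ 4 * h := by
    rw [div_lt_iff₀ (by positivity), pow_succ] at hk2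
    rw [hl, div_le_iff₀ (by positivity)]; linarith
  have l3 : l ≤ b - a := div_le_self hd.le (one_le_pow₀ (by norm_num))
  have key := lintegral_Icc_dyadic_le hab hU hW0 hW hr k
  rw [← hl, ← hc] at key
  obtain ⟨x, hx, hxb, hsub⟩ : ∃ x, a ≤ x ∧ x + l ≤ b ∧ I ∩ Icc (t - h) (t + h) ⊆ Icc x (x + l) := by
    rcases le_or_gt (t - h) a with h1 | h1
    · exact ⟨a, le_rfl, by linarith, fun w hw => ⟨hw.1.1, by linarith [hw.2.2]⟩⟩
    · rcases le_or_gt (t - h + l) b with h2 | h2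
      · exact ⟨t - h, h1.le, h2, fun w hw => ⟨hw.2.1, by linarith [hw.2.2]⟩⟩
      · exact ⟨b - l, by linarith, by linarith, fun w hw =>
          ⟨by linarith [hw.2.1], by linarith [hw.1.2]⟩⟩
  refine (lintegral_mono_set hsub).trans ((key x hx hxb).trans ?_)
  set Z := ofReal (1 / r) * (∫⁻ w in I, ∫⁻ w' in I,
    W w w' * ofReal (|w - w'| ^ (-(9 / 4) : ℝ))) + ofReal r
  set V := ∫⁻ w in I, U w
  calc _ ≤ ofReal (4 * h) * (ofReal (1 / (b - a) + c) * V +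
        ofReal (1 / (b - a) + c) * Z) := by
        have p : 0 ≤ ((2 : ℝ) ^ (-(1 / 8) : ℝ)) ^ k := by positivity
        have q : 0 < 1 / (b - a) := by positivity
        gcongr
        · linarith
        · nlinarith
    _ = _ := by
      rw [← mul_add, ← mul_assoc, ← ofReal_mul (by positivity)]
      congr 2
      ring

end Suprema

section Means

variable {S : Type*} [MeasurableSpace S] {ρ : Measure S} {a b : ℝ} {X : ℝ → S → ℝ} {σ : ℝ}
  {φ f : ℝ → ℝ}

local notation "g[" u ", " x "]" => smoothed σ φ (X u x)
local notation "𝓣" => timeLaw a b f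
local notation "ξ[" α "]" => obsMark X φ α
local notation "𝓛" => obsLaw a b f σ

/-- The integral of a product kernel against `R` under the law of two time points. -/
def pairIntegral (a b : ℝ) (f : ℝ → ℝ) (R : ℝ → ℝ → ℝ) (α β : ℝ → ℝ) : ℝ :=
  ∫ p, α p.1 * β p.2 * R p.1 p.2 ∂((timeLaw a b f).prod (timeLaw a b f))

/-- Processes for which the mark of a random observation has moments. -/
def IsRegularPath (a b : ℝ) (f : ℝ → ℝ) (X : ℝ → S → ℝ) (σ : ℝ) (φ : ℝ → ℝ) (x : S) : Prop :=
  HasMoments (obsLaw a b f σ) fun d => φ (X d.1 x + d.2)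

lemma IsCenteredProcess.ae_isRegularPath [IsProbabilityMeasure ρ]
  (hX : IsCenteredProcess ρ a b X) (hf : IsSamplingDensity a b f) (hφ : HasLinearGrowth φ) :
  ∀ᵐ x ∂ρ, IsRegularPath a b f X σ φ x := by
  have := hf.isProbabilityMeasure_obsLaw σ
  exact (hX.hasMoments_obs hf hφ).prod_right_ae

namespace IsRegularPath

variable [IsProbabilityMeasure (timeLaw a b f)] {x : S}

lemma integrable_smoothed (hx : IsRegularPath a b f X σ φ x) :
  Integrable (fun u => g[u, x]) 𝓣 := by
  exact (HasMoments.integrable hx).integral_prod_left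

lemma hasMoments_obsMark (hx : IsRegularPath a b f X σ φ x) {α : ℝ → ℝ} (hα : Measurable α)
  {p : ℝ} (hp : ∀ t, |α t| ≤ p) :
  HasMoments 𝓛 fun d => ξ[α] (x, d) := by
  exact (HasMoments.of_bounded (g := fun d : ℝ × ℝ => α d.1) (by fun_prop) fun d => hp _).mul hx

lemma integral_obsMark (hx : IsRegularPath a b f X σ φ x) {α : ℝ → ℝ} (hα : Measurable α) {p : ℝ}
  (hp : ∀ t, |α t| ≤ p) :
  ∫ d, ξ[α] (x, d) ∂𝓛 = ∫ u, α u * g[u, x] ∂𝓣 := by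
  have i := (hx.hasMoments_obsMark hα hp).integrable
  unfold obsLaw at i ⊢
  rw [integral_prod _ i]
  refine integral_congr_ae (ae_of_all _ fun u => ?_)
  simp only [obsMark, smoothed, integral_const_mul]

lemma integrable_mul_smoothed (hx : IsRegularPath a b f X σ φ x) {α : ℝ → ℝ} (hα : Measurable α)
  {p : ℝ} (hp : ∀ t, |α t| ≤ p) :
  Integrable (fun u => α u * g[u, x]) 𝓣 :=
  hx.integrable_smoothed.bdd_mul hα.aestronglyMeasurable (ae_of_all _ hp)

lemma condProd_eq (hx : IsRegularPath a b f X σ φ x) {α β : ℝ → ℝ} (hα : Measurable α)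
  (hβ : Measurable β) {p r : ℝ} (hp : ∀ t, |α t| ≤ p) (hr : ∀ t, |β t| ≤ r) :
  Integrable (fun q : ℝ × ℝ => α q.1 * β q.2 *
    (g[q.1, x] * g[q.2, x])) ((timeLaw a b f).prod 𝓣) ∧
  condProd 𝓛 ξ[α] ξ[β] x =
    ∫ q, α q.1 * β q.2 * (g[q.1, x] * g[q.2, x])
      ∂((timeLaw a b f).prod 𝓣) := by
  have e : ∀ q : ℝ × ℝ, α q.1 * β q.2 * (g[q.1, x] * g[q.2, x]) =
    (α q.1 * g[q.1, x]) * (β q.2 * g[q.2, x]) := fun q => by ring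
  simp_rw [e]
  refine ⟨(hx.integrable_mul_smoothed hα hp).mul_prod (hx.integrable_mul_smoothed hβ hr), ?_⟩
  rw [condProd, hx.integral_obsMark hα hp, hx.integral_obsMark hβ hr]
  exact (integral_prod_mul (fun u => α u * g[u, x])
    fun u => β u * g[u, x]).symm

lemma abs_condProd_sub_le (hx : IsRegularPath a b f X σ φ x) {α β α' β' : ℝ → ℝ}
  (hα : Measurable α) (hβ : Measurable β) (hα' : Measurable α') (hβ' : Measurable β') {p : ℝ}
  (h1 : ∀ t, |α t| ≤ p) (h2 : ∀ t, |β t| ≤ p) (h3 : ∀ t, |α' t| ≤ p) (h4 : ∀ t, |β' t| ≤ p)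
  {ε : ℝ} (hε : ∀ u w, |α u * β w - α' u * β' w| ≤ ε) :
  |condProd 𝓛 ξ[α] ξ[β] x - condProd 𝓛 ξ[α'] ξ[β'] x| ≤ ε * (∫ d, |φ (X d.1 x + d.2)| ∂𝓛) ^ 2 := by
  have i1 := (hx.hasMoments_obsMark hα h1).integrable.mul_prod
    (hx.hasMoments_obsMark hβ h2).integrable
  have i2 := (hx.hasMoments_obsMark hα' h3).integrable.mul_prod
    (hx.hasMoments_obsMark hβ' h4).integrable
  have hi := (HasMoments.abs hx).integrable
  rw [condProd, condProd, ← integral_prod_mul, ← integral_prod_mul, ← integral_sub i1 i2, sq,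
    ← integral_prod_mul, ← integral_const_mul, ← norm_eq_abs]
  refine norm_integral_le_of_norm_le ((hi.mul_prod hi).const_mul ε) (ae_of_all _ fun q => ?_)
  simp only [obsMark, norm_eq_abs]
  calc _ = |(α q.1.1 * β q.2.1 - α' q.1.1 * β' q.2.1) *
        (φ (X q.1.1 x + q.1.2) * φ (X q.2.1 x + q.2.2))| := by ring_nf
    _ ≤ ε * (|φ (X q.1.1 x + q.1.2)| * |φ (X q.2.1 x + q.2.2)|) := by
      rw [abs_mul, abs_mul]
      gcongr
      exact hε _ _

end IsRegularPath

lemma measurable_smoothed_path (hX : Measurable (Function.uncurry X)) (hφ : IsMark σ φ) :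
  Measurable fun q : S × ℝ => g[q.2, q.1] :=
  hφ.hasLinearGrowth_smoothed.measurable.comp (hX.comp measurable_swap)

lemma measurable_pairMean [SFinite ρ] (hX : Measurable (Function.uncurry X)) (hφ : IsMark σ φ) :
  Measurable fun q : ℝ × ℝ => pairMean ρ X σ φ q.1 q.2 := by
  simp_rw [pairMean_eq]
  have h := measurable_smoothed_path hX hφ
  have : Measurable fun z : (ℝ × ℝ) × S =>
      g[z.1.1, z.2] * g[z.1.2, z.2] :=
    (h.comp (f := fun z : (ℝ × ℝ) × S => (z.2, z.1.1)) (by fun_prop)).mul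
      (h.comp (f := fun z : (ℝ × ℝ) × S => (z.2, z.1.2)) (by fun_prop))
  exact this.stronglyMeasurable.integral_prod_right'.measurable

variable [IsProbabilityMeasure ρ]

lemma IsCenteredProcess.hasMoments_smoothed_path (hX : IsCenteredProcess ρ a b X)
  (hφ : IsMark σ φ) [IsProbabilityMeasure 𝓣] :
  HasMoments (ρ.prod 𝓣) (fun q => g[q.2, q.1]) := by
  have hm := measurable_smoothed_path hX.measurable hφ
  refine .of_lintegral_lt_top hm.aestronglyMeasurable fun k => ?_
  obtain ⟨B, hB⟩ := hX.exists_lintegral_le hφ.hasLinearGrowth_smoothed k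
  rw [lintegral_prod_symm _ (hm.enorm.pow_const k).aemeasurable]
  calc _ ≤ ∫⁻ _ : ℝ, (B : ℝ≥0∞) ∂𝓣 := by
        refine lintegral_mono_ae ?_
        filter_upwards [ae_mem_timeLaw] with u hu using hB u hu
    _ < ∞ := by simp

/-- The mean of the conditional mean of a pair of marks. -/
lemma IsCenteredProcess.integral_condProd (hX : IsCenteredProcess ρ a b X)
  (hf : IsSamplingDensity a b f) (hφ : IsMark σ φ) {α β : ℝ → ℝ} (hα : Measurable α)
  (hβ : Measurable β) {p r : ℝ} (hp : ∀ t, |α t| ≤ p) (hr : ∀ t, |β t| ≤ r) :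
  ∫ x, condProd 𝓛 ξ[α] ξ[β] x ∂ρ = pairIntegral a b f (pairMean ρ X σ φ) α β := by
  have := hf.isProbabilityMeasure
  set ν := 𝓣 with hν
  have m1 : HasMoments (ρ.prod (ν.prod ν)) (fun z => g[z.2.1, z.1]) :=
    (hX.hasMoments_smoothed_path hφ).comp ((MeasurePreserving.id ρ).prod measurePreserving_fst)
  have m2 : HasMoments (ρ.prod (ν.prod ν)) (fun z => g[z.2.2, z.1]) :=
    (hX.hasMoments_smoothed_path hφ).comp ((MeasurePreserving.id ρ).prod measurePreserving_snd)
  have m3 : HasMoments (ρ.prod (ν.prod ν)) (fun z => α z.2.1 * β z.2.2) :=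
    (HasMoments.of_bounded (g := fun z : S × (ℝ × ℝ) => α z.2.1) (by fun_prop) fun z => hp _).mul
      (HasMoments.of_bounded (g := fun z : S × (ℝ × ℝ) => β z.2.2) (by fun_prop) fun z => hr _)
  have i := (m3.mul (m1.mul m2)).integrable
  calc _ = ∫ x, ∫ q, α q.1 * β q.2 * (g[q.1, x] * g[q.2, x])
        ∂(ν.prod ν) ∂ρ := by
        refine integral_congr_ae ?_
        filter_upwards [hX.ae_isRegularPath (σ := σ) hf hφ.toHasLinearGrowth] with x hx
        exact (hx.condProd_eq hα hβ hp hr).2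
    _ = ∫ q, ∫ x, α q.1 * β q.2 * (g[q.1, x] * g[q.2, x]) ∂ρ
      ∂(ν.prod ν) := integral_integral_swap i
    _ = _ := by
      unfold pairIntegral
      simp_rw [integral_const_mul, pairMean_eq]
      rfl

lemma ae_prod_timeLaw : ∀ᵐ q ∂((timeLaw a b f).prod 𝓣), q.1 ∈ Icc a b ∧ q.2 ∈ Icc a b := by
  rw [eventually_and]
  exact ⟨Measure.quasiMeasurePreserving_fst.ae ae_mem_timeLaw,
    Measure.quasiMeasurePreserving_snd.ae ae_mem_timeLaw⟩

end Means

section ProcessPart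

variable {S U : Type*} [MeasurableSpace S] [MeasurableSpace U] {ρ : Measure S} {κ : Measure U}
  [IsProbabilityMeasure ρ] [IsProbabilityMeasure κ] {N : ℕ → ℕ} {n : ℕ}

lemma integral_processPart_sq_le {ξ : S → ℝ} (hξ : Measurable ξ) (hM : HasMoments ρ ξ) {h : ℝ}
  (hh : 0 < h) (hh1 : h ≤ 1) :
  ∫ ω, processPart ρ N n ξ ω ^ 2 ∂sampleLaw ρ κ ≤
    rosenthalConst 1 * 4 * pointVar h N n * ∫ x, ξ x ^ 2 ∂ρ := by
  set m := ∫ x, ξ x ∂ρ with hm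
  set w : ℕ → ℝ := fun i => obsWeight N n * ((N i : ℝ) * (N i - 1)) with hw
  have h0 : 0 ≤ ∫ x, ξ x ^ 2 ∂ρ := integral_nonneg fun x => sq_nonneg _
  have hΓ0 : 0 ≤ pointVar h N n := pointVar_nonneg hh
  have key := rosenthal_process (κ := κ) hξ hM hm w
    (D := 4 * pointVar h N n * ∫ x, ξ x ^ 2 ∂ρ) (by positivity) 1 n fun k hk hkq => ?_
  · refine key.trans_eq' ?_ |>.trans_eq (by ring)
    simp only [processPart, mul_one, hw, hm]
  · obtain rfl : k = 1 := by omega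
    simpa using mul_le_mul (sum_pairWeight_sq_le hh hh1) (integral_sub_mean_sq_le hM rfl)
      (integral_nonneg fun x => sq_nonneg _) (by positivity)

lemma processPart_sub {ξ ξ' : S → ℝ} (hξ : Integrable ξ ρ) (hξ' : Integrable ξ' ρ)
  (D : ℕ → S × (ℕ → U)) : processPart ρ N n (fun x => ξ x - ξ' x) D =
    processPart ρ N n ξ D - processPart ρ N n ξ' D := by
  rw [processPart, processPart, processPart, ← sum_sub_distrib, integral_sub hξ hξ']
  exact sum_congr rfl fun i _ => by ring

end ProcessPart

lemma exists_lintegral_abs_sub_rpow_le (a b : ℝ) {r : ℝ} (hr : -1 < r) : ∃ C : ℝ≥0,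
  ∀ w ∈ Icc a b, ∫⁻ w' in Icc a b, ofReal (|w - w'| ^ r) ≤ C := by
  have hi : IntegrableOn (fun x : ℝ => ‖x‖ ^ r) (Metric.ball 0 (|b - a| + 1)) := by
    rw [integrableOn_fun_norm_addHaar volume (f := fun y => y ^ r)]
    simp only [Module.finrank_self, tsub_self, pow_zero, one_smul]
    exact ((intervalIntegrable_iff_integrableOn_Ioo_of_le (by positivity)).1
      (intervalIntegral.intervalIntegrable_rpow' hr))
  refine ⟨(∫⁻ x in Metric.ball (0 : ℝ) (|b - a| + 1), ofReal (‖x‖ ^ r)).toNNReal, fun w hw => ?_⟩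
  rw [ENNReal.coe_toNNReal (hi.lintegral_lt_top).ne]
  calc ∫⁻ w' in Icc a b, ofReal (|w - w'| ^ r)
      ≤ ∫⁻ w', (Metric.ball (0 : ℝ) (|b - a| + 1)).indicator
          (fun x => ofReal (‖x‖ ^ r)) (w - w') := by
        rw [← lintegral_indicator measurableSet_Icc]
        refine lintegral_mono fun w' => ?_
        by_cases h : w' ∈ Icc a b
        · have : w - w' ∈ Metric.ball (0 : ℝ) (|b - a| + 1) := by
            rw [mem_ball_zero_iff, norm_eq_abs, abs_lt]
            have := le_abs_self (b - a)
            constructor <;> linarith [h.1, h.2, hw.1, hw.2]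
          rw [indicator_of_mem h, indicator_of_mem this, norm_eq_abs]
        · rw [indicator_of_notMem h]; exact zero_le
    _ = _ := by
      rw [lintegral_sub_left_eq_self (fun x => (Metric.ball (0 : ℝ) (|b - a| + 1)).indicator
        (fun x => ofReal (‖x‖ ^ r)) x) w, lintegral_indicator measurableSet_ball]

lemma HasMoments.lintegral_enorm_sq {Ω : Type*} [MeasurableSpace Ω] {μ : Measure Ω} [IsFiniteMeasure μ]
  {Y : Ω → ℝ} (hY : HasMoments μ Y) : ∫⁻ ω, ‖Y ω‖ₑ ^ 2 ∂μ = ofReal (∫ ω, Y ω ^ 2 ∂μ) := by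
  rw [ofReal_integral_eq_lintegral_ofReal (hY.pow 2).integrable (ae_of_all _ fun _ => sq_nonneg _)]
  refine lintegral_congr fun ω => ?_
  rw [enorm_eq_ofReal_abs, ← ofReal_pow (abs_nonneg _), sq_abs]

lemma enorm_le_mul_sq_add (x : ℝ) {k : ℝ} (hk : 0 < k) :
  ‖x‖ₑ ≤ ofReal k * ‖x‖ₑ ^ 2 + ofReal (1 / k) := by
  rw [enorm_eq_ofReal_abs, ← ofReal_pow (abs_nonneg _),
    ← ofReal_mul hk.le, ← ofReal_add (by positivity) (by positivity)]
  refine ofReal_le_ofReal ?_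
  rw [← sub_nonneg]
  have : k * |x| ^ 2 + 1 / k - |x| = ((k * |x| - 1 / 2) ^ 2 + 3 / 4) / k := by field_simp; ring
  rw [this]
  positivity

lemma IsKernel.measurable_scaledKernel_sub {K : ℝ → ℝ} (hK : IsKernel K) (h s : ℝ) : Measurable 𝓚[K; h; s] :=
  ((hK.continuous_scaledKernel h).comp (continuous_id.sub continuous_const)).measurable

lemma IsKernel.abs_scaledKernel_le {K : ℝ → ℝ} (hK : IsKernel K) {h : ℝ} (hh : 0 < h) {B : ℝ}
  (hB : ∀ x, K x ≤ B) (x : ℝ) : |scaledKernel K h x| ≤ B / h := by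
  rw [abs_of_nonneg (hK.scaledKernel_nonneg hh _)]; exact IsKernel.scaledKernel_le hB hh _

section PathDeviation

variable {S : Type*} [MeasurableSpace S] {ρ : Measure S} [IsProbabilityMeasure ρ] {a b : ℝ}
  {X : ℝ → S → ℝ} {σ : ℝ} {φ f : ℝ → ℝ}

local notation "g[" u ", " x "]" => smoothed σ φ (X u x)
local notation "I" => Icc a b
local notation "𝓛" => obsLaw a b f σ
local notation "𝓢" => sampleLaw ρ 𝓛

/-- The deviation of the weighted mean of `G(X_i(u)) G(X_i(w))` from its expectation, where `G` is
the smoothed mark. -/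
def pathDeviation {U : Type*} (ρ : Measure S) (X : ℝ → S → ℝ) (σ : ℝ) (φ : ℝ → ℝ) (N : ℕ → ℕ)
  (n : ℕ) (D : ℕ → S × (ℕ → U)) (u w : ℝ) : ℝ :=
  processPart ρ N n (fun x => smoothed σ φ (X u x) * smoothed σ φ (X w x)) D

lemma measurable_pathDeviation {U : Type*} [MeasurableSpace U]
  (hX : Measurable (Function.uncurry X)) (hφ : IsMark σ φ) (N : ℕ → ℕ) (n : ℕ) :
  Measurable fun z : (ℕ → S × (ℕ → U)) × ℝ × ℝ => pathDeviation ρ X σ φ N n z.1 z.2.1 z.2.2 := by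
  have h := measurable_smoothed_path hX hφ
  have hm := measurable_pairMean (ρ := ρ) hX hφ
  simp only [pathDeviation, processPart, ← pairMean_eq]
  refine measurable_sum _ fun i _ => .const_mul (.sub (.mul ?_ ?_) ?_) _
  · exact h.comp (f := fun z : (ℕ → S × (ℕ → U)) × ℝ × ℝ => ((z.1 i).1, z.2.1)) (by fun_prop)
  · exact h.comp (f := fun z : (ℕ → S × (ℕ → U)) × ℝ × ℝ => ((z.1 i).1, z.2.2)) (by fun_prop)
  · exact hm.comp (f := fun z : (ℕ → S × (ℕ → U)) × ℝ × ℝ => z.2) (by fun_prop)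

lemma IsCenteredProcess.processPart_condProd_eq (hab : a < b) (hX : IsCenteredProcess ρ a b X)
  (hf : IsSamplingDensity a b f) (hφ : IsMark σ φ) {α β : ℝ → ℝ} (hα : Measurable α)
  (hβ : Measurable β) {p r : ℝ} (hp : ∀ t, |α t| ≤ p) (hr : ∀ t, |β t| ≤ r) {N : ℕ → ℕ} {n : ℕ}
  {D : Data S} (hD : ∀ i, IsRegularPath a b f X σ φ (D i).1) :
  processPart ρ N n (condProd 𝓛 (obsMark X φ α) (obsMark X φ β)) D =
    ∫ q, α q.1 * β q.2 * pathDeviation ρ X σ φ N n D q.1 q.2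
      ∂((timeLaw a b f).prod (timeLaw a b f)) := by
  have := hf.isProbabilityMeasure
  set ν := timeLaw a b f with hν
  obtain ⟨L, hL⟩ := hX.isLipschitzKernel_pairMean hab hφ
  obtain ⟨B, hB0, hB⟩ := hL.exists_bound hab.le
  have hr0 : 0 ≤ r := (abs_nonneg _).trans (hr 0)
  have hp0 : 0 ≤ p := (abs_nonneg _).trans (hp 0)
  have i2 : Integrable (fun q : ℝ × ℝ => α q.1 * β q.2 * pairMean ρ X σ φ q.1 q.2) (ν.prod ν) := by
    refine Integrable.of_bound (((hα.comp measurable_fst).mul (hβ.comp measurable_snd)).mul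
      (measurable_pairMean hX.measurable hφ)).aestronglyMeasurable (p * r * B) ?_
    filter_upwards [ae_prod_timeLaw] with q hq
    rw [norm_eq_abs, abs_mul, abs_mul]
    have h1 := hp q.1
    have h2 := hr q.2
    have h3 := hB q.1 hq.1 q.2 hq.2
    gcongr
  have i1 := fun i => ((hD i).condProd_eq hα hβ hp hr).1
  simp only [pathDeviation, processPart, ← pairMean_eq, hX.integral_condProd hf hφ hα hβ hp hr,
    ((hD _).condProd_eq hα hβ hp hr).2, mul_sum]
  rw [integral_finsetSum]
  · refine sum_congr rfl fun i _ => ?_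
    rw [pairIntegral, ← integral_sub (i1 i) i2, ← integral_const_mul]
    refine integral_congr_ae (ae_of_all _ fun q => ?_)
    simp only
    ring
  · intro i _
    refine (((i1 i).sub i2).const_mul (obsWeight N n * ((N i : ℝ) * (N i - 1)))).congr
      (ae_of_all _ fun q => ?_)
    simp only [Pi.sub_apply]
    ring

lemma IsCenteredProcess.hasMoments_pathDeviation {U : Type*} [MeasurableSpace U] {κ : Measure U}
  [IsProbabilityMeasure κ] (hX : IsCenteredProcess ρ a b X) (hφ : IsMark σ φ) (N : ℕ → ℕ) (n : ℕ)
  {u w : ℝ} (hu : u ∈ I) (hw : w ∈ I) :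
  HasMoments (sampleLaw ρ κ) (fun D => pathDeviation ρ X σ φ N n D u w) :=
  hasMoments_processPart ((hX.hasMoments_smoothed hφ hu).mul (hX.hasMoments_smoothed hφ hw))

lemma IsCenteredProcess.exists_integral_pathDeviation_sq_le {U : Type*} [MeasurableSpace U]
  {κ : Measure U} [IsProbabilityMeasure κ] (hab : a < b) (hX : IsCenteredProcess ρ a b X)
  (hφ : IsMark σ φ) : ∃ C : ℝ, 0 ≤ C ∧ ∀ (N : ℕ → ℕ) (n : ℕ) (h : ℝ), 0 < h → h ≤ 1 →
    ∀ u ∈ I, ∀ w ∈ I, ∫ D, pathDeviation ρ X σ φ N n D u w ^ 2 ∂sampleLaw ρ κ ≤ C * pointVar h N n ∧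
      ∀ w' ∈ I, ∫ D, (pathDeviation ρ X σ φ N n D u w - pathDeviation ρ X σ φ N n D u w') ^ 2
        ∂sampleLaw ρ κ ≤ C * pointVar h N n * |w - w'| ^ (3 / 2 : ℝ) := by
  obtain ⟨L, hL0, hL⟩ := hX.exists_integral_mul_sub_sq_le hab hφ
  obtain ⟨B, hB0, hB⟩ := hX.exists_integral_le hφ.hasLinearGrowth_smoothed 4
  have hc := rosenthalConst_nonneg 1
  refine ⟨rosenthalConst 1 * 4 * (L + B), by positivity, fun N n h hh hh1 u hu w hw => ?_⟩
  have hΓ0 := pointVar_nonneg (N := N) (n := n) hh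
  have m : ∀ {v}, v ∈ I → HasMoments ρ (fun x => g[v, x]) := fun hv =>
    hX.hasMoments_smoothed hφ hv
  have hGm : ∀ v, Measurable fun x => g[v, x] := fun v =>
    hφ.hasLinearGrowth_smoothed.measurable.comp (hX.measurable_apply v)
  constructor
  · have h1 : ∫ x, (g[u, x] * g[w, x]) ^ 2 ∂ρ ≤ B := by
      calc _ ≤ ∫ x, (1 / 2 * |g[u, x]| ^ 4 + 1 / 2 * |g[w, x]| ^ 4) ∂ρ := by
            refine integral_mono (((m hu).mul (m hw)).pow 2).integrable
              ((((m hu).abs.pow 4).const_mul _).add (((m hw).abs.pow 4).const_mul _)).integrable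
              fun x => ?_
            have e : ∀ y : ℝ, |y| ^ 4 = (y ^ 2) ^ 2 := fun y => by rw [← sq_abs y]; ring
            simp only [e, mul_pow]
            nlinarith [sq_nonneg (g[u, x] ^ 2 - g[w, x] ^ 2)]
        _ ≤ B := by
          rw [integral_add ((m hu).abs.pow 4 |>.const_mul _).integrable
            ((m hw).abs.pow 4 |>.const_mul _).integrable, integral_const_mul, integral_const_mul]
          linarith [hB u hu, hB w hw]
    refine (integral_processPart_sq_le ((hGm u).mul (hGm w)) ((m hu).mul (m hw)) hh hh1).trans ?_
    calc _ ≤ rosenthalConst 1 * 4 * pointVar h N n * (L + B) := by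
          gcongr; exact h1.trans (by linarith)
      _ = _ := by ring
  · intro w' hw'
    have e : ∀ D : ℕ → S × (ℕ → U), pathDeviation ρ X σ φ N n D u w -
        pathDeviation ρ X σ φ N n D u w' = processPart ρ N n (fun x =>
          g[u, x] * g[w, x] -
          g[u, x] * g[w', x]) D := fun D =>
      (processPart_sub ((m hu).mul (m hw)).integrable ((m hu).mul (m hw')).integrable D).symm
    simp_rw [e]
    refine (integral_processPart_sq_le (((hGm u).mul (hGm w)).sub ((hGm u).mul (hGm w')))
      (((m hu).mul (m hw)).sub ((m hu).mul (m hw'))) hh hh1).trans ?_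
    calc _ ≤ rosenthalConst 1 * 4 * pointVar h N n * (L * |w - w'| ^ (3 / 2 : ℝ)) := by
          gcongr; exact hL u hu w hw w' hw'
      _ ≤ rosenthalConst 1 * 4 * pointVar h N n * ((L + B) * |w - w'| ^ (3 / 2 : ℝ)) := by
        gcongr; linarith
      _ = _ := by ring

set_option maxHeartbeats 1000000 in
/-- The influence of the processes, uniformly over one factor `K_h(· - t)` and a bounded factor. -/
lemma IsCenteredProcess.exists_processPart_le (hab : a < b) (hX : IsCenteredProcess ρ a b X)
  (hf : IsSamplingDensity a b f) (hφ : IsMark σ φ) {K : ℝ → ℝ} (hK : IsKernel K)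
  [IsProbabilityMeasure 𝓛] :
  ∃ C : ℝ, 0 ≤ C ∧ ∀ (N : ℕ → ℕ) (n : ℕ) (h r : ℝ), 0 < h → h ≤ 1 → 2 * h ≤ b - a → 0 < r →
    pointVar h N n ≤ r ^ 2 → ∃ Z : Data S → ℝ≥0∞, Measurable Z ∧
      ∫⁻ D, Z D ∂𝓢 ≤ ofReal (C * r) ∧
      ∀ᵐ D ∂𝓢, ∀ t ∈ I, ∀ (α : ℝ → ℝ) (p : ℝ), Measurable α →
        (∀ u, |α u| ≤ p) → ofReal |processPart ρ N n (condProd 𝓛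
          (obsMark X φ α) (obsMark X φ 𝓚[K; h; t])) D| ≤
          ofReal p * Z D := by
  have := hf.isProbabilityMeasure
  set ν := timeLaw a b f with hν
  obtain ⟨C₁, hC₁0, hC₁⟩ := hX.exists_integral_pathDeviation_sq_le (κ := 𝓛) hab hφ
  obtain ⟨C₂, hC₂0, hC₂⟩ := lintegral_Icc_inter_le hab
  obtain ⟨C₃, hC₃⟩ := exists_lintegral_abs_sub_rpow_le a b (r := -(3 / 4)) (by norm_num)
  obtain ⟨M, hM⟩ := hf.exists_le
  obtain ⟨B, hB1, hB⟩ := hK.exists_le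
  have hM' : ∀ g : ℝ → ℝ≥0∞, ∫⁻ u, g u ∂ν ≤ M * ∫⁻ u in I, g u := fun g =>
    (lintegral_mono' hM le_rfl).trans (by rw [lintegral_smul_measure]; rfl)
  have hba : 0 ≤ b - a := (sub_pos.2 hab).le
  refine ⟨B * M * C₂ * ((b - a) * (C₁ + 1) + (C₁ * (b - a) * C₃ + 1)), by positivity,
    fun N n h r hh hh1 hhab hr hΓ => ?_⟩
  have hΓ0 := pointVar_nonneg (N := N) (n := n) hh
  set V : Data S → ℝ → ℝ → ℝ := fun D u w => pathDeviation ρ X σ φ N n D u w with hV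
  have hVm : Measurable fun z : Data S × ℝ × ℝ => V z.1 z.2.1 z.2.2 :=
    measurable_pathDeviation hX.measurable hφ N n
  set U : Data S → ℝ → ℝ≥0∞ := fun D w => ∫⁻ u, ‖V D u w‖ₑ ∂ν with hU
  set W : Data S → ℝ → ℝ → ℝ≥0∞ := fun D w w' => ∫⁻ u, ‖V D u w - V D u w'‖ₑ ^ 2 ∂ν with hW
  have hUm : Measurable fun z : Data S × ℝ => U z.1 z.2 := by
    refine Measurable.lintegral_prod_right' (f := fun z : (Data S × ℝ) × ℝ =>
      ‖V z.1.1 z.2 z.1.2‖ₑ) (Measurable.enorm ?_)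
    exact hVm.comp (f := fun z : (Data S × ℝ) × ℝ => (z.1.1, z.2, z.1.2)) (by fun_prop)
  have hWm : Measurable fun z : Data S × ℝ × ℝ => W z.1 z.2.1 z.2.2 := by
    refine Measurable.lintegral_prod_right' (f := fun z : (Data S × ℝ × ℝ) × ℝ =>
      ‖V z.1.1 z.2 z.1.2.1 - V z.1.1 z.2 z.1.2.2‖ₑ ^ 2) (Measurable.pow_const (Measurable.enorm
        (Measurable.sub ?_ ?_)) 2)
    · exact hVm.comp (f := fun z : (Data S × ℝ × ℝ) × ℝ => (z.1.1, z.2, z.1.2.1)) (by fun_prop)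
    · exact hVm.comp (f := fun z : (Data S × ℝ × ℝ) × ℝ => (z.1.1, z.2, z.1.2.2)) (by fun_prop)
  set T₁ : Data S → ℝ≥0∞ := fun D => ∫⁻ w in I, U D w with hT₁
  set T₂ : Data S → ℝ≥0∞ := fun D => ∫⁻ w in I, ∫⁻ w' in I,
    W D w w' * ofReal (|w - w'| ^ (-(9 / 4) : ℝ)) with hT₂
  have hpow : Measurable fun z : ℝ × ℝ => ofReal (|z.1 - z.2| ^ (-(9 / 4) : ℝ)) := by fun_prop
  have hWm' : Measurable fun z : (Data S × ℝ) × ℝ =>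
      W z.1.1 z.1.2 z.2 * ofReal (|z.1.2 - z.2| ^ (-(9 / 4) : ℝ)) :=
    (hWm.comp (f := fun z : (Data S × ℝ) × ℝ => (z.1.1, z.1.2, z.2))
      (by fun_prop)).mul (hpow.comp (f := fun z : (Data S × ℝ) × ℝ => (z.1.2, z.2)) (by fun_prop))
  have hT₁m : Measurable T₁ := hUm.lintegral_prod_right'
  have hWm'' : Measurable fun z : Data S × ℝ =>
    ∫⁻ w' in I, W z.1 z.2 w' * ofReal (|z.2 - w'| ^ (-(9 / 4) : ℝ)) :=
    hWm'.lintegral_prod_right'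
  have hT₂m : Measurable T₂ := hWm''.lintegral_prod_right'
  have mV : ∀ u ∈ I, ∀ w ∈ I, HasMoments (𝓢) (fun D => V D u w) :=
    fun u hu w hw => hX.hasMoments_pathDeviation hφ N n hu hw
  have hT₁E : ∫⁻ D, T₁ D ∂𝓢 ≤ ofReal ((b - a) * (C₁ + 1) * r) := by
    rw [lintegral_lintegral_swap hUm.aemeasurable]
    calc _ ≤ ∫⁻ _ in I, ofReal ((C₁ + 1) * r) := by
          refine setLIntegral_mono' measurableSet_Icc fun w hw => ?_
          rw [lintegral_lintegral_swap (hVm.comp (f := fun z : Data S × ℝ =>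
            (z.1, z.2, w)) (by fun_prop)).enorm.aemeasurable]
          calc _ ≤ ∫⁻ _, ofReal ((C₁ + 1) * r) ∂ν := by
                refine lintegral_mono_ae ?_
                filter_upwards [ae_mem_timeLaw] with u hu
                calc ∫⁻ D, ‖V D u w‖ₑ ∂𝓢
                    ≤ ∫⁻ D, (ofReal (1 / r) * ‖V D u w‖ₑ ^ 2 +
                        ofReal (1 / (1 / r))) ∂𝓢 :=
                      lintegral_mono fun D => enorm_le_mul_sq_add _ (by positivity)
                  _ = ofReal (1 / r) * ofReal (∫ D, V D u w ^ 2 ∂𝓢) + ofReal r := by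
                    rw [lintegral_add_right _ measurable_const,
                      lintegral_const_mul' _ _ ofReal_ne_top,
                      (mV u hu w hw).lintegral_enorm_sq]
                    simp
                  _ ≤ ofReal (1 / r) * ofReal (C₁ * r ^ 2) + ofReal r := by
                    gcongr
                    exact ((hC₁ N n h hh hh1 u hu w hw).1).trans (by gcongr)
                  _ = _ := by
                    rw [← ofReal_mul (by positivity), ← ofReal_add (by positivity) hr.le]
                    congr 1; field_simp
            _ = _ := by simp
      _ = _ := by
        rw [setLIntegral_const, volume_Icc, ← ofReal_mul (by positivity)]
        congr 1; ring
  have hT₂E : ∫⁻ D, T₂ D ∂𝓢 ≤ ofReal (C₁ * r ^ 2 * ((b - a) * C₃)) := by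
    rw [lintegral_lintegral_swap hWm''.aemeasurable]
    calc _ ≤ ∫⁻ _ in I, ofReal (C₁ * r ^ 2) * C₃ := by
          refine setLIntegral_mono' measurableSet_Icc fun w hw => ?_
          have hWw : Measurable fun z : Data S × ℝ =>
              W z.1 w z.2 * ofReal (|w - z.2| ^ (-(9 / 4) : ℝ)) :=
            hWm'.comp (f := fun z : Data S × ℝ => ((z.1, w), z.2)) (by fun_prop)
          rw [lintegral_lintegral_swap hWw.aemeasurable]
          calc _ ≤ ∫⁻ w' in I, ofReal (C₁ * r ^ 2) *
                ofReal (|w - w'| ^ (-(3 / 4) : ℝ)) := by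
                refine setLIntegral_mono' measurableSet_Icc fun w' hw' => ?_
                rw [lintegral_mul_const' _ _ ofReal_ne_top]
                rcases eq_or_ne w w' with rfl | hne
                · simp [hW]
                have hpos : 0 < |w - w'| := abs_pos.2 (sub_ne_zero.2 hne)
                have hWE : ∫⁻ D, W D w w' ∂𝓢 ≤
                    ofReal (C₁ * r ^ 2 * |w - w'| ^ (3 / 2 : ℝ)) := by
                  rw [lintegral_lintegral_swap (((hVm.comp (f := fun z :
                    Data S × ℝ => (z.1, z.2, w)) (by fun_prop)).sub
                    (hVm.comp (f := fun z : Data S × ℝ => (z.1, z.2, w'))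
                    (by fun_prop))).enorm.pow_const 2).aemeasurable]
                  calc _ ≤ ∫⁻ _, ofReal (C₁ * r ^ 2 * |w - w'| ^ (3 / 2 : ℝ)) ∂ν := by
                        refine lintegral_mono_ae ?_
                        filter_upwards [ae_mem_timeLaw] with u hu
                        have := ((mV u hu w hw).sub (mV u hu w' hw')).lintegral_enorm_sq
                        rw [this]
                        refine ofReal_le_ofReal ?_
                        exact ((hC₁ N n h hh hh1 u hu w hw).2 w' hw').trans (by gcongr)
                    _ = _ := by simp
                calc _ ≤ ofReal (C₁ * r ^ 2 * |w - w'| ^ (3 / 2 : ℝ)) *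
                      ofReal (|w - w'| ^ (-(9 / 4) : ℝ)) := by gcongr
                  _ = _ := by
                    rw [← ofReal_mul (by positivity), ← ofReal_mul (by positivity),
                      mul_assoc, ← Real.rpow_add hpos]
                    norm_num
            _ ≤ _ := by
              rw [lintegral_const_mul' _ _ ofReal_ne_top]
              gcongr
              exact hC₃ w hw
      _ = _ := by
        rw [setLIntegral_const, volume_Icc, ← ofReal_coe_nnreal,
          ← ofReal_mul (by positivity), ← ofReal_mul (by positivity)]
        congr 1; ring
  refine ⟨fun D => ofReal (B * M * C₂) * (T₁ D + (ofReal (1 / r) * T₂ D + ofReal r)), ?_, ?_, ?_⟩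
  · exact (hT₁m.add ((hT₂m.const_mul _).add_const _)).const_mul _
  · rw [lintegral_const_mul' _ _ ofReal_ne_top, lintegral_add_left hT₁m,
      lintegral_add_right _ measurable_const, lintegral_const_mul' _ _ ofReal_ne_top]
    calc _ ≤ ofReal (B * M * C₂) * (ofReal ((b - a) * (C₁ + 1) * r) +
          (ofReal (1 / r) * ofReal (C₁ * r ^ 2 * ((b - a) * C₃)) + ofReal r)) := by
          gcongr
          simp
      _ = _ := by
        rw [← ofReal_mul (by positivity), ← ofReal_add (by positivity) hr.le,
          ← ofReal_add (by positivity) (by positivity),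
          ← ofReal_mul (by positivity)]
        congr 1; field_simp
  · have hreg : ∀ᵐ D ∂𝓢, ∀ i, IsRegularPath a b f X σ φ (D i).1 :=
      ae_all_iff.2 fun i => (measurePreserving_process i).quasiMeasurePreserving.ae
        (hX.ae_isRegularPath (σ := σ) hf hφ.toHasLinearGrowth)
    filter_upwards [hreg] with D hD t ht α p hα hp
    have hβm := hK.measurable_scaledKernel_sub h t
    have hβ := fun u => hK.abs_scaledKernel_le hh hB (u - t)
    have hUDm : Measurable fun w => U D w := hUm.comp (f := fun w : ℝ => (D, w)) (by fun_prop)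
    rw [hX.processPart_condProd_eq hab hf hφ hα hβm hp hβ hD, ← enorm_eq_ofReal_abs]
    have hVDm : Measurable fun q : ℝ × ℝ => V D q.1 q.2 :=
      hVm.comp (f := fun q : ℝ × ℝ => (D, q)) (by fun_prop)
    calc _ ≤ ∫⁻ q, ‖α q.1 * scaledKernel K h (q.2 - t) * V D q.1 q.2‖ₑ ∂(ν.prod ν) :=
          enorm_integral_le_lintegral_enorm _
      _ ≤ ∫⁻ q, ofReal p * (ofReal (B / h) *
          (Icc (t - h) (t + h)).indicator (fun _ => ‖V D q.1 q.2‖ₑ) q.2) ∂(ν.prod ν) := by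
        refine lintegral_mono fun q => ?_
        rw [enorm_mul, enorm_mul, mul_assoc]
        refine mul_le_mul' (by rw [enorm_eq_ofReal_abs]; exact ofReal_le_ofReal (hp _)) ?_
        by_cases hq : q.2 ∈ Icc (t - h) (t + h)
        · rw [indicator_of_mem hq]
          gcongr
          rw [enorm_eq_ofReal_abs]; exact ofReal_le_ofReal (hβ _)
        · have : h < |q.2 - t| := by
            by_contra hcon
            rw [not_lt, abs_le] at hcon
            exact hq ⟨by linarith, by linarith⟩
          rw [hK.scaledKernel_eq_zero hh this]
          simp
      _ = ofReal p * (ofReal (B / h) * ∫⁻ w, (Icc (t - h) (t + h)).indicator (U D) w ∂ν) := by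
        rw [lintegral_const_mul' _ _ ofReal_ne_top,
          lintegral_const_mul' _ _ ofReal_ne_top, lintegral_prod_symm]
        · congr 3
          ext w
          by_cases hw : w ∈ Icc (t - h) (t + h)
          · simp only [indicator_of_mem hw, hU]
          · simp only [indicator_of_notMem hw, lintegral_zero]
        · have : Measurable fun q : ℝ × ℝ => (Prod.snd ⁻¹' Icc (t - h) (t + h)).indicator
              (fun q : ℝ × ℝ => ‖V D q.1 q.2‖ₑ) q :=
            hVDm.enorm.indicator (measurable_snd measurableSet_Icc)
          exact this.aemeasurable
      _ ≤ ofReal p * (ofReal (B / h) * (M * ∫⁻ w in I ∩ Icc (t - h) (t + h), U D w)) := by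
        gcongr
        refine (hM' _).trans_eq ?_
        rw [lintegral_indicator measurableSet_Icc, Measure.restrict_restrict measurableSet_Icc,
          inter_comm]
      _ ≤ ofReal p * (ofReal (B / h) * (M * (ofReal (C₂ * h) *
          (T₁ D + (ofReal (1 / r) * T₂ D + ofReal r))))) := by
        gcongr
        refine hC₂ (U D) (W D) hUDm (fun w => by simp [hW]) (fun w hw w' hw' k hk => ?_) r h t hr hh
          hhab ht
        have m1 : Measurable fun u => V D u w' := hVDm.comp (f := fun u => (u, w')) (by fun_prop)
        calc U D w ≤ ∫⁻ u, (‖V D u w'‖ₑ + (ofReal k * ‖V D u w - V D u w'‖ₑ ^ 2 +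
              ofReal (1 / k))) ∂ν := by
              refine lintegral_mono fun u => ?_
              have : V D u w = V D u w' + (V D u w - V D u w') := by ring
              calc ‖V D u w‖ₑ ≤ ‖V D u w'‖ₑ + ‖V D u w - V D u w'‖ₑ := by
                    conv_lhs => rw [this]
                    exact enorm_add_le _ _
                _ ≤ _ := by gcongr; exact enorm_le_mul_sq_add _ hk
          _ = _ := by
            rw [lintegral_add_left m1.enorm, lintegral_add_right _ measurable_const,
              lintegral_const_mul' _ _ ofReal_ne_top]
            simp [hU, hW]
      _ = _ := by
        congr 1
        rw [← mul_assoc, ← mul_assoc, ← ofReal_coe_nnreal,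
          ← ofReal_mul (by positivity), ← ofReal_mul (by positivity)]
        congr 2
        field_simp

end PathDeviation

section Uniform

variable {S : Type*} [MeasurableSpace S] {ρ : Measure S} [IsProbabilityMeasure ρ] {a b : ℝ}
  {X : ℝ → S → ℝ} {σ : ℝ} {φ f : ℝ → ℝ}

local notation "𝓣" => timeLaw a b f
local notation "ξ[" α "]" => obsMark X φ α
local notation "I" => Icc a b
local notation "𝓛" => obsLaw a b f σ
local notation "𝓢" => sampleLaw ρ 𝓛

/-- Bounded weights that depend on a parameter in a Lipschitz way. -/
structure IsWeightFamily (a b p L : ℝ) (α : ℝ → ℝ → ℝ) : Prop where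
  measurable : ∀ t ∈ Icc a b, Measurable (α t)
  abs_le : ∀ t ∈ Icc a b, ∀ u, |α t u| ≤ p
  abs_sub_le : ∀ t ∈ Icc a b, ∀ t' ∈ Icc a b, ∀ u, |α t u - α t' u| ≤ L * |t - t'|

lemma noisePart_eq {U : Type*} [MeasurableSpace U] (κ : Measure U) (N : ℕ → ℕ) (n : ℕ)
  (F F' : S × U → ℝ) (D : ℕ → S × (ℕ → U)) :
  noisePart κ N n F F' D = pairAverage N n F F' D -
    ∑ i ∈ range n, obsWeight N n * ((N i : ℝ) * (N i - 1)) * condProd κ F F' (D i).1 := by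
  rw [noisePart, pairAverage, ← sum_sub_distrib]
  refine sum_congr rfl fun i _ => ?_
  rw [subjectPairSum, centeredPairSum, condProd]
  ring

lemma abs_pairAverage_sub_le {α β α' β' : ℝ → ℝ} {ε : ℝ}
  (hε : ∀ u w, |α u * β w - α' u * β' w| ≤ ε) (N : ℕ → ℕ) (n : ℕ) (D : Data S) :
  |pairAverage N n ξ[α] ξ[β] D - pairAverage N n ξ[α'] ξ[β'] D| ≤
    ε * pairAverage N n (fun d => |φ (X d.2.1 d.1 + d.2.2)|)
      (fun d => |φ (X d.2.1 d.1 + d.2.2)|) D := by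
  rw [pairAverage, pairAverage, pairAverage, ← sum_sub_distrib, mul_sum]
  refine (abs_sum_le_sum_abs _ _).trans (sum_le_sum fun i _ => ?_)
  rw [← mul_sub, ← sum_sub_distrib, abs_mul, abs_of_nonneg obsWeight_nonneg, mul_left_comm, mul_sum]
  refine mul_le_mul_of_nonneg_left ((abs_sum_le_sum_abs _ _).trans
    (sum_le_sum fun p _ => ?_)) obsWeight_nonneg
  simp only [obsMark]
  rw [← abs_mul]
  have e : ∀ x y x' y' F G : ℝ, |x * F * (y * G) - x' * F * (y' * G)| =
    |x * y - x' * y'| * |F * G| := fun x y x' y' F G => by rw [← abs_mul]; ring_nf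
  rw [e]
  exact mul_le_mul_of_nonneg_right (hε _ _) (abs_nonneg _)

/-- A random Lipschitz constant for the dependence on the weights. -/
lemma IsCenteredProcess.exists_lipschitz_bound (hX : IsCenteredProcess ρ a b X)
  (hf : IsSamplingDensity a b f) (hφ : HasLinearGrowth φ) [IsProbabilityMeasure 𝓛] :
  ∃ C : ℝ, 0 ≤ C ∧ ∀ (N : ℕ → ℕ) (n : ℕ), 0 < factMoment N n 2 →
    ∃ ζ : Data S → ℝ, Integrable ζ 𝓢 ∧ (∀ D, 0 ≤ ζ D) ∧ ∫ D, ζ D ∂𝓢 ≤ C ∧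
      ∀ᵐ D ∂𝓢, ∀ (α β α' β' : ℝ → ℝ) (p ε : ℝ), Measurable α →
        Measurable β → Measurable α' → Measurable β' → (∀ u, |α u| ≤ p) → (∀ u, |β u| ≤ p) →
        (∀ u, |α' u| ≤ p) → (∀ u, |β' u| ≤ p) → (∀ u w, |α u * β w - α' u * β' w| ≤ ε) →
        |noisePart 𝓛 N n ξ[α] ξ[β] D - noisePart 𝓛 N n ξ[α'] ξ[β'] D| ≤ ζ D * ε ∧
        |(pairAverage N n ξ[α] ξ[β] D - ∫ x, condProd 𝓛 ξ[α] ξ[β] x ∂ρ) -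
          (pairAverage N n ξ[α'] ξ[β'] D - ∫ x, condProd 𝓛 ξ[α'] ξ[β'] x ∂ρ)| ≤
          ζ D * ε := by
  have := hf.isProbabilityMeasure
  set κ := 𝓛 with hκ
  set F : S × (ℝ × ℝ) → ℝ := fun d => |φ (X d.2.1 d.1 + d.2.2)| with hF
  have mF : HasMoments (ρ.prod κ) F := (hX.hasMoments_obs (σ := σ) hf hφ).abs
  have hF0 : ∀ d, 0 ≤ F d := fun d => abs_nonneg _
  set Q : S → ℝ := fun x => (∫ d, F (x, d) ∂κ) ^ 2 with hQ
  have mQ : HasMoments ρ Q := mF.integral_prod_right.pow 2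
  have hQ0 : ∀ x, 0 ≤ Q x := fun x => sq_nonneg _
  set q := ∫ x, Q x ∂ρ with hq
  have hq0 : 0 ≤ q := integral_nonneg hQ0
  set q₂ := ∫ d, F d ^ 2 ∂(ρ.prod κ) with hq₂
  have hq₂0 : 0 ≤ q₂ := integral_nonneg fun _ => sq_nonneg _
  refine ⟨q₂ + q + q, by positivity, fun N n hN => ?_⟩
  set μ := sampleLaw ρ κ with hμ
  set v : ℕ → ℝ := fun i => obsWeight N n * ((N i : ℝ) * (N i - 1))
  have hw0 : ∀ i, 0 ≤ v i := fun i => mul_nonneg obsWeight_nonneg (mul_sub_one_nonneg _)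
  have hv : ∑ i ∈ range n, v i = 1 := sum_pairWeight hN
  have mp : ∀ i j : ℕ, MeasurePreserving (fun D : Data S => ((D i).1, (D i).2 j)) μ
      (ρ.prod κ) := fun i j =>
    (measurePreserving_eval_right (ρ := ρ) (κ := κ) j).comp (measurePreserving_subject i)
  have mFF : ∀ i j k, HasMoments μ fun D : Data S =>
      F ((D i).1, (D i).2 j) * F ((D i).1, (D i).2 k) := fun i j k =>
    (mF.comp (mp i j)).mul (mF.comp (mp i k))
  have hint : ∀ i j, ∫ D : Data S, F ((D i).1, (D i).2 j) ^ 2 ∂μ = q₂ := fun i j => by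
    have := integral_map (μ := μ) (mp i j).measurable.aemeasurable (f := fun d => F d ^ 2)
      (by rw [(mp i j).map_eq]; exact (mF.pow 2).aestronglyMeasurable)
    rw [(mp i j).map_eq] at this
    exact this.symm
  have m1 : HasMoments μ (pairAverage N n F F) :=
    HasMoments.sum _ fun i _ => (HasMoments.sum _ fun p _ => mFF i p.1 p.2).const_mul _
  have mQi : ∀ i, HasMoments μ fun D => Q (D i).1 := fun i => mQ.comp (measurePreserving_process i)
  have m2 : HasMoments μ (fun D => ∑ i ∈ range n, v i * Q (D i).1) :=
    HasMoments.sum _ fun i _ => (mQi i).const_mul _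
  have e1 : ∫ D, pairAverage N n F F D ∂μ ≤ q₂ := by
    simp only [pairAverage]
    rw [integral_finsetSum _ fun i _ =>
      ((HasMoments.sum _ fun p _ => mFF i p.1 p.2).const_mul _).integrable]
    calc _ ≤ ∑ i ∈ range n, v i * q₂ := by
          refine sum_le_sum fun i _ => ?_
          rw [integral_const_mul, integral_finsetSum _ fun p _ => (mFF i p.1 p.2).integrable,
            mul_assoc]
          refine mul_le_mul_of_nonneg_left ?_ obsWeight_nonneg
          calc _ ≤ ∑ p ∈ (range (N i)).offDiag, q₂ := by
                refine sum_le_sum fun p _ => ?_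
                calc _ ≤ ∫ D, (1 / 2 * F ((D i).1, (D i).2 p.1) ^ 2 +
                      1 / 2 * F ((D i).1, (D i).2 p.2) ^ 2) ∂μ := by
                      refine integral_mono (mFF i p.1 p.2).integrable
                        ((((mF.comp (mp i p.1)).pow 2).const_mul _).add
                          (((mF.comp (mp i p.2)).pow 2).const_mul _)).integrable fun D => ?_
                      simp only
                      nlinarith [sq_nonneg (F ((D i).1, (D i).2 p.1) - F ((D i).1, (D i).2 p.2))]
                  _ = q₂ := by
                    rw [integral_add (((mF.comp (mp i p.1)).pow 2).const_mul _).integrable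
                      (((mF.comp (mp i p.2)).pow 2).const_mul _).integrable, integral_const_mul,
                      integral_const_mul, hint, hint]
                    ring
            _ = _ := by
              rw [sum_const, Finset.offDiag_card, Finset.card_range, nsmul_eq_mul,
                Nat.cast_sub (Nat.le_mul_self _)]
              push_cast; ring
      _ = q₂ := by rw [← sum_mul, hv, one_mul]
  have e2 : ∫ D : Data S, ∑ i ∈ range n, v i * Q (D i).1 ∂μ = q := by
    have hi : ∀ i, ∫ D : Data S, Q (D i).1 ∂μ = q := fun i => by
      have := integral_map (μ := μ) (measurePreserving_process (ρ := ρ) (κ := κ) i).measurable.aemeasurable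
        (f := Q) (by rw [(measurePreserving_process i).map_eq]; exact mQ.aestronglyMeasurable)
      rw [(measurePreserving_process i).map_eq] at this
      exact this.symm
    rw [integral_finsetSum _ fun i _ => ((mQi i).const_mul _).integrable]
    simp_rw [integral_const_mul, hi]
    rw [← sum_mul, hv, one_mul]
  refine ⟨fun D => pairAverage N n F F D + (∑ i ∈ range n, v i * Q (D i).1) + q,
    ((m1.add m2).add (.const q)).integrable, fun D => ?_, ?_, ?_⟩
  · refine add_nonneg (add_nonneg (sum_nonneg fun i _ => mul_nonneg obsWeight_nonneg
      (sum_nonneg fun p _ => mul_nonneg (hF0 _) (hF0 _)))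
      (sum_nonneg fun i _ => mul_nonneg (hw0 i) (hQ0 _))) hq0
  · rw [integral_add_add m1.integrable m2.integrable (integrable_const _), e2]
    simp only [integral_const, probReal_univ, smul_eq_mul, one_mul]
    gcongr
  · have hreg := hX.ae_isRegularPath (σ := σ) hf hφ
    have hregD : ∀ᵐ D ∂μ, ∀ i, IsRegularPath a b f X σ φ (D i).1 :=
      ae_all_iff.2 fun i => (measurePreserving_process i).quasiMeasurePreserving.ae hreg
    filter_upwards [hregD] with D hD α β α' β' p ε hα hβ hα' hβ' h1 h2 h3 h4 hε
    have hε0 : 0 ≤ ε := (abs_nonneg _).trans (hε 0 0)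
    have a1 := abs_pairAverage_sub_le (X := X) (φ := φ) hε N n D
    have a1' : 0 ≤ pairAverage N n F F D := sum_nonneg fun i _ => mul_nonneg obsWeight_nonneg
      (sum_nonneg fun p _ => mul_nonneg (hF0 _) (hF0 _))
    have a2' : 0 ≤ ∑ i ∈ range n, v i * Q (D i).1 :=
      sum_nonneg fun i _ => mul_nonneg (hw0 i) (hQ0 _)
    constructor
    · rw [noisePart_eq, noisePart_eq]
      have a2 : |(∑ i ∈ range n, v i * condProd κ ξ[α] ξ[β] (D i).1) -
          ∑ i ∈ range n, v i * condProd κ ξ[α'] ξ[β'] (D i).1| ≤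
          ε * ∑ i ∈ range n, v i * Q (D i).1 := by
        rw [← sum_sub_distrib, mul_sum]
        refine (abs_sum_le_sum_abs _ _).trans (sum_le_sum fun i _ => ?_)
        rw [← mul_sub, abs_mul, abs_of_nonneg (hw0 i), mul_left_comm ε]
        exact mul_le_mul_of_nonneg_left
          ((hD i).abs_condProd_sub_le hα hβ hα' hβ' h1 h2 h3 h4 hε) (hw0 i)
      rw [abs_le] at a1 a2 ⊢
      have := mul_nonneg hε0 hq0
      constructor <;> linarith [a1.1, a1.2, a2.1, a2.2]
    · have mc : ∀ {α β : ℝ → ℝ}, Measurable α → Measurable β → (∀ u, |α u| ≤ p) →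
          (∀ u, |β u| ≤ p) → HasMoments ρ (condProd κ ξ[α] ξ[β]) :=
        fun hα hβ h1 h2 => (hX.hasMoments_obsMark hf hφ hα h1).integral_prod_right.mul
          (hX.hasMoments_obsMark hf hφ hβ h2).integral_prod_right
      have a3 : |∫ x, condProd κ ξ[α] ξ[β] x ∂ρ - ∫ x, condProd κ ξ[α'] ξ[β'] x ∂ρ| ≤ ε * q := by
        rw [← integral_sub (mc hα hβ h1 h2).integrable (mc hα' hβ' h3 h4).integrable, hq,
          ← integral_const_mul, ← norm_eq_abs]
        refine norm_integral_le_of_norm_le (mQ.const_mul ε).integrable ?_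
        filter_upwards [hreg] with x hx
        exact hx.abs_condProd_sub_le hα hβ hα' hβ' h1 h2 h3 h4 hε
      have := mul_nonneg hε0 a2'
      rw [abs_le] at a1 a3 ⊢
      constructor <;> linarith [a1.1, a1.2, a3.1, a3.2]

variable {K : ℝ → ℝ}

lemma IsKernel.integral_abs_scaledKernel_le (hK : IsKernel K) {h : ℝ} (hh : 0 < h) {M : ℝ≥0}
  (hM : 𝓣 ≤ M • volume.restrict I) (s : ℝ) :
  ∫ u, |scaledKernel K h (u - s)| ∂𝓣 ≤ M := by
  simp_rw [abs_of_nonneg (hK.scaledKernel_nonneg hh _)]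
  exact hK.smoothedDensity_le hh hM s

lemma abs_mul_sub_mul_le {x y x' y' p r ε ε' : ℝ} (hx : |x - x'| ≤ ε) (hy : |y - y'| ≤ ε')
  (hyr : |y| ≤ r) (hxp : |x'| ≤ p) : |x * y - x' * y'| ≤ ε * r + p * ε' := by
  have e : x * y - x' * y' = (x - x') * y + x' * (y - y') := by ring
  rw [e]
  refine (abs_add_le _ _).trans ?_
  rw [abs_mul, abs_mul]
  have := (abs_nonneg _).trans hx
  have := (abs_nonneg _).trans hxp
  gcongr

lemma add_le_add_mul_add {A B x y : ℝ} (hA : 0 ≤ A) (hB : 0 ≤ B) (hx : 0 ≤ x) (hy : 0 ≤ y) :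
  A * x + B * y ≤ (A + B) * (x + y) := by linarith [mul_nonneg hA hy, mul_nonneg hB hx]

/-- The estimators with two kernel weights, uniformly over the square. -/
lemma IsCenteredProcess.exists_measure_pairAverage_le (hab : a < b) (hX : IsCenteredProcess ρ a b X)
  (hf : IsSamplingDensity a b f) (hφ : HasLinearGrowth φ) (hK : IsKernel K)
  [IsProbabilityMeasure 𝓛] {q : ℕ} (hq : 1 ≤ q) :
  ∃ C : ℝ, 0 ≤ C ∧ ∀ (N : ℕ → ℕ) (n : ℕ) (h r w : ℝ), 0 < factMoment N n 2 → 0 < h → h ≤ 1 →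
    pointVar h N n ≤ 1 → h ≤ r → pointVar h N n ≤ r ^ 2 → 0 < w →
    𝓢 {D | ∃ x ∈ I ×ˢ I, w * r <
      |pairAverage N n ξ[𝓚[K; h; x.1]] ξ[𝓚[K; h; x.2]] D -
        ∫ z, condProd 𝓛 ξ[𝓚[K; h; x.1]] ξ[𝓚[K; h; x.2]] z ∂ρ|} ≤
      ofReal (C * (1 / (h ^ 10 * w ^ (2 * q)) + 1 / w)) := by
  obtain ⟨M, hM⟩ := hf.exists_le
  obtain ⟨B, hB1, hB⟩ := hK.exists_le
  obtain ⟨L, hL0, hL⟩ := hK.exists_scaledKernel_lipschitz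
  obtain ⟨C₁, hC₁0, hC₁⟩ := hX.exists_integral_pairAverage_sub_pow_le (σ := σ) hf hφ
    (A := M + 1) (by positivity) hB1 hq
  obtain ⟨C₂, hC₂0, hC₂⟩ := hX.exists_lipschitz_bound (σ := σ) hf hφ
  set κ := 𝓛 with hκ
  refine ⟨(b - a + 1) ^ 2 * C₁ * 2 ^ (2 * q) + 4 * B * L * C₂, by positivity,
    fun N n h r w hN hh hh1 hΓ1 hhr hΓ hw => ?_⟩
  have hr := hh.trans_le hhr
  obtain ⟨ζ, iζ, ζ0, hζ, hζL⟩ := hC₂ N n hN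
  have mK := fun s => hK.measurable_scaledKernel_sub h s
  have bK := fun x => hK.abs_scaledKernel_le hh hB x
  have iK : ∀ s, ∫ u, |scaledKernel K h (u - s)| ∂𝓣 ≤ M + 1 := fun s =>
    (hK.integral_abs_scaledKernel_le hh hM s).trans (by simp)
  obtain ⟨t, ht, htη, hc⟩ := exists_net hab.le (pow_pos hh 4) (pow_le_one₀ hh.le hh1)
  have key := measure_exists_lt_abs_le (μ := sampleLaw ρ κ) (T := I ×ˢ I) (t := t ×ˢ t)
    (by rw [Finset.coe_product]; exact prod_mono ht ht) (η := h ^ 4) (fun x hx => ?_)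
    (F := fun x D => pairAverage N n ξ[𝓚[K; h; x.1]] ξ[𝓚[K; h; x.2]] D -
      ∫ z, condProd 𝓛 ξ[𝓚[K; h; x.1]] ξ[𝓚[K; h; x.2]] z ∂ρ)
    (ζ := fun D => ζ D * (2 * (B * L) / h ^ 3))
    (ae_of_all _ fun D => mul_nonneg (ζ0 D) (by positivity)) ?_ (q := q)
    (A := C₁ * (1 / h ^ 2 * (r ^ 2) ^ q)) (B := C₂ * (2 * (B * L) / h ^ 3)) (fun x hx => ?_)
    (iζ.mul_const _) (by rw [integral_mul_const]; gcongr) (u := w * r) (by positivity) (by positivity)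
  · refine key.trans ?_
    rw [Finset.card_product]
    push_cast
    rw [← ofReal_natCast, ← ofReal_mul (by positivity), ← ofReal_mul (by positivity),
      ← ofReal_add (by positivity) (by positivity)]
    refine ofReal_le_ofReal ?_
    calc _ ≤ (b - a + 1) / h ^ 4 * ((b - a + 1) / h ^ 4) *
          (C₁ * (1 / h ^ 2 * (r ^ 2) ^ q) / (w * r / 2) ^ (2 * q)) +
          C₂ * (2 * (B * L) / h ^ 3) / (w * r / 2 / h ^ 4) := by
          gcongr
      _ = (b - a + 1) ^ 2 * C₁ * 2 ^ (2 * q) * (1 / (h ^ 10 * w ^ (2 * q))) +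
        4 * B * L * C₂ * (h / r) * (1 / w) := by
        rw [div_pow, mul_pow, ← pow_mul]
        field_simp
        ring
      _ ≤ (b - a + 1) ^ 2 * C₁ * 2 ^ (2 * q) * (1 / (h ^ 10 * w ^ (2 * q))) +
        4 * B * L * C₂ * 1 * (1 / w) := by
        gcongr
        exact div_le_one_of_le₀ hhr hr.le
      _ ≤ _ := by
        rw [mul_one]
        apply add_le_add_mul_add <;> positivity
  · obtain ⟨y₁, hy₁, h1⟩ := htη x.1 hx.1
    obtain ⟨y₂, hy₂, h2⟩ := htη x.2 hx.2
    exact ⟨(y₁, y₂), Finset.mk_mem_product hy₁ hy₂, by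
      rw [Prod.dist_eq, dist_eq, dist_eq]; exact max_le h1 h2⟩
  · filter_upwards [hζL] with D hD x _ y _
    have := (hD _ _ _ _ (B / h) (2 * (B * L) / h ^ 3 * dist x y) (mK x.1) (mK x.2) (mK y.1) (mK y.2)
      (fun _ => bK _) (fun _ => bK _) (fun _ => bK _) (fun _ => bK _) fun u w => ?_).2
    · rwa [← mul_assoc] at this
    · have d1 : |x.1 - y.1| ≤ dist x y := by rw [Prod.dist_eq, ← dist_eq]; exact le_max_left _ _
      have d2 : |x.2 - y.2| ≤ dist x y := by rw [Prod.dist_eq, ← dist_eq]; exact le_max_right _ _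
      have l : ∀ u s s' : ℝ, |s - s'| ≤ dist x y →
          |scaledKernel K h (u - s) - scaledKernel K h (u - s')| ≤ L / h ^ 2 * dist x y := by
        intro u s s' hs
        refine (hL h hh _ _).trans ?_
        gcongr
        rwa [sub_sub_sub_cancel_left, abs_sub_comm]
      refine (abs_mul_sub_mul_le (l u _ _ d1) (l w _ _ d2) (bK _) (bK _)).trans (le_of_eq ?_)
      field_simp
      ring
  · obtain ⟨h1, h2⟩ := hC₁ N n h _ _ hN hh hh1 hΓ1 (mK x.1) (mK x.2) (fun _ => bK _) (fun _ => bK _)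
      (iK _) (iK _)
    refine ⟨(h1.pow (2 * q)).integrable, h2.trans ?_⟩
    have := pointVar_nonneg (N := N) (n := n) hh
    gcongr

/-- The noise with one bounded weight and one kernel weight, uniformly over the interval. -/
lemma IsCenteredProcess.exists_measure_noisePart_le (hab : a < b) (hX : IsCenteredProcess ρ a b X)
  (hf : IsSamplingDensity a b f) (hφ : HasLinearGrowth φ) (hK : IsKernel K)
  [IsProbabilityMeasure 𝓛] {q : ℕ} (hq : 1 ≤ q) {p C₀ L' : ℝ} (hp : 1 ≤ p)
  (hC₀ : 0 ≤ C₀) (hL' : 0 ≤ L') :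
  ∃ C : ℝ, 0 ≤ C ∧ ∀ (N : ℕ → ℕ) (n : ℕ) (h r w θ : ℝ) (α : ℝ → ℝ → ℝ), 0 < factMoment N n 2 →
    0 < h → h ≤ θ → θ ≤ 1 → pointVar h N n ≤ θ ^ 2 → h ≤ r → pointVar h N n ≤ r ^ 2 →
    sharedVar h N n ≤ C₀ * (θ * r ^ 2) → 0 < w → IsWeightFamily a b p L' α →
    𝓢 {D | ∃ t ∈ I, w * r <
      |noisePart 𝓛 N n ξ[α t] ξ[𝓚[K; h; t]] D|} ≤
      ofReal (C * (θ ^ q / (h ^ 6 * w ^ (2 * q)) + 1 / w)) := by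
  obtain ⟨M, hM⟩ := hf.exists_le
  obtain ⟨B, hB1, hB⟩ := hK.exists_le
  obtain ⟨L, hL0, hL⟩ := hK.exists_scaledKernel_lipschitz
  have := hf.isProbabilityMeasure
  obtain ⟨C₁, hC₁0, hC₁⟩ := hX.exists_integral_noisePart_pow_le (σ := σ) hf hφ
    (A := M + p) (by positivity) hB1 hp hC₀ hq
  obtain ⟨C₂, hC₂0, hC₂⟩ := hX.exists_lipschitz_bound (σ := σ) hf hφ
  set κ := 𝓛 with hκ
  refine ⟨(b - a + 1) * C₁ * 2 ^ (2 * q) + 2 * (B * L' + p * L) * C₂, by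
    have := sub_pos.2 hab
    positivity,
    fun N n h r w θ α hN hh hhθ hθ1 hΓ1 hhr hΓ hS hw ⟨mα, bα, lα⟩ => ?_⟩
  have hh1 := hhθ.trans hθ1
  have hθ0 := hh.trans_le hhθ
  have hr := hh.trans_le hhr
  have hba := sub_pos.2 hab
  obtain ⟨ζ, iζ, ζ0, hζ, hζL⟩ := hC₂ N n hN
  have mK := fun s => hK.measurable_scaledKernel_sub h s
  have bK := fun x => hK.abs_scaledKernel_le hh hB x
  have iK : ∀ s, ∫ u, |scaledKernel K h (u - s)| ∂𝓣 ≤ M + p := fun s =>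
    (hK.integral_abs_scaledKernel_le hh hM s).trans (by linarith)
  have iα : ∀ t ∈ I, ∫ u, |α t u| ∂𝓣 ≤ M + p := fun t ht => by
    have := integral_mono (μ := 𝓣) (f := fun u => |α t u|) (g := fun _ => p)
      (Integrable.of_bound (mα t ht).norm.aestronglyMeasurable p (ae_of_all _ fun u => by
        simpa using bα t ht u)) (integrable_const p) (bα t ht)
    simp only [integral_const, probReal_univ, smul_eq_mul, one_mul] at this
    linarith [M.coe_nonneg]
  obtain ⟨s, hs, hsη, hc⟩ := exists_net hab.le (pow_pos hh 4) (pow_le_one₀ hh.le hh1)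
  have key := measure_exists_lt_abs_le (μ := sampleLaw ρ κ) (T := I) (t := s) hs (η := h ^ 4) hsη
    (F := fun t D => noisePart 𝓛 N n ξ[α t] ξ[𝓚[K; h; t]] D)
    (ζ := fun D => ζ D * ((B * L' + p * L) / h ^ 2))
    (ae_of_all _ fun D => mul_nonneg (ζ0 D) (by positivity)) ?_ (q := q)
    (A := C₁ * (1 / h ^ 2 * (θ * r ^ 2) ^ q)) (B := C₂ * ((B * L' + p * L) / h ^ 2)) (fun x hx => ?_)
    (iζ.mul_const _) (by rw [integral_mul_const]; gcongr) (u := w * r) (by positivity) (by positivity)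
  · refine key.trans ?_
    rw [← ofReal_natCast, ← ofReal_mul (by positivity),
      ← ofReal_add (by positivity) (by positivity)]
    refine ofReal_le_ofReal ?_
    calc _ ≤ (b - a + 1) / h ^ 4 *
          (C₁ * (1 / h ^ 2 * (θ * r ^ 2) ^ q) / (w * r / 2) ^ (2 * q)) +
          C₂ * ((B * L' + p * L) / h ^ 2) / (w * r / 2 / h ^ 4) := by
          gcongr
      _ = (b - a + 1) * C₁ * 2 ^ (2 * q) * (θ ^ q / (h ^ 6 * w ^ (2 * q))) +
        2 * (B * L' + p * L) * C₂ * (h * (h / r)) * (1 / w) := by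
        rw [div_pow, mul_pow, mul_pow, ← pow_mul]
        field_simp
      _ ≤ (b - a + 1) * C₁ * 2 ^ (2 * q) * (θ ^ q / (h ^ 6 * w ^ (2 * q))) +
        2 * (B * L' + p * L) * C₂ * (1 * 1) * (1 / w) := by
        gcongr
        exact div_le_one_of_le₀ hhr hr.le
      _ ≤ _ := by
        rw [mul_one, mul_one]
        apply add_le_add_mul_add <;> positivity
  · filter_upwards [hζL] with D hD x hx y hy
    have ep : p ≤ p + B / h := by linarith [div_nonneg (zero_le_one.trans hB1) hh.le]
    have eB : B / h ≤ p + B / h := by linarith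
    have := (hD _ _ _ _ (p + B / h) ((B * L' + p * L) / h ^ 2 * dist x y) (mα x hx) (mK x) (mα y hy) (mK y)
      (fun u => (bα x hx u).trans ep) (fun _ => (bK _).trans eB)
      (fun u => (bα y hy u).trans ep) (fun _ => (bK _).trans eB) fun u w => ?_).1
    · rwa [← mul_assoc] at this
    · have l : |scaledKernel K h (w - x) - scaledKernel K h (w - y)| ≤ L / h ^ 2 * dist x y := by
        refine (hL h hh _ _).trans ?_
        rw [sub_sub_sub_cancel_left, abs_sub_comm, dist_eq]
      refine (abs_mul_sub_mul_le (lα x hx y hy u) l (bK _) (bα y hy u)).trans ?_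
      rw [← dist_eq]
      calc _ = (B * L' * h + p * L) / h ^ 2 * dist x y := by field_simp
        _ ≤ _ := by
          have : B * L' * h ≤ B * L' := mul_le_of_le_one_right (by positivity) hh1
          gcongr
  · obtain ⟨h1, h2⟩ := hC₁ N n h θ (r ^ 2) _ _ hN hh hhθ hθ1 hΓ1 hΓ hS (mα x hx) (mK x) (bα x hx)
      (fun _ => bK _) (iα x hx) (iK _)
    exact ⟨(h1.pow (2 * q)).integrable, h2⟩

end Uniform

section Deviation

variable {S : Type*} [MeasurableSpace S] {ρ : Measure S} {a b : ℝ}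
  {X : ℝ → S → ℝ} {σ : ℝ} {φ f K : ℝ → ℝ}

local notation "ξ[" α "]" => obsMark X φ α
local notation "I" => Icc a b
local notation "𝓛" => obsLaw a b f σ

/-- The deviation of the weighted sum over pairs of observations from its mean. -/
def pairDeviation (ρ : Measure S) (κ : Measure (ℝ × ℝ)) (X : ℝ → S → ℝ) (φ : ℝ → ℝ) (N : ℕ → ℕ)
  (n : ℕ) (α β : ℝ → ℝ) (D : Data S) : ℝ :=
  pairAverage N n (obsMark X φ α) (obsMark X φ β) D -
    ∫ x, condProd κ (obsMark X φ α) (obsMark X φ β) x ∂ρ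

/-- The deviation for two kernel weights. -/
def kernelDeviation (ρ : Measure S) (κ : Measure (ℝ × ℝ)) (X : ℝ → S → ℝ) (φ : ℝ → ℝ) (N : ℕ → ℕ)
  (n : ℕ) (K : ℝ → ℝ) (h : ℝ) (D : Data S) (s t : ℝ) : ℝ :=
  pairDeviation ρ κ X φ N n 𝓚[K; h; s] 𝓚[K; h; t] D

variable [IsProbabilityMeasure ρ]

lemma measurable_kernelDeviation {κ : Measure (ℝ × ℝ)} [IsProbabilityMeasure κ]
  (hX : Measurable (Function.uncurry X)) (hφ : Measurable φ) (hK : IsKernel K) (N : ℕ → ℕ) (n : ℕ)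
  (h : ℝ) : Measurable fun z : Data S × ℝ × ℝ =>
    kernelDeviation ρ κ X φ N n K h z.1 z.2.1 z.2.2 := by
  have hk := (hK.continuous_scaledKernel h).measurable
  have hm : Measurable fun z : (ℝ × S) × (ℝ × ℝ) => ξ[𝓚[K; h; z.1.1]] (z.1.2, z.2) := by
    simp only [obsMark]
    refine (hk.comp (by fun_prop)).mul ?_
    exact (hφ.comp (measurable_obsResponse hX)).comp
      (f := fun z : (ℝ × S) × (ℝ × ℝ) => (z.1.2, z.2)) (by fun_prop)
  have hm' : Measurable fun z : ℝ × S => ∫ d, ξ[𝓚[K; h; z.1]] (z.2, d) ∂κ :=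
    hm.stronglyMeasurable.integral_prod_right'.measurable
  have hc : Measurable fun z : (ℝ × ℝ) × S => condProd κ ξ[𝓚[K; h; z.1.1]] ξ[𝓚[K; h; z.1.2]] z.2 :=
    (hm'.comp (f := fun z : (ℝ × ℝ) × S => (z.1.1, z.2)) (by fun_prop)).mul
      (hm'.comp (f := fun z : (ℝ × ℝ) × S => (z.1.2, z.2)) (by fun_prop))
  have hc' : Measurable fun q : ℝ × ℝ => ∫ x, condProd κ ξ[𝓚[K; h; q.1]] ξ[𝓚[K; h; q.2]] x ∂ρ :=
    hc.stronglyMeasurable.integral_prod_right'.measurable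
  unfold kernelDeviation pairDeviation pairAverage
  refine Measurable.sub (measurable_sum _ fun i _ => .const_mul (measurable_sum _
    fun p _ => .mul ?_ ?_) _) (hc'.comp measurable_snd)
  · exact hm.comp (f := fun z : Data S × ℝ × ℝ => ((z.2.1, (z.1 i).1), (z.1 i).2 p.1)) (by fun_prop)
  · exact hm.comp (f := fun z : Data S × ℝ × ℝ => ((z.2.2, (z.1 i).1), (z.1 i).2 p.2)) (by fun_prop)

/-- The deviations in mean square. -/
lemma IsCenteredProcess.exists_measure_lintegral_kernelDeviation_le (hab : a < b)
  (hX : IsCenteredProcess ρ a b X) (hf : IsSamplingDensity a b f) (hφ : HasLinearGrowth φ)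
  (hK : IsKernel K) [IsProbabilityMeasure 𝓛] :
  ∃ C : ℝ, 0 ≤ C ∧ ∀ (N : ℕ → ℕ) (n : ℕ) (h r m : ℝ), 0 < factMoment N n 2 → 0 < h → h ≤ 1 →
    pointVar h N n ≤ 1 → 0 < r → pointVar h N n ≤ r ^ 2 → 0 < m →
    sampleLaw ρ 𝓛 {D | ofReal ((m * r) ^ 2) <
      ∫⁻ s in I, ∫⁻ t in I, ‖kernelDeviation ρ 𝓛 X φ N n K h D s t‖ₑ ^ 2} ≤
      ofReal (C / m ^ 2) := by
  obtain ⟨M, hM⟩ := hf.exists_le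
  obtain ⟨B, hB1, hB⟩ := hK.exists_le
  obtain ⟨C, hC0, hC⟩ := hX.exists_integral_pairAverage_sub_sq_le (σ := σ) hf hφ
    (A := M + 1) (by positivity) hB1
  set κ := 𝓛 with hκ
  have hba := sub_pos.2 hab
  refine ⟨(b - a) ^ 2 * C, by positivity, fun N n h r m hN hh hh1 hΓ1 hr hΓ hm => ?_⟩
  have mK := fun s => hK.measurable_scaledKernel_sub h s
  have bK := fun x => hK.abs_scaledKernel_le hh hB x
  have iK : ∀ s, ∫ u, |scaledKernel K h (u - s)| ∂timeLaw a b f ≤ M + 1 := fun s =>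
    (hK.integral_abs_scaledKernel_le hh hM s).trans (by simp)
  have hmeas := measurable_kernelDeviation (ρ := ρ) (κ := κ) hX.measurable hφ.measurable hK N n h
  have m1 : Measurable fun z : (Data S × ℝ) × ℝ =>
      ‖kernelDeviation ρ κ X φ N n K h z.1.1 z.1.2 z.2‖ₑ ^ 2 :=
    (hmeas.comp (f := fun z : (Data S × ℝ) × ℝ => (z.1.1, z.1.2, z.2))
      (by fun_prop)).enorm.pow_const 2
  have m2 : Measurable fun z : Data S × ℝ =>
      ∫⁻ t in I, ‖kernelDeviation ρ κ X φ N n K h z.1 z.2 t‖ₑ ^ 2 :=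
    m1.lintegral_prod_right'
  have m3 : Measurable fun D : Data S => ∫⁻ s in I, ∫⁻ t in I,
    ‖kernelDeviation ρ κ X φ N n K h D s t‖ₑ ^ 2 := m2.lintegral_prod_right'
  have key : ∫⁻ D, (∫⁻ s in I, ∫⁻ t in I,
      ‖kernelDeviation ρ κ X φ N n K h D s t‖ₑ ^ 2) ∂sampleLaw ρ κ ≤
      ofReal ((b - a) ^ 2 * C * r ^ 2) := by
    rw [lintegral_lintegral_swap m2.aemeasurable]
    calc _ ≤ ∫⁻ _ in I, ∫⁻ _ in I, ofReal (C * r ^ 2) := by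
          refine lintegral_mono fun s => ?_
          have m4 : Measurable fun z : Data S × ℝ =>
              ‖kernelDeviation ρ κ X φ N n K h z.1 s z.2‖ₑ ^ 2 :=
            m1.comp (f := fun z : Data S × ℝ => ((z.1, s), z.2)) (by fun_prop)
          rw [lintegral_lintegral_swap m4.aemeasurable]
          refine lintegral_mono fun t => ?_
          obtain ⟨h1, h2⟩ := hC N n h _ _ hN hh hh1 hΓ1 (mK s) (mK t) (fun _ => bK _) (fun _ => bK _)
            (iK _) (iK _)
          exact (HasMoments.lintegral_enorm_sq h1).trans_le
            (ofReal_le_ofReal (h2.trans (by gcongr)))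
      _ = _ := by
        rw [setLIntegral_const, setLIntegral_const, volume_Icc,
          ← ofReal_mul (by positivity), ← ofReal_mul (by positivity)]
        congr 1; ring
  have hpos : 0 < (m * r) ^ 2 := by positivity
  have h1 := meas_ge_le_lintegral_div (μ := sampleLaw ρ κ) m3.aemeasurable
    (ε := ofReal ((m * r) ^ 2)) (by simpa using hpos.ne') ofReal_ne_top
  have h2 : {D | ofReal ((m * r) ^ 2) < ∫⁻ s in I, ∫⁻ t in I,
      ‖kernelDeviation ρ κ X φ N n K h D s t‖ₑ ^ 2} ⊆
      {D | ofReal ((m * r) ^ 2) ≤ ∫⁻ s in I, ∫⁻ t in I,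
      ‖kernelDeviation ρ κ X φ N n K h D s t‖ₑ ^ 2} := fun D hD =>
    LT.lt.le (show ofReal ((m * r) ^ 2) < _ from hD)
  refine (measure_mono h2).trans (h1.trans ((ENNReal.div_le_div_right key _).trans_eq ?_))
  rw [← ofReal_div_of_pos hpos]
  congr 1; field_simp

/-- The deviations with one bounded weight and one kernel weight, uniformly over the interval. -/
lemma IsCenteredProcess.exists_measure_pairDeviation_le (hab : a < b)
  (hX : IsCenteredProcess ρ a b X) (hf : IsSamplingDensity a b f) (hφ : IsMark σ φ)
  (hK : IsKernel K) [IsProbabilityMeasure 𝓛] {q : ℕ} (hq : 1 ≤ q) {p C₀ L' : ℝ}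
  (hp : 1 ≤ p) (hC₀ : 0 ≤ C₀) (hL' : 0 ≤ L') :
  ∃ C : ℝ, 0 ≤ C ∧ ∀ (N : ℕ → ℕ) (n : ℕ) (h r m θ : ℝ) (α : ℝ → ℝ → ℝ), 0 < factMoment N n 2 →
    0 < h → 2 * h ≤ b - a → h ≤ θ → θ ≤ 1 → pointVar h N n ≤ θ ^ 2 → h ≤ r →
    pointVar h N n ≤ r ^ 2 → sharedVar h N n ≤ C₀ * (θ * r ^ 2) → θ ^ q ≤ h ^ 6 → 1 ≤ m →
    IsWeightFamily a b p L' α → sampleLaw ρ 𝓛 {D | ∃ t ∈ I, m * r <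
      |pairDeviation ρ 𝓛 X φ N n (α t) 𝓚[K; h; t] D|} ≤
      ofReal (C / m) := by
  obtain ⟨C₁, hC₁0, hC₁⟩ := hX.exists_measure_noisePart_le (σ := σ) hab hf hφ.toHasLinearGrowth hK hq
    hp hC₀ hL'
  obtain ⟨C₂, hC₂0, hC₂⟩ := hX.exists_processPart_le (σ := σ) hab hf hφ hK
  set κ := 𝓛 with hκ
  refine ⟨C₁ * (2 ^ (2 * q) + 2) + 2 * p * C₂, by positivity,
    fun N n h r m θ α hN hh hhab hhθ hθ1 hΓ1 hhr hΓ hS hθq hm hα => ?_⟩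
  have hh1 := hhθ.trans hθ1
  have hθ0 := hh.trans_le hhθ
  have hr := hh.trans_le hhr
  have hm0 := zero_lt_one.trans_le hm
  obtain ⟨Z, mZ, eZ, hZ⟩ := hC₂ N n h r hh hh1 hhab hr hΓ
  have h1 := hC₁ N n h r (m / 2) θ α hN hh hhθ hθ1 hΓ1 hhr hΓ hS (by positivity) hα
  have h2 : sampleLaw ρ κ {D | ofReal (m * r / (2 * p)) ≤ Z D} ≤ ofReal (2 * p * C₂ / m) := by
    have hpos : 0 < m * r / (2 * p) := by positivity
    calc _ ≤ _ := meas_ge_le_lintegral_div mZ.aemeasurable (by simpa using hpos)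
          ofReal_ne_top
      _ ≤ ofReal (C₂ * r) / ofReal (m * r / (2 * p)) := by gcongr
      _ = _ := by
        rw [← ofReal_div_of_pos hpos]
        congr 1; field_simp
  have hsub : {D | ∃ t ∈ I, m * r <
        |pairDeviation ρ κ X φ N n (α t) 𝓚[K; h; t] D|} ≤ᵐ[sampleLaw ρ κ]
      ({D | ∃ t ∈ I, m / 2 * r < |noisePart κ N n ξ[α t] ξ[𝓚[K; h; t]] D|} ∪
        {D | ofReal (m * r / (2 * p)) ≤ Z D} : Set (Data S)) := by
    filter_upwards [hZ] with D hD hex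
    obtain ⟨t, ht, hlt⟩ : ∃ t ∈ I, m * r <
      |pairDeviation ρ κ X φ N n (α t) 𝓚[K; h; t] D| := hex
    rw [pairDeviation, pairAverage_sub_eq hN] at hlt
    rcases lt_or_ge (m / 2 * r) |noisePart κ N n ξ[α t] ξ[𝓚[K; h; t]] D| with hn | hn
    · exact Or.inl ⟨t, ht, hn⟩
    · refine Or.inr ?_
      have h3 := hD t ht (α t) p (hα.measurable t ht) (hα.abs_le t ht)
      have h4 : m * r / 2 ≤ |processPart ρ N n (condProd κ ξ[α t] ξ[𝓚[K; h; t]]) D| := by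
        have := abs_add_le (noisePart κ N n ξ[α t]
          ξ[𝓚[K; h; t]] D) (processPart ρ N n (condProd κ ξ[α t] ξ[𝓚[K; h; t]]) D)
        linarith
      have h5 := (ofReal_le_ofReal h4).trans h3
      have e : m * r / 2 = p * (m * r / (2 * p)) := by field_simp
      rw [e, ofReal_mul (by positivity)] at h5
      exact (ENNReal.mul_le_mul_iff_right (by simpa using (by linarith : 0 < p)) ofReal_ne_top).1 h5
  refine (measure_mono_ae hsub).trans ((measure_union_le _ _).trans ((add_le_add h1 h2).trans ?_))
  rw [← ofReal_add (by positivity) (by positivity)]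
  refine ofReal_le_ofReal ?_
  have e1 : θ ^ q / (h ^ 6 * (m / 2) ^ (2 * q)) ≤ 2 ^ (2 * q) / m := by
    calc _ ≤ h ^ 6 / (h ^ 6 * (m / 2) ^ (2 * q)) := by gcongr
      _ = 2 ^ (2 * q) / m ^ (2 * q) := by rw [div_pow]; field_simp
      _ ≤ _ := by
        gcongr
        exact le_self_pow₀ hm (by omega)
  calc _ ≤ C₁ * (2 ^ (2 * q) / m + 1 / (m / 2)) + 2 * p * C₂ / m := by gcongr
    _ = _ := by field_simp

end Deviation

section Sequences

/-- The rate `h + Γ^{1/2} = T^{-1/2}`. -/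
def rate (h : ℝ) (N : ℕ → ℕ) (n : ℕ) : ℝ := h + √(pointVar h N n)

lemma le_rate {h : ℝ} {N : ℕ → ℕ} {n : ℕ} : h ≤ rate h N n :=
  le_add_of_nonneg_right (Real.sqrt_nonneg _)

lemma pointVar_le_rate_sq {h : ℝ} (hh : 0 < h) {N : ℕ → ℕ} {n : ℕ} :
  pointVar h N n ≤ rate h N n ^ 2 := by
  have h1 := sq_sqrt (pointVar_nonneg (N := N) (n := n) hh)
  have h2 := Real.sqrt_nonneg (pointVar h N n)
  rw [rate]; nlinarith

lemma rateT_rpow {h : ℝ} (hh : 0 < h) {N : ℕ → ℕ} {n : ℕ} :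
  rateT h N n ^ (-(1 / 2) : ℝ) = rate h N n := by
  have h0 : 0 ≤ rate h N n := hh.le.trans le_rate
  change ((rate h N n ^ 2)⁻¹) ^ (-(1 / 2) : ℝ) = _
  rw [Real.rpow_neg (by positivity), Real.inv_rpow (by positivity), inv_inv, ← Real.sqrt_eq_rpow,
    Real.sqrt_sq h0]

/-- The conditions on the design that the moment bounds need. -/
structure IsRegularDesign (a b δ C₀ h : ℝ) (N : ℕ → ℕ) (n : ℕ) : Prop where
  pos : 0 < h
  two_mul_le : 2 * h ≤ b - a
  le_one : h ≤ 1
  factMoment_pos : 0 < factMoment N n 2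
  pointVar_le : pointVar h N n ≤ (h ^ (δ / 2)) ^ 2
  sharedVar_le : sharedVar h N n ≤ C₀ * (h ^ (δ / 2) * rate h N n ^ 2)

variable {a b : ℝ} {N : ℕ → ℕ → ℕ} {h : ℕ → ℝ}

local notation "I" => Icc a b

lemma eventually_isRegularDesign (hab : a < b) (hN : ∀ᶠ n in atTop, ∃ i < n, 2 ≤ N n i)
  (h_pos : ∀ n, 0 < h n) (h_lim : Tendsto h atTop (𝓝 0)) {δ : ℝ} (hδ : 0 < δ)
  (hvar : Tendsto (fun n => h n ^ (-δ) * pointVar (h n) (N n) n) atTop (𝓝 0))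
  (hshared : (fun n => h n ^ (-δ) * sharedVar (h n) (N n) n)
    =O[atTop] fun n => (rateT (h n) (N n) n)⁻¹) :
  ∃ δ' C₀, 0 < δ' ∧ δ' ≤ 1 ∧ 0 ≤ C₀ ∧ ∀ᶠ n in atTop, IsRegularDesign a b δ' C₀ (h n) (N n) n := by
  obtain ⟨C₀, hC₀, hO⟩ := hshared.exists_pos
  refine ⟨min δ 1, C₀, lt_min hδ one_pos, min_le_right _ _, hC₀.le, ?_⟩
  have hba : 0 < (b - a) / 2 := half_pos (sub_pos.2 hab)
  filter_upwards [hN, h_lim.eventually_le_const one_pos, h_lim.eventually_le_const hba,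
    hvar.eventually_le_const one_pos, hO.bound] with n h1 h2 h3 h4 h5
  have hp := h_pos n
  have e : ∀ {x C : ℝ}, h n ^ (-δ) * x ≤ C → x ≤ C * h n ^ δ := fun {x C} hx => by
    rw [Real.rpow_neg hp.le, inv_mul_eq_div, div_le_iff₀ (by positivity)] at hx
    exact hx
  refine ⟨hp, by linarith, h2, factMoment_two_pos h1, ?_, ?_⟩
  · refine (e h4).trans ?_
    rw [one_mul, ← Real.rpow_natCast, ← Real.rpow_mul hp.le]
    refine rpow_le_rpow_of_exponent_ge hp h2 ?_
    have := min_le_left δ 1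
    push_cast
    linarith
  · have h6 : h n ^ (-δ) * sharedVar (h n) (N n) n ≤ C₀ * rate (h n) (N n) n ^ 2 := by
      refine (le_abs_self _).trans (h5.trans_eq ?_)
      rw [rateT, inv_inv, Real.norm_of_nonneg (by positivity)]
      rfl
    refine (e h6).trans ?_
    have h7 : h n ^ δ ≤ h n ^ (min δ 1 / 2) := rpow_le_rpow_of_exponent_ge hp h2 (by
      have := min_le_left δ 1
      linarith)
    calc _ ≤ C₀ * rate (h n) (N n) n ^ 2 * h n ^ (min δ 1 / 2) := by gcongr
      _ = _ := by ring

variable {S : Type*} [MeasurableSpace S] {ρ : Measure S} [IsProbabilityMeasure ρ]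
  {X : ℝ → S → ℝ} {σ : ℝ} {φ f K : ℝ → ℝ}

local notation "𝓛" => obsLaw a b f σ

/-- Samples with small deviations: `m` bounds those of the order of the rate, `w` the uniform
deviation in units of the rate. -/
structure IsGoodSample (a b : ℝ) (ρ : Measure S) (κ : Measure (ℝ × ℝ)) (X : ℝ → S → ℝ)
  (φ : ℝ → ℝ) (N : ℕ → ℕ) (n : ℕ) (K : ℝ → ℝ) (h : ℝ) (α : ℝ → ℝ → ℝ) (m w : ℝ)
  (D : Data S) : Prop where
  meanSquare : ∫⁻ s in Icc a b, ∫⁻ t in Icc a b, ‖kernelDeviation ρ κ X φ N n K h D s t‖ₑ ^ 2 ≤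
    ofReal ((m * rate h N n) ^ 2)
  uniform : ∀ s ∈ Icc a b, ∀ t ∈ Icc a b, |kernelDeviation ρ κ X φ N n K h D s t| ≤ w * rate h N n
  weighted : ∀ t ∈ Icc a b,
    |pairDeviation ρ κ X φ N n (α t) 𝓚[K; h; t] D| ≤ m * rate h N n

lemma IsCenteredProcess.exists_measure_not_isGoodSample_le (hab : a < b)
  (hX : IsCenteredProcess ρ a b X) (hf : IsSamplingDensity a b f) (hφ : IsMark σ φ)
  (hK : IsKernel K) [IsProbabilityMeasure 𝓛] {δ C₀ : ℝ} (hδ : 0 < δ)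
  (hC₀ : 0 ≤ C₀) (h_lim : Tendsto h atTop (𝓝 0))
  (hreg : ∀ᶠ n in atTop, IsRegularDesign a b δ C₀ (h n) (N n) n) (hδ1 : δ ≤ 1) {p L' : ℝ}
  (hp : 1 ≤ p) (hL' : 0 ≤ L') {α : ℕ → ℝ → ℝ → ℝ}
  (hα : ∀ᶠ n in atTop, IsWeightFamily a b p L' (α n)) {η : ℝ} (hη : 0 < η) : ∃ m₀ : ℝ, ∀ m, 1 ≤ m → m₀ ≤ m → ∀ᶠ n in atTop,
    sampleLaw ρ 𝓛 {D | ¬ IsGoodSample a b ρ 𝓛 X φ (N n) n K (h n)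
      (α n) m (h n ^ (-(δ / 8))) D} ≤ ofReal η := by
  set κ := 𝓛 with hκ
  obtain ⟨q, hq⟩ := exists_nat_ge (44 / δ)
  have hqδ : 44 ≤ q * δ := by rwa [div_le_iff₀ hδ] at hq
  have hq1 : 1 ≤ q := by
    rcases Nat.eq_zero_or_pos q with rfl | h
    · norm_num at hqδ
    · exact h
  obtain ⟨C₁, hC₁0, hC₁⟩ := hX.exists_measure_lintegral_kernelDeviation_le (σ := σ) hab hf
    hφ.toHasLinearGrowth hK
  obtain ⟨C₂, hC₂0, hC₂⟩ := hX.exists_measure_pairAverage_le (σ := σ) hab hf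
    hφ.toHasLinearGrowth hK hq1
  obtain ⟨C₃, hC₃0, hC₃⟩ := hX.exists_measure_pairDeviation_le (σ := σ) hab hf hφ hK hq1 hp hC₀ hL'
  refine ⟨2 * (C₁ + C₃) / η, fun m hm hm0 => ?_⟩
  have hlim : Tendsto (fun n => C₂ * (h n + h n ^ (δ / 8))) atTop (𝓝 0) := by
    have h1 : Tendsto (fun n => h n ^ (δ / 8)) atTop (𝓝 0) := by
      have := h_lim.rpow_const (p := δ / 8) (Or.inr (by positivity))
      rwa [Real.zero_rpow (by positivity)] at this
    simpa using (h_lim.add h1).const_mul C₂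
  filter_upwards [hreg, hα, hlim.eventually_le_const (half_pos hη)] with n hd hα h3
  have hh := hd.pos
  have hθ1 : h n ^ (δ / 2) ≤ 1 := Real.rpow_le_one hh.le hd.le_one (by positivity)
  have hhθ : h n ≤ h n ^ (δ / 2) := by
    conv_lhs => rw [← Real.rpow_one (h n)]
    exact rpow_le_rpow_of_exponent_ge hh hd.le_one (by linarith)
  have hΓ1 : pointVar (h n) (N n) n ≤ 1 := hd.pointVar_le.trans (pow_le_one₀ (by positivity) hθ1)
  have hw0 : 0 < h n ^ (-(δ / 8)) := by positivity
  have hm1 := zero_lt_one.trans_le hm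
  have hΓr := pointVar_le_rate_sq (N := N n) (n := n) hh
  have b1 := hC₁ (N n) n (h n) (rate (h n) (N n) n) m hd.factMoment_pos hh hd.le_one hΓ1
    (hh.trans_le le_rate) hΓr hm1
  have b2 := hC₂ (N n) n (h n) (rate (h n) (N n) n) (h n ^ (-(δ / 8))) hd.factMoment_pos hh hd.le_one
    hΓ1 le_rate hΓr hw0
  have b3 := hC₃ (N n) n (h n) (rate (h n) (N n) n) m (h n ^ (δ / 2)) (α n) hd.factMoment_pos hh
    hd.two_mul_le hhθ hθ1 hd.pointVar_le le_rate hΓr hd.sharedVar_le (by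
      rw [← Real.rpow_mul_natCast hh.le, ← Real.rpow_natCast (h n) 6]
      refine rpow_le_rpow_of_exponent_ge hh hd.le_one ?_
      push_cast; linarith) hm hα
  have hsub : {D | ¬ IsGoodSample a b ρ κ X φ (N n) n K (h n) (α n) m (h n ^ (-(δ / 8))) D} ⊆
      ({D | ofReal ((m * rate (h n) (N n) n) ^ 2) < ∫⁻ s in I, ∫⁻ t in I,
          ‖kernelDeviation ρ κ X φ (N n) n K (h n) D s t‖ₑ ^ 2} ∪
        {D | ∃ x ∈ I ×ˢ I, h n ^ (-(δ / 8)) * rate (h n) (N n) n <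
          |kernelDeviation ρ κ X φ (N n) n K (h n) D x.1 x.2|}) ∪
        {D | ∃ t ∈ I, m * rate (h n) (N n) n < |pairDeviation ρ κ X φ (N n) n (α n t)
          (fun u => scaledKernel K (h n) (u - t)) D|} := by
    intro D hD
    by_contra hcon
    simp only [mem_union, mem_ofPred_eq, not_or, not_exists, not_and, not_lt] at hcon hD
    exact hD ⟨hcon.1.1, fun s hs t ht => hcon.1.2 (s, t) ⟨hs, ht⟩, hcon.2⟩
  refine (measure_mono hsub).trans ((measure_union_le _ _).trans ((add_le_add
    ((measure_union_le _ _).trans (add_le_add b1 b2)) b3).trans ?_))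
  rw [← ofReal_add (by positivity) (by positivity), ← ofReal_add (by positivity) (by positivity)]
  refine ofReal_le_ofReal ?_
  have e1 : C₁ / m ^ 2 + C₃ / m ≤ η / 2 := by
    rw [div_le_iff₀ hη] at hm0
    calc C₁ / m ^ 2 + C₃ / m ≤ C₁ / m + C₃ / m := by
          gcongr; exact le_self_pow₀ hm (by norm_num)
      _ ≤ η / 2 := by rw [← add_div, div_le_iff₀ hm1]; linarith
  have e2 : 1 / (h n ^ 10 * (h n ^ (-(δ / 8))) ^ (2 * q)) + 1 / h n ^ (-(δ / 8)) ≤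
      h n + h n ^ (δ / 8) := by
    refine add_le_add ?_ (le_of_eq (by rw [Real.rpow_neg hh.le, one_div, inv_inv]))
    rw [← Real.rpow_mul_natCast hh.le, ← Real.rpow_natCast (h n) 10, ← Real.rpow_add hh, one_div,
      ← Real.rpow_neg hh.le]
    conv_rhs => rw [← Real.rpow_one (h n)]
    refine rpow_le_rpow_of_exponent_ge hh hd.le_one ?_
    push_cast
    linarith
  have := mul_le_mul_of_nonneg_left e2 hC₂0
  linarith

end Sequences

section Smoothing

variable {a b : ℝ} {f K : ℝ → ℝ} {h : ℝ}

local notation "𝓣" => timeLaw a b f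
local notation "I" => Icc a b

/-- A weight function smoothed by the kernel. -/
def smoothedWeight (a b : ℝ) (K : ℝ → ℝ) (h : ℝ) (V : ℝ → ℝ) (u : ℝ) : ℝ :=
  ∫ s in Icc a b, scaledKernel K h (u - s) * V s

lemma IsKernel.scaledKernel_sub_comm (hK : IsKernel K) (h u s : ℝ) :
  scaledKernel K h (u - s) = scaledKernel K h (s - u) := by
  rw [← hK.scaledKernel_neg, neg_sub]

lemma IsKernel.integrableOn_scaledKernel_mul (hK : IsKernel K) (h : ℝ) {V : ℝ → ℝ}
  (hV : ContinuousOn V I) (u : ℝ) :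
  Integrable (fun s => scaledKernel K h (u - s) * V s) (volume.restrict I) :=
  (((hK.continuous_scaledKernel h).comp (by fun_prop : Continuous fun s => u - s)).continuousOn.mul
    hV).integrableOn_compact isCompact_Icc

lemma IsKernel.abs_smoothedWeight_le (hK : IsKernel K) (hh : 0 < h) {V : ℝ → ℝ} {B : ℝ}
  (hB : 0 ≤ B) {u : ℝ} (hV : ∀ s ∈ I, |u - s| ≤ h → |V s| ≤ B) :
  |smoothedWeight a b K h V u| ≤ B := by
  have i1 := (hK.integrable_scaledKernel_sub hh u).restrict (s := I)
  rw [smoothedWeight, ← norm_eq_abs]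
  calc _ ≤ ∫ s in I, scaledKernel K h (s - u) * B := by
        refine norm_integral_le_of_norm_le (i1.mul_const B) ?_
        filter_upwards [ae_restrict_mem measurableSet_Icc] with s hs
        rw [norm_eq_abs, abs_mul, hK.scaledKernel_sub_comm,
          abs_of_nonneg (hK.scaledKernel_nonneg hh _)]
        rcases le_or_gt |u - s| h with h1 | h1
        · exact mul_le_mul_of_nonneg_left (hV s hs h1) (hK.scaledKernel_nonneg hh _)
        · rw [hK.scaledKernel_eq_zero hh (abs_sub_comm u s ▸ h1)]; simp
    _ ≤ 1 * B := by
      rw [integral_mul_const]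
      exact mul_le_mul_of_nonneg_right (hK.integral_scaledKernel_le_one hh u _) hB
    _ = B := one_mul B

lemma IsKernel.continuous_smoothedWeight (hK : IsKernel K) (hh : 0 < h) {V : ℝ → ℝ}
  (hV : ContinuousOn V I) : Continuous (smoothedWeight a b K h V) := by
  obtain ⟨B, hB1, hB⟩ := hK.exists_le
  refine continuous_of_dominated (bound := fun s => B / h * |V s|)
    (fun u => (hK.integrableOn_scaledKernel_mul h hV u).aestronglyMeasurable) (fun u => ?_)
    ((hV.abs.integrableOn_compact isCompact_Icc).const_mul _) ?_
  · refine ae_of_all _ fun s => ?_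
    rw [norm_eq_abs, abs_mul]
    exact mul_le_mul_of_nonneg_right (hK.abs_scaledKernel_le hh hB _) (abs_nonneg _)
  · exact ae_of_all _ fun s => ((hK.continuous_scaledKernel h).comp (by fun_prop)).mul_const _

variable {R R' : ℝ → ℝ → ℝ} {α α' β : ℝ → ℝ}

lemma IsSamplingDensity.integrable_mul_mul (hf : IsSamplingDensity a b f)
  (hα : Measurable α) (hβ : Measurable β) (hR : Measurable fun q : ℝ × ℝ => R q.1 q.2)
  {p r B : ℝ} (bα : ∀ u, |α u| ≤ p) (bβ : ∀ u, |β u| ≤ r)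
  (bR : ∀ s ∈ I, ∀ t ∈ I, |R s t| ≤ B) :
  Integrable (fun q : ℝ × ℝ => α q.1 * β q.2 * R q.1 q.2) ((timeLaw a b f).prod 𝓣) := by
  have := hf.isProbabilityMeasure
  refine Integrable.of_bound (by fun_prop) (p * r * B) ?_
  filter_upwards [ae_prod_timeLaw] with q hq
  rw [norm_eq_abs, abs_mul, abs_mul]
  have hp := (abs_nonneg _).trans (bα q.1)
  have hr := (abs_nonneg _).trans (bβ q.2)
  gcongr
  exacts [bα _, bβ _, bR _ hq.1 _ hq.2]

/-- Comparison of two mean values of products with a common weight `β`. -/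
lemma IsSamplingDensity.abs_pairIntegral_sub_le (hf : IsSamplingDensity a b f)
  (hα : Measurable α) (hα' : Measurable α') (hβ : Measurable β)
  (hR : Measurable fun q : ℝ × ℝ => R q.1 q.2) (hR' : Measurable fun q : ℝ × ℝ => R' q.1 q.2)
  {p p' r B B' : ℝ} (bα : ∀ u, |α u| ≤ p) (bα' : ∀ u, |α' u| ≤ p') (bβ : ∀ u, |β u| ≤ r)
  (bR : ∀ s ∈ I, ∀ t ∈ I, |R s t| ≤ B)
  (bR' : ∀ s ∈ I, ∀ t ∈ I, |R' s t| ≤ B') {γ : ℝ → ℝ}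
  (hγ : Integrable γ 𝓣)
  (hle : ∀ u ∈ I, ∀ v ∈ I, β v ≠ 0 → |α u * R u v - α' u * R' u v| ≤ γ u) :
  |pairIntegral a b f R α β - pairIntegral a b f R' α' β| ≤ (∫ u, γ u ∂𝓣) * ∫ v, |β v| ∂𝓣 := by
  have := hf.isProbabilityMeasure
  have iβ : Integrable β 𝓣 := .of_bound hβ.aestronglyMeasurable r (ae_of_all _ bβ)
  rw [pairIntegral, pairIntegral, ← integral_sub (hf.integrable_mul_mul hα hβ hR bα bβ bR)
    (hf.integrable_mul_mul hα' hβ hR' bα' bβ bR'), ← integral_prod_mul, ← norm_eq_abs]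
  refine norm_integral_le_of_norm_le (hγ.mul_prod iβ.abs) ?_
  filter_upwards [ae_prod_timeLaw] with q hq
  have e : α q.1 * β q.2 * R q.1 q.2 - α' q.1 * β q.2 * R' q.1 q.2 =
    (α q.1 * R q.1 q.2 - α' q.1 * R' q.1 q.2) * β q.2 := by ring
  rw [e, norm_eq_abs, abs_mul]
  rcases eq_or_ne (β q.2) 0 with h0 | h0
  · simp [h0]
  · exact mul_le_mul_of_nonneg_right (hle _ hq.1 _ hq.2 h0) (abs_nonneg _)

/-- Replacing the kernel weights by point masses: the bias of a local average. -/
lemma IsKernel.abs_pairIntegral_sub_mul_le (hK : IsKernel K) (hf : IsSamplingDensity a b f)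
  (hh : 0 < h) {M : ℝ≥0} (hM : 𝓣 ≤ M • volume.restrict I)
  (hR : Measurable fun q : ℝ × ℝ => R q.1 q.2) (hR' : Measurable fun q : ℝ × ℝ => R' q.1 q.2)
  {B B' Λ c s t : ℝ} (hΛ : 0 ≤ Λ) (bR : ∀ s ∈ I, ∀ t ∈ I, |R s t| ≤ B)
  (bR' : ∀ s ∈ I, ∀ t ∈ I, |R' s t| ≤ B')
  (hle : ∀ u ∈ I, ∀ v ∈ I, |R u v - c * R' u v| ≤ Λ * (|u - s| + |v - t|)) :
  |pairIntegral a b f R 𝓚[K; h; s] 𝓚[K; h; t] -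
    c * pairIntegral a b f R' 𝓚[K; h; s] 𝓚[K; h; t]| ≤ 2 * Λ * M ^ 2 * h := by
  have := hf.isProbabilityMeasure
  obtain ⟨A, hA1, hA⟩ := hK.exists_le
  have mK := fun s => hK.measurable_scaledKernel_sub h s
  have bK := fun x => hK.abs_scaledKernel_le hh hA x
  have k0 := hK.scaledKernel_nonneg hh
  have iK : ∀ s, Integrable 𝓚[K; h; s] 𝓣 := fun s =>
    .of_bound (mK s).aestronglyMeasurable _ (ae_of_all _ fun _ => bK _)
  have e : c * pairIntegral a b f R' 𝓚[K; h; s] 𝓚[K; h; t] = pairIntegral a b f R'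
      (fun u => c * scaledKernel K h (u - s)) 𝓚[K; h; t] := by
    rw [pairIntegral, ← integral_const_mul]
    refine integral_congr_ae (ae_of_all _ fun q => ?_)
    ring
  rw [e]
  refine (hf.abs_pairIntegral_sub_le (mK s) ((mK s).const_mul c) (mK t) hR hR' (fun _ => bK _)
    (p' := |c| * (A / h)) (fun u => ?_) (fun _ => bK _) bR bR' ((iK s).const_mul (2 * Λ * h))
    fun u hu v hv hv0 => ?_).trans ?_
  · rw [abs_mul]; gcongr; exact bK _
  · have h1 : |v - t| ≤ h := not_lt.1 fun h1 => hv0 (hK.scaledKernel_eq_zero hh h1)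
    have e2 : scaledKernel K h (u - s) * R u v - c * scaledKernel K h (u - s) * R' u v =
      scaledKernel K h (u - s) * (R u v - c * R' u v) := by ring
    rw [e2, abs_mul, abs_of_nonneg (k0 _), mul_comm]
    rcases le_or_gt |u - s| h with h2 | h2
    · refine mul_le_mul_of_nonneg_right ((hle u hu v hv).trans ?_) (k0 _)
      nlinarith
    · simp [hK.scaledKernel_eq_zero hh h2]
  · have h2 := hK.integral_abs_scaledKernel_le hh hM
    have h3 : ∫ u, scaledKernel K h (u - s) ∂𝓣 ≤ M :=
      (integral_mono (iK s) (iK s).abs fun _ => le_abs_self _).trans (h2 s)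
    have h4 : 0 ≤ ∫ u, scaledKernel K h (u - s) ∂𝓣 := integral_nonneg fun _ => k0 _
    rw [integral_const_mul]
    calc _ ≤ 2 * Λ * h * M * M := by
          gcongr
          exact h2 t
      _ = _ := by ring

/-- The bias when one kernel weight is integrated against a weight function. -/
lemma IsKernel.abs_pairIntegral_smoothedWeight_sub_le (hK : IsKernel K)
  (hf : IsSamplingDensity a b f) (hh : 0 < h) {M : ℝ≥0}
  (hM : 𝓣 ≤ M • volume.restrict I)
  (hR : Measurable fun q : ℝ × ℝ => R q.1 q.2) (hR' : Measurable fun q : ℝ × ℝ => R' q.1 q.2)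
  {B B' Λ p t : ℝ} (hΛ : 0 ≤ Λ) (bR : ∀ s ∈ I, ∀ t ∈ I, |R s t| ≤ B)
  (bR' : ∀ s ∈ I, ∀ t ∈ I, |R' s t| ≤ B') {V A : ℝ → ℝ}
  (hV : ContinuousOn V I) (hA : ContinuousOn A I)
  (bV : ∀ s ∈ I, |V s| ≤ p) (hp : 0 ≤ p)
  (hle : ∀ s ∈ I, ∀ u ∈ I, ∀ v ∈ I,
    |R u v - A s * R' u v| ≤ Λ * (|u - s| + |v - t|)) :
  |pairIntegral a b f R (smoothedWeight a b K h V) 𝓚[K; h; t] -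
    pairIntegral a b f R' (smoothedWeight a b K h fun s => V s * A s)
      𝓚[K; h; t]| ≤ 2 * Λ * p * M * h := by
  have := hf.isProbabilityMeasure
  obtain ⟨Bk, hA1, hBk⟩ := hK.exists_le
  have hVA : ContinuousOn (fun s => V s * A s) I := hV.mul hA
  obtain ⟨BA, hBA⟩ := isCompact_Icc.exists_bound_of_continuousOn hVA
  have mK := fun s => hK.measurable_scaledKernel_sub h s
  have bK := fun x => hK.abs_scaledKernel_le hh hBk x
  refine (hf.abs_pairIntegral_sub_le (hK.continuous_smoothedWeight hh hV).measurable
    (hK.continuous_smoothedWeight hh hVA).measurable (mK t) hR hR'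
    (fun u => hK.abs_smoothedWeight_le hh hp fun s hs _ => bV s hs)
    (fun u => hK.abs_smoothedWeight_le hh (le_max_right BA 0)
      fun s hs _ => (hBA s hs).trans (le_max_left _ _)) (fun _ => bK _) bR bR'
    (integrable_const (2 * Λ * p * h)) fun u hu v hv hv0 => ?_).trans ?_
  · have h1 : |v - t| ≤ h := not_lt.1 fun h1 => hv0 (hK.scaledKernel_eq_zero hh h1)
    have e : smoothedWeight a b K h V u * R u v -
        smoothedWeight a b K h (fun s => V s * A s) u * R' u v =
        smoothedWeight a b K h (fun s => V s * (R u v - A s * R' u v)) u := by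
      rw [smoothedWeight, smoothedWeight, ← integral_mul_const, ← integral_mul_const,
        ← integral_sub ((hK.integrableOn_scaledKernel_mul h hV u).mul_const _)
          ((hK.integrableOn_scaledKernel_mul h hVA u).mul_const _), smoothedWeight]
      congr 1 with s
      ring
    rw [e]
    refine hK.abs_smoothedWeight_le hh (by positivity) fun s hs hus => ?_
    rw [abs_mul]
    calc _ ≤ p * (Λ * (h + h)) := by
          gcongr
          exacts [bV s hs, (hle s hs u hu v hv).trans (by gcongr)]
      _ = _ := by ring
  · rw [integral_const, probReal_univ, one_smul]
    calc _ ≤ 2 * Λ * p * h * M := by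
          gcongr
          exact hK.integral_abs_scaledKernel_le hh hM t
      _ = _ := by ring

end Smoothing

section Linear

variable {S : Type*} [MeasurableSpace S] {a b : ℝ} {X : ℝ → S → ℝ} {φ K : ℝ → ℝ} {h : ℝ}

local notation "ξ[" α "]" => obsMark X φ α
local notation "I" => Icc a b

lemma IsKernel.pairAverage_smoothedWeight (hK : IsKernel K) (N : ℕ → ℕ) (n : ℕ) {V : ℝ → ℝ}
  (hV : ContinuousOn V I) (F : S × ℝ × ℝ → ℝ) (D : Data S) :
  pairAverage N n ξ[smoothedWeight a b K h V] F D =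
    ∫ s in I, V s * pairAverage N n ξ[𝓚[K; h; s]] F D := by
  have e : ∀ s, V s * pairAverage N n ξ[𝓚[K; h; s]] F D =
      ∑ i ∈ range n, ∑ p ∈ (range (N i)).offDiag,
        scaledKernel K h (((D i).2 p.1).1 - s) * V s * (obsWeight N n *
          (φ (X ((D i).2 p.1).1 (D i).1 + ((D i).2 p.1).2) * F ((D i).1, (D i).2 p.2))) := by
    intro s
    simp only [pairAverage, obsMark, mul_sum]
    refine sum_congr rfl fun i _ => sum_congr rfl fun p _ => ?_
    ring
  have hi := fun u => hK.integrableOn_scaledKernel_mul h hV u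
  simp_rw [e]
  rw [integral_finsetSum _ fun i _ => integrable_finsetSum _ fun p _ => (hi _).mul_const _]
  simp_rw [pairAverage, mul_sum]
  refine sum_congr rfl fun i _ => ?_
  rw [integral_finsetSum _ fun p _ => (hi _).mul_const _]
  refine sum_congr rfl fun p _ => ?_
  rw [integral_mul_const, obsMark, smoothedWeight]
  ring

/-- The average of products at a pair of time points. -/
def localAverage (X : ℝ → S → ℝ) (φ : ℝ → ℝ) (N : ℕ → ℕ) (n : ℕ) (K : ℝ → ℝ) (h : ℝ)
  (D : Data S) (s t : ℝ) : ℝ :=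
  pairAverage N n (obsMark X φ 𝓚[K; h; s]) (obsMark X φ 𝓚[K; h; t]) D

lemma localAverage_symm (N : ℕ → ℕ) (n : ℕ) (D : Data S) (s t : ℝ) :
  localAverage X φ N n K h D s t = localAverage X φ N n K h D t s := by
  simp only [localAverage, pairAverage]
  refine sum_congr rfl fun i _ => ?_
  congr 1
  refine Finset.sum_nbij' Prod.swap Prod.swap ?_ ?_ (by simp) (by simp) ?_
  · simp only [Finset.mem_offDiag]; rintro p ⟨h1, h2, h3⟩; exact ⟨h2, h1, h3.symm⟩
  · simp only [Finset.mem_offDiag]; rintro p ⟨h1, h2, h3⟩; exact ⟨h2, h1, h3.symm⟩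
  · intro p _; exact mul_comm _ _

lemma IsKernel.continuous_localAverage (hK : IsKernel K) (N : ℕ → ℕ) (n : ℕ) (D : Data S) :
  Continuous fun q : ℝ × ℝ => localAverage X φ N n K h D q.1 q.2 := by
  have := hK.continuous_scaledKernel h
  unfold localAverage pairAverage obsMark
  fun_prop

end Linear

section IteratedIntegral

variable {a b : ℝ}

local notation "I" => Icc a b

lemma integral_integral_sq_le {H G G' : ℝ → ℝ → ℝ} (hab : a ≤ b)
  (hG : Measurable (Function.uncurry G)) {c r ε : ℝ} (hr : 0 ≤ r) (hrε : r ≤ ε)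
  (hH : ∀ s ∈ I, ∀ t ∈ I, |H s t| ≤ c * (|G s t| + |G' s t| + r))
  (h1 : ∫⁻ s in I, ∫⁻ t in I, ‖G s t‖ₑ ^ 2 ≤ ofReal (ε ^ 2))
  (h2 : ∫⁻ s in I, ∫⁻ t in I, ‖G' s t‖ₑ ^ 2 ≤ ofReal (ε ^ 2)) :
  ∫ s in I, ∫ t in I, H s t ^ 2 ≤ (3 * (c * (b - a + 1)) * ε) ^ 2 := by
  have hba := sub_nonneg.2 hab
  have m1 : Measurable fun q : ℝ × ℝ => ‖G q.1 q.2‖ₑ ^ 2 := hG.enorm.pow_const 2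
  have m2 : Measurable fun s => ∫⁻ t in I, ‖G s t‖ₑ ^ 2 := m1.lintegral_prod_right'
  have key : ‖∫ s in I, ∫ t in I, H s t ^ 2‖ₑ ≤ ofReal ((3 * (c * (b - a + 1)) * ε) ^ 2) := by
    calc _ ≤ ∫⁻ s in I, ∫⁻ t in I, ‖H s t ^ 2‖ₑ :=
          (enorm_integral_le_lintegral_enorm _).trans
            (lintegral_mono fun s => enorm_integral_le_lintegral_enorm _)
      _ ≤ ∫⁻ s in I, ∫⁻ t in I, ofReal (3 * c ^ 2) *
          (‖G s t‖ₑ ^ 2 + (‖G' s t‖ₑ ^ 2 + ofReal (r ^ 2))) := by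
        refine setLIntegral_mono' measurableSet_Icc fun s hs =>
          setLIntegral_mono' measurableSet_Icc fun t ht => ?_
        have h3 := hH s hs t ht
        have e : ∀ x : ℝ, ‖x‖ₑ ^ 2 = ofReal (x ^ 2) := fun x => by
          rw [← sq_abs, ofReal_pow (abs_nonneg x), ← enorm_eq_ofReal_abs]
        rw [e, e, ← ofReal_add (sq_nonneg _) (sq_nonneg _),
          ← ofReal_add (sq_nonneg _) (by positivity),
          ← ofReal_mul (by positivity), enorm_eq_ofReal_abs, abs_pow]
        refine ofReal_le_ofReal ((pow_le_pow_left₀ (abs_nonneg _) h3 2).trans ?_)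
        rw [← sq_abs (G s t), ← sq_abs (G' s t), mul_pow, mul_comm 3, mul_assoc]
        refine mul_le_mul_of_nonneg_left ?_ (sq_nonneg c)
        nlinarith [sq_nonneg (|G s t| - |G' s t|), sq_nonneg (|G s t| - r),
          sq_nonneg (|G' s t| - r)]
      _ = ofReal (3 * c ^ 2) * ((∫⁻ s in I, ∫⁻ t in I, ‖G s t‖ₑ ^ 2) +
          ((∫⁻ s in I, ∫⁻ t in I, ‖G' s t‖ₑ ^ 2) +
            ofReal (b - a) * (ofReal (b - a) * ofReal (r ^ 2)))) := by
        simp_rw [lintegral_const_mul' _ _ ofReal_ne_top]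
        congr 1
        have h3 : ∀ s, ∫⁻ t in I, (‖G s t‖ₑ ^ 2 + (‖G' s t‖ₑ ^ 2 + ofReal (r ^ 2))) =
            (∫⁻ t in I, ‖G s t‖ₑ ^ 2) + ((∫⁻ t in I, ‖G' s t‖ₑ ^ 2) +
              ofReal (b - a) * ofReal (r ^ 2)) := fun s => by
          rw [lintegral_add_left (f := fun t => ‖G s t‖ₑ ^ 2) (m1.comp measurable_prodMk_left), lintegral_add_right _
            measurable_const, setLIntegral_const, volume_Icc, mul_comm (ofReal (r ^ 2))]
        simp_rw [h3]
        rw [lintegral_add_left m2, lintegral_add_right _ measurable_const, setLIntegral_const,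
          volume_Icc, mul_comm _ (ofReal (b - a))]
      _ ≤ ofReal (3 * c ^ 2) * (ofReal (ε ^ 2) + (ofReal (ε ^ 2) +
          ofReal (b - a) * (ofReal (b - a) * ofReal (r ^ 2)))) := by
        gcongr
      _ ≤ _ := by
        rw [← ofReal_mul hba, ← ofReal_mul hba, ← ofReal_add (sq_nonneg _)
          (by positivity), ← ofReal_add (sq_nonneg _) (by positivity),
          ← ofReal_mul (by positivity)]
        refine ofReal_le_ofReal ?_
        have h4 : r ^ 2 ≤ ε ^ 2 := pow_le_pow_left₀ hr hrε 2
        calc _ ≤ 3 * c ^ 2 * (ε ^ 2 + (ε ^ 2 + (b - a) * ((b - a) * ε ^ 2))) := by gcongr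
          _ = c ^ 2 * ε ^ 2 * (3 * (2 + (b - a) ^ 2)) := by ring
          _ ≤ c ^ 2 * ε ^ 2 * (9 * (b - a + 1) ^ 2) :=
            mul_le_mul_of_nonneg_left (by nlinarith) (by positivity)
          _ = _ := by ring
  rw [enorm_eq_ofReal_abs] at key
  exact (le_abs_self _).trans ((ENNReal.ofReal_le_ofReal_iff (sq_nonneg _)).1 key)

end IteratedIntegral

section Ratio

variable {S : Type*} [MeasurableSpace S] {ρ : Measure S} {a b : ℝ}
  {X : ℝ → S → ℝ} {σ : ℝ} {f K : ℝ → ℝ}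

local notation "I" => Icc a b

lemma IsWeightFamily.mono {p p' L L' : ℝ} {α : ℝ → ℝ → ℝ} (hα : IsWeightFamily a b p L α)
  (hp : p ≤ p') (hL : L ≤ L') : IsWeightFamily a b p' L' α where
  measurable := hα.measurable
  abs_le t ht u := (hα.abs_le t ht u).trans hp
  abs_sub_le t ht t' ht' u := (hα.abs_sub_le t ht t' ht' u).trans (by gcongr)

lemma IsLipschitzKernel.continuousOn_left {R : ℝ → ℝ → ℝ} {L : ℝ}
  (hR : IsLipschitzKernel a b R L) {t : ℝ} (ht : t ∈ I) :
  ContinuousOn (fun s => R s t) I :=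
  hR.continuousOn.comp (f := fun s => (s, t)) (by fun_prop) fun _ hs => ⟨hs, ht⟩

lemma IsKernel.isWeightFamily_smoothedWeight (hK : IsKernel K) {h : ℝ} (hh : 0 < h) {ω : ℝ → ℝ}
  (hω : ContinuousOn ω I) {Bω B L : ℝ} (hBω : 0 ≤ Bω) (hB : 0 ≤ B)
  (bω : ∀ s ∈ I, |ω s| ≤ Bω) {W : ℝ → ℝ → ℝ} (hW : IsLipschitzKernel a b W L)
  (bW : ∀ s ∈ I, ∀ t ∈ I, |W s t| ≤ B) :
  IsWeightFamily a b (Bω * B) (Bω * L) fun t => smoothedWeight a b K h fun s => ω s * W s t where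
  measurable t ht := (hK.continuous_smoothedWeight hh (hω.mul (hW.continuousOn_left ht))).measurable
  abs_le t ht u := hK.abs_smoothedWeight_le hh (by positivity) fun s hs _ => by
    rw [abs_mul]
    exact mul_le_mul (bω s hs) (bW s hs t ht) (abs_nonneg _) hBω
  abs_sub_le t ht t' ht' u := by
    have e : smoothedWeight a b K h (fun s => ω s * W s t) u -
        smoothedWeight a b K h (fun s => ω s * W s t') u =
        smoothedWeight a b K h (fun s => ω s * (W s t - W s t')) u := by
      have hc : ∀ t ∈ I, ContinuousOn (fun s => ω s * W s t) I := fun t ht =>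
        hω.mul (hW.continuousOn_left ht)
      rw [smoothedWeight, smoothedWeight, ← integral_sub
        (hK.integrableOn_scaledKernel_mul h (hc t ht) u)
        (hK.integrableOn_scaledKernel_mul h (hc t' ht') u), smoothedWeight]
      congr 1 with s
      ring
    have hL := hW.nonneg
    rw [e]
    refine hK.abs_smoothedWeight_le hh (by positivity) fun s hs _ => ?_
    rw [abs_mul, mul_assoc]
    refine mul_le_mul (bω s hs) ?_ (abs_nonneg _) hBω
    simpa using hW.abs_sub_le s hs s hs t ht t' ht'

lemma pairIntegral_one (hf : IsSamplingDensity a b f) (h s t : ℝ) :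
  pairIntegral a b f (fun _ _ => 1) 𝓚[K; h; s] 𝓚[K; h; t] =
    smoothedDensity a b f K h s * smoothedDensity a b f K h t := by
  have := hf.isProbabilityMeasure
  simp_rw [pairIntegral, mul_one, smoothedDensity]
  exact integral_prod_mul 𝓚[K; h; s] fun u => scaledKernel K h (u - t)

/-- Deterministic bounds for the difference between a ratio `G / Q` and its target `A`. -/
lemma div_sub_bounds (hab : a < b) {G Q A Q₀ x y H : ℝ → ℝ → ℝ} {ψ : ℝ → ℝ}
  {c₁ c₂ c₃ e₀ r w m Bψ : ℝ} (hc₁ : 0 ≤ c₁) (hc₂ : 0 ≤ c₂) (he₀ : 0 < e₀)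
  (hr : 0 < r) (hw : 1 ≤ w) (hm : 1 ≤ m) (hs1 : w ^ 2 * r ≤ 1) (hs2 : 2 * c₂ / e₀ * (w ^ 2 * r) ≤ 1)
  (hs3 : 6 * c₁ / e₀ * (w ^ 2 * r) ≤ 1)
  (hG : ContinuousOn (fun q : ℝ × ℝ => G q.1 q.2) (I ×ˢ I))
  (hQ : ContinuousOn (fun q : ℝ × ℝ => Q q.1 q.2) (I ×ˢ I))
  (hA : ContinuousOn (fun q : ℝ × ℝ => A q.1 q.2) (I ×ˢ I))
  (hQ₀ : ContinuousOn (fun q : ℝ × ℝ => Q₀ q.1 q.2) (I ×ˢ I))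
  (hψ : ContinuousOn ψ I) (bψ : ∀ s ∈ I, |ψ s| ≤ Bψ)
  (mx : Measurable (Function.uncurry x))
  (hx : ∀ s ∈ I, ∀ t ∈ I, |x s t| ≤ w * r)
  (hy : ∀ s ∈ I, ∀ t ∈ I, |y s t| ≤ w * r)
  (hx2 : ∫⁻ s in I, ∫⁻ t in I, ‖x s t‖ₑ ^ 2 ≤ ofReal ((m * r) ^ 2))
  (hy2 : ∫⁻ s in I, ∫⁻ t in I, ‖y s t‖ₑ ^ 2 ≤ ofReal ((m * r) ^ 2))
  (hnum : ∀ s ∈ I, ∀ t ∈ I,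
    |G s t - A s t * Q s t| ≤ c₁ * (|x s t| + |y s t| + r))
  (hden : ∀ s ∈ I, ∀ t ∈ I, |Q s t - Q₀ s t| ≤ c₂ * (w * r))
  (hpos : ∀ s ∈ I, ∀ t ∈ I, e₀ ≤ Q₀ s t)
  (hlin : ∀ t ∈ I, |∫ s in I, (G s t - A s t * Q s t) / Q₀ s t * ψ s| ≤ c₃ * (m * r))
  (hH : ∀ s t, H s t = G s t / Q s t - A s t) :
  (∀ s ∈ I, ∀ t ∈ I, Q s t ≠ 0 ∧ |H s t| ≤ 1) ∧
    ∫ s in I, ∫ t in I, H s t ^ 2 ≤ (3 * (2 * c₁ / e₀ * (b - a + 1)) * (m * r)) ^ 2 ∧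
    ∀ t ∈ I, |∫ s in I, H s t * ψ s| ≤ (c₃ + 6 * c₁ * c₂ / e₀ ^ 2 * Bψ * (b - a)) * (m * r) := by
  have hba := sub_pos.2 hab
  have hBψ : 0 ≤ Bψ := (abs_nonneg _).trans (bψ a (left_mem_Icc.2 hab.le))
  have hwr : r ≤ w * r := le_mul_of_one_le_left hr.le hw
  have hw2 : w * r ≤ w ^ 2 * r := by gcongr; nlinarith
  have hmr : r ≤ m * r := le_mul_of_one_le_left hr.le hm
  have hs2' : c₂ * (w * r) ≤ e₀ / 2 := by
    have h1 : 2 * c₂ / e₀ * (w * r) ≤ 1 := le_trans (by gcongr) hs2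
    rw [div_mul_eq_mul_div, div_le_one he₀] at h1
    linarith
  have hQe : ∀ s ∈ I, ∀ t ∈ I, e₀ / 2 ≤ Q s t := fun s hs t ht => by
    have := (abs_le.1 (hden s hs t ht)).1
    linarith [hpos s hs t ht]
  have hQ0 : ∀ s ∈ I, ∀ t ∈ I, 0 < Q s t := fun s hs t ht => (half_pos he₀).trans_le (hQe s hs t ht)
  have hQ₀0 : ∀ s ∈ I, ∀ t ∈ I, 0 < Q₀ s t := fun s hs t ht => he₀.trans_le (hpos s hs t ht)
  have hnum' : ∀ s ∈ I, ∀ t ∈ I, |G s t - A s t * Q s t| ≤ 3 * c₁ * (w * r) :=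
    fun s hs t ht => by
      have h1 := hx s hs t ht
      have h2 := hy s hs t ht
      calc _ ≤ _ := hnum s hs t ht
        _ ≤ c₁ * (w * r + w * r + w * r) := by gcongr
        _ = _ := by ring
  have eH : ∀ s ∈ I, ∀ t ∈ I, H s t = (G s t - A s t * Q s t) / Q s t :=
    fun s hs t ht => by rw [hH, sub_div, mul_div_assoc, div_self (hQ0 s hs t ht).ne', mul_one]
  have bH : ∀ s ∈ I, ∀ t ∈ I, |H s t| ≤ 2 * c₁ / e₀ * (|x s t| + |y s t| + r) :=
    fun s hs t ht => by
      rw [eH s hs t ht, abs_div, abs_of_pos (hQ0 s hs t ht)]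
      refine (div_le_div₀ (by positivity) (hnum s hs t ht) (half_pos he₀)
        (hQe s hs t ht)).trans_eq ?_
      field_simp
  refine ⟨fun s hs t ht => ⟨(hQ0 s hs t ht).ne', (bH s hs t ht).trans ?_⟩,
    integral_integral_sq_le hab.le mx hr.le hmr bH hx2 hy2, fun t ht => ?_⟩
  · have h1 := hx s hs t ht
    have h2 := hy s hs t ht
    calc _ ≤ 2 * c₁ / e₀ * (w * r + w * r + w * r) := by gcongr
      _ = 6 * c₁ / e₀ * (w * r) := by ring
      _ ≤ 1 := le_trans (by gcongr) hs3
  · have left : ∀ {R : ℝ → ℝ → ℝ}, ContinuousOn (fun q : ℝ × ℝ => R q.1 q.2)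
        (I ×ˢ I) → ContinuousOn (fun s => R s t) I := fun hR =>
      hR.comp (f := fun s => (s, t)) (by fun_prop) fun _ hs => ⟨hs, ht⟩
    have cE := (left hG).sub ((left hA).mul (left hQ))
    have i1 : IntegrableOn (fun s => (G s t - A s t * Q s t) / Q₀ s t * ψ s) I :=
      ((cE.div (left hQ₀) fun s hs => (hQ₀0 s hs t ht).ne').mul hψ).integrableOn_compact isCompact_Icc
    have i2 : IntegrableOn (fun s => (G s t - A s t * Q s t) * (Q₀ s t - Q s t) /
        (Q₀ s t * Q s t) * ψ s) I :=
      (((cE.mul ((left hQ₀).sub (left hQ))).div ((left hQ₀).mul (left hQ)) fun s hs =>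
        (mul_pos (hQ₀0 s hs t ht) (hQ0 s hs t ht)).ne').mul hψ).integrableOn_compact isCompact_Icc
    have e : ∫ s in I, H s t * ψ s = (∫ s in I, (G s t - A s t * Q s t) / Q₀ s t * ψ s) +
        ∫ s in I, (G s t - A s t * Q s t) * (Q₀ s t - Q s t) / (Q₀ s t * Q s t) * ψ s := by
      rw [← integral_add i1 i2]
      refine setIntegral_congr_fun measurableSet_Icc fun s hs => ?_
      have h1 := (hQ0 s hs t ht).ne'
      have h2 := (hQ₀0 s hs t ht).ne'
      simp only [eH s hs t ht]
      field_simp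
      ring
    have h2 : |∫ s in I, (G s t - A s t * Q s t) * (Q₀ s t - Q s t) / (Q₀ s t * Q s t) * ψ s| ≤
        3 * c₁ * (w * r) * (c₂ * (w * r)) / (e₀ * (e₀ / 2)) * Bψ * (b - a) := by
      have h3 := norm_setIntegral_le_of_norm_le_const (μ := volume) (s := I)
        (C := 3 * c₁ * (w * r) * (c₂ * (w * r)) / (e₀ * (e₀ / 2)) * Bψ)
        (f := fun s => (G s t - A s t * Q s t) * (Q₀ s t - Q s t) / (Q₀ s t * Q s t) * ψ s)
        (by simp) fun s hs => ?_
      · simpa [Measure.real, hba.le] using h3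
      · rw [norm_eq_abs, abs_mul, abs_div, abs_mul, abs_sub_comm (Q₀ s t),
          abs_of_pos (mul_pos (hQ₀0 s hs t ht) (hQ0 s hs t ht))]
        gcongr
        exacts [hnum' s hs t ht, hden s hs t ht, (hQ₀0 s hs t ht).le, hpos s hs t ht, hQe s hs t ht, bψ s hs]
    rw [e]
    calc _ ≤ _ := abs_add_le _ _
      _ ≤ c₃ * (m * r) + 3 * c₁ * (w * r) * (c₂ * (w * r)) / (e₀ * (e₀ / 2)) * Bψ * (b - a) :=
        add_le_add (hlin t ht) h2
      _ = c₃ * (m * r) + 6 * c₁ * c₂ / e₀ ^ 2 * Bψ * (b - a) * (w ^ 2 * r * r) := by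
        field_simp
        ring
      _ ≤ c₃ * (m * r) + 6 * c₁ * c₂ / e₀ ^ 2 * Bψ * (b - a) * (1 * (m * r)) := by gcongr
      _ = _ := by ring

end Ratio

section Ratio

variable {S : Type*} [MeasurableSpace S] {ρ : Measure S} {a b : ℝ}
  {X : ℝ → S → ℝ} {σ : ℝ} {f K : ℝ → ℝ}

local notation "I" => Icc a b

local notation "𝓛" => obsLaw a b f σ

variable [IsProbabilityMeasure ρ]

set_option maxHeartbeats 1600000 in
/-- On good samples the ratio of the local averages is close to the ratio of the means: in mean
square, and after integration against a fixed function. -/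
lemma IsCenteredProcess.exists_localAverage_div_bounds (hab : a < b)
  (hX : IsCenteredProcess ρ a b X) (hf : IsSamplingDensity a b f) (hK : IsKernel K) {g d : ℝ → ℝ}
  (hg : IsMark σ g) (hd : IsMark σ d) {d₀ : ℝ} (hd₀ : 0 < d₀)
  (hR : ∀ s ∈ I, ∀ t ∈ I, d₀ ≤ pairMean ρ X σ d s t) {ψ : ℝ → ℝ}
  (hψ : ContinuousOn ψ I) :
  ∃ C p L : ℝ, 1 ≤ C ∧ 1 ≤ p ∧ 0 ≤ L ∧ ∀ h, 0 < h → 2 * h ≤ b - a → ∃ α α' : ℝ → ℝ → ℝ,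
    IsWeightFamily a b p L α ∧ IsWeightFamily a b p L α' ∧
    ∀ (N : ℕ → ℕ) (n : ℕ) (m w : ℝ) (D : Data S), 1 ≤ m → 1 ≤ w → C * (w ^ 2 * rate h N n) ≤ 1 →
      IsGoodSample a b ρ 𝓛 X g N n K h α m w D →
      IsGoodSample a b ρ 𝓛 X d N n K h α' m w D →
      ∀ H : ℝ → ℝ → ℝ, (∀ s t, H s t = localAverage X g N n K h D s t /
        localAverage X d N n K h D s t - pairMean ρ X σ g s t / pairMean ρ X σ d s t) →
      (∀ s ∈ I, ∀ t ∈ I, localAverage X d N n K h D s t ≠ 0 ∧ |H s t| ≤ 1) ∧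
      ∫ s in I, ∫ t in I, H s t ^ 2 ≤ (C * (m * rate h N n)) ^ 2 ∧
      ∀ t ∈ I, |∫ s in I, H s t * ψ s| ≤ C * (m * rate h N n) := by
  have := hf.isProbabilityMeasure_obsLaw σ
  obtain ⟨M, hM⟩ := hf.exists_le
  obtain ⟨m₁, hm₁, hm₁'⟩ := hf.exists_ge
  obtain ⟨Bk, hBk1, hBk⟩ := hK.exists_le
  obtain ⟨Lg, hLg⟩ := hX.isLipschitzKernel_pairMean hab hg
  obtain ⟨Ld, hLd⟩ := hX.isLipschitzKernel_pairMean hab hd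
  have mRg := measurable_pairMean (ρ := ρ) hX.measurable hg
  have mRd := measurable_pairMean (ρ := ρ) hX.measurable hd
  have hcond := fun {φ α β : ℝ → ℝ} (hφ : IsMark σ φ) => hX.integral_condProd hf hφ (α := α) (β := β)
  set Rg := pairMean ρ X σ g
  set Rd := pairMean ρ X σ d
  have hLQ := hLd.inv hd₀ hR
  set LQ := Ld / d₀ ^ 2
  obtain ⟨LA, hLA'⟩ := hLg.mul hab.le hLQ
  set A : ℝ → ℝ → ℝ := fun s t => Rg s t * (Rd s t)⁻¹ with hA
  have hLA : IsLipschitzKernel a b A LA := hLA'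
  obtain ⟨LW, hLW⟩ := hLQ.mul hab.le hLA
  obtain ⟨Bg, hBg0, hBg⟩ := hLg.exists_bound hab.le
  obtain ⟨Bd, hBd0, hBd⟩ := hLd.exists_bound hab.le
  obtain ⟨BA, hBA0, hBA⟩ := hLA.exists_bound hab.le
  obtain ⟨BQ, hBQ0, hBQ⟩ := hLQ.exists_bound hab.le
  obtain ⟨BW, hBW0, hBW⟩ := hLW.exists_bound hab.le
  obtain ⟨Bψ, hBψ'⟩ := isCompact_Icc.exists_bound_of_continuousOn hψ
  have hBψ : ∀ t ∈ I, |ψ t| ≤ Bψ := hBψ'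
  have hBψ0 : 0 ≤ Bψ := (abs_nonneg _).trans (hBψ a (left_mem_Icc.2 hab.le))
  have hLA0 := hLA.nonneg
  have hLd0 := hLd.nonneg
  have hLQ0 := hLQ.nonneg
  have hLW0 := hLW.nonneg
  have hba := sub_pos.2 hab
  set κ : ℝ := m₁ / 2 with hκ
  have hκ0 : 0 < κ := half_pos (NNReal.coe_pos.2 hm₁)
  set e₀ := κ ^ 2 * d₀ with he₀
  have he₀0 : 0 < e₀ := by positivity
  set Λ := Bd * LA
  have hΛ0 : 0 ≤ Λ := by positivity
  set c₁ := 1 + BA + 2 * Λ * M ^ 2 with hc₁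
  set c₂ := 1 + 2 * Ld * M ^ 2 with hc₂
  have hc₁0 : 0 ≤ c₁ := by positivity
  have hc₂0 : 0 ≤ c₂ := by positivity
  set Bω := Bψ / κ
  have hBω0 : 0 ≤ Bω := by positivity
  set C₁ := 3 * (2 * c₁ / e₀ * (b - a + 1))
  set c₃ := (2 + 2 * Λ * (Bω * BQ) * M) / κ with hc₃
  have hc₃0 : 0 ≤ c₃ := by positivity
  set C₂ := c₃ + 6 * c₁ * c₂ / e₀ ^ 2 * Bψ * (b - a)
  have hC₁0 : 0 ≤ C₁ := by positivity
  have hC₂0 : 0 ≤ C₂ := by positivity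
  set C := 1 + 2 * c₂ / e₀ + 6 * c₁ / e₀ + C₁ + C₂ with hC
  have hCs : 1 ≤ C ∧ 2 * c₂ / e₀ ≤ C ∧ 6 * c₁ / e₀ ≤ C ∧ C₁ ≤ C ∧ C₂ ≤ C := by
    have h1 : 0 ≤ 2 * c₂ / e₀ := by positivity
    have h2 : 0 ≤ 6 * c₁ / e₀ := by positivity
    refine ⟨?_, ?_, ?_, ?_, ?_⟩ <;> linarith
  refine ⟨C, 1 + Bω * BQ + Bω * BW, Bω * LQ + Bω * LW,
    hCs.1, ?_, by positivity, fun h hh hhab => ?_⟩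
  · have : 0 ≤ Bω * BQ + Bω * BW := by positivity
    linarith
  have fle := hK.smoothedDensity_le hh hM
  have lef : ∀ s ∈ I, κ ≤ smoothedDensity a b f K h s := fun s hs =>
    hK.le_smoothedDensity hf hh (by linarith) hm₁' hs
  have cf := hK.continuous_smoothedDensity hf hh
  have mK := fun s => hK.measurable_scaledKernel_sub h s
  have bK := fun x => hK.abs_scaledKernel_le hh hBk x
  set F := smoothedDensity a b f K h
  have f0 : ∀ s ∈ I, 0 < F s := fun s hs => hκ0.trans_le (lef s hs)
  have cω : ContinuousOn (fun s => ψ s / F s) I := hψ.div cf.continuousOn fun s hs => (f0 s hs).ne'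
  have bω : ∀ s ∈ I, |ψ s / F s| ≤ Bω := fun s hs => by
    rw [abs_div, abs_of_pos (f0 s hs)]
    exact div_le_div₀ hBψ0 (hBψ s hs) hκ0 (lef s hs)
  have wg := hK.isWeightFamily_smoothedWeight hh cω hBω0 hBQ0 bω hLQ hBQ
  have wd := hK.isWeightFamily_smoothedWeight hh cω hBω0 hBW0 bω hLW hBW
  refine ⟨_, _, wg.mono (by nlinarith) (by nlinarith), wd.mono (by nlinarith) (by nlinarith), fun N n m w D hm hw hsmall sg sd H hH => ?_⟩
  have hhr : h ≤ rate h N n := le_rate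
  set r := rate h N n
  have hr0 : 0 < r := hh.trans_le hhr
  have hwr : r ≤ w * r := le_mul_of_one_le_left hr0.le hw
  have hmr : r ≤ m * r := le_mul_of_one_le_left hr0.le hm
  have hsC : ∀ x ≤ C, x * (w ^ 2 * r) ≤ 1 := fun x hx => le_trans (by gcongr) hsmall
  have e : ∀ {φ} (_ : IsMark σ φ) s t, localAverage X φ N n K h D s t =
      kernelDeviation ρ 𝓛 X φ N n K h D s t +
        pairIntegral a b f (pairMean ρ X σ φ) 𝓚[K; h; s] 𝓚[K; h; t] := fun hφ s t => by
    rw [kernelDeviation, pairDeviation, hcond hφ (mK s) (mK t) (fun _ => bK _) fun _ => bK _,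
      localAverage]
    ring
  have eg := e hg
  have ed := e hd
  have cG := hK.continuous_localAverage (X := X) (φ := g) (h := h) N n D
  have cE := hK.continuous_localAverage (X := X) (φ := d) (h := h) N n D
  have mdev : Measurable (Function.uncurry (kernelDeviation ρ 𝓛 X g N n K h D)) :=
    (measurable_kernelDeviation (ρ := ρ) (κ := 𝓛) hX.measurable hg.toHasLinearGrowth.measurable hK
      N n h).comp (f := fun q : ℝ × ℝ => (D, q)) (by fun_prop)
  set x := kernelDeviation ρ 𝓛 X g N n K h D
  set y := kernelDeviation ρ 𝓛 X d N n K h D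
  set G := localAverage X g N n K h D with hG
  set E := localAverage X d N n K h D with hE
  have Rpos : ∀ s ∈ I, ∀ t ∈ I, 0 < Rd s t := fun s hs t ht => hd₀.trans_le (hR s hs t ht)
  have RgA : ∀ s ∈ I, ∀ t ∈ I, Rg s t = A s t * Rd s t := fun s hs t ht => by
    simp only [hA]
    field_simp [(Rpos s hs t ht).ne']
  have bias : ∀ s ∈ I, ∀ t ∈ I, ∀ u ∈ I, ∀ v ∈ I,
      |Rg u v - A s t * Rd u v| ≤ Λ * (|u - s| + |v - t|) := fun s hs t ht u hu v hv => by
    rw [RgA u hu v hv, ← sub_mul, abs_mul, mul_comm, mul_assoc]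
    exact mul_le_mul (hBd u hu v hv) (hLA.abs_sub_le u hu s hs v hv t ht) (abs_nonneg _) hBd0
  have hx : ∀ s ∈ I, ∀ t ∈ I,
      |G s t - A s t * E s t| ≤
        c₁ * (|x s t| +
          |y s t| + r) := fun s hs t ht => by
    have h1 := hK.abs_pairIntegral_sub_mul_le hf hh hM mRg mRd hΛ0 hBg hBd (bias s hs t ht)
    rw [eg, ed]
    set I₁ := pairIntegral a b f Rg 𝓚[K; h; s] 𝓚[K; h; t]
    set I₂ := pairIntegral a b f Rd 𝓚[K; h; s] 𝓚[K; h; t]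
    have e : x s t + I₁ - A s t * (y s t + I₂) = x s t - A s t * y s t + (I₁ - A s t * I₂) := by ring
    have h2 : |A s t * y s t| ≤ BA * |y s t| := by rw [abs_mul]; gcongr; exact hBA s hs t ht
    have h3 : 0 ≤ 2 * Λ * M ^ 2 := by positivity
    calc _ ≤ |x s t| + BA * |y s t| + 2 * Λ * M ^ 2 * r := by
          rw [e]
          refine (abs_add_le _ _).trans (add_le_add ((abs_sub _ _).trans (by linarith)) (h1.trans ?_))
          gcongr
      _ ≤ _ := by
        rw [hc₁]
        nlinarith [abs_nonneg (x s t), abs_nonneg (y s t), mul_nonneg hBA0 (abs_nonneg (x s t)),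
          mul_nonneg h3 (abs_nonneg (x s t)), mul_nonneg h3 (abs_nonneg (y s t)), mul_nonneg hBA0 hr0.le]
  have hy : ∀ s ∈ I, ∀ t ∈ I,
      |E s t - F s * F t * Rd s t| ≤ c₂ * (w * r) := fun s hs t ht => by
    have h1 := hK.abs_pairIntegral_sub_mul_le hf hh hM mRd (R' := fun _ _ => 1) (by fun_prop) hLd0 hBd
      (B' := 1) (fun _ _ _ _ => by simp) (c := Rd s t) (s := s) (t := t) fun u hu v hv => by
        simpa using hLd.abs_sub_le u hu s hs v hv t ht
    rw [pairIntegral_one hf] at h1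
    have h2 : |y s t| ≤ w * r := sd.uniform s hs t ht
    have h3 : 2 * Ld * M ^ 2 * h ≤ 2 * Ld * M ^ 2 * (w * r) := by gcongr; linarith
    rw [ed, add_sub_assoc, mul_comm (F s * F t)]
    refine (abs_add_le _ _).trans ((add_le_add h2 (h1.trans h3)).trans_eq ?_)
    rw [hc₂]; ring
  have hDs : ∀ s ∈ I, ∀ t ∈ I, e₀ ≤ F s * F t * Rd s t := fun s hs t ht => by
    rw [he₀, sq]
    exact mul_le_mul (mul_le_mul (lef s hs) (lef t ht) hκ0.le (f0 s hs).le) (hR s hs t ht) hd₀.le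
      (mul_nonneg (f0 s hs).le (f0 t ht).le)
  have left : ∀ {R : ℝ → ℝ → ℝ} {t : ℝ}, t ∈ I → Continuous (fun q : ℝ × ℝ => R q.1 q.2) →
      ContinuousOn (fun s => R s t) I := fun {R t} _ hR =>
    (hR.comp (f := fun s => (s, t)) (by fun_prop)).continuousOn
  have hlin : ∀ t ∈ I, |∫ s in I, (G s t -
      A s t * E s t) / (F s * F t * Rd s t) * ψ s| ≤ c₃ * (m * r) :=
    fun t ht => by
      have cV : ContinuousOn (fun s => ψ s / F s * (Rd s t)⁻¹) I :=
        cω.mul (hLQ.continuousOn_left ht)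
      have cVA : ContinuousOn (fun s => ψ s / F s * (Rd s t)⁻¹ * A s t) I :=
        cV.mul (hLA.continuousOn_left ht)
      have h1 := hK.abs_pairIntegral_smoothedWeight_sub_le hf hh hM mRg mRd hΛ0 hBg hBd cV
        (hLA.continuousOn_left ht) (p := Bω * BQ) (t := t) (fun s hs => by
          rw [abs_mul]; exact mul_le_mul (bω s hs) (hBQ s hs t ht) (abs_nonneg _) hBω0)
        (by positivity) fun s hs => bias s hs t ht
      have cS := hK.continuous_smoothedWeight hh cV
      have cS' := hK.continuous_smoothedWeight hh cVA
      have h2 := sg.weighted t ht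
      have h3 := sd.weighted t ht
      simp only [← mul_assoc] at h3
      rw [pairDeviation, hcond hg cS.measurable (mK t) (fun u => (wg.abs_le t ht u)) fun _ => bK _,
        hK.pairAverage_smoothedWeight N n cV] at h2
      rw [pairDeviation, hcond hd cS'.measurable (mK t) (fun u => by
          simpa only [← mul_assoc] using wd.abs_le t ht u) fun _ => bK _,
        hK.pairAverage_smoothedWeight N n cVA] at h3
      have e : ∫ s in I, (G s t - A s t * E s t) / (F s * F t * Rd s t) * ψ s =
          ((∫ s in I, ψ s / F s * (Rd s t)⁻¹ * G s t) -
            ∫ s in I, ψ s / F s * (Rd s t)⁻¹ * A s t * E s t) / F t := by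
        have i1 : IntegrableOn (fun s => ψ s / F s * (Rd s t)⁻¹ * G s t)
          I := (cV.mul (left ht cG)).integrableOn_compact isCompact_Icc
        have i2 : IntegrableOn (fun s => ψ s / F s * (Rd s t)⁻¹ * A s t * E s t) I :=
          (cVA.mul (left ht cE)).integrableOn_compact isCompact_Icc
        rw [← integral_sub i1 i2, ← integral_div]
        refine setIntegral_congr_fun measurableSet_Icc fun s hs => ?_
        have e1 := (f0 s hs).ne'
        have e2 := (f0 t ht).ne'
        have e3 := (Rpos s hs t ht).ne'
        field_simp
      rw [e, abs_div, abs_of_pos (f0 t ht), hc₃, div_mul_eq_mul_div]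
      refine div_le_div₀ (by positivity) ?_ hκ0 (lef t ht)
      have h4 : 2 * Λ * (Bω * BQ) * M * h ≤ 2 * Λ * (Bω * BQ) * M * (m * r) := by
        gcongr
        exact hhr.trans hmr
      simp only [hG, hE, localAverage]
      rw [abs_le] at h1 h2 h3 ⊢
      constructor <;> linarith
  obtain ⟨h1, h2, h3⟩ := div_sub_bounds (H := H) hab hc₁0 hc₂0 he₀0 hr0 hw hm
    (by simpa using hsC 1 hCs.1) (hsC _ hCs.2.1) (hsC _ hCs.2.2.1) cG.continuousOn cE.continuousOn
    hLA.continuousOn ((((cf.comp continuous_fst).mul (cf.comp continuous_snd)).continuousOn.mul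
      hLd.continuousOn : ContinuousOn (fun q : ℝ × ℝ => F q.1 * F q.2 * Rd q.1 q.2) _)) hψ hBψ mdev
    sg.uniform sd.uniform sg.meanSquare sd.meanSquare hx hy hDs hlin
    fun s t => by rw [hH, div_eq_mul_inv (Rg s t)]
  refine ⟨h1, h2.trans ?_, fun t ht => (h3 t ht).trans ?_⟩
  · exact pow_le_pow_left₀ (by positivity) (mul_le_mul_of_nonneg_right hCs.2.2.2.1 (by positivity)) 2
  · exact mul_le_mul_of_nonneg_right hCs.2.2.2.2 (by positivity)

end Ratio

section CloseKernel

variable {a b : ℝ} {C : ℝ → ℝ → ℝ} {l : ℕ} {lam : ℕ → ℝ} {psi : ℕ → ℝ → ℝ}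

local notation "I" => Icc a b

/-- The kernel `C'` is within `ε` of `C`, in mean square and when integrated against `ψ`. -/
structure IsCloseKernel (a b : ℝ) (C C' : ℝ → ℝ → ℝ) (ψ : ℝ → ℝ) (ε : ℝ) : Prop where
  isSymmKernel : IsSymmKernel a b C'
  abs_sub_le_one : ∀ s ∈ Icc a b, ∀ t ∈ Icc a b, |C' s t - C s t| ≤ 1
  integral_sq_le : ∫ t in Icc a b, ∫ s in Icc a b, (C' s t - C s t) ^ 2 ≤ ε ^ 2
  abs_integral_le : ∀ t ∈ Icc a b, |∫ s in Icc a b, (C' s t - C s t) * ψ s| ≤ ε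

lemma IsSymmKernel.exists_bound (hab : a ≤ b) (hC : IsSymmKernel a b C) :
  ∃ B, 0 ≤ B ∧ ∀ s ∈ I, ∀ t ∈ I, |C s t| ≤ B := by
  obtain ⟨B, hB⟩ := (isCompact_Icc.prod isCompact_Icc).exists_bound_of_continuousOn hC.continuousOn
  have ha := left_mem_Icc.2 hab
  exact ⟨B, (norm_nonneg _).trans (hB (a, a) ⟨ha, ha⟩), fun s hs t ht => hB (s, t) ⟨hs, ht⟩⟩

/-- The eigenfunction of a simple eigenvalue depends on the kernel in a Lipschitz way. -/
lemma IsSymmKernel.exists_eigenfunction_bounds (hab : a < b) (hC : IsSymmKernel a b C)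
  (h : ∀ k, IsLeadingEigensystem I C k lam psi) (hl : 0 < lam l)
  (hgap : lam (l + 1) < lam l) (hsimple : ∀ k < l, lam l < lam k) :
  ∃ A : ℝ, 0 ≤ A ∧ ∀ C' ε, 0 ≤ ε → ε ≤ lam l / 2 → IsCloseKernel a b C C' (psi l) ε → ∀ μ φ,
    IsNthEigenpair I C' l μ φ → 0 ≤ ∫ t in I, φ t * psi l t →
    ∫ t in I, (φ t - psi l t) ^ 2 ≤ (A * ε) ^ 2 ∧
    ∀ t ∈ I, |φ t - psi l t| ≤ A * ε := by
  obtain ⟨B, hB0, hB⟩ := hC.exists_bound hab.le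
  obtain ⟨g, hg, hg1, hg2⟩ : ∃ g : ℝ, 0 < g ∧ (∀ k < l, lam l + g ≤ lam k) ∧
      max (lam (l + 1)) 0 + g ≤ lam l := by
    have hg0 : 0 < lam l - max (lam (l + 1)) 0 := sub_pos.2 (max_lt hgap hl)
    rcases Nat.eq_zero_or_pos l with rfl | h0
    · exact ⟨_, hg0, by simp, by simp⟩
    · refine ⟨min (lam l - max (lam (l + 1)) 0) (lam (l - 1) - lam l),
        lt_min hg0 (sub_pos.2 (hsimple _ (by omega))), fun k hk => ?_, ?_⟩
      · have h1 := (h l).ordered k (l - 1) (by omega) (by omega)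
        linarith [min_le_right (lam l - max (lam (l + 1)) 0) (lam (l - 1) - lam l)]
      · linarith [min_le_left (lam l - max (lam (l + 1)) 0) (lam (l - 1) - lam l)]
  set A₁ := ((B + 1) * √(b - a) * (4 / g) + 1 + B * √(b - a) / lam l) / (lam l / 2)
  have hA₁ : 0 ≤ A₁ := by positivity
  refine ⟨4 / g + A₁, by positivity, fun C' ε hε hεl hc μ φ hμ hsign => ?_⟩
  have hεl' : ε < lam l := by linarith
  have h1 := IsLeadingEigensystem.integral_eigenfunction_sub_sq_le (fun k _ => h k) hC hc.isSymmKernel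
    hε hc.integral_sq_le hεl' hg hg1 hg2 hμ hsign
  have h2 := (h l).abs_eigenvalue_sub_le hC hc.isSymmKernel hε hc.integral_sq_le hεl' hμ
  have hμl : lam l / 2 ≤ μ := by linarith [(abs_le.1 h2).1]
  have e : 4 * ε / g = 4 / g * ε := by ring
  rw [e] at h1
  have hle : 4 / g * ε ≤ (4 / g + A₁) * ε :=
    mul_le_mul_of_nonneg_right (le_add_of_nonneg_right hA₁) hε
  refine ⟨h1.trans (pow_le_pow_left₀ (by positivity) hle 2), fun t ht => ?_⟩
  have hψ1 : ∫ t in I, psi l t ^ 2 ≤ 1 := by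
    have := (h l).orthonormal l le_rfl l le_rfl
    simp only [if_true] at this
    simp only [sq, this, le_refl]
  have h3 := hμ.integral_sq_eq_one.1.abs_sub_le hab.le hC hc.isSymmKernel hB0 (B' := B + 1)
    (by positivity) hB (fun s hs t ht => ?_) hl ((half_pos hl).trans_le hμl)
    ((h l).isEigenfunction l le_rfl) hψ1 (by positivity) h1 ht
  · refine h3.trans ?_
    calc _ ≤ ((B + 1) * √(b - a) * (4 / g * ε) + ε + ε * (B * √(b - a) / lam l)) / (lam l / 2) := by
          have := half_pos hl
          gcongr
          exact hc.abs_integral_le t ht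
      _ = A₁ * ε := by ring
      _ ≤ _ := mul_le_mul_of_nonneg_right (le_add_of_nonneg_left (by positivity)) hε
  · have h4 := abs_add_le (C' s t - C s t) (C s t)
    rw [sub_add_cancel] at h4
    linarith [hc.abs_sub_le_one s hs t ht, hB s hs t ht]

end CloseKernel

section Estimator

variable {S Ω : Type*} [MeasurableSpace S] [MeasurableSpace Ω] {ρ : Measure S} {P : Measure Ω}
  {a b σ : ℝ} {X : ℝ → S → ℝ} {K f : ℝ → ℝ} {Z : ℕ → Ω → S} {τ e : ℕ → ℕ → Ω → ℝ}

local notation "I" => Icc a b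

lemma covHat_sub_covFun (hσ : 0 < σ) (c h : ℝ) (N : ℕ → ℕ) (n : ℕ) (ω : Ω) (s t : ℝ) :
  covHat ρ X K h σ c N n Z τ e ω s t - covFun ρ X s t =
    localAverage X (pseudoResponse σ c) N n K h (dataMap Z τ e ω) s t /
      localAverage X (pseudoWeight c) N n K h (dataMap Z τ e ω) s t -
    pairMean ρ X σ (pseudoResponse σ c) s t / pairMean ρ X σ (pseudoWeight c) s t := by
  have h1 : numer K h σ c N n (fun i j => τ i j ω) (fun i j => response X Z τ e i j ω) s t =
      localAverage X (pseudoResponse σ c) N n K h (dataMap Z τ e ω) s t := by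
    simp only [numer, localAverage, pairAverage, obsMark, dataMap, response]
    refine sum_congr rfl fun i _ => congrArg _ (sum_congr rfl fun p _ => ?_)
    ring
  have h2 : denom K h c N n (fun i j => τ i j ω) (fun i j => response X Z τ e i j ω) s t =
      localAverage X (pseudoWeight c) N n K h (dataMap Z τ e ω) s t := by
    simp only [denom, localAverage, pairAverage, obsMark, dataMap, response]
    refine sum_congr rfl fun i _ => congrArg _ (sum_congr rfl fun p _ => ?_)
    ring
  rw [covHat, covTilde, h1, h2, biasFun, div_mul_cancel₀ _ (pow_ne_zero 2 hσ.ne')]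
  ring

lemma IsCenteredProcess.isSymmKernel_covFun (hX : IsCenteredProcess ρ a b X) :
  IsSymmKernel a b (covFun ρ X) :=
  ⟨hX.smooth.continuousOn, fun _ _ _ _ => covariance_comm _ _⟩

lemma eventually_mul_rate_le {N : ℕ → ℕ → ℕ} {h : ℕ → ℝ} (h_lim : Tendsto h atTop (𝓝 0))
  {δ C₀ : ℝ} (hδ : 0 < δ) (hδ1 : δ ≤ 1)
  (hreg : ∀ᶠ n in atTop, IsRegularDesign a b δ C₀ (h n) (N n) n) (C : ℝ) {ε : ℝ} (hε : 0 < ε) :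
  ∀ᶠ n in atTop, 1 ≤ h n ^ (-(δ / 8)) ∧
    |C| * ((h n ^ (-(δ / 8))) ^ 2 * rate (h n) (N n) n) ≤ ε := by
  have h1 : Tendsto (fun n => |C| * (2 * h n ^ (δ / 4))) atTop (𝓝 0) := by
    have := h_lim.rpow_const (p := δ / 4) (Or.inr (by positivity))
    rw [Real.zero_rpow (by positivity)] at this
    simpa using (this.const_mul 2).const_mul |C|
  filter_upwards [hreg, h1.eventually_le_const hε] with n hd hn
  have hh := hd.pos
  refine ⟨Real.one_le_rpow_of_pos_of_le_one_of_nonpos hh hd.le_one (by linarith), le_trans ?_ hn⟩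
  have h2 : √(pointVar (h n) (N n) n) ≤ h n ^ (δ / 2) :=
    (Real.sqrt_le_sqrt hd.pointVar_le).trans_eq (Real.sqrt_sq (by positivity))
  have h3 : h n ≤ h n ^ (δ / 2) := by
    conv_lhs => rw [← Real.rpow_one (h n)]
    exact rpow_le_rpow_of_exponent_ge hh hd.le_one (by linarith)
  refine mul_le_mul_of_nonneg_left ?_ (abs_nonneg C)
  calc _ ≤ (h n ^ (-(δ / 8))) ^ 2 * (2 * h n ^ (δ / 2)) := by
        refine mul_le_mul_of_nonneg_left ?_ (by positivity)
        rw [rate]; linarith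
    _ = 2 * h n ^ (δ / 4) := by
      rw [← Real.rpow_mul_natCast hh.le, mul_left_comm, ← Real.rpow_add hh]
      congr 2; push_cast; ring

/-- The estimated covariance function is close to the covariance function, with large
probability. -/
lemma IsSample.exists_measure_not_isCloseKernel_le [IsProbabilityMeasure ρ]
  [IsProbabilityMeasure P] (hs : IsSample ρ P a b f σ Z τ e) (hab : a < b) (hσ : 0 < σ) (c : ℝ)
  (hX : IsCenteredProcess ρ a b X) (hK : IsKernel K) (hf : IsSamplingDensity a b f)
  {N : ℕ → ℕ → ℕ} {h : ℕ → ℝ} (h_pos : ∀ n, 0 < h n) (h_lim : Tendsto h atTop (𝓝 0))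
  {δ C₀ : ℝ} (hδ : 0 < δ) (hδ1 : δ ≤ 1) (hC₀ : 0 ≤ C₀)
  (hreg : ∀ᶠ n in atTop, IsRegularDesign a b δ C₀ (h n) (N n) n) {ψ : ℝ → ℝ}
  (hψ : ContinuousOn ψ I) {η : ℝ} (hη : 0 < η) :
  ∃ A : ℝ, 0 ≤ A ∧ ∀ᶠ n in atTop, P {ω | ¬ IsCloseKernel a b (covFun ρ X)
    (covHat ρ X K (h n) σ c (N n) n Z τ e ω) ψ (A * rate (h n) (N n) n)} ≤ ofReal η := by
  have := hf.isProbabilityMeasure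
  have := hf.isProbabilityMeasure_obsLaw σ
  have hg := isMark_pseudoResponse hσ c
  have hd := isMark_pseudoWeight hσ c
  obtain ⟨C, p, L, hC1, hp, hL, hrep⟩ := hX.exists_localAverage_div_bounds hab hf hK hg hd
    (by norm_num : (0 : ℝ) < 1 / 4) (fun s hs t ht => hX.pairMean_pseudoWeight_ge hσ c hs ht) hψ
  have hα : ∀ n, ∃ α α' : ℝ → ℝ → ℝ, 2 * h n ≤ b - a → _ := fun n => by
    by_cases h2 : 2 * h n ≤ b - a
    · obtain ⟨α, α', h3⟩ := hrep (h n) (h_pos n) h2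
      exact ⟨α, α', fun _ => h3⟩
    · exact ⟨0, 0, fun h3 => absurd h3 h2⟩
  choose α α' hα using hα
  obtain ⟨m₁, hm₁⟩ := hX.exists_measure_not_isGoodSample_le hab hf hg hK hδ hC₀ h_lim hreg hδ1 hp hL
    (α := α) (hreg.mono fun n hn => (hα n hn.two_mul_le).1) (half_pos hη)
  obtain ⟨m₂, hm₂⟩ := hX.exists_measure_not_isGoodSample_le hab hf hd hK hδ hC₀ h_lim hreg hδ1 hp hL
    (α := α') (hreg.mono fun n hn => (hα n hn.two_mul_le).2.1) (half_pos hη)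
  set m := max 1 (max m₁ m₂)
  have hm : 1 ≤ m := le_max_left _ _
  refine ⟨C * m, by positivity, ?_⟩
  filter_upwards [hreg, hm₁ m hm ((le_max_left _ _).trans (le_max_right _ _)),
    hm₂ m hm ((le_max_right _ _).trans (le_max_right _ _)),
    eventually_mul_rate_le h_lim hδ hδ1 hreg C one_pos] with n hn b1 b2 ⟨hw, hsmall⟩
  rw [abs_of_nonneg (zero_le_one.trans hC1)] at hsmall
  have hlaw := hs.hasLaw_dataMap
  set w := h n ^ (-(δ / 8))
  set bad := {D | ¬ IsGoodSample a b ρ (obsLaw a b f σ) X (pseudoResponse σ c) (N n) n K (h n) (α n) m w D} ∪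
    {D | ¬ IsGoodSample a b ρ (obsLaw a b f σ) X (pseudoWeight c) (N n) n K (h n) (α' n) m w D}
  have hsub : {ω | ¬ IsCloseKernel a b (covFun ρ X) (covHat ρ X K (h n) σ c (N n) n Z τ e ω) ψ
      (C * m * rate (h n) (N n) n)} ⊆ dataMap Z τ e ⁻¹' bad := by
    intro ω hω
    by_contra hgood
    obtain ⟨sg, sd⟩ : IsGoodSample a b ρ (obsLaw a b f σ) X (pseudoResponse σ c) (N n) n K (h n)
        (α n) m w (dataMap Z τ e ω) ∧ IsGoodSample a b ρ (obsLaw a b f σ) X (pseudoWeight c) (N n) n K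
        (h n) (α' n) m w (dataMap Z τ e ω) := by
      constructor <;> by_contra hcon
      exacts [hgood (Or.inl hcon), hgood (Or.inr hcon)]
    refine hω ?_
    have eH := covHat_sub_covFun (ρ := ρ) (X := X) (K := K) (Z := Z) (τ := τ) (e := e) hσ c (h n)
      (N n) n ω
    obtain ⟨h1, h2, h3⟩ := (hα n hn.two_mul_le).2.2 (N n) n m w _ hm hw hsmall sg sd
      (fun s t => covHat ρ X K (h n) σ c (N n) n Z τ e ω s t - covFun ρ X s t) eH
    have hsymm : ∀ s t, covHat ρ X K (h n) σ c (N n) n Z τ e ω s t - covFun ρ X s t =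
        covHat ρ X K (h n) σ c (N n) n Z τ e ω t s - covFun ρ X t s := fun s t => by
      rw [eH, eH, localAverage_symm, localAverage_symm (φ := pseudoWeight c),
        pairMean_symm (φ := pseudoResponse σ c), pairMean_symm (φ := pseudoWeight c)]
    refine ⟨⟨?_, fun s _ t _ => ?_⟩, fun s hs t ht => (h1 s hs t ht).2, ?_, fun t ht => ?_⟩
    · obtain ⟨Lg, hLg⟩ := hX.isLipschitzKernel_pairMean hab hg
      obtain ⟨Ld, hLd⟩ := hX.isLipschitzKernel_pairMean hab hd
      have := (((hK.continuous_localAverage (X := X) (φ := pseudoResponse σ c) (h := h n) (N n) n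
        (dataMap Z τ e ω)).continuousOn.div (hK.continuous_localAverage (X := X)
          (φ := pseudoWeight c) (h := h n) (N n) n (dataMap Z τ e ω)).continuousOn
          fun q hq => (h1 q.1 hq.1 q.2 hq.2).1).sub (hLg.continuousOn.div hLd.continuousOn
          fun q hq => (lt_of_lt_of_le (by norm_num) (hX.pairMean_pseudoWeight_ge hσ c hq.1
            hq.2)).ne')).add hX.smooth.continuousOn
      refine this.congr fun q _ => ?_
      rw [← sub_add_cancel (covHat ρ X K (h n) σ c (N n) n Z τ e ω q.1 q.2) (covFun ρ X q.1 q.2), eH]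
      rfl
    · rw [← sub_left_inj (a := covFun ρ X s t), hsymm, show covFun ρ X s t = covFun ρ X t s from
        covariance_comm _ _]
    · rw [mul_assoc]
      refine le_of_eq_of_le (integral_congr_ae (ae_of_all _ fun t =>
        integral_congr_ae (ae_of_all _ fun s => ?_))) h2
      exact congrArg (· ^ 2) (hsymm s t)
    · rw [mul_assoc]
      exact h3 t ht
  calc _ ≤ P (dataMap Z τ e ⁻¹' bad) := measure_mono hsub
    _ ≤ P.map (dataMap Z τ e) bad := Measure.le_map_apply hlaw.aemeasurable _
    _ = sampleLaw ρ (obsLaw a b f σ) bad := by rw [hlaw.map_eq]; rfl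
    _ ≤ ofReal (η / 2) + ofReal (η / 2) := (measure_union_le _ _).trans (add_le_add b1 b2)
    _ = _ := by rw [← ofReal_add (by positivity) (by positivity), add_halves]

end Estimator

end DetectionLimit

end

theorem theorem1 {S Ω : Type*} [MeasurableSpace S] [MeasurableSpace Ω]
    (ρ : Measure S) [IsProbabilityMeasure ρ] (P : Measure Ω) [IsProbabilityMeasure P]
    (a b : ℝ) (hab : a < b) (σ : ℝ) (hσ : 0 < σ) (c : ℝ)
    (X : ℝ → S → ℝ) (hX : DetectionLimit.IsCenteredProcess ρ a b X)
    (K : ℝ → ℝ) (hK : DetectionLimit.IsKernel K)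
    (f : ℝ → ℝ) (hf : DetectionLimit.IsSamplingDensity a b f)
    (Z : ℕ → Ω → S) (τ e : ℕ → ℕ → Ω → ℝ)
    (hsample : DetectionLimit.IsSample ρ P a b f σ Z τ e)
    -- `N n i` is the number of measurements of subject `i` in the sample of size `n`
    (N : ℕ → ℕ → ℕ) (hN : ∀ᶠ n in atTop, ∃ i < n, 2 ≤ N n i)
    (h : ℕ → ℝ) (h_pos : ∀ n, 0 < h n) (h_lim : Tendsto h atTop (𝓝 0))
    (δ : ℝ) (hδ : 0 < δ)
    (hvar : Tendsto (fun n => h n ^ (-δ) * DetectionLimit.pointVar (h n) (N n) n) atTop (𝓝 0))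
    (hshared : (fun n => h n ^ (-δ) * DetectionLimit.sharedVar (h n) (N n) n)
      =O[atTop] fun n => (DetectionLimit.rateT (h n) (N n) n)⁻¹)
    -- the ordered eigenvalues and eigenfunctions of the covariance function
    (lam : ℕ → ℝ) (psi : ℕ → ℝ → ℝ)
    (hpsi : ∀ l, DetectionLimit.IsLeadingEigensystem (Icc a b) (DetectionLimit.covFun ρ X) l lam psi)
    -- estimated eigenpairs, arbitrary if there is no `l`-th eigenpair; the sign of an estimated
    -- eigenfunction is fixed as usual
    (lamHat : ℕ → ℕ → Ω → ℝ) (psiHat : ℕ → ℕ → Ω → ℝ → ℝ)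
    (hhat : ∀ n l ω,
      (∃ μ φ, DetectionLimit.IsNthEigenpair (Icc a b)
        (DetectionLimit.covHat ρ X K (h n) σ c (N n) n Z τ e ω) l μ φ) →
      DetectionLimit.IsNthEigenpair (Icc a b)
        (DetectionLimit.covHat ρ X K (h n) σ c (N n) n Z τ e ω) l (lamHat n l ω) (psiHat n l ω) ∧
      0 ≤ ∫ t in Icc a b, psiHat n l ω t * psi l t)
    (cLam : ℝ) (hcLam : 0 < cLam) (J : Set ℕ)
    (hJ : J = {l | cLam < lam l ∧ lam (l + 1) < lam l}) :
    J.Finite ∧ ∀ l ∈ J,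
      DetectionLimit.IsBigOp P (fun n ω => ENNReal.ofReal |lamHat n l ω - lam l|)
        (fun n => DetectionLimit.rateT (h n) (N n) n ^ (-(1 / 2) : ℝ)) ∧
      ((∀ k < l, lam l < lam k) →
        DetectionLimit.IsBigOp P
          (fun n ω => eLpNorm (fun t => psiHat n l ω t - psi l t) 2 (volume.restrict (Icc a b)))
          (fun n => DetectionLimit.rateT (h n) (N n) n ^ (-(1 / 2) : ℝ)) ∧
        DetectionLimit.IsBigOp P
          (fun n ω => ⨆ t ∈ Icc a b, ENNReal.ofReal |psiHat n l ω t - psi l t|)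
          (fun n => DetectionLimit.rateT (h n) (N n) n ^ (-(1 / 2) : ℝ))) := by
  have hC := hX.isSymmKernel_covFun
  obtain ⟨δ', C₀, hδ', hδ1, hC₀, hreg⟩ :=
    DetectionLimit.eventually_isRegularDesign hab hN h_pos h_lim hδ hvar hshared
  refine ⟨(DetectionLimit.finite_setOf_lt_eigenvalue hC hpsi hcLam).subset fun l hl => ?_,
    fun l hl => ?_⟩
  · exact (hJ ▸ hl : l ∈ {l | cLam < lam l ∧ lam (l + 1) < lam l}).1
  obtain ⟨hl1, hgap⟩ : cLam < lam l ∧ lam (l + 1) < lam l :=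
    (hJ ▸ hl : l ∈ {l | cLam < lam l ∧ lam (l + 1) < lam l})
  have hl0 : 0 < lam l := hcLam.trans hl1
  have hψ := ((hpsi l).isEigenfunction l le_rfl).continuousOn hC hl0.ne'
  -- a bound on the event of a close covariance estimate is a bound in probability
  have key : ∀ (A : ℝ), 0 ≤ A → ∀ Y : ℕ → Ω → ℝ≥0∞,
      (∀ n ω ε, 0 ≤ ε → ε ≤ lam l / 2 → DetectionLimit.IsCloseKernel a b (DetectionLimit.covFun ρ X)
        (DetectionLimit.covHat ρ X K (h n) σ c (N n) n Z τ e ω) (psi l) ε →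
        Y n ω ≤ ENNReal.ofReal (A * ε)) →
      DetectionLimit.IsBigOp P Y fun n => DetectionLimit.rateT (h n) (N n) n ^ (-(1 / 2) : ℝ) := by
    intro A hA Y hY η hη
    obtain ⟨η', hη', hle⟩ : ∃ η' : ℝ, 0 < η' ∧ ENNReal.ofReal η' ≤ η := by
      obtain ⟨x, hx0, hx⟩ := ENNReal.lt_iff_exists_real_btwn.1 hη
      exact ⟨x, by simpa using hx.1, hx.2.le⟩
    obtain ⟨B, hB, hclose⟩ := hsample.exists_measure_not_isCloseKernel_le hab hσ c hX hK hf h_pos h_lim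
      hδ' hδ1 hC₀ hreg hψ hη'
    refine ⟨⟨A * B, by positivity⟩, ?_⟩
    filter_upwards [hclose, DetectionLimit.eventually_mul_rate_le h_lim hδ' hδ1 hreg B (half_pos hl0)]
      with n hn ⟨hw, hsmall⟩
    have hr : 0 ≤ DetectionLimit.rate (h n) (N n) n := (h_pos n).le.trans DetectionLimit.le_rate
    rw [DetectionLimit.rateT_rpow (h_pos n)]
    refine (measure_mono fun ω hω hc => ?_).trans (hn.trans hle)
    refine absurd (hY n ω _ (by positivity) (le_trans ?_ hsmall) hc) (not_le.2 ?_)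
    · rw [abs_of_nonneg hB]
      exact mul_le_mul_of_nonneg_left (le_mul_of_one_le_left hr (one_le_pow₀ hw)) hB
    · rw [← mul_assoc]; exact hω
  have pair : ∀ n ω ε, 0 ≤ ε → ε ≤ lam l / 2 →
      DetectionLimit.IsCloseKernel a b (DetectionLimit.covFun ρ X)
        (DetectionLimit.covHat ρ X K (h n) σ c (N n) n Z τ e ω) (psi l) ε → _ :=
    fun n ω ε hε hεl hc => hhat n l ω ((hpsi l).exists_isNthEigenpair hC hc.isSymmKernel hε
      hc.integral_sq_le (by linarith))
  refine ⟨key 1 zero_le_one _ fun n ω ε hε hεl hc => ?_, fun hsimple => ?_⟩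
  · rw [one_mul]
    exact ENNReal.ofReal_le_ofReal ((hpsi l).abs_eigenvalue_sub_le hC hc.isSymmKernel hε
      hc.integral_sq_le (by linarith) (pair n ω ε hε hεl hc).1)
  obtain ⟨A, hA, hbound⟩ := hC.exists_eigenfunction_bounds hab hpsi hl0 hgap hsimple
  refine ⟨key A hA _ fun n ω ε hε hεl hc => ?_, key A hA _ fun n ω ε hε hεl hc => ?_⟩
  · obtain ⟨h1, h2⟩ := pair n ω ε hε hεl hc
    have h3 := (hbound _ ε hε hεl hc _ _ h1 h2).1
    have hmem := h1.integral_sq_eq_one.1.memLp.sub ((hpsi l).isEigenfunction l le_rfl).memLp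
    rw [show (fun t => psiHat n l ω t - psi l t) = psiHat n l ω - psi l from rfl,
      hmem.eLpNorm_eq_integral_rpow_norm (by norm_num) (by norm_num)]
    refine ENNReal.ofReal_le_ofReal ?_
    simp only [ENNReal.toReal_ofNat, Real.rpow_two, Real.norm_eq_abs, sq_abs, Pi.sub_apply]
    rw [← one_div, ← Real.sqrt_eq_rpow]
    exact (Real.sqrt_le_sqrt h3).trans_eq (Real.sqrt_sq (by positivity))
  · obtain ⟨h1, h2⟩ := pair n ω ε hε hεl hc
    exact iSup₂_le fun t ht => ENNReal.ofReal_le_ofReal ((hbound _ ε hε hεl hc _ _ h1 h2).2 t ht)
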